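/- Let $k$ be a commutative ring with unit and let $A$ be an associative unital $k$-algebra with unit $e$ which is free as a $k$-module on a basis $\mathcal B=\{\varphi_\omega\mid\omega\in\Omega\}$ such that for all $\alpha,\beta\in\Omega$ one has $\varphi_\alpha\varphi_\beta=\mu_{\alpha,\beta}\,\varphi_m$ for some $\varphi_m\in\mathcal B$ and some idempotent $\mu_{\alpha,\beta}\in k$. Let $\delta$ be the Hochschild coboundary on $\mathrm{Hom}_k(A^{\otimes *},A)$. Let $AP^n=AP(A^{\otimes n},A)$, $n\ge 0$, be the module of (strictly) autopoietic cochains, i.e. of those $f\in\mathrm{Hom}_k(A^{\otimes n},A)$ with $f(\varphi_1\otimes\cdots\otimes\varphi_n)\in k\cdot\varphi_1\cdots\varphi_n$ for all $\varphi_i\in\mathcal B$ (for $n=0$: $f(1)\in k\cdot e$). It is a subcomplex. For $\alpha\in\mathrm{Hom}_k(A^{\otimes n},k)$ let $d^*\alpha=\sum_i(-1)^i\,\alpha\circ d_i$ with the faces $d_i$ of the bar construction (the outer faces $d_0,d_n$ omit the first or the last basis element, the others multiply neighbours), and let $\Psi(\alpha)\in AP^n$ be given by $\Psi(\alpha)(\varphi_1\otimes\cdots\otimes\varphi_n)=\alpha(\varphi_1\otimes\cdots\otimes\varphi_n)\,\varphi_1\cdots\varphi_n$.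 For $f\in AP^n$ let $\Phi(f)\in\mathrm{Hom}_k(A^{\otimes n},k)$ be given by $\Phi(f)(\varphi_1\otimes\cdots\otimes\varphi_n)=\lambda$, where $\lambda$ is the unique scalar with $f(\varphi_1\otimes\cdots\otimes\varphi_n)=\lambda\,\varphi_1\cdots\varphi_n$ which is annihilated by the annihilator of $\varphi_1\cdots\varphi_n$ in $k$ (so $\lambda=0$ if $\varphi_1\cdots\varphi_n=0$). For $\alpha\in\mathrm{Hom}_k(A^{\otimes p},k)$, $\beta\in\mathrm{Hom}_k(A^{\otimes q},k)$ and $n=p+q-i$, Steenrod's cup-$i$ product $\alpha\cup_i\beta\in\mathrm{Hom}_k(A^{\otimes n},k)$ is $$(\alpha\cup_i\beta)(\sigma)=\sum_{U}(-1)^{\mathrm{inv}(U)+(p+q)\binom i2}\,\alpha(\sigma|_{E_U})\,\beta(\sigma|_{O_U}),$$ where $\sigma=\varphi_1\otimes\cdots\otimes\varphi_n$ is regarded as a simplex with vertices $0,\dots,n$, $U=\{j_0<\dots<j_i\}\subseteq\{0,\dots,n\}$, $E_U$ (resp. $O_U$) is the union of the even-numbered (resp. odd-numbered) intervals among $[0,j_0],[j_0,j_1],\dots,[j_i,n]$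 (numbered from $0$), the sum is over those $U$ with $|E_U|=p+1$ and $|O_U|=q+1$, $\sigma|_S$ is the face of $\sigma$ spanned by $S$, and $\mathrm{inv}(U)$ is the number of pairs $x<y$ with $x\in O_U\setminus U$ and $y\in E_U\setminus U$. For $f\in AP^p$, $g\in AP^q$ put $f\cup_ig=\Psi(\Phi(f)\cup_i\Phi(g))\in AP^{p+q-i}$ (this is $0$ for $i>p+q$). Then: 1. $\Phi$ and $\Psi$ are $k$-linear, $\Psi\Phi=\mathrm{id}$, $\Psi d^*=\delta\Psi$, and $\Psi(\alpha)\cup_i\Psi(\beta)=\Psi(\alpha\cup_i\beta)$ for all $i\ge0$ (so $f\cup_ig$ does not depend on the choice of scalars in $\Phi$). If the product of any two elements of $\mathcal B$ lies in $\mathcal B$, then also $\Phi\delta=d^*\Phi$. 2. $f\cup_0g$ is the Gerstenhaber product $f(a_1,\dots,a_p)\,g(a_{p+1},\dots,a_{p+q})$. For $q\ge1$ all partial compositions $f\circ_{(j)}g=f(a_1,\dots,a_j,g(a_{j+1},\dots,a_{j+q}),\dots)$, $0\le j\le p-1$, are autopoietic, and $f\cup_1g$ is the pre-Lie product $\sum_{j=0}^{p-1}(-1)^{(p-1-j)(q-1)}f\circ_{(j)}g$.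 3. For $f\in AP^p$, $g\in AP^q$ Steenrod's coboundary formula holds: $\delta(f\cup_0g)=\delta f\cup_0g+(-1)^pf\cup_0\delta g$, and for $i\ge1$ $$\delta(f\cup_ig)=(-1)^{\binom i2}\,\delta f\cup_ig+(-1)^{\binom{i-1}2+p-1}\,f\cup_i\delta g+(-1)^p\big[(-1)^{(i-1)(p+q+1)}f\cup_{i-1}g-(-1)^{pq}g\cup_{i-1}f\big].$$ 4. $(AP^*,\delta)$ is an $E_\infty$-algebra via the cup-$i$ products: there are a symmetric operad $O$ in non-negatively graded chain complexes over $k$, with a quasi-isomorphism of operads $\varepsilon$ from $O$ to the operad of (unital) commutative algebras and with every $O(r)_a$ free over $k[\Sigma_r]$, an $O$-algebra structure on $(AP^*,\delta)$, and elements $e_i\in O(2)_i$, $i\ge0$, with $\varepsilon(e_0)=1$ and $de_i=e_{i-1}\tau+(-1)^ie_{i-1}$ for $i\ge 1$ ($\tau$ the transposition), such that $e_i$ acts by $e_i(f,g)=(-1)^{i+p\binom{i+1}2+q\binom i2}f\cup_ig$. Moreover an element $x\in O(0)_0$ with $\varepsilon(x)=1$ acts as the unit cochain $e\in AP^0$,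 and the operations of arity $\ge 1$ map cochains of positive degree to cochains of positive degree, so that the autopoietic cochains of degree $\ge1$ also form a (non-unital) $E_\infty$-algebra. -/

import Mathlib

open scoped DirectSum

universe u v w

/-! ### Differential graded operads and algebras over them -/

namespace EInf

/-- In the partial composition `u ∘ᵢ w` (`u` with `r` inputs, `w` with `s` inputs, the result with
`n = r + s - 1` inputs), the input of the composite which feeds the input `j ≠ i` of `u`. -/
def outerPos {r s n : ℕ} (h : n + 1 = r + s) (i j : Fin r) (hij : j ≠ i) : Fin n :=
  ⟨if j < i then j else j + s - 1, by
    have h1 := i.isLt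
    have h2 := j.isLt
    have h3 : (j : ℕ) ≠ i := fun e => hij (Fin.ext e)
    split_ifs with h4
    · have : (j : ℕ) < i := h4
      omega
    · have : ¬ (j : ℕ) < i := h4
      omega⟩

/-- In the partial composition `u ∘ᵢ w`, the input of the composite which feeds the input `l`
of `w`. -/
def innerPos {r s n : ℕ} (h : n + 1 = r + s) (i : Fin r) (l : Fin s) : Fin n :=
  ⟨i + l, by
    have h1 := i.isLt
    have h2 := l.isLt
    omega⟩

/-- `ρ` is the permutation of the inputs of a partial composition induced by a permutation `σ` of
the outer inputs (moving the slot `i` to the slot `σ i`) and a permutation `τ` of the inner ones. -/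
def IsBlockPerm {r s n : ℕ} (h : n + 1 = r + s) (i : Fin r) (σ : Equiv.Perm (Fin r))
    (τ : Equiv.Perm (Fin s)) (ρ : Equiv.Perm (Fin n)) : Prop :=
  (∀ l, ρ (innerPos h i l) = innerPos h (σ i) (τ l)) ∧
  ∀ j (hj : j ≠ i), ρ (outerPos h i j hj) = outerPos h (σ i) (σ j) (σ.injective.ne hj)

/-- A symmetric operad in non-negatively graded chain complexes of `k`-modules, presented by
partial compositions. The chain complex of arity `r` is the module `obj r` with the internal
grading `deg r` and the differential `d r` of degree `-1`. -/
structure DGOperad (k : Type u) [CommRing k] where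
  obj : ℕ → Type u
  [addCommGroup : ∀ r, AddCommGroup (obj r)]
  [module : ∀ r, Module k (obj r)]
  deg : ∀ r, ℕ → Submodule k (obj r)
  isInternal : ∀ r, DirectSum.IsInternal (deg r)
  d : ∀ r, obj r →ₗ[k] obj r
  d_mem : ∀ {r a} {x : obj r}, x ∈ deg r (a + 1) → d r x ∈ deg r a
  d_zero : ∀ {r} {x : obj r}, x ∈ deg r 0 → d r x = 0
  d_d : ∀ {r} (x : obj r), d r (d r x) = 0
  /-- The right action of the symmetric group: `act r σ x` is `x · σ`. -/
  act : ∀ r, Equiv.Perm (Fin r) → obj r →ₗ[k] obj r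
  act_one : ∀ {r} (x : obj r), act r 1 x = x
  act_mul : ∀ {r} (σ τ : Equiv.Perm (Fin r)) (x : obj r), act r (σ * τ) x = act r τ (act r σ x)
  act_mem : ∀ {r a} (σ : Equiv.Perm (Fin r)) {x : obj r}, x ∈ deg r a → act r σ x ∈ deg r a
  act_d : ∀ {r} (σ : Equiv.Perm (Fin r)) (x : obj r), d r (act r σ x) = act r σ (d r x)
  one : obj 1
  one_mem : one ∈ deg 1 0
  /-- The partial composition `x ∘ᵢ y`. -/
  comp : ∀ {r s n} (_ : n + 1 = r + s) (_ : Fin r), obj r →ₗ[k] obj s →ₗ[k] obj n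
  comp_mem : ∀ {r s n a b} (h : n + 1 = r + s) (i : Fin r) {x : obj r} {y : obj s},
    x ∈ deg r a → y ∈ deg s b → comp h i x y ∈ deg n (a + b)
  d_comp : ∀ {r s n a} (h : n + 1 = r + s) (i : Fin r) {x : obj r} (y : obj s), x ∈ deg r a →
    d n (comp h i x y) = comp h i (d r x) y + (-1 : k) ^ a • comp h i x (d s y)
  one_comp : ∀ {s} (h : s + 1 = 1 + s) (y : obj s), comp h 0 one y = y
  comp_one : ∀ {r} (h : r + 1 = r + 1) (i : Fin r) (x : obj r), comp h i x one = x
  /-- Sequential associativity: `(x ∘ᵢ y) ∘ᵢ₊ⱼ z = x ∘ᵢ (y ∘ⱼ z)`. -/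
  comp_assoc : ∀ {r s t m l n} (h₁ : m + 1 = r + s) (h₂ : n + 1 = m + t) (h₃ : l + 1 = s + t)
    (h₄ : n + 1 = r + l) (i : Fin r) (j : Fin s) (x : obj r) (y : obj s) (z : obj t),
    comp h₂ (innerPos h₁ i j) (comp h₁ i x y) z = comp h₄ i x (comp h₃ j y z)
  /-- Parallel associativity, with the Koszul sign. -/
  comp_comm : ∀ {r s t m l n a b} (h₁ : m + 1 = r + s) (h₂ : n + 1 = m + t) (h₃ : l + 1 = r + t)
    (h₄ : n + 1 = l + s) (i j : Fin r) (hij : i < j) (x : obj r) {y : obj s} {z : obj t},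
    y ∈ deg s a → z ∈ deg t b →
    comp h₂ (outerPos h₁ i j hij.ne') (comp h₁ i x y) z =
      (-1 : k) ^ (a * b) • comp h₄ (outerPos h₃ j i hij.ne) (comp h₃ j x z) y
  /-- Equivariance of the partial compositions. -/
  act_comp : ∀ {r s n} (h : n + 1 = r + s) (i : Fin r) (σ : Equiv.Perm (Fin r))
    (τ : Equiv.Perm (Fin s)) (ρ : Equiv.Perm (Fin n)), IsBlockPerm h i σ τ ρ →
    ∀ (x : obj r) (y : obj s),
      comp h i (act r σ x) (act s τ y) = act n ρ (comp h (σ i) x y)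

attribute [instance] DGOperad.addCommGroup DGOperad.module

/-- `O` with the augmentation `ε` is a (unital) `E_∞`-operad: `ε` is a quasi-isomorphism of
operads onto the operad of commutative algebras (which is `k` in every arity), and in every
arity `r` and degree `a` the module `O(r)_a` is free over `k[Σ_r]`. -/
structure DGOperad.IsEInfinity {k : Type u} [CommRing k] (O : DGOperad k)
    (ε : ∀ r, O.obj r →ₗ[k] k) : Prop where
  aug_one : ε 1 O.one = 1
  aug_act : ∀ {r} (σ : Equiv.Perm (Fin r)) (x : O.obj r), ε r (O.act r σ x) = ε r x
  aug_comp : ∀ {r s n} (h : n + 1 = r + s) (i : Fin r) (x : O.obj r) (y : O.obj s),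
    ε n (O.comp h i x y) = ε r x * ε s y
  aug_pos : ∀ {r a} {x : O.obj r}, x ∈ O.deg r (a + 1) → ε r x = 0
  aug_d : ∀ {r} (x : O.obj r), ε r (O.d r x) = 0
  aug_surj : ∀ r, ∃ x ∈ O.deg r 0, ε r x = 1
  exact_zero : ∀ {r} {x : O.obj r}, x ∈ O.deg r 0 → ε r x = 0 → ∃ y ∈ O.deg r 1, O.d r y = x
  exact_succ : ∀ {r a} {x : O.obj r}, x ∈ O.deg r (a + 1) → O.d r x = 0 →
    ∃ y ∈ O.deg r (a + 2), O.d r y = x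
  free : ∀ r a, ∃ (ι : Type u) (β : ι → O.obj r),
    LinearIndependent k (fun x : ι × Equiv.Perm (Fin r) => O.act r x.2 (β x.1)) ∧
    Submodule.span k (Set.range fun x : ι × Equiv.Perm (Fin r) => O.act r x.2 (β x.1)) = O.deg r a

/-- The Koszul sign of a permutation `σ` of homogeneous elements of degrees `p`. -/
def koszulSign (k : Type u) [CommRing k] {r : ℕ} (σ : Equiv.Perm (Fin r)) (p : Fin r → ℕ) : k :=
  ∏ x : Fin r × Fin r, if x.1 < x.2 ∧ σ x.2 < σ x.1 then (-1) ^ (p x.1 * p x.2) else 1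

/-- The structure of an algebra over the operad `O` on the cochain complex `(⨁ n, V n, D)`. An
operation of degree `a` lowers the cohomological degree by `a`; all signs follow the Koszul rule. -/
structure OperadAlgebra {k : Type u} [CommRing k] (O : DGOperad k) (V : ℕ → Type v)
    [∀ n, AddCommGroup (V n)] [∀ n, Module k (V n)] (D : (⨁ n, V n) →ₗ[k] ⨁ n, V n) where
  D_deg : ∀ {p n} (x : V p), n ≠ p + 1 → D (DirectSum.lof k ℕ V p x) n = 0
  D_D : ∀ x, D (D x) = 0
  act : ∀ r, O.obj r →ₗ[k] MultilinearMap k (fun _ : Fin r => ⨁ n, V n) (⨁ n, V n)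
  act_deg : ∀ {r a n} {u : O.obj r} (p : Fin r → ℕ) (x : ∀ j, V (p j)), u ∈ O.deg r a →
    n + a ≠ ∑ j, p j → act r u (fun j => DirectSum.lof k ℕ V (p j) (x j)) n = 0
  act_one : ∀ x, act 1 O.one x = x 0
  D_act : ∀ {r a} {u : O.obj r} (p : Fin r → ℕ) (x : ∀ j, V (p j)), u ∈ O.deg r a →
    D (act r u fun j => DirectSum.lof k ℕ V (p j) (x j)) =
      act r (O.d r u) (fun j => DirectSum.lof k ℕ V (p j) (x j)) +
      ∑ j : Fin r, (-1 : k) ^ (a + ∑ l : Fin r with l < j, p l) •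
        act r u (Function.update (fun l => DirectSum.lof k ℕ V (p l) (x l)) j
          (D (DirectSum.lof k ℕ V (p j) (x j))))
  act_perm : ∀ {r} (u : O.obj r) (σ : Equiv.Perm (Fin r)) (p : Fin r → ℕ) (x : ∀ j, V (p j)),
    act r (O.act r σ u) (fun j => DirectSum.lof k ℕ V (p j) (x j)) =
      koszulSign k σ p •
        act r u (fun j => DirectSum.lof k ℕ V (p (σ.symm j)) (x (σ.symm j)))
  act_comp : ∀ {r s n b} (h : n + 1 = r + s) (i : Fin r) (u : O.obj r) {w : O.obj s}
    (p : Fin n → ℕ) (x : ∀ j, V (p j)), w ∈ O.deg s b →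
    act n (O.comp h i u w) (fun j => DirectSum.lof k ℕ V (p j) (x j)) =
      (-1 : k) ^ (b * ∑ l ∈ Finset.univ.filter (fun l : Fin n => (l : ℕ) < i), p l) •
        act r u (fun j => if hj : j = i
          then act s w (fun l => DirectSum.lof k ℕ V _ (x (innerPos h i l)))
          else DirectSum.lof k ℕ V _ (x (outerPos h i j hj)))

end EInf

/-! ### Cochains on the tensor powers of an algebra -/

namespace Autopoietic

variable {k : Type u} {A : Type v} {Ω : Type w} [CommRing k] [Ring A] [Algebra k A]

/-- `Hom_k(A^{⊗n}, M)`, as the module of `k`-multilinear maps `Aⁿ → M`. -/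
abbrev Cochain (k : Type u) (A : Type v) [CommRing k] [Ring A] [Algebra k A] (M : Type*)
    [AddCommGroup M] [Module k M] (n : ℕ) :=
  MultilinearMap k (fun _ : Fin n => A) M

theorem contractNth_update {n : ℕ} (j : Fin n) (a : Fin (n + 1) → A) (l : Fin (n + 1)) :
    ∃ (l' : Fin n) (g : A →ₗ[k] A), ∀ x, Fin.contractNth j.castSucc (· * ·)
      (Function.update a l x) =
        Function.update (Fin.contractNth j.castSucc (· * ·) a) l' (g x) := by
  have hj := j.isLt
  have hl := l.isLt
  have key : ∀ (l' : Fin n) (g : A →ₗ[k] A),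
      (∀ x, Fin.contractNth j.castSucc (· * ·) (Function.update a l x) l' = g x) →
      (∀ x m, m ≠ l' → Fin.contractNth j.castSucc (· * ·) (Function.update a l x) m =
        Fin.contractNth j.castSucc (· * ·) a m) →
      ∃ (l' : Fin n) (g : A →ₗ[k] A), ∀ x, Fin.contractNth j.castSucc (· * ·)
        (Function.update a l x) =
          Function.update (Fin.contractNth j.castSucc (· * ·) a) l' (g x) := by
    intro l' g h1 h2
    refine ⟨l', g, fun x => ?_⟩
    ext m
    by_cases hm : m = l'
    · subst hm; simp [h1]
    · rw [Function.update_of_ne hm]; exact h2 x m hm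
  rcases lt_trichotomy (l : ℕ) j with h | h | h
  · refine key ⟨l, by omega⟩ LinearMap.id (fun x => ?_) (fun x m hm => ?_)
    · simp [Fin.contractNth, h, Function.update_apply, Fin.ext_iff]
    · have : (m : ℕ) ≠ l := fun e => hm (Fin.ext e)
      simp only [Fin.contractNth, Function.update_apply, Fin.ext_iff, Fin.val_castSucc,
        Fin.val_succ]
      grind
  · refine key ⟨l, by omega⟩ (LinearMap.mulRight k (a j.succ)) (fun x => ?_) (fun x m hm => ?_)
    · have hs : (⟨l, by omega⟩ : Fin n) = j := Fin.ext h
      simp [Fin.contractNth, h, Function.update_apply, Fin.ext_iff]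
    · have : (m : ℕ) ≠ l := fun e => hm (Fin.ext e)
      simp only [Fin.contractNth, Function.update_apply, Fin.ext_iff, Fin.val_castSucc,
        Fin.val_succ]
      grind
  · by_cases h' : (l : ℕ) = j + 1
    · refine key j (LinearMap.mulLeft k (a j.castSucc)) (fun x => ?_) (fun x m hm => ?_)
      · simp [Fin.contractNth, h', Function.update_apply, Fin.ext_iff]
      · have : (m : ℕ) ≠ j := fun e => hm (Fin.ext e)
        simp only [Fin.contractNth, Function.update_apply, Fin.ext_iff, Fin.val_castSucc,
          Fin.val_succ]
        grind
    · refine key ⟨l - 1, by omega⟩ LinearMap.id (fun x => ?_) (fun x m hm => ?_)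
      · simp only [Fin.contractNth, Function.update_apply, Fin.ext_iff, Fin.val_castSucc,
          Fin.val_succ, LinearMap.id_apply]
        grind
      · have : (m : ℕ) ≠ l - 1 := fun e => hm (Fin.ext e)
        simp only [Fin.contractNth, Function.update_apply, Fin.ext_iff, Fin.val_castSucc,
          Fin.val_succ]
        grind

/-- `f(a₁, …, aⱼaⱼ₊₁, …, aₙ₊₁)` (with `j` counted from `0`). -/
def inner {n : ℕ} (f : Cochain k A A n) (j : Fin n) : Cochain k A A (n + 1) where
  toFun a := f (Fin.contractNth j.castSucc (· * ·) a)
  map_update_add' {inst} a l x y := by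
    obtain rfl : inst = instDecidableEqFin _ := Subsingleton.elim _ _
    obtain ⟨l', g, h⟩ := contractNth_update (k := k) j a l
    simp only [h, map_add, MultilinearMap.map_update_add]
  map_update_smul' {inst} a l c x := by
    obtain rfl : inst = instDecidableEqFin _ := Subsingleton.elim _ _
    obtain ⟨l', g, h⟩ := contractNth_update (k := k) j a l
    simp only [h, map_smul, MultilinearMap.map_update_smul]

/-- `a₁ f(a₂, …, aₙ₊₁)`. -/
def leftMul {n : ℕ} (f : Cochain k A A n) : Cochain k A A (n + 1) where
  toFun a := a 0 * f (fun l => a l.succ)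
  map_update_add' {inst} a l x y := by
    obtain rfl : inst = instDecidableEqFin _ := Subsingleton.elim _ _
    refine Fin.cases ?_ (fun l => ?_) l
    · simp [add_mul]
    · have : ∀ x, (fun m : Fin n => Function.update a l.succ x m.succ) =
          Function.update (fun m => a m.succ) l x := by
        intro x; ext m; simp [Function.update_apply]
      simp [this, mul_add, Function.update_of_ne (Fin.succ_ne_zero l).symm]
  map_update_smul' {inst} a l c x := by
    obtain rfl : inst = instDecidableEqFin _ := Subsingleton.elim _ _
    refine Fin.cases ?_ (fun l => ?_) l
    · simp
    · have : ∀ x, (fun m : Fin n => Function.update a l.succ x m.succ) =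
          Function.update (fun m => a m.succ) l x := by
        intro x; ext m; simp [Function.update_apply]
      simp [this, Function.update_of_ne (Fin.succ_ne_zero l).symm]

/-- `f(a₁, …, aₙ) aₙ₊₁`. -/
def rightMul {n : ℕ} (f : Cochain k A A n) : Cochain k A A (n + 1) where
  toFun a := f (fun l => a l.castSucc) * a (Fin.last n)
  map_update_add' {inst} a l x y := by
    obtain rfl : inst = instDecidableEqFin _ := Subsingleton.elim _ _
    refine Fin.lastCases ?_ (fun l => ?_) l
    · have : ∀ x, (fun m : Fin n => Function.update a (Fin.last n) x m.castSucc) =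
          (fun m => a m.castSucc) := by
        intro x; ext m; simp [(Fin.castSucc_lt_last m).ne]
      simp [mul_add]
    · have : ∀ x, (fun m : Fin n => Function.update a l.castSucc x m.castSucc) =
          Function.update (fun m => a m.castSucc) l x := by
        intro x; ext m; simp [Function.update_apply]
      simp [this, add_mul, Function.update_of_ne (Fin.castSucc_lt_last l).ne']
  map_update_smul' {inst} a l c x := by
    obtain rfl : inst = instDecidableEqFin _ := Subsingleton.elim _ _
    refine Fin.lastCases ?_ (fun l => ?_) l
    · have : ∀ x, (fun m : Fin n => Function.update a (Fin.last n) x m.castSucc) =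
          (fun m => a m.castSucc) := by
        intro x; ext m; simp [(Fin.castSucc_lt_last m).ne]
      simp [this]
    · have : ∀ x, (fun m : Fin n => Function.update a l.castSucc x m.castSucc) =
          Function.update (fun m => a m.castSucc) l x := by
        intro x; ext m; simp [Function.update_apply]
      simp [this, Function.update_of_ne (Fin.castSucc_lt_last l).ne']

/-- The Hochschild coboundary. -/
def hochschild (n : ℕ) : Cochain k A A n →ₗ[k] Cochain k A A (n + 1) where
  toFun f := leftMul f + ∑ j : Fin n, (-1 : k) ^ ((j : ℕ) + 1) • inner f j +
    (-1 : k) ^ (n + 1) • rightMul f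
  map_add' f g := by
    ext a
    simp only [leftMul, inner, rightMul, add_apply, sum_apply,
      smul_apply, MultilinearMap.coe_mk, mul_add, add_mul, smul_add,
      Finset.sum_add_distrib]
    abel
  map_smul' c f := by
    ext a
    simp only [leftMul, inner, rightMul, add_apply, sum_apply,
      smul_apply, MultilinearMap.coe_mk, mul_smul_comm, smul_mul_assoc,
      smul_add, Finset.smul_sum, RingHom.id_apply, smul_comm c]

/-- The `j`-th partial composition
`(f ∘₍ⱼ₎ g)(a) = f(a₁, …, aⱼ, g(aⱼ₊₁, …, aⱼ₊q), aⱼ₊q₊₁, …)`. -/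
def partialComp {p q n : ℕ} (h : n + 1 = p + q) (f : Cochain k A A p) (g : Cochain k A A q)
    (j : Fin p) (a : Fin n → A) : A :=
  f fun m => if hm : m = j then g fun l => a (EInf.innerPos h j l) else a (EInf.outerPos h j m hm)

/-! ### Autopoietic cochains -/

/-- The product of two elements of the basis `b` is an idempotent of `k` times an element of `b`. -/
def IsIdempotentBasis (b : Module.Basis Ω k A) : Prop :=
  ∀ α β, ∃ (m : Ω) (μ : k), μ * μ = μ ∧ b α * b β = μ • b m

/-- The product `φ₁φ₂⋯φₙ` of a tuple of basis elements (the unit of `A` if `n = 0`). -/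
noncomputable def basisProd (b : Module.Basis Ω k A) {n : ℕ} (σ : Fin n → Ω) : A :=
  (List.ofFn fun l => b (σ l)).prod

/-- The (strictly) autopoietic cochains `AP(A^{⊗n}, A)`: the cochains `f` with
`f(φ₁, …, φₙ) ∈ k · φ₁⋯φₙ` for all basis elements; for `n = 0` this says `f(1) ∈ k · e`. -/
noncomputable def AP (b : Module.Basis Ω k A) (n : ℕ) : Submodule k (Cochain k A A n) where
  carrier := {f | ∀ σ : Fin n → Ω, ∃ c : k, f (fun l => b (σ l)) = c • basisProd b σ}
  add_mem' {f g} hf hg σ := by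
    obtain ⟨c, hc⟩ := hf σ
    obtain ⟨c', hc'⟩ := hg σ
    exact ⟨c + c', by rw [add_apply, hc, hc', add_smul]⟩
  zero_mem' σ := ⟨0, by simp⟩
  smul_mem' c f hf σ := by
    obtain ⟨c', hc'⟩ := hf σ
    exact ⟨c * c', by rw [smul_apply, hc', mul_smul]⟩

theorem prod_contractNth {n : ℕ} (j : Fin n) (a : Fin (n + 1) → A) :
    (List.ofFn (Fin.contractNth j.castSucc (· * ·) a)).prod = (List.ofFn a).prod := by
  have key : ∀ {m : ℕ} (c : Fin m → A), (List.ofFn c).prod = Fin.partialProd c (Fin.last m) := by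
    intro m c
    rw [Fin.partialProd, Fin.val_last, List.take_of_length_le (by simp)]
  rw [key, key, Fin.partialProd_contractNth, Function.comp_apply, Fin.succAbove_of_le_castSucc]
  · rfl
  · have := j.isLt
    simp only [Fin.le_def, Fin.val_succ, Fin.val_castSucc, Fin.val_last]
    omega

theorem hochschild_mem {b : Module.Basis Ω k A} (hb : IsIdempotentBasis b) {n : ℕ}
    {f : Cochain k A A n} (hf : f ∈ AP b n) : hochschild n f ∈ AP b (n + 1) := by
  have hin : ∀ j, inner f j ∈ AP b (n + 1) := by
    intro j σ
    obtain ⟨m, μ, -, hμ⟩ := hb (σ j.castSucc) (σ j.succ)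
    let τ : Fin n → Ω := fun l => if l < j then σ l.castSucc else if l = j then m else σ l.succ
    have hτ : Fin.contractNth j.castSucc (· * ·) (fun l => b (σ l)) =
        Function.update (fun l => b (τ l)) j (μ • b (τ j)) := by
      ext l
      rcases lt_trichotomy l j with h | h | h
      · rw [Fin.contractNth_apply_of_lt _ _ _ _ (by simpa using h), Function.update_of_ne h.ne]
        simp [τ, h]
      · subst h
        rw [Fin.contractNth_apply_of_eq _ _ _ _ (by simp), Function.update_self]
        simp [τ, hμ]
      · rw [Fin.contractNth_apply_of_gt _ _ _ _ (by simpa using h), Function.update_of_ne h.ne']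
        simp [τ, h.not_gt, h.ne']
    have hp : basisProd b σ = μ • basisProd b τ := by
      have h1 := prod_contractNth j (fun l => b (σ l))
      rw [hτ] at h1
      have h2 := (MultilinearMap.mkPiAlgebraFin k n A).map_update_smul (fun l => b (τ l)) j μ
        (b (τ j))
      rw [Function.update_eq_self, MultilinearMap.mkPiAlgebraFin_apply,
        MultilinearMap.mkPiAlgebraFin_apply] at h2
      exact h1.symm.trans h2
    obtain ⟨c, hc⟩ := hf τ
    refine ⟨c, ?_⟩
    change f (Fin.contractNth j.castSucc (· * ·) fun l => b (σ l)) = _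
    rw [hτ, f.map_update_smul, Function.update_eq_self, hc, hp, smul_comm]
  have hl : leftMul f ∈ AP b (n + 1) := by
    intro σ
    obtain ⟨c, hc⟩ := hf fun l => σ l.succ
    refine ⟨c, ?_⟩
    change b (σ 0) * f (fun l => b (σ l.succ)) = _
    rw [hc, mul_smul_comm, basisProd, basisProd, List.ofFn_succ, List.prod_cons]
  have hr : rightMul f ∈ AP b (n + 1) := by
    intro σ
    obtain ⟨c, hc⟩ := hf fun l => σ l.castSucc
    refine ⟨c, ?_⟩
    change f (fun l => b (σ l.castSucc)) * b (σ (Fin.last n)) = _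
    rw [hc, smul_mul_assoc, basisProd, basisProd, List.ofFn_succ_last, List.prod_append]
    simp
  exact add_mem (add_mem hl (sum_mem fun j _ => Submodule.smul_mem _ _ (hin j)))
    (Submodule.smul_mem _ _ hr)

/-- The restriction of the Hochschild coboundary to the autopoietic cochains. -/
noncomputable def delta {b : Module.Basis Ω k A} (hb : IsIdempotentBasis b) (n : ℕ) :
    AP b n →ₗ[k] AP b (n + 1) :=
  (hochschild n).restrict fun _ hf => hochschild_mem hb hf

/-- The coboundary of the total complex `⨁ n, AP(A^{⊗n}, A)`. -/
noncomputable def deltaTotal {b : Module.Basis Ω k A} (hb : IsIdempotentBasis b) :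
    (⨁ n, AP b n) →ₗ[k] ⨁ n, AP b n :=
  DirectSum.toModule k ℕ _ fun n => DirectSum.lof k ℕ (fun n => AP b n) (n + 1) ∘ₗ delta hb n

/-! ### Simplicial cochains on the bar construction and the cup-`i` products -/

/-- The cochain with prescribed values on the tuples of basis elements. -/
noncomputable def ofBasis (b : Module.Basis Ω k A) {M : Type*} [AddCommGroup M] [Module k M]
    {n : ℕ} (g : (Fin n → Ω) → M) : Cochain k A M n :=
  ((Basis.piTensorProduct fun _ : Fin n => b).constr k g).compMultilinearMap
    (PiTensorProduct.tprod k)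

theorem ofBasis_apply (b : Module.Basis Ω k A) {M : Type*} [AddCommGroup M] [Module k M]
    {n : ℕ} (g : (Fin n → Ω) → M) (σ : Fin n → Ω) : ofBasis b g (fun l => b (σ l)) = g σ := by
  rw [ofBasis, LinearMap.compMultilinearMap_apply, ← Basis.piTensorProduct_apply,
    Module.Basis.constr_basis]

/-- The face of the simplex `(a₁, …, aₙ)` (with vertices `0, …, n`, the edge from `l - 1` to `l`
being labelled by `aₗ`) spanned by the set `S` of `p + 1` vertices: the edge from a vertex of `S`
to the next one is labelled by the product of the labels in between, and the labels before the
first and after the last vertex of `S` are omitted. -/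
def face {n p : ℕ} (S : Finset (Fin (n + 1))) (hS : S.card = p + 1) (a : Fin n → A) :
    Fin p → A := fun j =>
  (((List.finRange n).filter fun l => S.orderEmbOfFin hS j.castSucc ≤ l.castSucc ∧
    l.castSucc < S.orderEmbOfFin hS j.succ).map a).prod

/-- The coboundary `d*` of `Hom_k(A^{⊗*}, k)`, dual to `∑ (-1)ⁱ dᵢ`, where `dᵢ` is the face
omitting the vertex `i`. -/
noncomputable def dStar (b : Module.Basis Ω k A) {n : ℕ} (α : Cochain k A k n) :
    Cochain k A k (n + 1) :=
  ofBasis b fun σ => ∑ i : Fin (n + 2), (-1) ^ (i : ℕ) *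
    α (face (Finset.univ.erase i) (by simp) fun l => b (σ l))

/-- For the cut points `U = {j₀ < ⋯ < jᵢ}` of `{0, …, n}`, the union of the intervals
`[0, j₀], [j₀, j₁], …, [jᵢ, n]` with an even number (counted from `0`). -/
def evenPart {n : ℕ} (U : Finset (Fin (n + 1))) : Finset (Fin (n + 1)) :=
  {v | v ∈ U ∨ Even {u ∈ U | u < v}.card}

/-- The union of the intervals `[0, j₀], [j₀, j₁], …, [jᵢ, n]` with an odd number. -/
def oddPart {n : ℕ} (U : Finset (Fin (n + 1))) : Finset (Fin (n + 1)) :=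
  {v | v ∈ U ∨ Odd {u ∈ U | u < v}.card}

/-- The number of pairs `x < y` of vertices outside `U` with `x` in an interval with an odd number
and `y` in one with an even number. -/
def inversions {n : ℕ} (U : Finset (Fin (n + 1))) : ℕ :=
  Finset.card {z : Fin (n + 1) × Fin (n + 1) | z.1 ∈ oddPart U \ U ∧ z.2 ∈ evenPart U \ U ∧
    z.1 < z.2}

/-- Steenrod's cup-`i` product `α ∪ᵢ β` on `Hom_k(A^{⊗*}, k)`. -/
noncomputable def cup (b : Module.Basis Ω k A) (i : ℕ) {p q : ℕ} (α : Cochain k A k p)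
    (β : Cochain k A k q) : Cochain k A k (p + q - i) :=
  ofBasis b fun σ => ∑ U ∈ (Finset.univ : Finset (Fin (p + q - i + 1))).powersetCard (i + 1),
    if h : (evenPart U).card = p + 1 ∧ (oddPart U).card = q + 1 then
      (-1) ^ (inversions U + (p + q) * i.choose 2) *
        α (face (evenPart U) h.1 fun l => b (σ l)) * β (face (oddPart U) h.2 fun l => b (σ l))
    else 0

/-- `Ψ(α)(φ₁, …, φₙ) = α(φ₁, …, φₙ) · φ₁⋯φₙ`. -/
noncomputable def Psi (b : Module.Basis Ω k A) {n : ℕ} (α : Cochain k A k n) : AP b n :=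
  ⟨ofBasis b fun σ => α (fun l => b (σ l)) • basisProd b σ, fun σ => ⟨_, ofBasis_apply b _ σ⟩⟩

/-- `c` is the coefficient `λ` of `f` at `(φ₁, …, φₙ)`: it satisfies
`f(φ₁, …, φₙ) = c · φ₁⋯φₙ`, and it is normalised by the condition that it is killed by every scalar
which kills `φ₁⋯φₙ`. So `c = 0` if `φ₁⋯φₙ = 0`, and if `φ₁⋯φₙ = μ φₘ` with an idempotent `μ`,
the condition says `c = μ c`, which is no condition if `μ = 1`. -/
def IsCoeff (b : Module.Basis Ω k A) {n : ℕ} (f : Cochain k A A n) (σ : Fin n → Ω) (c : k) : Prop :=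
  f (fun l => b (σ l)) = c • basisProd b σ ∧ ∀ t : k, t • basisProd b σ = 0 → t * c = 0

open Classical in
/-- `Φ(f)(φ₁, …, φₙ)` is the coefficient of `f` at `(φ₁, …, φₙ)`. -/
noncomputable def Phi (b : Module.Basis Ω k A) {n : ℕ} (f : AP b n) : Cochain k A k n :=
  ofBasis b fun σ => if h : ∃ c, IsCoeff b f.1 σ c then h.choose else 0

/-- The cup-`i` product of autopoietic cochains. -/
noncomputable def apCup (b : Module.Basis Ω k A) (i : ℕ) {p q : ℕ} (f : AP b p) (g : AP b q) :
    AP b (p + q - i) :=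
  Psi b (cup b i (Phi b f) (Phi b g))

/-- The inclusion of `AP(A^{⊗n}, A)` into the total complex. -/
noncomputable def incl (b : Module.Basis Ω k A) {n : ℕ} (f : AP b n) : ⨁ n, AP b n :=
  DirectSum.lof k ℕ (fun n => AP b n) n f

end Autopoietic

/-! A tuple `φ₁, …, φₙ` of basis elements is treated as an `n`-simplex with edges labelled by the
`φₗ`; the face spanned by a set of vertices is labelled by products of consecutive `φₗ`. An
autopoietic cochain is then essentially a scalar function on simplices, and the Hochschild
coboundary is the simplicial one: an inner face does not change the product `φ₁⋯φₙ`, and the factor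
omitted by an outer face is restored by the left or right multiplication. Thus the theory of cochain
operations of Steenrod and of McClure and Smith applies, once the ambiguity of the scalars is under
control.

Scalars. A product of basis elements is `μ • b m` with an idempotent `μ`, so a coefficient is
determined only up to the annihilator of `μ`, and `Φ` need not commute with the coboundaries. The
idempotent `weight hb σ` has the same annihilator as the product of `σ`. The edges of every face of
`σ` are multiples `μⱼ • b (τ j)` with `weight * μⱼ = weight`. Hence the simplicial identities
between coefficients hold after multiplication by the weight, and this is all that `Ψ` can see
(`Psi_eq_Psi`). For fixed `σ`, `coeffs` turns a cochain into a function on the subsets of `{0, …,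
n}`, and `coeffs_deltaTotal` says that the coboundary becomes the simplicial one.

The operad. An operation on functions of finite sets of vertices is given by a kernel `c N S`: its
value at `N` is the sum over the families `S` of subsets of `N` of `c N S * ∏ f j (S j)`.
Composition is matrix multiplication with Koszul signs, and the differential is the graded
commutator with the simplicial coboundary `bd`. The operad `linkedOperad` consists of the kernels of
bounded degree which are invariant under monotone relabelling and which, together with their
differential, live on families such that any two neighbouring vertices of `N` lie in a common
member. This forces non-negative degrees (`excess_nonneg`) and identifies the modules with those of
the surjection operad.

To see this, a family is encoded by the word whose letters say which members contain a given vertex.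
Up to signs the differential becomes `wd` (`toWord_dk`). The operator `prep j`, which prepends an
interval with label `j`, satisfies a homotopy formula (`wd_prep`). Iterating it yields a function
`cutW u` for each sequence `u` of labels. An admissible function is determined by its values on the
shortest words `genW u`, where `u` has no equal neighbours (`Good.eq_zero_of_genW`), and on these
the functions `cutW u` form a diagonal matrix of signs. The symmetric group permutes the surjective
sequences freely, whence freeness (`linkedOperad_free_succ`). Acyclicity (`exists_dk_eq`) is an
induction on the arity: inserting the unit into the first slot of a cycle gives a cycle of smaller
arity, and a primitive of that one corrects the original cycle so that `prep 0` contracts it.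

Cup products. The alternating sequences `0, 1, 0, …` give kernels `altKern` whose entries are
exactly Steenrod's decompositions into overlapping intervals, with his signs (`altKern_apply`,
`act_cup`). The homotopy formula gives their differential (`wd_altW`), and the Leibniz rule and
equivariance of the operad action then give the coboundary formula. The products for `i = 0, 1` are
found by listing the sets of one or two cut points. -/

namespace EInf

/-! ### Signs -/

/-- The sign `(-1)^e` for `e` modulo `2`. -/
def sgn (k : Type*) [CommRing k] (e : ZMod 2) : k := (-1) ^ e.val

section Sign
variable {k : Type*} [CommRing k]

theorem sgn_natCast (n : ℕ) : sgn k (n : ZMod 2) = (-1) ^ n := by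
  rw [sgn, ZMod.val_natCast, ← neg_one_pow_eq_pow_mod_two]

theorem sgn_add (a b : ZMod 2) : sgn k (a + b) = sgn k a * sgn k b := by
  obtain ⟨m, rfl⟩ := ZMod.natCast_zmod_surjective a
  obtain ⟨n, rfl⟩ := ZMod.natCast_zmod_surjective b
  rw [← Nat.cast_add, sgn_natCast, sgn_natCast, sgn_natCast, pow_add]

@[simp] theorem sgn_zero : sgn k 0 = 1 := by simp [sgn]

@[simp] theorem sgn_one : sgn k 1 = -1 := by
  have := sgn_natCast (k := k) 1
  simpa using this

@[simp] theorem sgn_mul_self (a : ZMod 2) : sgn k a * sgn k a = 1 := by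
  rw [← sgn_add, CharTwo.add_self_eq_zero, sgn_zero]

theorem sgn_sum {ι : Type*} (s : Finset ι) (f : ι → ZMod 2) :
    sgn k (∑ i ∈ s, f i) = ∏ i ∈ s, sgn k (f i) := by
  classical
  induction s using Finset.induction_on with
  | empty => simp
  | insert a s ha ih => rw [Finset.sum_insert ha, Finset.prod_insert ha, sgn_add, ih]

/-- The normaliser behind `linear_combination` does not know the characteristic. Identities between
sign exponents are therefore proved as integral identities plus an explicit multiple of this
relation. -/
theorem two_zmod : (2 : ZMod 2) = 0 := rfl

end Sign

/-! ### Splitting the inputs of a composite -/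

section Fam
variable {X : Type*} {r s t m l n : ℕ}

/-- The arguments of the outer operation of a partial composite, `t` being put into the slot `i`. -/
def outerFam (h : n + 1 = r + s) (i : Fin r) (y : Fin n → X) (t : X) : Fin r → X :=
  fun j => if hj : j = i then t else y (outerPos h i j hj)

/-- The arguments of the inner operation of a partial composite. -/
def innerFam (h : n + 1 = r + s) (i : Fin r) (y : Fin n → X) : Fin s → X :=
  fun l => y (innerPos h i l)

/-- The arguments of a partial composite with given outer and inner arguments. -/
def glue (h : n + 1 = r + s) (i : Fin r) (z : Fin r → X) (w : Fin s → X) : Fin n → X := fun m =>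
  if h1 : (m : ℕ) < i then z ⟨m, by omega⟩
  else if h2 : (m : ℕ) < i + s then w ⟨m - i, by omega⟩
  else z ⟨m + 1 - s, by omega⟩

@[simp] theorem outerFam_self (h : n + 1 = r + s) (i : Fin r) (y : Fin n → X) (t : X) :
    outerFam h i y t i = t := by simp [outerFam]

theorem outerFam_of_ne (h : n + 1 = r + s) (i : Fin r) (y : Fin n → X) (t : X) {j : Fin r}
    (hj : j ≠ i) : outerFam h i y t j = y (outerPos h i j hj) := by simp [outerFam, hj]

theorem outerFam_glue (h : n + 1 = r + s) (i : Fin r) (z : Fin r → X) (w : Fin s → X) :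
    outerFam h i (glue h i z w) (z i) = z := by
  funext j
  by_cases hj : j = i
  · subst hj; simp
  · rw [outerFam_of_ne _ _ _ _ hj]
    have hj' : (j : ℕ) ≠ i := fun e => hj (Fin.ext e)
    have := i.isLt
    have := j.isLt
    simp only [glue, outerPos, Fin.lt_def]
    split_ifs <;> first | (congr 1; ext; simp; omega) | omega | rfl

theorem innerFam_glue (h : n + 1 = r + s) (i : Fin r) (z : Fin r → X) (w : Fin s → X) :
    innerFam h i (glue h i z w) = w := by
  funext j
  have := i.isLt
  have := j.isLt
  rw [innerFam, glue, dif_neg (by simp [innerPos]), dif_pos (by simp [innerPos])]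
  congr 1
  ext
  simp [innerPos]

theorem glue_outerFam_innerFam (h : n + 1 = r + s) (i : Fin r) (y : Fin n → X) (t : X) :
    glue h i (outerFam h i y t) (innerFam h i y) = y := by
  funext j
  have := i.isLt
  have := j.isLt
  simp only [glue]
  split_ifs with h1 h2
  · rw [outerFam_of_ne]
    · congr 1; ext; simp only [outerPos, Fin.lt_def]; split_ifs; rfl
    · intro e; have := congrArg Fin.val e; simp at this; omega
  · simp only [innerFam, innerPos]; congr 1; ext; simp; omega
  · rw [outerFam_of_ne]
    · congr 1; ext; simp only [outerPos, Fin.lt_def]; split_ifs <;> omega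
    · intro e; have := congrArg Fin.val e; simp at this; omega

/-- This and the next two lemmas are the positional content of sequential associativity: the three
operations receive the same arguments under both bracketings. -/
theorem outerFam_outerFam_inner (h₁ : m + 1 = r + s) (h₂ : n + 1 = m + t) (h₃ : l + 1 = s + t)
    (h₄ : n + 1 = r + l) (i : Fin r) (j : Fin s) (y : Fin n → X) (a b : X) :
    outerFam h₁ i (outerFam h₂ (innerPos h₁ i j) y a) b = outerFam h₄ i y b := by
  funext x
  by_cases hx : x = i
  · subst hx; simp
  · have := i.isLt
    have := j.isLt
    have := x.isLt
    have hx' : (x : ℕ) ≠ i := fun e => hx (Fin.ext e)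
    have hne : outerPos h₁ i x hx ≠ innerPos h₁ i j := by
      intro e
      have := congrArg Fin.val e
      simp only [outerPos, innerPos, Fin.lt_def] at this
      split_ifs at this <;> omega
    rw [outerFam_of_ne _ _ _ _ hx, outerFam_of_ne _ _ _ _ hx, outerFam_of_ne _ _ _ _ hne]
    congr 1
    ext
    simp only [outerPos, innerPos, Fin.lt_def]
    split_ifs <;> omega

theorem innerFam_outerFam_inner (h₁ : m + 1 = r + s) (h₂ : n + 1 = m + t) (h₃ : l + 1 = s + t)
    (h₄ : n + 1 = r + l) (i : Fin r) (j : Fin s) (y : Fin n → X) (a : X) :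
    innerFam h₁ i (outerFam h₂ (innerPos h₁ i j) y a) = outerFam h₃ j (innerFam h₄ i y) a := by
  funext x
  have := i.isLt
  have := j.isLt
  have := x.isLt
  by_cases hx : x = j
  · subst hx; simp [innerFam]
  · have hx' : (x : ℕ) ≠ j := fun e => hx (Fin.ext e)
    have hne : innerPos h₁ i x ≠ innerPos h₁ i j := by
      intro e
      have := congrArg Fin.val e
      simp only [innerPos] at this
      omega
    rw [innerFam, outerFam_of_ne _ _ _ _ hx, outerFam_of_ne _ _ _ _ hne, innerFam]
    congr 1
    ext
    simp only [outerPos, innerPos, Fin.lt_def]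
    split_ifs <;> omega

theorem innerFam_innerFam (h₁ : m + 1 = r + s) (h₂ : n + 1 = m + t) (h₃ : l + 1 = s + t)
    (h₄ : n + 1 = r + l) (i : Fin r) (j : Fin s) (y : Fin n → X) :
    innerFam h₂ (innerPos h₁ i j) y = innerFam h₃ j (innerFam h₄ i y) := by
  funext x
  simp only [innerFam]
  congr 1
  ext
  simp only [innerPos]
  omega

/-- The positional content of parallel associativity. It is stated for `i ≠ j`, so that it can be
used with the two slots interchanged. -/
theorem outerFam_outerFam_outer (h₁ : m + 1 = r + s) (h₂ : n + 1 = m + t) (h₃ : l + 1 = r + t)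
    (h₄ : n + 1 = l + s) (i j : Fin r) (hij : i ≠ j) (y : Fin n → X) (a b : X) :
    outerFam h₁ i (outerFam h₂ (outerPos h₁ i j hij.symm) y a) b =
      outerFam h₃ j (outerFam h₄ (outerPos h₃ j i hij) y b) a := by
  have := i.isLt
  have := j.isLt
  have hij' : (i : ℕ) ≠ j := fun e => hij (Fin.ext e)
  funext x
  have := x.isLt
  by_cases hx : x = i
  · subst hx
    rw [outerFam_self, outerFam_of_ne _ _ _ _ hij, outerFam_self]
  · by_cases hx2 : x = j
    · subst hx2
      rw [outerFam_self, outerFam_of_ne _ _ _ _ hx, outerFam_self]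
    · have hx' : (x : ℕ) ≠ i := fun e => hx (Fin.ext e)
      have hx2' : (x : ℕ) ≠ j := fun e => hx2 (Fin.ext e)
      rw [outerFam_of_ne _ _ _ _ hx, outerFam_of_ne _ _ _ _ hx2, outerFam_of_ne, outerFam_of_ne]
      · congr 1
        ext
        simp only [outerPos, Fin.lt_def]
        split_ifs <;> omega
      all_goals
        intro e
        have := congrArg Fin.val e
        simp only [outerPos, Fin.lt_def] at this
        split_ifs at this <;> omega

theorem innerFam_outerFam_outer (h₁ : m + 1 = r + s) (h₂ : n + 1 = m + t) (h₃ : l + 1 = r + t)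
    (h₄ : n + 1 = l + s) (i j : Fin r) (hij : i ≠ j) (y : Fin n → X) (a : X) :
    innerFam h₁ i (outerFam h₂ (outerPos h₁ i j hij.symm) y a) =
      innerFam h₄ (outerPos h₃ j i hij) y := by
  have := i.isLt
  have := j.isLt
  have hij' : (i : ℕ) ≠ j := fun e => hij (Fin.ext e)
  funext x
  have := x.isLt
  rw [innerFam, outerFam_of_ne, innerFam]
  · congr 1
    ext
    simp only [outerPos, innerPos, Fin.lt_def]
    split_ifs <;> omega
  · intro e
    have := congrArg Fin.val e
    simp only [outerPos, innerPos, Fin.lt_def] at this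
    split_ifs at this <;> omega

/-- The inputs of a composite are the disjoint union of the outer positions for `j ≠ i` and the
inner positions. The slot `i` contributes zero, so that the outer sum runs over all of `Fin r`. -/
theorem sum_split {M : Type*} [AddCommMonoid M] (h : n + 1 = r + s) (i : Fin r) (F : Fin n → M) :
    ∑ m, F m = (∑ j, if hj : j = i then 0 else F (outerPos h i j hj)) +
      ∑ l, F (innerPos h i l) := by
  have hout : (∑ j, if hj : j = i then 0 else F (outerPos h i j hj)) =
      ∑ m ∈ Finset.univ.filter (fun m : Fin n => ¬ ((i : ℕ) ≤ m ∧ (m : ℕ) < i + s)), F m := by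
    have := i.isLt
    have h0 : (∑ j, if hj : j = i then 0 else F (outerPos h i j hj)) =
        ∑ j ∈ Finset.univ.erase i, if hj : j = i then 0 else F (outerPos h i j hj) := by
      rw [← Finset.add_sum_erase _ _ (Finset.mem_univ i)]
      simp
    rw [h0]
    refine Finset.sum_bij (fun j hj => outerPos h i j (Finset.ne_of_mem_erase hj)) ?_ ?_ ?_ ?_
    · intro j hj
      have hj' : (j : ℕ) ≠ i := fun e => (Finset.ne_of_mem_erase hj) (Fin.ext e)
      simp only [Finset.mem_filter, Finset.mem_univ, true_and, outerPos, Fin.lt_def]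
      split_ifs <;> omega
    · intro j hj j' hj' e
      have hj1 : (j : ℕ) ≠ i := fun e => (Finset.ne_of_mem_erase hj) (Fin.ext e)
      have hj2 : (j' : ℕ) ≠ i := fun e => (Finset.ne_of_mem_erase hj') (Fin.ext e)
      have := congrArg Fin.val e
      ext
      simp only [outerPos, Fin.lt_def] at this
      split_ifs at this <;> omega
    · intro m hm
      simp only [Finset.mem_filter, Finset.mem_univ, true_and] at hm
      have := m.isLt
      by_cases hmi : (m : ℕ) < i
      · refine ⟨⟨m, by omega⟩, ?_, ?_⟩
        · simp [Fin.ext_iff]; omega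
        · ext; simp only [outerPos, Fin.lt_def]; split_ifs; rfl
      · refine ⟨⟨m + 1 - s, by omega⟩, ?_, ?_⟩
        · simp [Fin.ext_iff]; omega
        · ext; simp only [outerPos, Fin.lt_def]; split_ifs <;> omega
    · intro j hj
      rw [dif_neg (Finset.ne_of_mem_erase hj)]
  have hin : ∑ l, F (innerPos h i l) =
      ∑ m ∈ Finset.univ.filter (fun m : Fin n => (i : ℕ) ≤ m ∧ (m : ℕ) < i + s), F m := by
    have := i.isLt
    refine Finset.sum_bij (fun l _ => innerPos h i l) ?_ ?_ ?_ ?_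
    · intro l _
      have := l.isLt
      simp only [Finset.mem_filter, Finset.mem_univ, true_and, innerPos]
      omega
    · intro j _ j' _ e
      have := congrArg Fin.val e
      ext
      simp only [innerPos] at this
      omega
    · intro m hm
      simp only [Finset.mem_filter, Finset.mem_univ, true_and] at hm
      exact ⟨⟨m - i, by omega⟩, Finset.mem_univ _, by ext; simp only [innerPos]; omega⟩
    · intro l _; rfl
  rw [hout, hin, add_comm, Finset.sum_filter_add_sum_filter_not]

end Fam
end EInf

/-! ### Degrees of the outer and inner arguments of a composite -/

namespace EInf

section Degrees
variable {X : Type*} {r s t m l n : ℕ} (dg : X → ZMod 2)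

/-- The total degree of a family. -/
def tot (y : Fin n → X) : ZMod 2 := ∑ m, dg (y m)

/-- The total degree of the members of a family before the position `i`. -/
def pre (i : ℕ) (y : Fin n → X) : ZMod 2 := ∑ m : Fin n, if (m : ℕ) < i then dg (y m) else 0

theorem sum_outerFam {M : Type*} [AddCommMonoid M] (h : n + 1 = r + s) (i : Fin r)
    (G : Fin r → X → M) (y : Fin n → X) (t : X) :
    ∑ j, G j (outerFam h i y t j) =
      (∑ j, if hj : j = i then 0 else G j (y (outerPos h i j hj))) + G i t := by
  rw [← Finset.add_sum_erase _ _ (Finset.mem_univ i),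
    ← Finset.add_sum_erase Finset.univ (fun j => if hj : j = i then 0 else _) (Finset.mem_univ i),
    outerFam_self, dif_pos rfl, zero_add, add_comm]
  congr 1
  refine Finset.sum_congr rfl fun j hj => ?_
  rw [outerFam_of_ne _ _ _ _ (Finset.ne_of_mem_erase hj), dif_neg (Finset.ne_of_mem_erase hj)]

theorem tot_outerFam (h : n + 1 = r + s) (i : Fin r) (y : Fin n → X) (t : X) :
    tot dg (outerFam h i y t) + tot dg (innerFam h i y) = tot dg y + dg t := by
  unfold tot
  rw [sum_outerFam h i (fun _ x => dg x), sum_split h i]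
  simp only [innerFam]
  ring

theorem pre_outerFam_self (h : n + 1 = r + s) (i : Fin r) (y : Fin n → X) (t : X) :
    pre dg i (outerFam h i y t) = pre dg i y := by
  unfold pre
  rw [sum_outerFam h i (fun j x => if (j : ℕ) < i then dg x else 0), sum_split h i]
  have h1 : ∀ l, ¬ ((innerPos h i l : Fin n) : ℕ) < i := fun l => by simp [innerPos]
  simp only [h1, lt_irrefl, if_false, Finset.sum_const_zero, add_zero]
  refine Finset.sum_congr rfl fun j _ => ?_
  split_ifs with h2 h3 h4 h4
  any_goals rfl
  all_goals
    exfalso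
    have := i.isLt
    have := j.isLt
    have hj' : (j : ℕ) ≠ i := fun e => h2 (Fin.ext e)
    simp only [outerPos, Fin.lt_def] at h4
    split_ifs at h4 <;> omega

theorem pre_add (h : n + 1 = r + s) (i : Fin r) {j : ℕ} (hj : j ≤ s) (y : Fin n → X) :
    pre dg (i + j) y = pre dg i y + pre dg j (innerFam h i y) := by
  unfold pre
  rw [sum_split h i, sum_split h i (fun m => if (m : ℕ) < i then dg (y m) else 0)]
  have h1 : ∀ l, ¬ ((innerPos h i l : Fin n) : ℕ) < i := fun l => by simp [innerPos]
  simp only [h1, if_false, Finset.sum_const_zero, add_zero]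
  congr 1
  · refine Finset.sum_congr rfl fun x _ => ?_
    split_ifs with h2 h3 h4 h4
    any_goals rfl
    all_goals
      exfalso
      have := i.isLt
      have := x.isLt
      have hj' : (x : ℕ) ≠ i := fun e => h2 (Fin.ext e)
      simp only [outerPos, Fin.lt_def] at h3 h4
      split_ifs at h3 h4 <;> omega
  · refine Finset.sum_congr rfl fun x _ => ?_
    simp [innerPos, innerFam]

/-- To the right of the slot `i`, the whole inner family stands where the outer family has the
single intermediate argument `t`. This discrepancy produces the Koszul sign of parallel
associativity. -/
theorem pre_outerPos_of_lt (h : n + 1 = r + s) (i j : Fin r) (hij : i < j) (y : Fin n → X) (t : X) :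
    pre dg (outerPos h i j hij.ne') y + dg t =
      pre dg j (outerFam h i y t) + tot dg (innerFam h i y) := by
  have hij' : (i : ℕ) < j := hij
  unfold pre tot
  rw [sum_outerFam h i (fun x z => if (x : ℕ) < j then dg z else 0), sum_split h i]
  have h1 : ∀ l, ((innerPos h i l : Fin n) : ℕ) < (outerPos h i j hij.ne' : Fin n) := fun l => by
    have := l.isLt
    simp only [innerPos, outerPos, Fin.lt_def]
    split_ifs <;> omega
  have h2 : ∀ x (hx : x ≠ i), ((outerPos h i x hx : Fin n) : ℕ) < (outerPos h i j hij.ne' : Fin n)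
      ↔ (x : ℕ) < j := fun x hx => by
    have := i.isLt
    have := j.isLt
    have := x.isLt
    have hj' : (x : ℕ) ≠ i := fun e => hx (Fin.ext e)
    simp only [outerPos, Fin.lt_def]
    split_ifs <;> omega
  simp only [h1, h2, if_true, hij', innerFam]
  ring

theorem pre_outerPos_of_gt (h : n + 1 = r + s) (i j : Fin r) (hij : j < i) (y : Fin n → X) (t : X) :
    pre dg (outerPos h i j hij.ne) y = pre dg j (outerFam h i y t) := by
  have hij' : (j : ℕ) < i := hij
  unfold pre
  rw [sum_outerFam h i (fun x z => if (x : ℕ) < j then dg z else 0), sum_split h i]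
  have h1 : ∀ l, ¬ ((innerPos h i l : Fin n) : ℕ) < (outerPos h i j hij.ne : Fin n) := fun l => by
    have := l.isLt
    simp only [innerPos, outerPos, Fin.lt_def]
    split_ifs <;> omega
  have h2 : ∀ x (hx : x ≠ i), ((outerPos h i x hx : Fin n) : ℕ) < (outerPos h i j hij.ne : Fin n)
      ↔ (x : ℕ) < j := fun x hx => by
    have := i.isLt
    have := j.isLt
    have := x.isLt
    have hj' : (x : ℕ) ≠ i := fun e => hx (Fin.ext e)
    simp only [outerPos, Fin.lt_def]
    split_ifs <;> omega
  simp only [h1, h2, if_false, hij'.not_gt, Finset.sum_const_zero]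

end Degrees

/-! ### Kernels -/

/-- A kernel with `r` inputs: the matrix of an operation on the functions on `X`. -/
abbrev Kern (k X : Type*) (r : ℕ) := X → (Fin r → X) → k

section Theta
variable {k : Type*} [CommRing k] {X : Type*} (dg : X → ZMod 2) {r s t m l n : ℕ}

/-- The kernel has parity `a`. -/
def HasParity (c : Kern k X r) (a : ZMod 2) : Prop := ∀ x y, c x y ≠ 0 → tot dg y + dg x = a

/-- The kernel changed by the sign `(-1)^b` on entries of odd parity. -/
def theta (b : ZMod 2) (c : Kern k X r) : Kern k X r :=
  fun x y => sgn k (b * (tot dg y + dg x)) * c x y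

/-- So `theta dg b` is the Koszul sign `(-1)^{b|c|}` in a form that makes sense for inhomogeneous
kernels. The rules for composition and differential can then be stated without decomposing kernels.
-/
theorem theta_of_parity {c : Kern k X r} {a : ZMod 2} (hc : HasParity dg c a) (b : ZMod 2) :
    theta dg b c = sgn k (b * a) • c := by
  funext x y
  simp only [theta, Pi.smul_apply, smul_eq_mul]
  by_cases h0 : c x y = 0
  · simp [h0]
  · rw [hc x y h0]

theorem theta_theta (b : ZMod 2) (c : Kern k X r) : theta dg b (theta dg b c) = c := by
  funext x y
  simp only [theta, ← mul_assoc, sgn_mul_self, one_mul]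


/-- The kernel only involves inputs below the output. -/
def Local [LE X] (c : Kern k X r) : Prop := ∀ x y, c x y ≠ 0 → ∀ j, y j ≤ x

theorem theta_local [LE X] {c : Kern k X r} (hc : Local c) (b : ZMod 2) : Local (theta dg b c) :=
  fun x y h => hc x y (right_ne_zero_of_mul h)

end Theta

section Kernel
variable {k : Type*} [CommRing k] {X : Type*} [PartialOrder X] [LocallyFiniteOrderBot X]
  (dg : X → ZMod 2) {r s t m l n : ℕ}

/-- The partial composition of kernels. -/
def kcomp (h : n + 1 = r + s) (i : Fin r) (c : Kern k X r) (c' : Kern k X s) : Kern k X n :=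
  -- A matrix product over the intermediate `t`, finite because of the bound `t ≤ x`. The sign moves
  -- the inner kernel, whose parity at this entry is `tot dg (innerFam h i y) + dg t`, past the
  -- inputs in front of the slot.
  fun x y => ∑ t ∈ Finset.Iic x, sgn k ((tot dg (innerFam h i y) + dg t) * pre dg i y) *
    c x (outerFam h i y t) * c' t (innerFam h i y)

theorem kcomp_add_left (h : n + 1 = r + s) (i : Fin r) (c₁ c₂ : Kern k X r) (c' : Kern k X s) :
    kcomp dg h i (c₁ + c₂) c' = kcomp dg h i c₁ c' + kcomp dg h i c₂ c' := by
  funext x y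
  simp only [kcomp, Pi.add_apply, ← Finset.sum_add_distrib]
  exact Finset.sum_congr rfl fun _ _ => by ring

theorem kcomp_add_right (h : n + 1 = r + s) (i : Fin r) (c : Kern k X r) (c₁ c₂ : Kern k X s) :
    kcomp dg h i c (c₁ + c₂) = kcomp dg h i c c₁ + kcomp dg h i c c₂ := by
  funext x y
  simp only [kcomp, Pi.add_apply, ← Finset.sum_add_distrib]
  exact Finset.sum_congr rfl fun _ _ => by ring

theorem kcomp_smul_left (h : n + 1 = r + s) (i : Fin r) (a : k) (c : Kern k X r)
    (c' : Kern k X s) : kcomp dg h i (a • c) c' = a • kcomp dg h i c c' := by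
  funext x y
  simp only [kcomp, Pi.smul_apply, smul_eq_mul, Finset.mul_sum]
  exact Finset.sum_congr rfl fun _ _ => by ring

theorem kcomp_smul_right (h : n + 1 = r + s) (i : Fin r) (a : k) (c : Kern k X r)
    (c' : Kern k X s) : kcomp dg h i c (a • c') = a • kcomp dg h i c c' := by
  funext x y
  simp only [kcomp, Pi.smul_apply, smul_eq_mul, Finset.mul_sum]
  exact Finset.sum_congr rfl fun _ _ => by ring

/-- The partial composition as a bilinear map. -/
def kcompL (k : Type*) [CommRing k] (h : n + 1 = r + s) (i : Fin r) :
    Kern k X r →ₗ[k] Kern k X s →ₗ[k] Kern k X n :=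
  LinearMap.mk₂ k (kcomp dg h i) (kcomp_add_left dg h i) (fun a c c' => kcomp_smul_left dg h i a c c')
    (kcomp_add_right dg h i) (fun a c c' => kcomp_smul_right dg h i a c c')

theorem theta_kcomp (h : n + 1 = r + s) (i : Fin r) (b : ZMod 2) (c : Kern k X r)
    (c' : Kern k X s) :
    theta dg b (kcomp dg h i c c') = kcomp dg h i (theta dg b c) (theta dg b c') := by
  funext x y
  simp only [theta, kcomp, Finset.mul_sum]
  refine Finset.sum_congr rfl fun t _ => ?_
  have h3 := tot_outerFam dg h i y t
  have h4 : b * (tot dg y + dg x) = b * (tot dg (outerFam h i y t) + dg x) +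
      b * (tot dg (innerFam h i y) + dg t) := by
    linear_combination (-b) * h3 - b * dg t * two_zmod
  rw [h4, sgn_add]
  ring

/-- Both sides are double sums over intermediate `u` and `v`. On the left `v` is bounded by `x`, on
the right by `u`; locality of the middle kernel kills the extra terms. The exponents agree because
the parity of the composite inner kernel is the sum of the two parities. -/
theorem kcomp_assoc (h₁ : m + 1 = r + s) (h₂ : n + 1 = m + t) (h₃ : l + 1 = s + t)
    (h₄ : n + 1 = r + l) (i : Fin r) (j : Fin s) (c : Kern k X r) {c' : Kern k X s}
    (hc' : Local c') (c'' : Kern k X t) :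
    kcomp dg h₂ (innerPos h₁ i j) (kcomp dg h₁ i c c') c'' =
      kcomp dg h₄ i c (kcomp dg h₃ j c' c'') := by
  funext x y
  simp only [kcomp, Finset.mul_sum, Finset.sum_mul]
  rw [Finset.sum_comm]
  refine Finset.sum_congr rfl fun u hu => ?_
  refine Eq.trans ?_ (Finset.sum_subset (Finset.Iic_subset_Iic.2 (Finset.mem_Iic.1 hu)) ?_).symm
  · refine Finset.sum_congr rfl fun v _ => ?_
    have e1 := tot_outerFam dg h₃ j (innerFam h₄ i y) v
    have e2 : pre dg i (outerFam h₂ (innerPos h₁ i j) y v) = pre dg i y := by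
      rw [← pre_outerFam_self dg h₁ i (outerFam h₂ (innerPos h₁ i j) y v) u,
        outerFam_outerFam_inner h₁ h₂ h₃ h₄, pre_outerFam_self]
    have e4 : pre dg (innerPos h₁ i j) y = pre dg i y + pre dg j (innerFam h₄ i y) :=
      pre_add dg h₄ i (by omega) y
    rw [outerFam_outerFam_inner h₁ h₂ h₃ h₄, innerFam_outerFam_inner h₁ h₂ h₃ h₄,
      innerFam_innerFam h₁ h₂ h₃ h₄, e2, e4]
    have key : (tot dg (innerFam h₃ j (innerFam h₄ i y)) + dg v) *
          (pre dg i y + pre dg j (innerFam h₄ i y)) +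
        (tot dg (outerFam h₃ j (innerFam h₄ i y) v) + dg u) * pre dg i y =
        (tot dg (innerFam h₄ i y) + dg u) * pre dg i y +
        (tot dg (innerFam h₃ j (innerFam h₄ i y)) + dg v) * pre dg j (innerFam h₄ i y) := by
      linear_combination pre dg i y * e1 + dg v * pre dg i y * two_zmod
    have key' := congrArg (sgn k) key
    rw [sgn_add, sgn_add] at key'
    linear_combination c x (outerFam h₄ i y u) * c' u (outerFam h₃ j (innerFam h₄ i y) v) *
      c'' v (innerFam h₃ j (innerFam h₄ i y)) * key'
  · intro v _ hv
    by_contra h0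
    have h1 := right_ne_zero_of_mul (left_ne_zero_of_mul (right_ne_zero_of_mul h0))
    have := hc' _ _ h1 j
    rw [outerFam_self] at this
    exact hv (Finset.mem_Iic.2 this)

/-- The two inner kernels act on disjoint inputs and only their order changes. Parity is needed for
one of them; the sign is recorded on the other by `theta`. Each order of `i` and `j` uses the
comparison of `pre` on the appropriate side. -/
theorem kcomp_comm (h₁ : m + 1 = r + s) (h₂ : n + 1 = m + t) (h₃ : l + 1 = r + t)
    (h₄ : n + 1 = l + s) (i j : Fin r) (hij : i ≠ j) (c : Kern k X r) (c' : Kern k X s)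
    {c'' : Kern k X t} {b : ZMod 2} (hc'' : HasParity dg c'' b) :
    kcomp dg h₂ (outerPos h₁ i j hij.symm) (kcomp dg h₁ i c c') c'' =
      kcomp dg h₄ (outerPos h₃ j i hij) (kcomp dg h₃ j c c'') (theta dg b c') := by
  funext x y
  simp only [kcomp, Finset.mul_sum, Finset.sum_mul]
  rw [Finset.sum_comm]
  refine Finset.sum_congr rfl fun u hu => Finset.sum_congr rfl fun v hv => ?_
  rw [outerFam_outerFam_outer h₁ h₂ h₃ h₄ i j hij, innerFam_outerFam_outer h₁ h₂ h₃ h₄ i j hij,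
    ← innerFam_outerFam_outer h₃ h₄ h₁ h₂ j i hij.symm y u]
  by_cases h0 : c'' v (innerFam h₃ j (outerFam h₄ (outerPos h₃ j i hij) y u)) = 0
  · simp [h0]
  have hb := hc'' _ _ h0
  rw [theta]
  have key : (tot dg (innerFam h₃ j (outerFam h₄ (outerPos h₃ j i hij) y u)) + dg v) *
        pre dg (outerPos h₁ i j hij.symm) y +
      (tot dg (innerFam h₄ (outerPos h₃ j i hij) y) + dg u) *
        pre dg i (outerFam h₂ (outerPos h₁ i j hij.symm) y v) =
      (tot dg (innerFam h₄ (outerPos h₃ j i hij) y) + dg u) * pre dg (outerPos h₃ j i hij) y +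
      (tot dg (innerFam h₃ j (outerFam h₄ (outerPos h₃ j i hij) y u)) + dg v) *
        pre dg j (outerFam h₄ (outerPos h₃ j i hij) y u) +
      b * (tot dg (innerFam h₄ (outerPos h₃ j i hij) y) + dg u) := by
    rw [hb]
    have f1 : pre dg i (outerFam h₂ (outerPos h₁ i j hij.symm) y v) =
        pre dg i (outerFam h₃ j (outerFam h₄ (outerPos h₃ j i hij) y u) v) := by
      rw [← outerFam_outerFam_outer h₁ h₂ h₃ h₄ i j hij, pre_outerFam_self]
    have f2 : pre dg j (outerFam h₄ (outerPos h₃ j i hij) y u) =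
        pre dg j (outerFam h₁ i (outerFam h₂ (outerPos h₁ i j hij.symm) y v) u) := by
      rw [outerFam_outerFam_outer h₁ h₂ h₃ h₄ i j hij, pre_outerFam_self]
    rcases lt_or_gt_of_ne hij with hlt | hlt
    · have g1 := pre_outerPos_of_lt dg h₁ i j hlt (outerFam h₂ (outerPos h₁ i j hij.symm) y v) u
      have g2 := pre_outerPos_of_gt dg h₃ j i hlt (outerFam h₄ (outerPos h₃ j i hij) y u) v
      have g3 : pre dg (outerPos h₁ i j hij.symm) (outerFam h₂ (outerPos h₁ i j hij.symm) y v) =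
        pre dg (outerPos h₁ i j hij.symm) y := pre_outerFam_self _ _ _ _ _
      have g4 : pre dg (outerPos h₃ j i hij) (outerFam h₄ (outerPos h₃ j i hij) y u) =
        pre dg (outerPos h₃ j i hij) y := pre_outerFam_self _ _ _ _ _
      rw [g3, innerFam_outerFam_outer h₁ h₂ h₃ h₄ i j hij] at g1
      rw [g4] at g2
      rw [f1, f2, g2]
      linear_combination b * g1 - b * dg u * two_zmod
    · have g1 := pre_outerPos_of_gt dg h₁ i j hlt (outerFam h₂ (outerPos h₁ i j hij.symm) y v) u
      have g2 := pre_outerPos_of_lt dg h₃ j i hlt (outerFam h₄ (outerPos h₃ j i hij) y u) v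
      have g3 : pre dg (outerPos h₁ i j hij.symm) (outerFam h₂ (outerPos h₁ i j hij.symm) y v) =
        pre dg (outerPos h₁ i j hij.symm) y := pre_outerFam_self _ _ _ _ _
      have g4 : pre dg (outerPos h₃ j i hij) (outerFam h₄ (outerPos h₃ j i hij) y u) =
        pre dg (outerPos h₃ j i hij) y := pre_outerFam_self _ _ _ _ _
      rw [g3] at g1
      rw [g4] at g2
      rw [f1, f2, g1]
      have g5 : pre dg (outerPos h₃ j i hij) y + b =
          pre dg i (outerFam h₃ j (outerFam h₄ (outerPos h₃ j i hij) y u) v) := by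
        linear_combination g2 + hb + (b - dg v) * two_zmod
      rw [← g5]
      ring
  have key' := congrArg (sgn k) key
  rw [sgn_add, sgn_add, sgn_add] at key'
  linear_combination c x (outerFam h₃ j (outerFam h₄ (outerPos h₃ j i hij) y u) v) *
    c' u (innerFam h₄ (outerPos h₃ j i hij) y) *
    c'' v (innerFam h₃ j (outerFam h₄ (outerPos h₃ j i hij) y u)) * key'

end Kernel
end EInf

namespace EInf

/-! ### The Koszul sign -/

section Koszul
variable {r s n : ℕ}

/-- The exponent of the Koszul sign. -/
def kos (σ : Equiv.Perm (Fin r)) (p : Fin r → ZMod 2) : ZMod 2 :=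
  ∑ x, ∑ y, if x < y ∧ σ y < σ x then p x * p y else 0

theorem koszulSign_eq (k : Type*) [CommRing k] (σ : Equiv.Perm (Fin r)) (p : Fin r → ℕ) :
    koszulSign k σ p = sgn k (kos σ fun j => (p j : ZMod 2)) := by
  rw [koszulSign, kos, sgn_sum, Fintype.prod_prod_type]
  refine Finset.prod_congr rfl fun x _ => ?_
  rw [sgn_sum]
  refine Finset.prod_congr rfl fun y _ => ?_
  split_ifs
  · rw [← Nat.cast_mul, sgn_natCast]
  · simp

@[simp] theorem kos_one (p : Fin r → ZMod 2) : kos 1 p = 0 := by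
  refine Finset.sum_eq_zero fun x _ => Finset.sum_eq_zero fun y _ => if_neg ?_
  rintro ⟨h1, h2⟩
  exact lt_asymm h1 h2

/-- Grouping by unordered pairs makes cancellation within a pair visible; it serves both the cocycle
rule `kos_mul` and the vanishing of the square of the differential. -/
theorem sum_pairs {M : Type*} [AddCommMonoid M] (G : Fin r → Fin r → M) :
    ∑ x, ∑ y, G x y = (∑ x, ∑ y, if x < y then G x y + G y x else 0) + ∑ x, G x x := by
  have h1 : (∑ x, ∑ y, if x < y then G x y + G y x else 0) =
      (∑ x, ∑ y, if x < y then G x y else 0) + ∑ x, ∑ y, if y < x then G x y else 0 := by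
    rw [Finset.sum_comm (f := fun x y => if y < x then G x y else 0)]
    simp only [← Finset.sum_add_distrib]
    refine Finset.sum_congr rfl fun x _ => Finset.sum_congr rfl fun y _ => ?_
    split_ifs <;> simp
  rw [h1, ← Finset.sum_add_distrib, ← Finset.sum_add_distrib]
  refine Finset.sum_congr rfl fun x _ => ?_
  have h2 : G x x = ∑ y, if x = y then G x y else 0 := by simp
  rw [h2, ← Finset.sum_add_distrib, ← Finset.sum_add_distrib]
  refine Finset.sum_congr rfl fun y _ => ?_
  rcases lt_trichotomy x y with h | h | h
  · simp [h, h.not_gt, h.ne]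
  · simp [h]
  · simp [h, h.not_gt, h.ne']

/-- A pair is inverted by `σ * τ` when exactly one of `τ` and (afterwards) `σ` inverts it. Pairs
inverted twice contribute `2 p x p y`, which is zero. -/
theorem kos_mul (σ τ : Equiv.Perm (Fin r)) (p : Fin r → ZMod 2) :
    kos (σ * τ) p = kos τ p + kos σ (p ∘ τ.symm) := by
  have h1 : kos σ (p ∘ τ.symm) =
      ∑ x, ∑ y, if τ x < τ y ∧ σ (τ y) < σ (τ x) then p x * p y else 0 := by
    rw [kos, ← Equiv.sum_comp τ]
    refine Finset.sum_congr rfl fun x _ => ?_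
    rw [← Equiv.sum_comp τ]
    simp
  rw [h1, sum_pairs, kos, kos]
  simp only [lt_irrefl, false_and, if_false, Finset.sum_const_zero, add_zero,
    ← Finset.sum_add_distrib]
  refine Finset.sum_congr rfl fun x _ => Finset.sum_congr rfl fun y _ => ?_
  by_cases hxy : x < y
  · have hτ : τ x ≠ τ y := τ.injective.ne hxy.ne
    have hσ : σ (τ x) ≠ σ (τ y) := σ.injective.ne hτ
    simp only [hxy, true_and, if_true, Equiv.Perm.mul_apply]
    rcases lt_or_gt_of_ne hτ with a | a <;> rcases lt_or_gt_of_ne hσ with b | b <;>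
      simp only [a, b, a.not_gt, b.not_gt, if_true, if_false, and_self, and_true, and_false,
        true_and, false_and, add_zero, zero_add]
    linear_combination (- p x * p y) * two_zmod
  · simp [hxy]

theorem sum_dite_mul {M : Type*} [CommSemiring M] (i : Fin r) (a : M)
    (F : ∀ j : Fin r, j ≠ i → M) :
    (∑ j, if hj : j = i then 0 else a * F j hj) = a * ∑ j, if hj : j = i then 0 else F j hj := by
  rw [Finset.mul_sum]
  refine Finset.sum_congr rfl fun j _ => ?_
  split_ifs <;> simp

theorem outerPos_lt_outerPos (h : n + 1 = r + s) (i j j' : Fin r) (hj : j ≠ i) (hj' : j' ≠ i) :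
    outerPos h i j hj < outerPos h i j' hj' ↔ j < j' := by
  have h1 : (j : ℕ) ≠ i := fun e => hj (Fin.ext e)
  have h2 : (j' : ℕ) ≠ i := fun e => hj' (Fin.ext e)
  have := i.isLt
  simp only [outerPos, Fin.lt_def]
  split_ifs <;> omega

theorem outerPos_lt_innerPos (h : n + 1 = r + s) (i j : Fin r) (hj : j ≠ i) (l : Fin s) :
    outerPos h i j hj < innerPos h i l ↔ j < i := by
  have h1 : (j : ℕ) ≠ i := fun e => hj (Fin.ext e)
  have := l.isLt
  simp only [outerPos, innerPos, Fin.lt_def]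
  split_ifs <;> omega

theorem innerPos_lt_outerPos (h : n + 1 = r + s) (i j : Fin r) (hj : j ≠ i) (l : Fin s) :
    innerPos h i l < outerPos h i j hj ↔ i < j := by
  have h1 : (j : ℕ) ≠ i := fun e => hj (Fin.ext e)
  have := l.isLt
  simp only [outerPos, innerPos, Fin.lt_def]
  split_ifs <;> omega

theorem innerPos_lt_innerPos (h : n + 1 = r + s) (i : Fin r) (l l' : Fin s) :
    innerPos h i l < innerPos h i l' ↔ l < l' := by
  simp only [innerPos, Fin.lt_def]
  omega

/-- Inversions of a block permutation are of three kinds: between outer inputs (`OO`), inside the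
block (`kos τ`), and mixed. The mixed ones contribute the degree of the block times `S₁ + S₂`, the
degree of the outer inputs that change sides with the block. For `σ` the block is replaced by one
input of degree `t`, and `S₁ + S₂` is the change of the degree in front of the block, which is what
the two `pre` terms measure. -/
theorem kos_block (h : n + 1 = r + s) (i : Fin r) (σ : Equiv.Perm (Fin r))
    (τ : Equiv.Perm (Fin s)) (ρ : Equiv.Perm (Fin n)) (hρ : IsBlockPerm h i σ τ ρ)
    (p : Fin n → ZMod 2) (t : ZMod 2) :
    kos ρ p + (tot id (innerFam h i p) + t) * pre id (σ i) (p ∘ ρ.symm) =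
      (tot id (innerFam h i p) + t) * pre id i p + kos σ (outerFam h i p t) +
        kos τ (innerFam h i p) := by
  obtain ⟨hin, hout⟩ := hρ
  set OO : ZMod 2 := ∑ j, if hj : j = i then 0 else ∑ j', if hj' : j' = i then 0 else
    if j < j' ∧ σ j' < σ j then p (outerPos h i j hj) * p (outerPos h i j' hj') else 0 with hOO
  set S₁ : ZMod 2 := ∑ j, if hj : j = i then 0 else
    if j < i ∧ σ i < σ j then p (outerPos h i j hj) else 0 with hS₁
  set S₂ : ZMod 2 := ∑ j, if hj : j = i then 0 else
    if i < j ∧ σ j < σ i then p (outerPos h i j hj) else 0 with hS₂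
  have hD : tot id (innerFam h i p) = ∑ l, p (innerPos h i l) := rfl
  have A : kos ρ p = OO + tot id (innerFam h i p) * (S₁ + S₂) + kos τ (innerFam h i p) := by
    rw [kos, sum_split h i]
    have e1 : ∀ j (hj : j ≠ i), (∑ y, if outerPos h i j hj < y ∧ ρ y < ρ (outerPos h i j hj) then
        p (outerPos h i j hj) * p y else 0) =
        (∑ j', if hj' : j' = i then 0 else
          if j < j' ∧ σ j' < σ j then p (outerPos h i j hj) * p (outerPos h i j' hj') else 0) +
        tot id (innerFam h i p) * if j < i ∧ σ i < σ j then p (outerPos h i j hj) else 0 := by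
      intro j hj
      rw [sum_split h i]
      congr 1
      · refine Finset.sum_congr rfl fun j' _ => ?_
        split_ifs with h1 h2 h3 h3
        any_goals rfl
        all_goals simp only [hout _ hj, hout _ h1, outerPos_lt_outerPos] at h2; contradiction
      · rw [hD, Finset.sum_mul]
        refine Finset.sum_congr rfl fun l _ => ?_
        simp only [hout _ hj, hin, outerPos_lt_innerPos, innerPos_lt_outerPos]
        split_ifs
        · ring
        · simp
    have e2 : ∀ l, (∑ y, if innerPos h i l < y ∧ ρ y < ρ (innerPos h i l) then
        p (innerPos h i l) * p y else 0) = p (innerPos h i l) * S₂ +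
        ∑ l', if l < l' ∧ τ l' < τ l then p (innerPos h i l) * p (innerPos h i l') else 0 := by
      intro l
      rw [sum_split h i]
      congr 1
      · rw [hS₂, ← sum_dite_mul]
        refine Finset.sum_congr rfl fun j _ => ?_
        split_ifs with h1 h2 h3 h3
        any_goals rfl
        all_goals
          simp only [hout _ h1, hin, outerPos_lt_innerPos, innerPos_lt_outerPos] at h2
        any_goals contradiction
      · refine Finset.sum_congr rfl fun l' _ => ?_
        simp only [hin, innerPos_lt_innerPos]
    have e3 : (∑ j, if hj : j = i then 0 else
        ∑ y, if outerPos h i j hj < y ∧ ρ y < ρ (outerPos h i j hj) then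
        p (outerPos h i j hj) * p y else 0) = OO + tot id (innerFam h i p) * S₁ := by
      rw [hOO, hS₁, ← sum_dite_mul, ← Finset.sum_add_distrib]
      refine Finset.sum_congr rfl fun j _ => ?_
      split_ifs with h1
      · simp
      · rw [e1 j h1, if_pos (by assumption)]
      · rw [e1 j h1, if_neg (by assumption)]
    rw [e3, Finset.sum_congr rfl fun l _ => e2 l, Finset.sum_add_distrib, ← Finset.sum_mul, ← hD,
      kos]
    simp only [innerFam]
    ring
  have B : kos σ (outerFam h i p t) = OO + t * (S₁ + S₂) := by
    rw [kos]
    rw [sum_outerFam h i (fun x z => ∑ y, if x < y ∧ σ y < σ x then z * outerFam h i p t y else 0)]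
    have e1 : ∀ x (z : ZMod 2), (∑ y, if x < y ∧ σ y < σ x then z * outerFam h i p t y else 0) =
        (∑ j, if hj : j = i then 0 else
          if x < j ∧ σ j < σ x then z * p (outerPos h i j hj) else 0) +
        if x < i ∧ σ i < σ x then z * t else 0 := by
      intro x z
      rw [sum_outerFam h i (fun y z' => if x < y ∧ σ y < σ x then z * z' else 0)]
    simp only [e1, lt_irrefl, false_and, if_false, add_zero]
    have e3 : (∑ x, if hx : x = i then 0 else
        (∑ j, if hj : j = i then 0 else
          if x < j ∧ σ j < σ x then p (outerPos h i x hx) * p (outerPos h i j hj) else 0) +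
        if x < i ∧ σ i < σ x then p (outerPos h i x hx) * t else 0) = OO + t * S₁ := by
      rw [hOO, hS₁, ← sum_dite_mul, ← Finset.sum_add_distrib]
      refine Finset.sum_congr rfl fun j _ => ?_
      split_ifs with h1
      · simp
      · ring
      · ring
    rw [e3, hS₂, mul_add, add_assoc, ← sum_dite_mul i t (fun j hj => if i < j ∧ σ j < σ i then _ else 0)]
    congr 2
    refine Finset.sum_congr rfl fun j _ => ?_
    split_ifs <;> simp
  have C : pre id (σ i) (p ∘ ρ.symm) + pre id i p = S₁ + S₂ := by
    have e1 : pre id (σ i) (p ∘ ρ.symm) =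
        ∑ j, if hj : j = i then 0 else if σ j < σ i then p (outerPos h i j hj) else 0 := by
      rw [pre, ← Equiv.sum_comp ρ, sum_split h i]
      have h1 : ∀ l, ¬ ((ρ (innerPos h i l) : Fin n) : ℕ) < (σ i) := fun l => by
        rw [hin]; simp [innerPos]
      simp only [h1, if_false, Finset.sum_const_zero, add_zero, id, Function.comp_apply,
        Equiv.symm_apply_apply]
      refine Finset.sum_congr rfl fun j _ => ?_
      split_ifs with h2 h3 h4 h4
      any_goals rfl
      all_goals
        rw [hout _ h2] at h3
        have := (σ i).isLt
        have := (σ j).isLt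
        have h5 : (σ j : ℕ) ≠ σ i := fun e => h2 (σ.injective (Fin.ext e))
        simp only [outerPos, Fin.lt_def] at h3 h4
        split_ifs at h3 <;> omega
    have e2 : pre id i p =
        ∑ j, if hj : j = i then 0 else if j < i then p (outerPos h i j hj) else 0 := by
      rw [pre, sum_split h i]
      have h1 : ∀ l, ¬ ((innerPos h i l : Fin n) : ℕ) < i := fun l => by simp [innerPos]
      simp only [h1, if_false, Finset.sum_const_zero, add_zero, id]
      refine Finset.sum_congr rfl fun j _ => ?_
      split_ifs with h2 h3 h4 h4
      any_goals rfl
      all_goals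
        have := i.isLt
        have := j.isLt
        have h5 : (j : ℕ) ≠ i := fun e => h2 (Fin.ext e)
        simp only [outerPos, Fin.lt_def] at h3 h4
        split_ifs at h3 <;> omega
    rw [e1, e2, hS₁, hS₂, ← Finset.sum_add_distrib, ← Finset.sum_add_distrib]
    refine Finset.sum_congr rfl fun j _ => ?_
    by_cases hj : j = i
    · simp [hj]
    · simp only [hj, dif_neg, not_false_iff]
      have hσ := σ.injective.ne hj
      rcases lt_or_gt_of_ne hj with a | a <;> rcases lt_or_gt_of_ne hσ with b | b <;>
        simp only [a, b, a.not_gt, b.not_gt, if_true, if_false, and_self, and_true, and_false,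
          true_and, false_and, add_zero, zero_add]
      linear_combination p (outerPos h i j hj) * two_zmod
  rw [A, B, ← C]
  linear_combination (tot id (innerFam h i p) * pre id (σ i) (p ∘ ρ.symm) - pre id i p * t) * two_zmod
end Koszul

/-! ### The action of the symmetric groups on kernels -/

section Act
variable {k : Type*} [CommRing k] {X : Type*} (dg : X → ZMod 2) {r s n : ℕ}

/-- The right action of a permutation on kernels. -/
def kact (σ : Equiv.Perm (Fin r)) (c : Kern k X r) : Kern k X r :=
  fun x y => sgn k (kos σ (dg ∘ y)) * c x (y ∘ σ.symm)

theorem kact_one (c : Kern k X r) : kact dg 1 c = c := by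
  funext x y
  simp only [kact, kos_one, sgn_zero, one_mul]
  rfl

theorem kact_mul (σ τ : Equiv.Perm (Fin r)) (c : Kern k X r) :
    kact dg (σ * τ) c = kact dg τ (kact dg σ c) := by
  funext x y
  simp only [kact, kos_mul, sgn_add, mul_assoc]
  rfl

theorem tot_perm (σ : Equiv.Perm (Fin r)) (y : Fin r → X) : tot dg (y ∘ σ) = tot dg y :=
  Equiv.sum_comp σ fun j => dg (y j)

theorem theta_kact (b : ZMod 2) (σ : Equiv.Perm (Fin r)) (c : Kern k X r) :
    theta dg b (kact dg σ c) = kact dg σ (theta dg b c) := by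
  funext x y
  simp only [theta, kact, tot_perm]
  ring

theorem kact_kcomp [PartialOrder X] [LocallyFiniteOrderBot X] (h : n + 1 = r + s) (i : Fin r)
    (σ : Equiv.Perm (Fin r)) (τ : Equiv.Perm (Fin s)) (ρ : Equiv.Perm (Fin n))
    (hρ : IsBlockPerm h i σ τ ρ) (c : Kern k X r) (c' : Kern k X s) :
    kcomp dg h i (kact dg σ c) (kact dg τ c') = kact dg ρ (kcomp dg h (σ i) c c') := by
  funext x y
  have hin : ∀ l, ρ.symm (innerPos h (σ i) l) = innerPos h i (τ.symm l) := fun l => by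
    rw [Equiv.symm_apply_eq, hρ.1, Equiv.apply_symm_apply]
  have hfam1 : innerFam h (σ i) (y ∘ ρ.symm) = innerFam h i y ∘ τ.symm := by
    funext l
    simp only [innerFam, Function.comp_apply, hin]
  simp only [kcomp, kact, Finset.mul_sum]
  refine Finset.sum_congr rfl fun t _ => ?_
  have hfam2 : outerFam h (σ i) (y ∘ ρ.symm) t = outerFam h i y t ∘ σ.symm := by
    funext j
    obtain ⟨j, rfl⟩ := σ.surjective j
    by_cases hj : j = i
    · subst hj; simp
    · rw [outerFam_of_ne _ _ _ _ (σ.injective.ne hj), Function.comp_apply, Function.comp_apply,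
        Equiv.symm_apply_apply, outerFam_of_ne _ _ _ _ hj, ← hρ.2 j hj, Equiv.symm_apply_apply]
  rw [hfam1, hfam2, tot_perm]
  have key := kos_block h i σ τ ρ hρ (dg ∘ y) (dg t)
  have e1 : outerFam h i (dg ∘ y) (dg t) = dg ∘ outerFam h i y t := by
    funext j
    simp only [outerFam, Function.comp_apply]
    split_ifs <;> rfl
  rw [e1] at key
  have key' := congrArg (sgn k) key
  rw [sgn_add, sgn_add, sgn_add] at key'
  change _ * sgn k ((tot dg (innerFam h i y) + dg t) * pre dg (σ i) (y ∘ ρ.symm)) =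
    sgn k ((tot dg (innerFam h i y) + dg t) * pre dg i y) * _ *
      sgn k (kos τ (dg ∘ innerFam h i y)) at key'
  linear_combination (- c x (outerFam h i y t ∘ σ.symm) * c' t (innerFam h i y ∘ τ.symm)) * key'

end Act

/-! ### The differential of kernels -/

section Diff
variable {k : Type*} [CommRing k] {X : Type*} [PartialOrder X] [LocallyFiniteOrderBot X]
  (dg : X → ZMod 2) (D : Kern k X 1) {r s n : ℕ}

/-- The differential on kernels induced by the differential `D` on functions. -/
def kd (c : Kern k X r) : Kern k X r :=
  -- The graded commutator with `D`; `theta dg 1` supplies the factor `(-1)^{|c|}`.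
  kcomp dg (n := r) (by omega) 0 D c - ∑ j, kcomp dg (s := 1) (n := r) rfl j (theta dg 1 c) D

theorem kcomp_zero_left (h : n + 1 = r + s) (i : Fin r) (c' : Kern k X s) :
    kcomp dg h i 0 c' = 0 := LinearMap.map_zero₂ (kcompL dg k h i) c'

theorem kcomp_zero_right (h : n + 1 = r + s) (i : Fin r) (c : Kern k X r) :
    kcomp dg h i c (0 : Kern k X s) = 0 := (kcompL dg k h i c).map_zero

theorem kcomp_sub_left (h : n + 1 = r + s) (i : Fin r) (c₁ c₂ : Kern k X r) (c' : Kern k X s) :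
    kcomp dg h i (c₁ - c₂) c' = kcomp dg h i c₁ c' - kcomp dg h i c₂ c' :=
  LinearMap.map_sub₂ (kcompL dg k h i) c₁ c₂ c'

theorem kcomp_sub_right (h : n + 1 = r + s) (i : Fin r) (c : Kern k X r) (c₁ c₂ : Kern k X s) :
    kcomp dg h i c (c₁ - c₂) = kcomp dg h i c c₁ - kcomp dg h i c c₂ :=
  (kcompL dg k h i c).map_sub c₁ c₂

theorem kcomp_sum_left {ι : Type*} (S : Finset ι) (h : n + 1 = r + s) (i : Fin r)
    (c : ι → Kern k X r) (c' : Kern k X s) :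
    kcomp dg h i (∑ j ∈ S, c j) c' = ∑ j ∈ S, kcomp dg h i (c j) c' :=
  LinearMap.map_sum₂ (kcompL dg k h i) S c c'

theorem kcomp_sum_right {ι : Type*} (S : Finset ι) (h : n + 1 = r + s) (i : Fin r)
    (c : Kern k X r) (c' : ι → Kern k X s) :
    kcomp dg h i c (∑ j ∈ S, c' j) = ∑ j ∈ S, kcomp dg h i c (c' j) :=
  map_sum (kcompL dg k h i c) c' S

theorem theta_sub (b : ZMod 2) (c₁ c₂ : Kern k X r) :
    theta dg b (c₁ - c₂) = theta dg b c₁ - theta dg b c₂ := by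
  funext x y
  simp only [theta, Pi.sub_apply, mul_sub]

theorem theta_sum {ι : Type*} (S : Finset ι) (b : ZMod 2) (c : ι → Kern k X r) :
    theta dg b (∑ j ∈ S, c j) = ∑ j ∈ S, theta dg b (c j) := by
  funext x y
  simp only [theta, Finset.sum_apply, Finset.mul_sum]

theorem theta_add (b : ZMod 2) (c₁ c₂ : Kern k X r) :
    theta dg b (c₁ + c₂) = theta dg b c₁ + theta dg b c₂ := by
  funext x y
  simp only [theta, Pi.add_apply, mul_add]

theorem theta_smul (b : ZMod 2) (a : k) (c : Kern k X r) :
    theta dg b (a • c) = a • theta dg b c := by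
  funext x y
  simp only [theta, Pi.smul_apply, smul_eq_mul]
  ring

/-- The differential of kernels as a linear map. -/
def kdL : Kern k X r →ₗ[k] Kern k X r where
  toFun := kd dg D
  map_add' c c' := by
    simp only [kd, theta_add, kcomp_add_left, kcomp_add_right, Finset.sum_add_distrib]
    abel
  map_smul' a c := by
    simp only [kd, theta_smul, kcomp_smul_left, kcomp_smul_right, ← Finset.smul_sum, smul_sub,
      RingHom.id_apply]

theorem kdL_apply (c : Kern k X r) : kdL dg D c = kd dg D c := rfl

variable {D} (hD : HasParity dg D 1) (hloc : Local D)

theorem theta_D (hD : HasParity dg D 1) : theta dg 1 D = -D := by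
  rw [theta_of_parity dg hD]
  simp

include hD hloc in
theorem theta_kd (c : Kern k X r) : theta dg 1 (kd dg D c) = - kd dg D (theta dg 1 c) := by
  simp only [kd, theta_sub, theta_sum, theta_kcomp, theta_D dg hD]
  have e1 : ∀ (h : r + 1 = 1 + r) (c : Kern k X r), kcomp dg h 0 (-D) c = - kcomp dg h 0 D c :=
    fun h c => LinearMap.map_neg₂ (kcompL dg k h 0) D c
  have e2 : ∀ (c : Kern k X r) (j : Fin r), kcomp dg (s := 1) (n := r) rfl j c (-D) =
    - kcomp dg (s := 1) (n := r) rfl j c D := fun c j => map_neg (kcompL dg k rfl j c) D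
  simp only [e1, e2, Finset.sum_neg_distrib]
  abel

-- A commutator is a derivation of the composition. Inner slots give `D` applied inside `c'`; at an
-- outer slot `D` is moved past `c'` by parallel associativity, at the cost of a `theta` which
-- cancels the one already there. The terms with `D` between `c` and `c'` occur in both summands
-- with opposite signs (`e4`).
include hD hloc in
theorem kd_kcomp (h : n + 1 = r + s) (i : Fin r) {c : Kern k X r} (hc : Local c) {c' : Kern k X s}
    (hc' : Local c') :
    kd dg D (kcomp dg h i c c') =
      kcomp dg h i (kd dg D c) c' + kcomp dg h i (theta dg 1 c) (kd dg D c') := by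
  have e1 : kcomp dg (n := n) (by omega) 0 D (kcomp dg h i c c') =
      kcomp dg h i (kcomp dg (n := r) (by omega) 0 D c) c' := by
    have := kcomp_assoc dg (h₁ := (by omega : r + 1 = 1 + r)) (h₂ := h) (h₃ := h)
      (h₄ := (by omega : n + 1 = 1 + n)) 0 i D hc c'
    rw [← this]
    congr 1
    ext; simp [innerPos]
  have e2 : ∀ l, kcomp dg (s := 1) (n := n) rfl (innerPos h i l)
      (kcomp dg h i (theta dg 1 c) (theta dg 1 c')) D =
      kcomp dg h i (theta dg 1 c) (kcomp dg (s := 1) (n := s) rfl l (theta dg 1 c') D) := fun l =>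
    kcomp_assoc dg (h₁ := h) (h₂ := rfl) (h₃ := rfl) (h₄ := h) i l _ (theta_local dg hc' 1) D
  have e3 : ∀ j (hj : j ≠ i), kcomp dg (s := 1) (n := n) rfl (outerPos h i j hj)
      (kcomp dg h i (theta dg 1 c) (theta dg 1 c')) D =
      kcomp dg h i (kcomp dg (s := 1) (n := r) rfl j (theta dg 1 c) D) c' := fun j hj => by
    have := kcomp_comm dg (h₁ := h) (h₂ := (rfl : n + 1 = n + 1)) (h₃ := (rfl : r + 1 = r + 1))
      (h₄ := h) i j hj.symm (theta dg 1 c) (theta dg 1 c') hD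
    rw [this, theta_theta]
    congr 1
    have h1 : (j : ℕ) ≠ i := fun e => hj (Fin.ext e)
    ext; simp only [outerPos, Fin.lt_def]; split_ifs <;> omega
  have e4 : kcomp dg h i (kcomp dg (s := 1) (n := r) rfl i (theta dg 1 c) D) c' =
      kcomp dg h i (theta dg 1 c) (kcomp dg (n := s) (by omega) 0 D c') := by
    have := kcomp_assoc dg (h₁ := (rfl : r + 1 = r + 1)) (h₂ := h)
      (h₃ := (by omega : s + 1 = 1 + s)) (h₄ := h) i 0 (theta dg 1 c) hloc c'
    rw [← this]
    congr 1
  rw [kd, kd, kd, e1, theta_kcomp, sum_split h i, kcomp_sub_left, kcomp_sub_right, kcomp_sum_left,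
    kcomp_sum_right, Finset.sum_congr rfl fun l _ => e2 l, ← e4]
  have e5 : (∑ j, if hj : j = i then (0 : Kern k X n) else
      kcomp dg (s := 1) (n := n) rfl (outerPos h i j hj)
      (kcomp dg h i (theta dg 1 c) (theta dg 1 c')) D) = ∑ j ∈ Finset.univ.erase i,
      kcomp dg h i (kcomp dg (s := 1) (n := r) rfl j (theta dg 1 c) D) c' := by
    rw [← Finset.add_sum_erase _ _ (Finset.mem_univ i), dif_pos rfl, zero_add]
    refine Finset.sum_congr rfl fun j hj => ?_
    rw [dif_neg (Finset.ne_of_mem_erase hj), e3]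
  rw [e5, ← Finset.add_sum_erase (Finset.univ : Finset (Fin r))
    (fun j => kcomp dg h i (kcomp dg (s := 1) (n := r) rfl j (theta dg 1 c) D) c')
    (Finset.mem_univ i)]
  abel

-- Outer applications of `D` square to zero, the mixed terms cancel because `kd` anticommutes with
-- `theta dg 1`, and two applications of the odd `D` at different slots anticommute, while at the
-- same slot they compose to zero.
include hD hloc in
theorem kd_kd (hDD : kcomp dg (s := 1) (n := 1) rfl 0 D D = 0) {c : Kern k X r} (hc : Local c) :
    kd dg D (kd dg D c) = 0 := by
  have hθ := theta_local dg hc 1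
  have h1 : kcomp dg (n := r) (by omega) 0 D (kcomp dg (n := r) (by omega) 0 D c) = 0 := by
    rw [← kcomp_assoc dg (h₁ := (by omega : 1 + 1 = 1 + 1)) (h₂ := (by omega : r + 1 = 1 + r))
      (h₃ := (by omega : r + 1 = 1 + r)) (h₄ := (by omega : r + 1 = 1 + r)) 0 0 D hloc c]
    rw [hDD]
    exact kcomp_zero_left dg _ _ _
  have h2 : ∀ j, kcomp dg (n := r) (by omega) 0 D
      (kcomp dg (s := 1) (n := r) rfl j (theta dg 1 c) D) = kcomp dg (s := 1) (n := r) rfl j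
      (kcomp dg (n := r) (by omega) 0 D (theta dg 1 c)) D := fun j => by
    rw [← kcomp_assoc dg (h₁ := (by omega : r + 1 = 1 + r)) (h₂ := (rfl : r + 1 = r + 1))
      (h₃ := (rfl : r + 1 = r + 1)) (h₄ := (by omega : r + 1 = 1 + r)) 0 j D hθ D]
    congr 1
    ext; simp [innerPos]
  have h3 : ∑ m, ∑ j, kcomp dg (s := 1) (n := r) rfl m
      (kcomp dg (s := 1) (n := r) rfl j c D) D = 0 := by
    rw [sum_pairs]
    have hdiag : ∀ j, kcomp dg (s := 1) (n := r) rfl j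
        (kcomp dg (s := 1) (n := r) rfl j c D) D = 0 := fun j => by
      have := kcomp_assoc dg (h₁ := (rfl : r + 1 = r + 1)) (h₂ := (rfl : r + 1 = r + 1))
        (h₃ := (rfl : 1 + 1 = 1 + 1)) (h₄ := (rfl : r + 1 = r + 1)) j 0 c hloc D
      rw [hDD, kcomp_zero_right] at this
      exact this
    have hoff : ∀ m j, m ≠ j → kcomp dg (s := 1) (n := r) rfl m
        (kcomp dg (s := 1) (n := r) rfl j c D) D =
        - kcomp dg (s := 1) (n := r) rfl j (kcomp dg (s := 1) (n := r) rfl m c D) D := by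
      intro m j hmj
      have h5 : (m : ℕ) ≠ j := fun e => hmj (Fin.ext e)
      have := kcomp_comm dg (h₁ := (rfl : r + 1 = r + 1)) (h₂ := (rfl : r + 1 = r + 1))
        (h₃ := (rfl : r + 1 = r + 1)) (h₄ := (rfl : r + 1 = r + 1)) j m hmj.symm c D hD
      have e1 : outerPos (rfl : r + 1 = r + 1) j m hmj = m := by
        ext; simp only [outerPos, Fin.lt_def]; split_ifs <;> omega
      have e2 : outerPos (rfl : r + 1 = r + 1) m j hmj.symm = j := by
        ext; simp only [outerPos, Fin.lt_def]; split_ifs <;> omega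
      rw [e1, e2, theta_D dg hD] at this
      rw [this]
      exact map_neg (kcompL dg k (rfl : r + 1 = r + 1) j _) D
    simp only [hdiag, Finset.sum_const_zero, add_zero]
    refine Finset.sum_eq_zero fun x _ => Finset.sum_eq_zero fun y _ => ?_
    split_ifs with h
    · rw [hoff x y h.ne, neg_add_cancel]
    · rfl
  rw [kd, theta_kd dg hD hloc]
  have hneg : ∀ (j : Fin r) (c : Kern k X r), kcomp dg (s := 1) (n := r) rfl j (-c) D =
    - kcomp dg (s := 1) (n := r) rfl j c D := fun j c => LinearMap.map_neg₂ (kcompL dg k rfl j) c D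
  simp only [hneg, kd, theta_theta, kcomp_sub_left, kcomp_sub_right, kcomp_sum_left,
    kcomp_sum_right, h1, h2, Finset.sum_neg_distrib, Finset.sum_sub_distrib, h3]
  abel

include hD hloc in
theorem kd_kact (σ : Equiv.Perm (Fin r)) (c : Kern k X r) :
    kd dg D (kact dg σ c) = kact dg σ (kd dg D c) := by
  have h1 : kcomp dg (n := r) (by omega) 0 D (kact dg σ c) =
      kact dg σ (kcomp dg (n := r) (by omega) 0 D c) := by
    have := kact_kcomp dg (by omega : r + 1 = 1 + r) 0 1 σ σ ⟨fun l => ?_, fun j hj => ?_⟩ D c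
    · rw [kact_one] at this
      exact this
    · ext; simp [innerPos]
    · exact absurd (Subsingleton.elim j 0) hj
  have h2 : ∀ j, kcomp dg (s := 1) (n := r) rfl j (kact dg σ (theta dg 1 c)) D =
      kact dg σ (kcomp dg (s := 1) (n := r) rfl (σ j) (theta dg 1 c) D) := fun j => by
    have := kact_kcomp dg (rfl : r + 1 = r + 1) j σ 1 σ ⟨fun l => ?_, fun j' hj => ?_⟩
      (theta dg 1 c) D
    · rw [kact_one] at this
      exact this
    · simp only [Subsingleton.elim l 0, Equiv.Perm.one_apply]
      have e1 : ∀ x : Fin r, innerPos (rfl : r + 1 = r + 1) x 0 = x := fun x => by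
        ext; simp [innerPos]
      rw [e1, e1]
    · have e1 : ∀ (x y : Fin r) (h : y ≠ x), outerPos (rfl : r + 1 = r + 1) x y h = y :=
        fun x y h => by
          have h5 : (y : ℕ) ≠ x := fun e => h (Fin.ext e)
          ext; simp only [outerPos, Fin.lt_def]; split_ifs <;> omega
      rw [e1, e1]
  have h3 : ∀ c₁ c₂ : Kern k X r, kact dg σ (c₁ - c₂) = kact dg σ c₁ - kact dg σ c₂ :=
    fun c₁ c₂ => by funext x y; simp only [kact, Pi.sub_apply, mul_sub]
  have h4 : ∀ c : Fin r → Kern k X r, kact dg σ (∑ j, c j) = ∑ j, kact dg σ (c j) :=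
    fun c => by funext x y; simp only [kact, Finset.sum_apply, Finset.mul_sum]
  rw [kd, kd, h1, h3, h4, theta_kact]
  simp only [h2]
  rw [Equiv.sum_comp σ fun j => kact dg σ (kcomp dg (s := 1) (n := r) rfl j (theta dg 1 c) D)]

end Diff

end EInf

namespace EInf

/-! ### Kernels as multilinear operations on functions -/

section Eval
variable {k : Type*} [CommRing k] {X : Type*} [PartialOrder X] [LocallyFiniteOrderBot X]
  (dg : X → ZMod 2) {r s n : ℕ}

/-- The operation on functions on `X` with the kernel `c`, evaluated at `x`. -/
def kevM (c : Kern k X r) (x : X) : MultilinearMap k (fun _ : Fin r => X → k) k :=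
  ∑ y ∈ Fintype.piFinset fun _ : Fin r => Finset.Iic x, c x y •
    (MultilinearMap.mkPiAlgebra k (Fin r) k).compLinearMap fun j => LinearMap.proj (y j)

/-- The operation on functions on `X` with the kernel `c`. -/
def kev (c : Kern k X r) (f : Fin r → X → k) (x : X) : k := kevM c x f

theorem kev_eq (c : Kern k X r) (f : Fin r → X → k) (x : X) :
    kev c f x = ∑ y ∈ Fintype.piFinset fun _ : Fin r => Finset.Iic x, c x y * ∏ j, f j (y j) := by
  simp [kev, kevM, sum_apply]

theorem kev_congr (c : Kern k X r) {f g : Fin r → X → k} {x : X}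
    (h : ∀ y, c x y ≠ 0 → ∀ j, f j (y j) = g j (y j)) :
    kev c f x = kev c g x := by
  rw [kev_eq, kev_eq]
  refine Finset.sum_congr rfl fun y _ => ?_
  by_cases h0 : c x y = 0
  · rw [h0, zero_mul, zero_mul]
  · rw [Finset.prod_congr rfl fun j _ => h y h0 j]

theorem prod_outerFam (h : n + 1 = r + s) (i : Fin r) (f : Fin n → X → k) (g : X → k)
    (z : Fin r → X) (w : Fin s → X) :
    (∏ m, f m (glue h i z w m)) * g (z i) =
      (∏ j, outerFam h i f g j (z j)) * ∏ l, innerFam h i f l (w l) := by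
  have h1 : ∏ m, f m (glue h i z w m) =
      (∏ j, if hj : j = i then 1 else f (outerPos h i j hj) (glue h i z w (outerPos h i j hj))) *
      ∏ l, f (innerPos h i l) (glue h i z w (innerPos h i l)) :=
    sum_split (M := Additive k) h i fun m => Additive.ofMul (f m (glue h i z w m))
  rw [h1, ← Finset.mul_prod_erase _ (fun j => outerFam h i f g j (z j)) (Finset.mem_univ i),
    ← Finset.mul_prod_erase _ (fun j => if hj : j = i then 1 else _) (Finset.mem_univ i),
    dif_pos rfl, outerFam_self, one_mul]
  have h2 : ∀ l, glue h i z w (innerPos h i l) = w l := fun l =>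
    congrFun (innerFam_glue h i z w) l
  have h3 : ∀ j ∈ Finset.univ.erase i,
      (if hj : j = i then 1 else f (outerPos h i j hj) (glue h i z w (outerPos h i j hj))) =
      outerFam h i f g j (z j) := fun j hj => by
    have hj' := Finset.ne_of_mem_erase hj
    rw [dif_neg hj', outerFam_of_ne _ _ _ _ hj', ← outerFam_of_ne h i (glue h i z w) (z i) hj',
      outerFam_glue]
  simp only [h2, Finset.prod_congr rfl h3, innerFam]
  ring

/-- Splitting and glueing families is a bijection between pairs of a family `y` and an intermediate
`t`, and pairs of an outer and an inner family. Since each `f m` lives in one parity, the sign in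
`kcomp` is constant on the terms that do not vanish and can be pulled out. -/
theorem kev_kcomp (h : n + 1 = r + s) (i : Fin r) (c : Kern k X r) {c' : Kern k X s}
    (hc' : Local c') {b : ZMod 2} (hb : HasParity dg c' b) (f : Fin n → X → k)
    (p : Fin n → ZMod 2) (hf : ∀ m x, f m x ≠ 0 → dg x = p m) (x : X) :
    kev (kcomp dg h i c c') f x =
      sgn k (b * pre id i p) * kev c (outerFam h i f (kev c' (innerFam h i f))) x := by
  have hR : kev c (outerFam h i f (kev c' (innerFam h i f))) x =
      ∑ z ∈ Fintype.piFinset fun _ : Fin r => Finset.Iic x,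
      ∑ w ∈ Fintype.piFinset fun _ : Fin s => Finset.Iic x,
        c x z * c' (z i) w * ∏ m, f m (glue h i z w m) := by
    rw [kev_eq]
    refine Finset.sum_congr rfl fun z hz => ?_
    rw [Fintype.mem_piFinset] at hz
    have h1 : ∏ j, outerFam h i f (kev c' (innerFam h i f)) j (z j) =
        ∑ w ∈ Fintype.piFinset fun _ : Fin s => Finset.Iic x,
          c' (z i) w * ∏ m, f m (glue h i z w m) := by
      have h2 : kev c' (innerFam h i f) (z i) =
          ∑ w ∈ Fintype.piFinset fun _ : Fin s => Finset.Iic x,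
            c' (z i) w * ∏ l, innerFam h i f l (w l) := by
        rw [kev_eq]
        refine Finset.sum_subset (Fintype.piFinset_subset _ _ fun _ =>
          Finset.Iic_subset_Iic.2 (Finset.mem_Iic.1 (hz i))) fun w _ hw => ?_
        by_contra h0
        refine hw (Fintype.mem_piFinset.2 fun j => Finset.mem_Iic.2 ?_)
        exact hc' _ _ (left_ne_zero_of_mul h0) j
      have h3 : ∏ j, outerFam h i f (kev c' (innerFam h i f)) j (z j) =
          (∏ j, outerFam h i f (fun _ => 1) j (z j)) * kev c' (innerFam h i f) (z i) := by
        rw [← Finset.mul_prod_erase _ _ (Finset.mem_univ i),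
          ← Finset.mul_prod_erase _ (fun j => outerFam h i f (fun _ => 1) j (z j))
            (Finset.mem_univ i), outerFam_self, outerFam_self, one_mul, mul_comm]
        congr 1
        refine Finset.prod_congr rfl fun j hj => ?_
        rw [outerFam_of_ne _ _ _ _ (Finset.ne_of_mem_erase hj),
          outerFam_of_ne _ _ _ _ (Finset.ne_of_mem_erase hj)]
      rw [h3, h2, Finset.mul_sum]
      refine Finset.sum_congr rfl fun w _ => ?_
      have := prod_outerFam h i f (fun _ => (1 : k)) z w
      rw [mul_one] at this
      rw [this]
      ring
    rw [h1, Finset.mul_sum]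
    exact Finset.sum_congr rfl fun w _ => by ring
  rw [hR, kev_eq]
  simp only [kcomp, Finset.sum_mul]
  rw [← Finset.sum_product', ← Finset.sum_product', Finset.mul_sum]
  refine Finset.sum_bij' (fun yt _ => (outerFam h i yt.1 yt.2, innerFam h i yt.1))
    (fun zw _ => (glue h i zw.1 zw.2, zw.1 i)) ?_ ?_ ?_ ?_ ?_
  · rintro ⟨y, t⟩ hyt
    simp only [Finset.mem_product, Fintype.mem_piFinset] at hyt ⊢
    refine ⟨fun j => ?_, fun l => hyt.1 _⟩
    by_cases hj : j = i
    · subst hj; rw [outerFam_self]; exact hyt.2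
    · rw [outerFam_of_ne _ _ _ _ hj]; exact hyt.1 _
  · rintro ⟨z, w⟩ hzw
    simp only [Finset.mem_product, Fintype.mem_piFinset] at hzw ⊢
    refine ⟨fun j => ?_, hzw.1 i⟩
    simp only [glue]
    split_ifs
    · exact hzw.1 _
    · exact hzw.2 _
    · exact hzw.1 _
  · rintro ⟨y, t⟩ _
    simp only [glue_outerFam_innerFam, outerFam_self]
  · rintro ⟨z, w⟩ _
    simp only [outerFam_glue, innerFam_glue]
  · rintro ⟨y, t⟩ _
    simp only [glue_outerFam_innerFam, outerFam_self]
    by_cases h0 : c' t (innerFam h i y) = 0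
    · simp [h0]
    by_cases h1 : ∏ m, f m (y m) = 0
    · simp [h1]
    have h2 : ∀ m, dg (y m) = p m := fun m => hf m _ fun h3 =>
      h1 (Finset.prod_eq_zero (Finset.mem_univ m) h3)
    have h3 : pre dg i y = pre id i p := by simp only [pre, h2, id]
    rw [hb _ _ h0, h3]
    ring

theorem kev_kact (σ : Equiv.Perm (Fin r)) (c : Kern k X r) (f : Fin r → X → k)
    (p : Fin r → ZMod 2) (hf : ∀ m x, f m x ≠ 0 → dg x = p m) (x : X) :
    kev (kact dg σ c) f x = sgn k (kos σ p) * kev c (fun j => f (σ.symm j)) x := by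
  rw [kev_eq, kev_eq, Finset.mul_sum]
  refine Finset.sum_bij' (fun y _ => y ∘ σ.symm) (fun y _ => y ∘ σ) ?_ ?_ ?_ ?_ ?_
  · intro y hy
    rw [Fintype.mem_piFinset] at hy ⊢
    exact fun j => hy _
  · intro y hy
    rw [Fintype.mem_piFinset] at hy ⊢
    exact fun j => hy _
  · intro y _; funext j; simp
  · intro y _; funext j; simp
  · intro y _
    have h4 : ∏ j, f (σ.symm j) ((y ∘ σ.symm) j) = ∏ j, f j (y j) :=
      Equiv.prod_comp σ.symm fun j => f j (y j)
    rw [h4]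
    by_cases h1 : ∏ m, f m (y m) = 0
    · simp [h1]
    have h2 : dg ∘ y = p := funext fun m => hf m _ fun h3 =>
      h1 (Finset.prod_eq_zero (Finset.mem_univ m) h3)
    rw [kact, h2]
    ring

theorem kev_sub (c c' : Kern k X r) (f : Fin r → X → k) (x : X) :
    kev (c - c') f x = kev c f x - kev c' f x := by
  simp only [kev_eq, Pi.sub_apply, sub_mul, Finset.sum_sub_distrib]

theorem kev_add (c c' : Kern k X r) (f : Fin r → X → k) (x : X) :
    kev (c + c') f x = kev c f x + kev c' f x := by
  simp only [kev_eq, Pi.add_apply, add_mul, Finset.sum_add_distrib]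

theorem kev_smul (a : k) (c : Kern k X r) (f : Fin r → X → k) (x : X) :
    kev (a • c) f x = a * kev c f x := by
  simp only [kev_eq, Pi.smul_apply, smul_eq_mul, Finset.mul_sum, mul_assoc]

theorem kev_sum {ι : Type*} (S : Finset ι) (c : ι → Kern k X r) (f : Fin r → X → k) (x : X) :
    kev (∑ j ∈ S, c j) f x = ∑ j ∈ S, kev (c j) f x := by
  simp only [kev_eq, Finset.sum_apply, Finset.sum_mul]
  exact Finset.sum_comm

/-- The Leibniz rule. -/
theorem kev_kd {D : Kern k X 1} (hD : HasParity dg D 1) (hloc : Local D) {c : Kern k X r}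
    (hc : Local c) {a : ZMod 2} (ha : HasParity dg c a) (f : Fin r → X → k) (p : Fin r → ZMod 2)
    (hf : ∀ m x, f m x ≠ 0 → dg x = p m) (x : X) :
    kev D (fun _ => kev c f) x = kev (kd dg D c) f x + ∑ j : Fin r, sgn k (a + pre id j p) *
      kev c (Function.update f j (kev D fun _ => f j)) x := by
  have h1 : kev (kcomp dg (n := r) (by omega) 0 D c) f x = kev D (fun _ => kev c f) x := by
    rw [kev_kcomp dg _ _ _ hc ha f p hf]
    have e1 : pre id ((0 : Fin 1) : ℕ) p = 0 := by simp [pre]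
    have e2 : innerFam (by omega : r + 1 = 1 + r) 0 f = f := by
      funext l; simp only [innerFam]; congr 1; ext; simp [innerPos]
    rw [e1, mul_zero, sgn_zero, one_mul, e2]
    congr 1
    funext j
    rw [Subsingleton.elim j 0, outerFam_self]
  have h2 : ∀ j, kev (kcomp dg (s := 1) (n := r) rfl j (theta dg 1 c) D) f x =
      sgn k (a + pre id j p) * kev c (Function.update f j (kev D fun _ => f j)) x := fun j => by
    rw [kev_kcomp dg _ _ _ hloc hD f p hf, theta_of_parity dg ha, kev_smul, ← mul_assoc,
      ← sgn_add, one_mul, one_mul, add_comm]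
    congr 2
    funext j'
    have e1 : innerFam (rfl : r + 1 = r + 1) j f = fun _ => f j := by
      funext l; simp only [innerFam]; congr 1; ext; simp [innerPos]
    by_cases hj : j' = j
    · subst hj
      rw [outerFam_self, Function.update_self, e1]
    · rw [outerFam_of_ne _ _ _ _ hj, Function.update_of_ne hj]
      congr 1
      have h5 : (j' : ℕ) ≠ j := fun e => hj (Fin.ext e)
      ext; simp only [outerPos, Fin.lt_def]; split_ifs <;> omega
  rw [kd, kev_sub, kev_sum, h1, Finset.sum_congr rfl fun j _ => h2 j]
  ring

end Eval

/-! ### The unit kernel -/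

section One
variable {k : Type*} [CommRing k] {X : Type*} [PartialOrder X] [LocallyFiniteOrderBot X]
  [DecidableEq X] (dg : X → ZMod 2) {r s n : ℕ}

/-- The kernel of the identity. -/
def kone : Kern k X 1 := fun x y => if y 0 = x then 1 else 0

theorem kone_kcomp (h : s + 1 = 1 + s) (c : Kern k X s) : kcomp dg h 0 kone c = c := by
  funext x y
  have e2 : innerFam h 0 y = y := by
    funext l; simp only [innerFam]; congr 1; ext; simp [innerPos]
  have e1 : pre dg ((0 : Fin 1) : ℕ) y = 0 := by simp [pre]
  simp only [kcomp, kone, outerFam_self, e1, e2, mul_zero, sgn_zero, one_mul]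
  simp

theorem kcomp_kone (i : Fin r) {c : Kern k X r} (hc : Local c) :
    kcomp dg (rfl : r + 1 = r + 1) i c kone = c := by
  funext x y
  have e1 : innerFam (rfl : r + 1 = r + 1) i y 0 = y i := by
    simp only [innerFam]; congr 1
  have e2 : outerFam (rfl : r + 1 = r + 1) i y (y i) = y := by
    funext j
    by_cases hj : j = i
    · subst hj; simp
    · rw [outerFam_of_ne _ _ _ _ hj]
      congr 1
      have h5 : (j : ℕ) ≠ i := fun e => hj (Fin.ext e)
      ext; simp only [outerPos, Fin.lt_def]; split_ifs <;> omega
  have e3 : tot dg (innerFam (rfl : r + 1 = r + 1) i y) = dg (y i) := by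
    simp [tot, e1]
  simp only [kcomp, kone, e1, e3, mul_ite, mul_one, mul_zero]
  rw [Finset.sum_ite_eq, e2, CharTwo.add_self_eq_zero, zero_mul, sgn_zero, one_mul]
  split_ifs with h
  · rfl
  · by_contra h0
    exact h (Finset.mem_Iic.2 (hc x y (Ne.symm h0) i))

end One
end EInf

namespace EInf

/-! ### Kernels on the simplices of the infinite simplex -/

section Simplices
variable {k : Type*} [CommRing k] {r s n : ℕ}

/-- The parity of the dimension of the simplex with the set of vertices `N`. -/
def dimParity (N : Finset ℕ) : ZMod 2 := (N.card : ZMod 2) + 1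

/-- The degree of an entry of a kernel. -/
def excess (N : Finset ℕ) (S : Fin r → Finset ℕ) : ℤ :=
  (∑ j, (((S j).card : ℤ) - 1)) - ((N.card : ℤ) - 1)

/-- Consecutive elements of `N` lie in a common member of the family `S`. -/
def Linked (N : Finset ℕ) (S : Fin r → Finset ℕ) : Prop :=
  ∀ x ∈ N, ∀ y ∈ N, x < y → (∀ z ∈ N, ¬ (x < z ∧ z < y)) → ∃ j, x ∈ S j ∧ y ∈ S j

/-- The kernel only involves nonempty faces of nonempty simplices. -/
def Supp (c : Kern k (Finset ℕ) r) : Prop :=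
  ∀ N S, c N S ≠ 0 → N.Nonempty ∧ ∀ j, (S j).Nonempty ∧ S j ⊆ N

/-- The kernel is invariant under monotone relabelling of the vertices. -/
def Natural (c : Kern k (Finset ℕ) r) : Prop :=
  ∀ (N : Finset ℕ) (S : Fin r → Finset ℕ) (φ : ℕ → ℕ), StrictMonoOn φ N → (∀ j, S j ⊆ N) →
    c (N.image φ) (fun j => (S j).image φ) = c N S

/-- The kernel is supported on linked families. -/
def LinkedSupp (c : Kern k (Finset ℕ) r) : Prop := ∀ N S, c N S ≠ 0 → Linked N S

/-- The kernel is homogeneous of degree `a`. -/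
def HasDeg (c : Kern k (Finset ℕ) r) (a : ℤ) : Prop := ∀ N S, c N S ≠ 0 → excess N S = a

/-- The degrees of the entries of the kernel are at most `a`. -/
def DegLE (c : Kern k (Finset ℕ) r) (a : ℤ) : Prop := ∀ N S, c N S ≠ 0 → excess N S ≤ a

theorem Supp.local {c : Kern k (Finset ℕ) r} (hc : Supp c) : Local c :=
  fun N S h j => ((hc N S h).2 j).2

theorem excess_split (h : n + 1 = r + s) (i : Fin r) (N t : Finset ℕ) (S : Fin n → Finset ℕ) :
    excess N S = excess N (outerFam h i S t) + excess t (innerFam h i S) := by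
  unfold excess
  rw [sum_split h i, sum_outerFam h i (fun _ (z : Finset ℕ) => ((z.card : ℤ) - 1))]
  simp only [innerFam]
  ring

theorem excess_parity (N : Finset ℕ) (S : Fin r → Finset ℕ) :
    tot dimParity S + dimParity N = (excess N S : ZMod 2) := by
  simp only [tot, dimParity, excess, Int.cast_sub, Int.cast_sum, Int.cast_natCast, Int.cast_one]
  have h1 : (1 : ZMod 2) = -1 := rfl
  have h2 : ∀ j, ((S j).card : ZMod 2) + 1 = (S j).card - 1 := fun j => by rw [sub_eq_add_neg, ← h1]
  simp only [h2]
  have h3 : ((N.card : ZMod 2) + 1) = - ((N.card : ZMod 2) - 1) := by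
    linear_combination (N.card : ZMod 2) * two_zmod
  rw [h3]
  ring

theorem HasDeg.parity {c : Kern k (Finset ℕ) r} {a : ℤ} (hc : HasDeg c a) :
    HasParity dimParity c a := fun N S h => by rw [excess_parity, hc N S h]

theorem HasDeg.kcomp {c : Kern k (Finset ℕ) r} {c' : Kern k (Finset ℕ) s} {a b : ℤ}
    (h : n + 1 = r + s) (i : Fin r) (hc : HasDeg c a) (hc' : HasDeg c' b) :
    HasDeg (kcomp dimParity h i c c') (a + b) := by
  intro N S hNS
  obtain ⟨t, -, h0⟩ := Finset.exists_ne_zero_of_sum_ne_zero hNS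
  rw [excess_split h i N t, hc _ _ (right_ne_zero_of_mul (left_ne_zero_of_mul h0)),
    hc' _ _ (right_ne_zero_of_mul h0)]

theorem DegLE.kcomp {c : Kern k (Finset ℕ) r} {c' : Kern k (Finset ℕ) s} {a b : ℤ}
    (h : n + 1 = r + s) (i : Fin r) (hc : DegLE c a) (hc' : DegLE c' b) :
    DegLE (kcomp dimParity h i c c') (a + b) := by
  intro N S hNS
  obtain ⟨t, -, h0⟩ := Finset.exists_ne_zero_of_sum_ne_zero hNS
  rw [excess_split h i N t]
  exact add_le_add (hc _ _ (right_ne_zero_of_mul (left_ne_zero_of_mul h0)))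
    (hc' _ _ (right_ne_zero_of_mul h0))

theorem Supp.kcomp {c : Kern k (Finset ℕ) r} {c' : Kern k (Finset ℕ) s}
    (h : n + 1 = r + s) (i : Fin r) (hc : Supp c) (hc' : Supp c') :
    Supp (kcomp dimParity h i c c') := by
  intro N S hNS
  obtain ⟨t, ht, h0⟩ := Finset.exists_ne_zero_of_sum_ne_zero hNS
  have h1 := hc' _ _ (right_ne_zero_of_mul h0)
  have h2 := hc _ _ (right_ne_zero_of_mul (left_ne_zero_of_mul h0))
  have ht' : t ⊆ N := Finset.mem_Iic.1 ht
  refine ⟨h2.1, fun j => ?_⟩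
  have e := congrFun (glue_outerFam_innerFam h i S t) j
  rw [← e]
  simp only [glue]
  split_ifs
  · exact h2.2 _
  · exact ⟨(h1.2 _).1, (h1.2 _).2.trans ht'⟩
  · exact h2.2 _

/-- If neighbours in `N` are linked only through the intermediate face `t`, they are neighbours in
`t ⊆ N` as well, and the inner family links them. -/
theorem LinkedSupp.kcomp {c : Kern k (Finset ℕ) r} {c' : Kern k (Finset ℕ) s}
    (h : n + 1 = r + s) (i : Fin r) (hc : LinkedSupp c) (hc' : LinkedSupp c') :
    LinkedSupp (kcomp dimParity h i c c') := by
  intro N S hNS x hx y hy hxy hcons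
  obtain ⟨t, ht, h0⟩ := Finset.exists_ne_zero_of_sum_ne_zero hNS
  have ht' : t ⊆ N := Finset.mem_Iic.1 ht
  obtain ⟨j, hj1, hj2⟩ :=
    hc _ _ (right_ne_zero_of_mul (left_ne_zero_of_mul h0)) x hx y hy hxy hcons
  by_cases hj : j = i
  · subst hj
    rw [outerFam_self] at hj1 hj2
    obtain ⟨l, hl⟩ := hc' _ _ (right_ne_zero_of_mul h0) x hj1 y hj2 hxy fun z hz =>
      hcons z (ht' hz)
    exact ⟨_, hl⟩
  · rw [outerFam_of_ne _ _ _ _ hj] at hj1 hj2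
    exact ⟨_, hj1, hj2⟩

/-- The map `t ↦ φ(t)` is a bijection between the intermediate faces. Naturality of `c'` applies
only when its inputs lie in `t`; otherwise the support condition makes both values zero. -/
theorem Natural.kcomp {c : Kern k (Finset ℕ) r} {c' : Kern k (Finset ℕ) s}
    (h : n + 1 = r + s) (i : Fin r) (hc : Natural c) (hc' : Natural c') (hs : Supp c') :
    Natural (kcomp dimParity h i c c') := by
  intro N S φ hφ hS
  have hinj : Set.InjOn φ N := hφ.injOn
  have hcard : ∀ t ⊆ N, (t.image φ).card = t.card := fun t ht =>
    Finset.card_image_of_injOn (hinj.mono ht)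
  have hdim : ∀ t ⊆ N, dimParity (t.image φ) = dimParity t := fun t ht => by
    rw [dimParity, hcard t ht, dimParity]
  symm
  refine Finset.sum_nbij (fun t => t.image φ) ?_ ?_ ?_ ?_
  · intro t ht
    exact Finset.mem_Iic.2 (Finset.image_subset_image (Finset.mem_Iic.1 ht))
  · intro t ht t' ht' e
    have h1 : t ⊆ N := Finset.mem_Iic.1 (Finset.mem_coe.1 ht)
    have h2 : t' ⊆ N := Finset.mem_Iic.1 (Finset.mem_coe.1 ht')
    have e' : φ '' (t : Set ℕ) = φ '' t' := by
      rw [← Finset.coe_image, ← Finset.coe_image]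
      exact congrArg _ e
    have := (hinj.image_eq_image_iff h1 h2).1 e'
    exact_mod_cast this
  · intro t ht
    have h1 : t ⊆ N.image φ := Finset.mem_Iic.1 (Finset.mem_coe.1 ht)
    obtain ⟨t', ht', rfl⟩ := Finset.subset_image_iff.1 h1
    exact ⟨t', Finset.mem_coe.2 (Finset.mem_Iic.2 ht'), rfl⟩
  · intro t ht
    have ht' : t ⊆ N := Finset.mem_Iic.1 ht
    have e1 : outerFam h i (fun j => (S j).image φ) (t.image φ) =
        fun j => (outerFam h i S t j).image φ := by
      funext j
      simp only [outerFam]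
      split_ifs <;> rfl
    have e2 : innerFam h i (fun j => (S j).image φ) = fun l => (innerFam h i S l).image φ := rfl
    have e3 : tot dimParity (fun l => (innerFam h i S l).image φ) =
        tot dimParity (innerFam h i S) :=
      Finset.sum_congr rfl fun l _ => hdim _ (hS _)
    have e4 : pre dimParity i (fun j => (S j).image φ) = pre dimParity i S :=
      Finset.sum_congr rfl fun j _ => by rw [hdim _ (hS j)]
    have e5 : ∀ j, outerFam h i S t j ⊆ N := fun j => by
      simp only [outerFam]
      split_ifs
      · exact ht'
      · exact hS _
    rw [e1, e2, e3, e4, hdim t ht', hc N _ φ hφ e5]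
    congr 1
    by_cases hin : ∀ l, innerFam h i S l ⊆ t
    · exact (hc' t _ φ (hφ.mono ht') hin).symm
    · have z1 : c' t (innerFam h i S) = 0 := by
        by_contra h0
        exact hin fun l => ((hs _ _ h0).2 l).2
      have z2 : c' (t.image φ) (fun l => (innerFam h i S l).image φ) = 0 := by
        by_contra h0
        refine hin fun l x hx => ?_
        obtain ⟨x', hx', e⟩ := Finset.mem_image.1
          (((hs _ _ h0).2 l).2 (Finset.mem_image_of_mem φ hx))
        rwa [← hinj (ht' hx') (hS _ hx) e]
      rw [z1, z2]

theorem Natural.theta {c : Kern k (Finset ℕ) r} (hc : Natural c) (b : ZMod 2) :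
    Natural (theta dimParity b c) := by
  intro N S φ hφ hS
  have hdim : ∀ t ⊆ N, dimParity (t.image φ) = dimParity t := fun t ht => by
    rw [dimParity, Finset.card_image_of_injOn (hφ.injOn.mono ht), dimParity]
  have e3 : tot dimParity (fun l => (S l).image φ) = tot dimParity S :=
    Finset.sum_congr rfl fun l _ => hdim _ (hS _)
  rw [EInf.theta, EInf.theta, e3, hdim N subset_rfl, hc N S φ hφ hS]

theorem Natural.kact {c : Kern k (Finset ℕ) r} (hc : Natural c) (σ : Equiv.Perm (Fin r)) :
    Natural (kact dimParity σ c) := by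
  intro N S φ hφ hS
  have hdim : ∀ t ⊆ N, dimParity (t.image φ) = dimParity t := fun t ht => by
    rw [dimParity, Finset.card_image_of_injOn (hφ.injOn.mono ht), dimParity]
  have e3 : (dimParity ∘ fun l => (S l).image φ) = dimParity ∘ S :=
    funext fun l => hdim _ (hS _)
  rw [EInf.kact, EInf.kact, e3]
  congr 1
  exact hc N (S ∘ σ.symm) φ hφ fun j => hS _

theorem excess_perm (N : Finset ℕ) (S : Fin r → Finset ℕ) (σ : Equiv.Perm (Fin r)) :
    excess N (S ∘ σ) = excess N S := by
  unfold excess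
  rw [← Equiv.sum_comp σ fun j => (((S j).card : ℤ) - 1)]
  rfl

theorem Linked.perm {N : Finset ℕ} {S : Fin r → Finset ℕ} {σ : Equiv.Perm (Fin r)}
    (h : Linked N (S ∘ σ)) : Linked N S := fun x hx y hy hxy hc =>
  let ⟨j, hj⟩ := h x hx y hy hxy hc
  ⟨σ j, hj⟩

/-- The simplicial coboundary, as a kernel. -/
def bd (k : Type*) [CommRing k] : Kern k (Finset ℕ) 1 := fun N S =>
  ∑ x ∈ N, if N.erase x = S 0 ∧ (S 0).Nonempty then (-1) ^ (N.filter (· < x)).card else 0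

theorem bd_ne_zero {N : Finset ℕ} {S : Fin 1 → Finset ℕ} (h : bd k N S ≠ 0) :
    ∃ x ∈ N, N.erase x = S 0 ∧ (S 0).Nonempty := by
  obtain ⟨x, hx, h0⟩ := Finset.exists_ne_zero_of_sum_ne_zero h
  exact ⟨x, hx, by by_contra h1; exact h0 (if_neg h1)⟩

theorem bd_supp : Supp (bd k) := by
  intro N S h
  obtain ⟨x, hx, h1, h2⟩ := bd_ne_zero h
  refine ⟨⟨x, hx⟩, fun j => ?_⟩
  rw [Subsingleton.elim j 0]
  exact ⟨h2, h1 ▸ Finset.erase_subset _ _⟩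

theorem bd_deg : HasDeg (bd k) (-1) := by
  intro N S h
  obtain ⟨x, hx, h1, h2⟩ := bd_ne_zero h
  have h3 := Finset.card_erase_add_one hx
  rw [h1] at h3
  simp only [excess, Finset.univ_unique, Fin.default_eq_zero, Finset.sum_singleton, ← h3]
  push_cast
  ring

theorem bd_parity : HasParity dimParity (bd k) 1 := by
  have := (bd_deg (k := k)).parity
  simpa using this

theorem card_filter_image {N : Finset ℕ} {φ : ℕ → ℕ} (hφ : StrictMonoOn φ N) {x : ℕ} (hx : x ∈ N) :
    ((N.image φ).filter (· < φ x)).card = (N.filter (· < x)).card := by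
  rw [Finset.filter_image, Finset.card_image_of_injOn
    (hφ.injOn.mono (Finset.coe_subset.2 (Finset.filter_subset _ _)))]
  congr 1
  refine Finset.filter_congr fun y hy => ?_
  exact hφ.lt_iff_lt hy hx

theorem bd_natural : Natural (bd k) := by
  intro N S φ hφ hS
  rw [bd, bd, Finset.sum_image hφ.injOn]
  refine Finset.sum_congr rfl fun x hx => ?_
  rw [card_filter_image hφ hx]
  have h1 : (N.image φ).erase (φ x) = (S 0).image φ ↔ N.erase x = S 0 := by
    rw [← Finset.coe_inj, Finset.coe_erase, Finset.coe_image, Finset.coe_image,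
      ← Set.image_singleton, ← (hφ.injOn).image_sdiff_subset (by simpa using hx),
      hφ.injOn.image_eq_image_iff Set.sdiff_subset (hS 0), ← Finset.coe_erase, Finset.coe_inj]
  simp only [h1, Finset.image_nonempty]

theorem bd_kcomp (h : r + 1 = 1 + r) {c : Kern k (Finset ℕ) r} (hc : Supp c) (N : Finset ℕ)
    (S : Fin r → Finset ℕ) : kcomp dimParity h 0 (bd k) c N S =
      ∑ x ∈ N, (-1) ^ (N.filter (· < x)).card * c (N.erase x) S := by
  have e2 : innerFam h 0 S = S := by
    funext l; simp only [innerFam]; congr 1; ext; simp [innerPos]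
  have e1 : pre dimParity ((0 : Fin 1) : ℕ) S = 0 := by simp [pre]
  simp only [kcomp, bd, outerFam_self, e1, e2, mul_zero, sgn_zero, one_mul, Finset.sum_mul]
  rw [Finset.sum_comm]
  refine Finset.sum_congr rfl fun x hx => ?_
  rw [Finset.sum_eq_single (N.erase x)]
  · by_cases h0 : (N.erase x).Nonempty
    · rw [if_pos ⟨rfl, h0⟩]
    · have : c (N.erase x) S = 0 := by
        by_contra h1
        exact h0 (hc _ _ h1).1
      rw [this, mul_zero, mul_zero]
  · intro t _ ht
    rw [if_neg (fun h => ht h.1.symm), zero_mul]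
  · intro h0
    exact absurd (Finset.mem_Iic.2 (Finset.erase_subset x N)) h0

/-- The intermediate face must be `S j` with one more vertex. Vertices outside `N` can be left out,
since `c` vanishes on faces that are not contained in `N`. -/
theorem kcomp_bd (j : Fin r) {c : Kern k (Finset ℕ) r} (hc : Supp c) (N : Finset ℕ)
    (S : Fin r → Finset ℕ) : kcomp dimParity (rfl : r + 1 = r + 1) j c (bd k) N S =
      if (S j).Nonempty then ∑ x ∈ N \ S j, sgn k (pre dimParity j S) *
        (-1) ^ ((S j).filter (· < x)).card * c N (Function.update S j (insert x (S j))) else 0 := by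
  have e1 : ∀ l, innerFam (rfl : r + 1 = r + 1) j S l = S j := fun l => by
    simp only [innerFam]; congr 1; ext; simp [innerPos]
  have e2 : ∀ t, outerFam (rfl : r + 1 = r + 1) j S t = Function.update S j t := fun t => by
    funext j'
    by_cases hj : j' = j
    · subst hj; simp
    · rw [outerFam_of_ne _ _ _ _ hj, Function.update_of_ne hj]
      congr 1
      have h5 : (j' : ℕ) ≠ j := fun e => hj (Fin.ext e)
      ext; simp only [outerPos, Fin.lt_def]; split_ifs <;> omega
  have e3 : tot dimParity (innerFam (rfl : r + 1 = r + 1) j S) = dimParity (S j) := by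
    simp [tot, e1]
  simp only [kcomp, bd, e1, e2, e3]
  split_ifs with hne
  · have h1 : ∀ t ∈ Finset.Iic N, sgn k ((dimParity (S j) + dimParity t) * pre dimParity j S) *
        c N (Function.update S j t) *
        (∑ x ∈ t, if t.erase x = S j ∧ (S j).Nonempty then
          (-1) ^ (t.filter (· < x)).card else 0) =
        ∑ x ∈ N \ S j, if t = insert x (S j) then sgn k (pre dimParity j S) *
          (-1) ^ ((S j).filter (· < x)).card * c N (Function.update S j (insert x (S j))) else 0 := by
      intro t ht
      rw [Finset.mul_sum]
      have ht' : t ⊆ N := Finset.mem_Iic.1 ht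
      refine Finset.sum_congr_of_eq_on_inter ?_ ?_ ?_
      · intro x hx hx'
        rw [if_neg, mul_zero]
        rintro ⟨h1, -⟩
        refine hx' (Finset.mem_sdiff.2 ⟨ht' hx, ?_⟩)
        rw [← h1]
        exact Finset.notMem_erase _ _
      · intro x hx hx'
        rw [if_neg]
        rintro rfl
        exact hx' (Finset.mem_insert_self _ _)
      · intro x hx hx'
        have hxS := (Finset.mem_sdiff.1 hx').2
        by_cases h2 : t = insert x (S j)
        · subst h2
          have h3 : (insert x (S j)).erase x = S j := Finset.erase_insert hxS
          have h4 : (insert x (S j)).filter (· < x) = (S j).filter (· < x) := by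
            rw [Finset.filter_insert, if_neg (lt_irrefl x)]
          have h5 : dimParity (S j) + dimParity (insert x (S j)) = 1 := by
            rw [dimParity, dimParity, Finset.card_insert_of_notMem hxS]
            push_cast
            linear_combination (((S j).card : ZMod 2) + 1) * two_zmod
          rw [if_pos ⟨h3, hne⟩, if_pos rfl, h4, h5, one_mul]
          ring
        · rw [if_neg h2, if_neg, mul_zero]
          rintro ⟨h3, -⟩
          apply h2
          rw [← h3, Finset.insert_erase hx]
    rw [Finset.sum_congr rfl h1, Finset.sum_comm]
    refine Finset.sum_congr rfl fun x hx => ?_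
    rw [Finset.sum_ite_eq']
    split_ifs with h2
    · rfl
    · by_contra h0
      refine h2 (Finset.mem_Iic.2 ?_)
      have := ((hc _ _ (right_ne_zero_of_mul (Ne.symm h0))).2 j).2
      rwa [Function.update_self] at this
  · refine Finset.sum_eq_zero fun t _ => ?_
    simp [hne]

/-- Removing two vertices in the two possible orders gives opposite signs, because removing the
smaller one first shifts the position of the larger one. -/
theorem bd_bd : kcomp dimParity (s := 1) (n := 1) rfl 0 (bd k) (bd k) = 0 := by
  funext N S
  rw [bd_kcomp _ bd_supp]
  simp only [bd, Finset.mul_sum, Pi.zero_apply]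
  rw [Finset.sum_sigma']
  refine Finset.sum_involution (fun p _ => ⟨p.2, p.1⟩) ?_ ?_ ?_ ?_
  · rintro ⟨x, y⟩ hxy
    simp only [Finset.mem_sigma] at hxy
    obtain ⟨hx, hy⟩ := hxy
    have hyN := Finset.mem_of_mem_erase hy
    have hne : y ≠ x := Finset.ne_of_mem_erase hy
    simp only
    rw [Finset.erase_right_comm]
    split_ifs with h0
    · have key : ∀ {x y : ℕ}, x ∈ N → y ∈ N → x < y →
          (-1 : k) ^ (N.filter (· < x)).card * (-1) ^ ((N.erase x).filter (· < y)).card +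
          (-1) ^ (N.filter (· < y)).card * (-1) ^ ((N.erase y).filter (· < x)).card = 0 := by
        intro x y hx hy hlt
        have h1 : (N.erase y).filter (· < x) = N.filter (· < x) := by
          rw [Finset.filter_erase, Finset.erase_eq_of_notMem]
          simp [hlt.le]
        have h2 : ((N.erase x).filter (· < y)).card + 1 = (N.filter (· < y)).card := by
          rw [Finset.filter_erase, Finset.card_erase_add_one]
          simp [hx, hlt]
        rw [h1, ← h2, pow_succ]
        ring
      rcases lt_or_gt_of_ne hne with h | h
      · rw [add_comm]; exact key hyN hx h
      · exact key hx hyN h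
    · simp
  · rintro ⟨x, y⟩ hxy _ e
    simp only [Finset.mem_sigma] at hxy
    have := congrArg Sigma.fst e
    exact Finset.ne_of_mem_erase hxy.2 this
  · rintro ⟨x, y⟩ hxy
    simp only [Finset.mem_sigma, Finset.mem_erase] at hxy ⊢
    exact ⟨hxy.2.2, hxy.2.1.symm, hxy.1⟩
  · rintro ⟨x, y⟩ _
    rfl

end Simplices
end EInf

namespace EInf

/-! ### The operad of linked kernels -/

section Operad
variable {k : Type u} [CommRing k] {r s n : ℕ}

/-- The differential on kernels induced by the simplicial coboundary. -/
abbrev dk : Kern k (Finset ℕ) r →ₗ[k] Kern k (Finset ℕ) r := kdL dimParity (bd k)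

theorem Supp.theta {c : Kern k (Finset ℕ) r} (hc : Supp c) (b : ZMod 2) :
    Supp (theta dimParity b c) := fun N S h => hc N S (right_ne_zero_of_mul h)

theorem LinkedSupp.theta {c : Kern k (Finset ℕ) r} (hc : LinkedSupp c) (b : ZMod 2) :
    LinkedSupp (theta dimParity b c) := fun N S h => hc N S (right_ne_zero_of_mul h)

theorem HasDeg.theta {c : Kern k (Finset ℕ) r} {a : ℤ} (hc : HasDeg c a) (b : ZMod 2) :
    HasDeg (theta dimParity b c) a := fun N S h => hc N S (right_ne_zero_of_mul h)

theorem DegLE.theta {c : Kern k (Finset ℕ) r} {a : ℤ} (hc : DegLE c a) (b : ZMod 2) :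
    DegLE (theta dimParity b c) a := fun N S h => hc N S (right_ne_zero_of_mul h)

theorem dk_ne_zero {c : Kern k (Finset ℕ) r} {N : Finset ℕ} {S : Fin r → Finset ℕ}
    (h : dk c N S ≠ 0) : kcomp dimParity (n := r) (by omega) 0 (bd k) c N S ≠ 0 ∨
      ∃ j, kcomp dimParity (s := 1) (n := r) rfl j (theta dimParity 1 c) (bd k) N S ≠ 0 := by
  by_contra! h1
  apply h
  rw [kdL_apply, kd, Pi.sub_apply, Pi.sub_apply, h1.1, Finset.sum_apply, Finset.sum_apply]
  simp [h1.2]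

theorem Supp.dk {c : Kern k (Finset ℕ) r} (hc : Supp c) : Supp (dk c) := by
  intro N S h
  rcases dk_ne_zero h with h1 | ⟨j, h1⟩
  · exact bd_supp.kcomp _ _ hc _ _ h1
  · exact (hc.theta 1).kcomp _ _ bd_supp _ _ h1

theorem HasDeg.dk {c : Kern k (Finset ℕ) r} {a : ℤ} (hc : HasDeg c a) : HasDeg (dk c) (a - 1) := by
  intro N S h
  rcases dk_ne_zero h with h1 | ⟨j, h1⟩
  · rw [bd_deg.kcomp _ _ hc _ _ h1]; ring
  · rw [(hc.theta 1).kcomp _ _ bd_deg _ _ h1]; ring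

theorem DegLE.dk {c : Kern k (Finset ℕ) r} {a : ℤ} (hc : DegLE c a) : DegLE (dk c) (a - 1) := by
  have hbd : DegLE (bd k) (-1) := fun N S h => (bd_deg N S h).le
  intro N S h
  rcases dk_ne_zero h with h1 | ⟨j, h1⟩
  · exact (hbd.kcomp _ _ hc _ _ h1).trans (by linarith)
  · exact ((hc.theta 1).kcomp _ _ hbd _ _ h1).trans (by linarith)

theorem Natural.sub' {c c' : Kern k (Finset ℕ) r} (hc : Natural c) (hc' : Natural c') :
    Natural (c - c') := fun N S φ h1 h2 => by
  simp only [Pi.sub_apply, hc N S φ h1 h2, hc' N S φ h1 h2]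

theorem Natural.sum {ι : Type*} (T : Finset ι) {c : ι → Kern k (Finset ℕ) r}
    (hc : ∀ i, Natural (c i)) : Natural (∑ i ∈ T, c i) := fun N S φ h1 h2 => by
  simp only [Finset.sum_apply, fun i => hc i N S φ h1 h2]

theorem Natural.dk {c : Kern k (Finset ℕ) r} (hc : Natural c) (hs : Supp c) : Natural (dk c) :=
  (bd_natural.kcomp _ _ hc hs).sub' (Natural.sum _ fun j =>
    (hc.theta 1).kcomp _ _ bd_natural bd_supp)

/-- The kernels which belong to the operad: natural kernels of bounded degree which are, together
with their differential, supported on linked families. -/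
structure IsLinked (c : Kern k (Finset ℕ) r) : Prop where
  supp : Supp c
  natural : Natural c
  linked : LinkedSupp c
  -- The differential of a linked kernel need not be linked, so this is imposed separately; as the
  -- differential squares to zero, no further condition arises.
  dlinked : LinkedSupp (dk c)
  bounded : ∃ A, DegLE c A

theorem IsLinked.add {c c' : Kern k (Finset ℕ) r} (hc : IsLinked c) (hc' : IsLinked c') :
    IsLinked (c + c') where
  supp N S h := by
    by_cases h1 : c N S = 0
    · exact hc'.supp N S fun h2 => h (by simp [h1, h2])
    · exact hc.supp N S h1
  natural N S φ h1 h2 := by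
    simp only [Pi.add_apply, hc.natural N S φ h1 h2, hc'.natural N S φ h1 h2]
  linked N S h := by
    by_cases h1 : c N S = 0
    · exact hc'.linked N S fun h2 => h (by simp [h1, h2])
    · exact hc.linked N S h1
  dlinked N S h := by
    rw [map_add] at h
    by_cases h1 : dk c N S = 0
    · exact hc'.dlinked N S fun h2 => h (by rw [Pi.add_apply, Pi.add_apply, h1, h2, add_zero])
    · exact hc.dlinked N S h1
  bounded := by
    obtain ⟨A, hA⟩ := hc.bounded
    obtain ⟨A', hA'⟩ := hc'.bounded
    refine ⟨max A A', fun N S h => ?_⟩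
    by_cases h1 : c N S = 0
    · exact (hA' N S fun h2 => h (by simp [h1, h2])).trans (le_max_right _ _)
    · exact (hA N S h1).trans (le_max_left _ _)

theorem IsLinked.smul (a : k) {c : Kern k (Finset ℕ) r} (hc : IsLinked c) : IsLinked (a • c) where
  supp N S h := hc.supp N S (right_ne_zero_of_mul h)
  natural N S φ h1 h2 := by simp only [Pi.smul_apply, hc.natural N S φ h1 h2]
  linked N S h := hc.linked N S (right_ne_zero_of_mul h)
  dlinked N S h := by
    rw [map_smul] at h
    exact hc.dlinked N S (right_ne_zero_of_mul h)
  bounded := hc.bounded.imp fun A hA N S h => hA N S (right_ne_zero_of_mul h)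

theorem IsLinked.zero : IsLinked (0 : Kern k (Finset ℕ) r) where
  supp N S h := absurd rfl h
  natural N S φ h1 h2 := rfl
  linked N S h := absurd rfl h
  dlinked N S h := by rw [map_zero] at h; exact absurd rfl h
  bounded := ⟨0, fun N S h => absurd rfl h⟩

theorem dk_kcomp (h : n + 1 = r + s) (i : Fin r) {c : Kern k (Finset ℕ) r}
    {c' : Kern k (Finset ℕ) s} (hc : Supp c) (hc' : Supp c') :
    dk (kcomp dimParity h i c c') =
      kcomp dimParity h i (dk c) c' + kcomp dimParity h i (theta dimParity 1 c) (dk c') :=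
  kd_kcomp dimParity bd_parity bd_supp.local h i hc.local hc'.local

theorem IsLinked.kcomp (h : n + 1 = r + s) (i : Fin r) {c : Kern k (Finset ℕ) r}
    {c' : Kern k (Finset ℕ) s} (hc : IsLinked c) (hc' : IsLinked c') :
    IsLinked (kcomp dimParity h i c c') where
  supp := hc.supp.kcomp h i hc'.supp
  natural := hc.natural.kcomp h i hc'.natural hc'.supp
  linked := hc.linked.kcomp h i hc'.linked
  dlinked N S h1 := by
    rw [dk_kcomp h i hc.supp hc'.supp] at h1
    by_cases h2 : EInf.kcomp dimParity h i (dk c) c' N S = 0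
    · refine (hc.linked.theta 1).kcomp h i hc'.dlinked N S fun h3 => h1 ?_
      rw [Pi.add_apply, Pi.add_apply, h2, h3, add_zero]
    · exact hc.dlinked.kcomp h i hc'.linked N S h2
  bounded := by
    obtain ⟨A, hA⟩ := hc.bounded
    obtain ⟨A', hA'⟩ := hc'.bounded
    exact ⟨A + A', hA.kcomp h i hA'⟩

theorem dk_kact (σ : Equiv.Perm (Fin r)) (c : Kern k (Finset ℕ) r) :
    dk (kact dimParity σ c) = kact dimParity σ (dk c) :=
  kd_kact dimParity bd_parity bd_supp.local σ c

theorem LinkedSupp.kact {c : Kern k (Finset ℕ) r} (hc : LinkedSupp c) (σ : Equiv.Perm (Fin r)) :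
    LinkedSupp (kact dimParity σ c) := fun N S h => (hc N _ (right_ne_zero_of_mul h)).perm

theorem Supp.kact {c : Kern k (Finset ℕ) r} (hc : Supp c) (σ : Equiv.Perm (Fin r)) :
    Supp (kact dimParity σ c) := fun N S h => by
  have h1 := hc N _ (right_ne_zero_of_mul h)
  exact ⟨h1.1, fun j => by simpa using h1.2 (σ j)⟩

theorem HasDeg.kact {c : Kern k (Finset ℕ) r} {a : ℤ} (hc : HasDeg c a) (σ : Equiv.Perm (Fin r)) :
    HasDeg (kact dimParity σ c) a := fun N S h => by
  rw [← hc N _ (right_ne_zero_of_mul h), excess_perm]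

theorem IsLinked.kact {c : Kern k (Finset ℕ) r} (hc : IsLinked c) (σ : Equiv.Perm (Fin r)) :
    IsLinked (kact dimParity σ c) where
  supp := hc.supp.kact σ
  natural := hc.natural.kact σ
  linked := hc.linked.kact σ
  dlinked := by rw [dk_kact]; exact hc.dlinked.kact σ
  bounded := hc.bounded.imp fun A hA N S h => by
    rw [← excess_perm N S σ.symm]
    exact hA N _ (right_ne_zero_of_mul h)

theorem dk_dk {c : Kern k (Finset ℕ) r} (hc : Supp c) : dk (dk c) = 0 :=
  kd_kd dimParity bd_parity bd_supp.local bd_bd hc.local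

theorem IsLinked.dk {c : Kern k (Finset ℕ) r} (hc : IsLinked c) : IsLinked (dk c) where
  supp := hc.supp.dk
  natural := hc.natural.dk hc.supp
  linked := hc.dlinked
  dlinked N S h := by rw [dk_dk hc.supp] at h; exact absurd rfl h
  bounded := hc.bounded.imp' (· - 1) fun A hA => hA.dk

/-- The part of degree `a` of a kernel. -/
def degPart (a : ℤ) (c : Kern k (Finset ℕ) r) : Kern k (Finset ℕ) r :=
  fun N S => if excess N S = a then c N S else 0

theorem degPart_ne_zero {a : ℤ} {c : Kern k (Finset ℕ) r} {N : Finset ℕ} {S : Fin r → Finset ℕ}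
    (h : degPart a c N S ≠ 0) : excess N S = a ∧ c N S ≠ 0 := by
  unfold degPart at h
  split_ifs at h with h1
  · exact ⟨h1, h⟩
  · exact absurd rfl h

theorem degPart_hasDeg (a : ℤ) (c : Kern k (Finset ℕ) r) : HasDeg (degPart a c) a :=
  fun _ _ h => (degPart_ne_zero h).1

/-- In a linked family, the excess is not negative. -/
theorem excess_nonneg {N : Finset ℕ} {S : Fin r → Finset ℕ} (hN : N.Nonempty)
    (hS : ∀ j, (S j).Nonempty ∧ S j ⊆ N) (h : Linked N S) : 0 ≤ excess N S := by
  -- A vertex other than the last one shares some `S j` with its successor, hence is not the maximum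
  -- of that `S j`. So `card N - 1` is at most the sum of the `card (S j) - 1`.
  have hsub : N.erase (N.max' hN) ⊆
      Finset.univ.biUnion fun j => (S j).erase ((S j).max' (hS j).1) := by
    intro x hx
    obtain ⟨hx1, hx2⟩ := Finset.mem_erase.1 hx
    have hlt : x < N.max' hN := lt_of_le_of_ne (N.le_max' x hx2) hx1
    have hne : (N.filter (x < ·)).Nonempty :=
      ⟨N.max' hN, Finset.mem_filter.2 ⟨N.max'_mem hN, hlt⟩⟩
    obtain ⟨hy1, hy2⟩ := Finset.mem_filter.1 (Finset.min'_mem _ hne)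
    obtain ⟨j, hj1, hj2⟩ := h x hx2 _ hy1 hy2 fun z hz hz' =>
      absurd (Finset.min'_le _ z (Finset.mem_filter.2 ⟨hz, hz'.1⟩)) (not_le.2 hz'.2)
    refine Finset.mem_biUnion.2 ⟨j, Finset.mem_univ _, Finset.mem_erase.2 ⟨?_, hj1⟩⟩
    exact (lt_of_lt_of_le hy2 (Finset.le_max' _ _ hj2)).ne
  have h1 := (Finset.card_le_card hsub).trans Finset.card_biUnion_le
  have h2 := Finset.card_erase_add_one (N.max'_mem hN)
  have h3 : ((∑ j, ((S j).erase ((S j).max' (hS j).1)).card : ℕ) : ℤ) =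
      ∑ j, (((S j).card : ℤ) - 1) := by
    rw [Nat.cast_sum]
    refine Finset.sum_congr rfl fun j _ => ?_
    have := Finset.card_erase_add_one ((S j).max'_mem (hS j).1)
    omega
  unfold excess
  rw [← h3]
  omega

theorem IsLinked.excess_nonneg {c : Kern k (Finset ℕ) r} (hc : IsLinked c) {N : Finset ℕ}
    {S : Fin r → Finset ℕ} (h : c N S ≠ 0) : 0 ≤ excess N S :=
  EInf.excess_nonneg (hc.supp N S h).1 (hc.supp N S h).2 (hc.linked N S h)

theorem IsLinked.exists_sum_degPart {c : Kern k (Finset ℕ) r} (hc : IsLinked c) :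
    ∃ A : ℕ, c = ∑ a ∈ Finset.range A, degPart (a : ℤ) c := by
  obtain ⟨A, hA⟩ := hc.bounded
  refine ⟨A.toNat + 1, ?_⟩
  funext N S
  simp only [Finset.sum_apply, degPart]
  by_cases h0 : c N S = 0
  · simp [h0]
  · have h1 := hA N S h0
    have h2 := hc.excess_nonneg h0
    rw [Finset.sum_eq_single (excess N S).toNat]
    · rw [if_pos (by omega)]
    · intro b _ hb
      rw [if_neg (by omega)]
    · intro hb
      exact absurd (Finset.mem_range.2 (by omega)) hb

theorem Natural.degPart {c : Kern k (Finset ℕ) r} (hc : Natural c) (a : ℤ) :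
    Natural (degPart a c) := by
  intro N S φ hφ hS
  have hcard : ∀ t ⊆ N, (t.image φ).card = t.card := fun t ht =>
    Finset.card_image_of_injOn (hφ.injOn.mono ht)
  have h1 : excess (N.image φ) (fun j => (S j).image φ) = excess N S := by
    simp only [excess, hcard N subset_rfl, fun j => hcard _ (hS j)]
  rw [EInf.degPart, EInf.degPart, h1, hc N S φ hφ hS]

/-- The differential lowers the degree by exactly one, so an entry of excess `a - 1` sees only the
part of degree `a`. This makes the parts of a linked kernel linked and primitives homogeneous. -/
theorem IsLinked.dk_degPart_apply {c : Kern k (Finset ℕ) r} (hc : IsLinked c) (a : ℕ)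
    {N : Finset ℕ} {S : Fin r → Finset ℕ} (h : excess N S = a - 1) :
    EInf.dk c N S = EInf.dk (degPart (a : ℤ) c) N S := by
  obtain ⟨A, hA⟩ := hc.exists_sum_degPart
  have hother : ∀ b : ℕ, b ≠ a → EInf.dk (degPart (b : ℤ) c) N S = 0 := fun b hb => by
    by_contra h1
    have := (degPart_hasDeg (b : ℤ) c).dk N S h1
    omega
  conv_lhs => rw [hA, map_sum, Finset.sum_apply, Finset.sum_apply]
  by_cases haA : a ∈ Finset.range A
  · exact Finset.sum_eq_single a (fun b _ hb => hother b hb) fun h => absurd haA h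
  · have h2 : degPart (a : ℤ) c = 0 := by
      funext N S
      by_contra h3
      obtain ⟨h4, h5⟩ := degPart_ne_zero h3
      rw [hA, Finset.sum_apply, Finset.sum_apply] at h5
      apply h5
      refine Finset.sum_eq_zero fun b hb => ?_
      rw [degPart, if_neg]
      rintro h6
      have : b = a := by omega
      exact haA (this ▸ hb)
    rw [h2, map_zero]
    exact Finset.sum_eq_zero fun b hb => hother b fun h => haA (h ▸ hb)

theorem IsLinked.dk_degPart {c : Kern k (Finset ℕ) r} (hc : IsLinked c) {a : ℕ}
    (h : HasDeg (EInf.dk c) (a - 1)) : EInf.dk (degPart (a : ℤ) c) = EInf.dk c := by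
  funext N S
  by_cases h1 : excess N S = a - 1
  · exact (hc.dk_degPart_apply a h1).symm
  · rw [not_imp_comm.1 (h N S) h1, not_imp_comm.1 ((degPart_hasDeg (a : ℤ) c).dk N S) h1]

theorem IsLinked.degPart {c : Kern k (Finset ℕ) r} (hc : IsLinked c) (a : ℕ) :
    IsLinked (degPart (a : ℤ) c) where
  supp N S h := hc.supp N S (degPart_ne_zero h).2
  natural := hc.natural.degPart a
  linked N S h := hc.linked N S (degPart_ne_zero h).2
  dlinked N S h := by
    refine hc.dlinked N S ?_
    rw [hc.dk_degPart_apply a ((degPart_hasDeg (a : ℤ) c).dk N S h)]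
    exact h
  bounded := ⟨a, fun N S h => (degPart_ne_zero h).1.le⟩

variable (k) in
/-- The module of operations of arity `r`. -/
def linkedKern (r : ℕ) : Submodule k (Kern k (Finset ℕ) r) where
  carrier := {c | IsLinked c}
  add_mem' := IsLinked.add
  zero_mem' := IsLinked.zero
  smul_mem' a _ hc := IsLinked.smul a hc

variable (k) in
/-- The operations of arity `r` and degree `a`. -/
def linkedDeg (r a : ℕ) : Submodule k (linkedKern k r) where
  carrier := {c | HasDeg c.1 a}
  add_mem' {c c'} hc hc' N S h := by
    by_cases h1 : c.1 N S = 0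
    · exact hc' N S fun h2 => h (by
        change c.1 N S + c'.1 N S = 0
        rw [h1, h2, add_zero])
    · exact hc N S h1
  zero_mem' N S h := absurd rfl h
  smul_mem' a c hc N S h := hc N S (right_ne_zero_of_mul (show a * c.1 N S ≠ 0 from h))

theorem linkedDeg_isInternal (r : ℕ) : DirectSum.IsInternal (linkedDeg k r) := by
  constructor
  · intro x y hxy
    ext1 a
    -- The part of degree `a` of a sum recovers its component with index `a`, which gives
    -- injectivity; surjectivity is `exists_sum_degPart`.
    have key : ∀ (x : ⨁ a, linkedDeg k r a) (a : ℕ) (N : Finset ℕ) (S : Fin r → Finset ℕ),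
        degPart (a : ℤ) (DirectSum.coeAddMonoidHom (linkedDeg k r) x).1 N S = (x a).1.1 N S := by
      intro x a N S
      induction x using DirectSum.induction_on with
      | zero => simp [degPart]
      | of b y =>
        rw [DirectSum.coeAddMonoidHom_of, degPart]
        by_cases hab : b = a
        · subst hab
          rw [DirectSum.of_eq_same]
          split_ifs with h1
          · rfl
          · by_contra h0
            exact h1 (y.2 N S (Ne.symm h0))
        · rw [DirectSum.of_eq_of_ne _ _ _ (Ne.symm hab)]
          split_ifs with h1
          · by_contra h0
            have := y.2 N S h0
            omega
          · rfl
      | add y z hy hz =>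
        rw [map_add, DirectSum.add_apply]
        change degPart (a : ℤ) (_ + _) N S = (y a).1.1 N S + (z a).1.1 N S
        rw [← hy, ← hz]
        simp only [degPart, Pi.add_apply]
        split_ifs <;> simp
    apply Subtype.ext
    apply Subtype.ext
    funext N S
    rw [← key x a N S, ← key y a N S, hxy]
  · intro c
    obtain ⟨A, hA⟩ := c.2.exists_sum_degPart
    refine ⟨∑ a ∈ Finset.range A, DirectSum.of (fun a => linkedDeg k r a) a
      ⟨⟨degPart (a : ℤ) c.1, c.2.degPart a⟩, degPart_hasDeg _ _⟩, ?_⟩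
    rw [map_sum]
    simp only [DirectSum.coeAddMonoidHom_of]
    apply Subtype.ext
    rw [AddSubmonoidClass.coe_finsetSum]
    exact hA.symm

/-- The kernel of the identity operation. -/
def linkedOne : Kern k (Finset ℕ) 1 := fun N S => if S 0 = N ∧ N.Nonempty then 1 else 0

theorem linkedOne_ne_zero {N : Finset ℕ} {S : Fin 1 → Finset ℕ}
    (h : linkedOne (k := k) N S ≠ 0) : S 0 = N ∧ N.Nonempty := by
  by_contra h1
  exact h (if_neg h1)

theorem linkedOne_hasDeg : HasDeg (linkedOne (k := k)) 0 := fun N S h => by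
  simp [excess, (linkedOne_ne_zero h).1]

theorem linkedOne_kcomp (h : s + 1 = 1 + s) {c : Kern k (Finset ℕ) s} (hc : Supp c) :
    kcomp dimParity h 0 linkedOne c = c := by
  conv_rhs => rw [← kone_kcomp dimParity h c]
  funext N S
  refine Finset.sum_congr rfl fun t _ => ?_
  by_cases h0 : c t (innerFam h 0 S) = 0
  · rw [h0, mul_zero, mul_zero]
  · have h1 := (hc _ _ h0).1
    simp only [linkedOne, kone, outerFam_self]
    by_cases h2 : t = N
    · subst h2; rw [if_pos ⟨rfl, h1⟩, if_pos rfl]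
    · rw [if_neg (fun h => h2 h.1), if_neg h2]

theorem kcomp_linkedOne (i : Fin r) {c : Kern k (Finset ℕ) r} (hc : Supp c) :
    kcomp dimParity (rfl : r + 1 = r + 1) i c linkedOne = c := by
  conv_rhs => rw [← kcomp_kone dimParity i hc.local]
  funext N S
  refine Finset.sum_congr rfl fun t _ => ?_
  by_cases h0 : c N (outerFam (rfl : r + 1 = r + 1) i S t) = 0
  · rw [h0, mul_zero, zero_mul, zero_mul]
  · have h1 := ((hc _ _ h0).2 i).1
    rw [outerFam_self] at h1
    simp only [linkedOne, kone, h1, and_true]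

theorem linkedOne_supp : Supp (linkedOne (k := k)) := fun N S h => by
  obtain ⟨h1, h2⟩ := linkedOne_ne_zero h
  refine ⟨h2, fun j => ?_⟩
  rw [Subsingleton.elim j 0, h1]
  exact ⟨h2, subset_rfl⟩

theorem linkedOne_isLinked : IsLinked (linkedOne (k := k)) where
  supp := linkedOne_supp
  natural N S φ hφ hS := by
    have h1 : (S 0).image φ = N.image φ ↔ S 0 = N := by
      rw [← Finset.coe_inj, Finset.coe_image, Finset.coe_image,
        hφ.injOn.image_eq_image_iff (hS 0) subset_rfl, Finset.coe_inj]
    simp only [linkedOne, h1, Finset.image_nonempty]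
  linked N S h x hx y hy _ _ := ⟨0, by rw [(linkedOne_ne_zero h).1]; exact ⟨hx, hy⟩⟩
  dlinked := by
    have h1 : theta dimParity 1 (linkedOne (k := k)) = linkedOne := by
      rw [theta_of_parity dimParity linkedOne_hasDeg.parity]
      simp
    have h2 : dk (linkedOne (k := k)) = 0 := by
      rw [kdL_apply, kd, h1]
      simp only [Finset.univ_unique, Fin.default_eq_zero, Finset.sum_singleton]
      rw [linkedOne_kcomp _ bd_supp]
      have := kcomp_linkedOne (0 : Fin 1) (bd_supp (k := k))
      rw [this, sub_self]
    rw [h2]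
    exact fun N S h => absurd rfl h
  bounded := ⟨0, fun N S h => (linkedOne_hasDeg N S h).le⟩

variable (k) in
/-- The operad of linked kernels. -/
def linkedOperad : DGOperad k where
  obj r := linkedKern k r
  deg r a := linkedDeg k r a
  isInternal := linkedDeg_isInternal
  d r := dk.restrict fun _ hc => IsLinked.dk hc
  d_mem {r a x} hx := by
    have := HasDeg.dk (show HasDeg x.1 (a + 1 : ℕ) from hx)
    rwa [Nat.cast_add, Nat.cast_one, add_sub_cancel_right] at this
  -- The differential would have degree `-1`, but linked kernels have no entries of negative excess.
  d_zero {r x} hx := by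
    apply Subtype.ext
    funext N S
    by_contra h0
    have h1 := HasDeg.dk hx N S h0
    have h2 := (IsLinked.dk x.2).excess_nonneg h0
    simp at h1
    omega
  d_d x := Subtype.ext (dk_dk x.2.supp)
  act r σ :=
    { toFun := fun x => ⟨kact dimParity σ x.1, IsLinked.kact x.2 σ⟩
      map_add' := fun x y => Subtype.ext (by
        funext N S
        exact mul_add _ _ _)
      map_smul' := fun a x => Subtype.ext (by
        funext N S
        exact mul_left_comm _ _ _) }
  act_one x := Subtype.ext (kact_one dimParity x.1)
  act_mul σ τ x := Subtype.ext (kact_mul dimParity σ τ x.1)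
  act_mem {r a} σ {x} hx := HasDeg.kact (show HasDeg x.1 a from hx) σ
  act_d σ x := Subtype.ext (dk_kact σ x.1)
  one := ⟨linkedOne, linkedOne_isLinked⟩
  one_mem := linkedOne_hasDeg
  comp h i := LinearMap.mk₂ k
    (fun x y => ⟨kcomp dimParity h i x.1 y.1, IsLinked.kcomp h i x.2 y.2⟩)
    (fun x y z => Subtype.ext (kcomp_add_left dimParity h i x.1 y.1 z.1))
    (fun a x y => Subtype.ext (kcomp_smul_left dimParity h i a x.1 y.1))
    (fun x y z => Subtype.ext (kcomp_add_right dimParity h i x.1 y.1 z.1))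
    (fun a x y => Subtype.ext (kcomp_smul_right dimParity h i a x.1 y.1))
  comp_mem {r s n a b} h i {x y} hx hy := by
    have := HasDeg.kcomp h i (show HasDeg x.1 a from hx) (show HasDeg y.1 b from hy)
    rwa [← Nat.cast_add] at this
  d_comp {r s n a} h i x y hx := by
    apply Subtype.ext
    refine (dk_kcomp h i x.2.supp y.2.supp).trans ?_
    rw [theta_of_parity dimParity (HasDeg.parity hx), one_mul, Int.cast_natCast, sgn_natCast,
      kcomp_smul_left]
    rfl
  one_comp h y := Subtype.ext (linkedOne_kcomp h y.2.supp)
  comp_one h i x := Subtype.ext (kcomp_linkedOne i x.2.supp)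
  comp_assoc h₁ h₂ h₃ h₄ i j x y z :=
    Subtype.ext (kcomp_assoc dimParity h₁ h₂ h₃ h₄ i j x.1 y.2.supp.local z.1)
  comp_comm {r s t m l n a b} h₁ h₂ h₃ h₄ i j hij x {y z} hy hz := by
    apply Subtype.ext
    refine (kcomp_comm dimParity h₁ h₂ h₃ h₄ i j hij.ne x.1 y.1 (HasDeg.parity hz)).trans ?_
    rw [theta_of_parity dimParity (HasDeg.parity hy), Int.cast_natCast, Int.cast_natCast,
      ← Nat.cast_mul, sgn_natCast, kcomp_smul_right, mul_comm b a]
    rfl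
  act_comp h i σ τ ρ hρ x y := Subtype.ext (kact_kcomp dimParity h i σ τ ρ hρ x.1 y.1)

/-- The augmentation: the value on a single vertex. -/
def linkedAug (r : ℕ) : (linkedOperad k).obj r →ₗ[k] k where
  toFun x := x.1 {0} fun _ => {0}
  map_add' _ _ := rfl
  map_smul' _ _ := rfl

end Operad
end EInf

namespace EInf

/-! ### The augmentation -/

section Augmentation
variable {k : Type u} [CommRing k] {r s n : ℕ}

/-- The value of a kernel on a single vertex. -/
def aug (c : Kern k (Finset ℕ) r) : k := c {0} fun _ => {0}

theorem dimParity_singleton (x : ℕ) : dimParity {x} = 0 := by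
  simp [dimParity, one_add_one_eq_two, two_zmod]

/-- A single vertex has only one nonempty face, so the sum over intermediate faces has one relevant
term, and all dimensions in its sign are zero. -/
theorem aug_kcomp (h : n + 1 = r + s) (i : Fin r) {c : Kern k (Finset ℕ) r}
    {c' : Kern k (Finset ℕ) s} (hc' : Supp c') :
    aug (kcomp dimParity h i c c') = aug c * aug c' := by
  have h1 : outerFam h i (fun _ : Fin n => ({0} : Finset ℕ)) {0} = fun _ => {0} := by
    funext j; simp [outerFam]
  have h2 : innerFam h i (fun _ : Fin n => ({0} : Finset ℕ)) = fun _ => {0} := rfl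
  rw [aug, kcomp, Finset.sum_eq_single {0}]
  · simp only [h1, h2, dimParity_singleton, tot, pre, ite_self, Finset.sum_const_zero, mul_zero,
      sgn_zero, one_mul]
    rfl
  · intro t ht ht'
    by_cases h0 : c' t (innerFam h i fun _ => {0}) = 0
    · rw [h0, mul_zero]
    · exact absurd ((Finset.subset_singleton_iff.1 (Finset.mem_Iic.1 ht)).resolve_left
        (hc' _ _ h0).1.ne_empty) ht'
  · intro h0
    exact absurd (Finset.mem_Iic.2 le_rfl) h0

theorem aug_kact (σ : Equiv.Perm (Fin r)) (c : Kern k (Finset ℕ) r) :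
    aug (kact dimParity σ c) = aug c := by
  have h1 : kos σ (dimParity ∘ fun _ : Fin r => ({0} : Finset ℕ)) = 0 := by
    simp [kos, dimParity_singleton]
  rw [aug, kact, h1, sgn_zero, one_mul]
  rfl

/-- Deleting the only vertex leaves the empty set, where kernels vanish, and there is no vertex left
that could be added to an input. -/
theorem aug_dk {c : Kern k (Finset ℕ) r} (hc : Supp c) : aug (dk c) = 0 := by
  rw [aug, kdL_apply, kd, Pi.sub_apply, Pi.sub_apply, bd_kcomp _ hc, Finset.sum_apply,
    Finset.sum_apply]
  have h1 : ∀ S, c ∅ S = 0 := fun S => by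
    by_contra h0
    exact absurd (hc _ _ h0).1 (by simp)
  simp [kcomp_bd _ (hc.theta 1), h1]

theorem aug_of_hasDeg {c : Kern k (Finset ℕ) r} {a : ℤ} (hc : HasDeg c a) (ha : a ≠ 0) :
    aug c = 0 := by
  by_contra h0
  exact ha ((hc _ _ h0).symm.trans (by simp [excess]))

theorem aug_linkedOne : aug (linkedOne (k := k)) = 1 := by simp [aug, linkedOne]

/-- The kernel of the operation without arguments, the unit cochain. -/
def unitKern : Kern k (Finset ℕ) 0 := fun N _ => if N.card = 1 then 1 else 0

theorem unitKern_ne_zero {N : Finset ℕ} {S : Fin 0 → Finset ℕ}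
    (h : unitKern (k := k) N S ≠ 0) : N.card = 1 := by
  by_contra h1
  exact h (if_neg h1)

theorem unitKern_supp : Supp (unitKern (k := k)) := fun N S h => by
  refine ⟨Finset.card_pos.1 ?_, fun j => j.elim0⟩
  rw [unitKern_ne_zero h]; exact one_pos

theorem unitKern_hasDeg : HasDeg (unitKern (k := k)) 0 := fun N S h => by
  simp [excess, unitKern_ne_zero h]

theorem card_eq_one_of_linked {N : Finset ℕ} {S : Fin 0 → Finset ℕ} (hN : N.Nonempty)
    (h : Linked N S) : N.card = 1 := by
  have := excess_nonneg hN (fun j => j.elim0) h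
  simp only [excess, Finset.univ_eq_empty, Finset.sum_empty] at this
  have := Finset.card_pos.2 hN
  omega

/-- The unit is the constant function `1` on vertices. Its coboundary can be nonzero only on edges,
where it is `1 - 1`. -/
theorem dk_unitKern : dk (unitKern (k := k)) = 0 := by
  funext N S
  rw [kdL_apply, kd, Finset.univ_eq_empty, Finset.sum_empty, sub_zero, bd_kcomp _ unitKern_supp]
  by_cases hN : N.card = 2
  · obtain ⟨x, y, hxy, rfl⟩ := Finset.card_eq_two.1 hN
    wlog h : x < y generalizing x y
    · have := this y x hxy.symm (by rw [Finset.pair_comm]; exact hN)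
        (lt_of_le_of_ne (not_lt.1 h) hxy.symm)
      rwa [Finset.pair_comm]
    have h1 : (({x, y} : Finset ℕ).filter (· < x)) = ∅ := by
      ext z; simp only [Finset.mem_filter, Finset.mem_insert, Finset.mem_singleton]; grind
    have h2 : (({x, y} : Finset ℕ).filter (· < y)) = {x} := by
      ext z; simp only [Finset.mem_filter, Finset.mem_insert, Finset.mem_singleton]; grind
    have h3 : ({x, y} : Finset ℕ).erase x = {y} := by grind
    have h4 : ({x, y} : Finset ℕ).erase y = {x} := by grind
    rw [Finset.sum_pair hxy, h1, h2, h3, h4]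
    simp [unitKern]
  · refine Finset.sum_eq_zero fun x hx => ?_
    rw [unitKern, if_neg, mul_zero]
    rw [Finset.card_erase_of_mem hx]
    omega

theorem unitKern_isLinked : IsLinked (unitKern (k := k)) where
  supp := unitKern_supp
  natural N S φ hφ hS := by
    simp only [unitKern, Finset.card_image_of_injOn hφ.injOn]
  linked N S h x hx y hy hxy _ := by
    have := Finset.card_le_one.1 (unitKern_ne_zero h).le x hx y hy
    omega
  dlinked := by rw [dk_unitKern]; exact fun N S h => absurd rfl h
  bounded := ⟨0, fun N S h => (unitKern_hasDeg N S h).le⟩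

theorem aug_unitKern : aug (unitKern (k := k)) = 1 := by simp [aug, unitKern]

theorem Natural.singleton {c : Kern k (Finset ℕ) r} (hc : Natural c) (x : ℕ) :
    c {x} (fun _ => {x}) = aug c := by
  have := hc {0} (fun _ => {0}) (fun _ => x) (by simp) (fun _ => subset_rfl)
  simpa [aug] using this

/-- Without inputs the excess is minus the dimension of `N`, so linkedness leaves only single
vertices, and naturality makes the value independent of the vertex. The complex of arity zero is
therefore `k`, in degree zero. -/
theorem eq_smul_unitKern {c : Kern k (Finset ℕ) 0} (hs : Supp c) (hn : Natural c)
    (hl : LinkedSupp c) : c = aug c • unitKern := by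
  funext N S
  by_cases h : c N S = 0
  · by_cases hN : N.card = 1
    · obtain ⟨x, rfl⟩ := Finset.card_eq_one.1 hN
      rw [Subsingleton.elim S fun _ => {x}] at h ⊢
      rw [h, ← hn.singleton x, h, zero_smul]; rfl
    · rw [h]; simp [unitKern, hN]
  · have hN := card_eq_one_of_linked (hs N S h).1 (hl N S h)
    obtain ⟨x, rfl⟩ := Finset.card_eq_one.1 hN
    rw [Subsingleton.elim S fun _ => {x}, hn.singleton]
    simp [unitKern]

end Augmentation
end EInf

namespace EInf

/-! ### Functions on words of finite sets -/

section Words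
variable {k : Type u} [CommRing k] {r : ℕ}

/-- Words in the subsets of `Fin r`. The letters of the word of a family `S` of subsets of a simplex
say to which members of the family the vertices belong. -/
abbrev Word (r : ℕ) := List (Finset (Fin r))

/-- The number of elements of `T` below `l`. -/
def below (T : Finset (Fin r)) (l : Fin r) : ℕ := (T.filter (· < l)).card

theorem below_insert {T : Finset (Fin r)} {j : Fin r} (hj : j ∉ T) (l : Fin r) :
    below (insert j T) l = below T l + if j < l then 1 else 0 := by
  rw [below, below, Finset.filter_insert]
  split_ifs with h
  · rw [Finset.card_insert_of_notMem (fun h => hj (Finset.mem_filter.1 h).1)]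
  · rfl

theorem below_insert_self (T : Finset (Fin r)) (j : Fin r) : below (insert j T) j = below T j := by
  rw [below, below, Finset.filter_insert, if_neg (lt_irrefl j)]

/-- Insertions of labels into a letter anticommute, as in an exterior algebra. -/
theorem below_anticomm {T : Finset (Fin r)} {j l : Fin r} (hj : j ∉ T) (hl : l ∉ T) (h : j ≠ l) :
    (-1 : k) ^ below T j * (-1) ^ below (insert j T) l =
      -((-1) ^ below T l * (-1) ^ below (insert l T) j) := by
  rw [below_insert hj, below_insert hl, pow_add, pow_add]
  rcases lt_or_gt_of_ne h with h | h
  · rw [if_pos h, if_neg h.not_gt]; ring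
  · rw [if_neg h.not_gt, if_pos h]; ring

theorem neg_one_pow_mul_self (n : ℕ) : (-1 : k) ^ n * (-1) ^ n = 1 := by
  rw [← mul_pow, neg_one_mul, neg_neg, one_pow]

/-- The differential on functions on words: sum over the insertions of a label into a letter and
the deletions of an empty letter. -/
def wd : (Word r → k) → Word r → k
  | _, [] => 0
  | c, T :: w => ∑ l ∈ Tᶜ, (-1) ^ below T l * c (insert l T :: w) - (if T = ∅ then c w else 0) +
      (-1) ^ (T.card + 1) * wd (fun w' => c (T :: w')) w

theorem wd_add (c c' : Word r → k) (w : Word r) : wd (c + c') w = wd c w + wd c' w := by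
  induction w generalizing c c' with
  | nil => simp [wd]
  | cons T w ih =>
    have := ih (fun w' => c (T :: w')) (fun w' => c' (T :: w'))
    rw [Pi.add_def] at this
    simp only [wd, Pi.add_apply, this, mul_add, Finset.sum_add_distrib]
    split_ifs <;> ring

theorem wd_smul (a : k) (c : Word r → k) (w : Word r) : wd (a • c) w = a * wd c w := by
  induction w generalizing c with
  | nil => simp [wd]
  | cons T w ih =>
    have := ih (fun w' => c (T :: w'))
    simp only [Pi.smul_def, smul_eq_mul] at this
    simp only [wd, Pi.smul_apply, smul_eq_mul, this, mul_left_comm _ a, ← Finset.mul_sum]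
    split_ifs <;> ring

/-- The differential as a linear map. -/
def wdL : (Word r → k) →ₗ[k] Word r → k where
  toFun := wd
  map_add' c c' := funext (wd_add c c')
  map_smul' a c := funext (wd_smul a c)

theorem wdL_apply (c : Word r → k) : wdL c = wd c := rfl

theorem wd_zero (w : Word r) : wd (0 : Word r → k) w = 0 := congrFun (wdL (k := k)).map_zero w

theorem wd_zero' (w : Word r) : wd (fun _ => (0 : k)) w = 0 := wd_zero w

theorem wd_ne_zero {c : Word r → k} {w : Word r} (h : wd c w ≠ 0) :
    ∃ w₁ T w₂, w = w₁ ++ T :: w₂ ∧ ((∃ l ∉ T, c (w₁ ++ insert l T :: w₂) ≠ 0) ∨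
      (T = ∅ ∧ c (w₁ ++ w₂) ≠ 0)) := by
  induction w generalizing c with
  | nil => exact absurd rfl h
  | cons T w ih =>
    by_cases h1 : wd (fun w' => c (T :: w')) w = 0
    · rw [wd, h1, mul_zero, add_zero] at h
      refine ⟨[], T, w, rfl, ?_⟩
      by_contra! h2
      apply h
      rw [Finset.sum_eq_zero, zero_sub, neg_eq_zero]
      · split_ifs with h3
        · exact h2.2 h3
        · rfl
      · intro l hl
        rw [show c (insert l T :: w) = 0 from h2.1 l (by simpa using hl), mul_zero]
    · obtain ⟨w₁, T', w₂, rfl, h2⟩ := ih h1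
      exact ⟨T :: w₁, T', w₂, rfl, h2⟩

/-- Consecutive letters meet. -/
abbrev Chain (w : Word r) : Prop := w.IsChain fun s t => (s ∩ t).Nonempty

/-- The prepending operator: the contraction of the differential attached to the label `j`. -/
def prep (j : Fin r) (c : Word r → k) : Word r → k
  | [] => 0
  -- An initial interval with label `j` is stripped off: its vertices carry the letter `{j}`, except
  -- the last one, which it shares with the next interval and where `j` is one of several labels.
  | T :: w => if j ∈ T then if T = {j} then prep j c w else (-1) ^ below T j * c (T.erase j :: w)
      else 0

theorem prep_singleton (j : Fin r) (c : Word r → k) (w : Word r) :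
    prep j c ({j} :: w) = prep j c w := by simp [prep]

theorem prep_of_notMem {j : Fin r} (c : Word r → k) {T : Finset (Fin r)} (w : Word r)
    (h : j ∉ T) : prep j c (T :: w) = 0 := by simp [prep, h]

theorem prep_insert {j : Fin r} (c : Word r → k) {X : Finset (Fin r)} (w : Word r)
    (hX : X.Nonempty) (hj : j ∉ X) :
    prep j c (insert j X :: w) = (-1) ^ below X j * c (X :: w) := by
  have h1 : insert j X ≠ {j} := by
    intro h
    obtain ⟨x, hx⟩ := hX
    have : x ∈ ({j} : Finset (Fin r)) := h ▸ Finset.mem_insert_of_mem hx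
    exact hj (Finset.mem_singleton.1 this ▸ hx)
  rw [prep, if_pos (Finset.mem_insert_self _ _), if_neg h1, Finset.erase_insert hj,
    below_insert_self]

theorem prep_add (j : Fin r) (c c' : Word r → k) (w : Word r) :
    prep j (c + c') w = prep j c w + prep j c' w := by
  induction w with
  | nil => simp [prep]
  | cons T w ih =>
    simp only [prep, ih, Pi.add_apply]
    split_ifs <;> ring

theorem prep_smul (j : Fin r) (a : k) (c : Word r → k) (w : Word r) :
    prep j (a • c) w = a * prep j c w := by
  induction w with
  | nil => simp [prep]
  | cons T w ih =>
    simp only [prep, ih, Pi.smul_apply, smul_eq_mul]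
    split_ifs <;> ring

theorem prep_ne_zero {j : Fin r} {c : Word r → k} {w : Word r} (h : prep j c w ≠ 0) :
    ∃ n X w', X.Nonempty ∧ j ∉ X ∧ w = List.replicate n {j} ++ insert j X :: w' ∧
      c (X :: w') ≠ 0 := by
  induction w with
  | nil => exact absurd rfl h
  | cons T w ih =>
    rw [prep] at h
    split_ifs at h with h1 h2
    · obtain ⟨n, X, w', hX, hj, rfl, hc⟩ := ih h
      exact ⟨n + 1, X, w', hX, hj, by rw [h2]; rfl, hc⟩
    · refine ⟨0, T.erase j, w, ?_, Finset.notMem_erase _ _, ?_, right_ne_zero_of_mul h⟩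
      · rw [Finset.nonempty_iff_ne_empty]
        intro h3
        apply h2
        rw [← Finset.insert_erase h1, h3]; rfl
      · rw [Finset.insert_erase h1]; rfl
    · exact absurd rfl h

theorem chain_replicate {j : Fin r} {w : Word r} {T : Finset (Fin r)} (hj : j ∈ T)
    (hw : Chain (T :: w)) (n : ℕ) : Chain (List.replicate n {j} ++ T :: w) := by
  have key : ∀ n, ∃ T' w', List.replicate n {j} ++ T :: w = T' :: w' ∧ j ∈ T' ∧ Chain (T' :: w') := by
    intro n
    induction n with
    | zero => exact ⟨T, w, rfl, hj, hw⟩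
    | succ n ih =>
      obtain ⟨T', w', h1, h2, h3⟩ := ih
      refine ⟨{j}, T' :: w', by rw [List.replicate_succ, List.cons_append, h1],
        Finset.mem_singleton_self j, List.isChain_cons_cons.2 ⟨⟨j, by simp [h2]⟩, h3⟩⟩
  obtain ⟨T', w', h1, -, h3⟩ := key n
  rw [h1]; exact h3

theorem chain_head_mono {X T : Finset (Fin r)} {w : Word r} (h : X ⊆ T) (hw : Chain (X :: w)) :
    Chain (T :: w) := by
  cases w with
  | nil => exact List.isChain_singleton _
  | cons Y w =>
    obtain ⟨h1, h2⟩ := List.isChain_cons_cons.1 hw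
    exact List.isChain_cons_cons.2 ⟨h1.mono (Finset.inter_subset_inter_right h), h2⟩

theorem prep_chain {j : Fin r} {c : Word r → k} (hc : ∀ w, c w ≠ 0 → Chain w) (w : Word r)
    (h : prep j c w ≠ 0) : Chain w := by
  obtain ⟨n, X, w', hX, hj, rfl, h1⟩ := prep_ne_zero h
  exact chain_replicate (Finset.mem_insert_self _ _)
    (chain_head_mono (Finset.subset_insert _ _) (hc _ h1)) n

/-- The function which is `1` on the nonempty words with all letters `{j}`. -/
def constW (k : Type u) [CommRing k] (j : Fin r) : Word r → k
  | [] => 0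
  | T :: w => if T = {j} then (if w = [] then 1 else constW k j w) else 0

/-- The homotopy formula for the prepending operators. -/
theorem wd_prep (j : Fin r) {c : Word r → k} (h1 : c [] = 0) (h2 : ∀ w, c (∅ :: w) = 0)
    (h3 : ∀ w, w ≠ [] → wd c (∅ :: w) = 0) (w : Word r) :
    wd (prep j c) w + prep j (wd c) w = c w - (∑ l, c [{l}]) * constW k j w := by
  induction w with
  | nil => simp [wd, prep, constW, h1]
  | cons T w ih =>
    by_cases hT : T = ∅
    · subst hT
      have h4 : (fun w' => prep j c (∅ :: w')) = fun _ => 0 :=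
        funext fun w' => prep_of_notMem c w' (Finset.notMem_empty j)
      rw [prep_of_notMem _ w (Finset.notMem_empty j), wd, h4, wd_zero', h2,
        Finset.sum_eq_single j]
      · simp [prep_singleton, constW, below]
      · intro l _ hl
        rw [prep_of_notMem, mul_zero]
        simpa using Ne.symm hl
      · simp
    by_cases hj : j ∈ T
    · obtain ⟨X, hX, rfl⟩ : ∃ X, j ∉ X ∧ T = insert j X :=
        ⟨T.erase j, Finset.notMem_erase _ _, (Finset.insert_erase hj).symm⟩
      rcases X.eq_empty_or_nonempty with rfl | hXn
      · -- the letter `{j}`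
        have h4 : (fun w' => prep j c ({j} :: w')) = prep j c :=
          funext fun w' => prep_singleton j c w'
        have h5 : ∀ l ∈ ({j} : Finset (Fin r))ᶜ, (-1 : k) ^ below {j} l * prep j c (insert l {j} :: w)
            = - c ({l} :: w) := by
          intro l hl
          have hl : j ≠ l := by simpa [eq_comm] using hl
          have h6 := below_anticomm (k := k) (Finset.notMem_empty j) (Finset.notMem_empty l) hl
          rw [Finset.pair_comm, prep_insert c w (Finset.singleton_nonempty l) (by simpa using hl)]
          simp only [below, Finset.filter_empty, Finset.card_empty, pow_zero, one_mul] at h6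
          change (-1 : k) ^ (Finset.filter (· < l) {j}).card = - (-1) ^ (Finset.filter (· < j) {l}).card at h6
          rw [below, below, h6, neg_mul, ← mul_assoc, neg_one_pow_mul_self, one_mul]
        rw [show insert j (∅ : Finset (Fin r)) = {j} from rfl, prep_singleton, wd, h4,
          if_neg (Finset.singleton_ne_empty j), sub_zero, Finset.card_singleton, neg_one_sq, one_mul,
          add_assoc, ih, Finset.sum_congr rfl h5, Finset.sum_neg_distrib, constW, if_pos rfl]
        have h6 : ∑ l, c ({l} :: w) = c ({j} :: w) + ∑ l ∈ ({j} : Finset (Fin r))ᶜ, c ({l} :: w) := by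
          rw [← Finset.sum_add_sum_compl {j}, Finset.sum_singleton]
        split_ifs with h7
        · subst h7
          rw [h1, h6, constW]
          ring
        · have h8 := h3 w h7
          have h9 : (fun w' => c (∅ :: w')) = fun _ => 0 := funext h2
          rw [wd, h9, wd_zero'] at h8
          simp only [Finset.compl_empty, below, Finset.filter_empty, Finset.card_empty, pow_zero,
            one_mul, if_true, mul_zero, add_zero, insert_empty_eq] at h8
          linear_combination -h8 + h6
      · have h4 : (fun w' => prep j c (insert j X :: w')) =
            (-1 : k) ^ below X j • fun w' => c (X :: w') :=
          funext fun w' => prep_insert c w' hXn hX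
        have h5 : insert j X ≠ {j} := by
          intro h
          obtain ⟨x, hx⟩ := hXn
          have : x ∈ ({j} : Finset (Fin r)) := h ▸ Finset.mem_insert_of_mem hx
          exact hX (Finset.mem_singleton.1 this ▸ hx)
        have h6 : ∑ l ∈ Xᶜ, (-1 : k) ^ below X l * c (insert l X :: w) =
            (-1) ^ below X j * c (insert j X :: w) +
              ∑ l ∈ (insert j X)ᶜ, (-1 : k) ^ below X l * c (insert l X :: w) := by
          rw [Finset.compl_insert]
          exact (Finset.add_sum_erase Xᶜ (fun l => (-1 : k) ^ below X l * c (insert l X :: w))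
            (by simpa using hX)).symm
        have h7 : ∀ l ∈ (insert j X)ᶜ, (-1 : k) ^ below (insert j X) l *
            prep j c (insert l (insert j X) :: w) =
            - ((-1) ^ below X j * ((-1) ^ below X l * c (insert l X :: w))) := by
          intro l hl
          have hl' : l ≠ j ∧ l ∉ X := by simpa using hl
          rw [Finset.insert_comm, prep_insert c w (Finset.insert_nonempty _ _)
            (by simp [hl'.1.symm, hX])]
          have h8 := below_anticomm (k := k) hX hl'.2 hl'.1.symm
          have h9 := neg_one_pow_mul_self (k := k) (below (insert l X) j)
          have h10 := neg_one_pow_mul_self (k := k) (below X j)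
          linear_combination ((-1) ^ below X j * (-1) ^ below (insert l X) j * c (insert l X :: w)) * h8
            - (-1) ^ below (insert j X) l * (-1) ^ below (insert l X) j * c (insert l X :: w) * h10
            - (-1) ^ below X j * (-1) ^ below X l * c (insert l X :: w) * h9
        rw [prep_insert _ w hXn hX, wd, h4, wd_smul, wd, if_neg hXn.ne_empty,
          if_neg (Finset.insert_ne_empty _ _), Finset.sum_congr rfl h7, h6, constW, if_neg h5,
          Finset.card_insert_of_notMem hX, Finset.sum_neg_distrib, ← Finset.mul_sum]
        have h10 := neg_one_pow_mul_self (k := k) (below X j)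
        linear_combination c (insert j X :: w) * h10
    · have h4 : (fun w' => prep j c (T :: w')) = fun _ => 0 :=
        funext fun w' => prep_of_notMem c w' hj
      have h5 : T ≠ {j} := by rintro rfl; simp at hj
      rw [prep_of_notMem _ w hj, wd, h4, wd_zero', if_neg hT, constW, if_neg h5,
        Finset.sum_eq_single j, prep_insert c w (Finset.nonempty_iff_ne_empty.2 hT) hj,
        ← mul_assoc, neg_one_pow_mul_self]
      · ring
      · intro l _ hl
        rw [prep_of_notMem, mul_zero]
        simp [Ne.symm hl, hj]
      · intro h; exact absurd (by simpa using hj) h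

end Words
end EInf

namespace EInf

/-! ### Functions supported on chains and their basis -/

section Good
variable {k : Type u} [CommRing k] {r : ℕ}

/-- The functions on words which are, together with their differential, supported on chains. -/
structure Good (c : Word r → k) : Prop where
  nil : c [] = 0
  empty : c [∅] = 0
  chain : ∀ w, c w ≠ 0 → Chain w
  dchain : ∀ w, wd c w ≠ 0 → Chain w

theorem Good.eq_zero_of_not_chain {c : Word r → k} (hc : Good c) {w : Word r} (hw : ¬ Chain w) :
    c w = 0 := by_contra fun h => hw (hc.chain w h)

theorem Good.wd_eq_zero_of_not_chain {c : Word r → k} (hc : Good c) {w : Word r}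
    (hw : ¬ Chain w) : wd c w = 0 := by_contra fun h => hw (hc.dchain w h)

theorem not_chain_of_disjoint {S T : Finset (Fin r)} (h : S ∩ T = ∅) (w : Word r) :
    ¬ Chain (S :: T :: w) := fun h1 => (List.isChain_cons_cons.1 h1).1.ne_empty h

theorem not_chain_tail {T : Finset (Fin r)} {w : Word r} (h : ¬ Chain w) : ¬ Chain (T :: w) :=
  fun h1 => h h1.tail

theorem Good.cons_empty {c : Word r → k} (hc : Good c) (w : Word r) : c (∅ :: w) = 0 := by
  cases w with
  | nil => exact hc.empty
  | cons T w => exact hc.eq_zero_of_not_chain (not_chain_of_disjoint (Finset.empty_inter T) w)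

theorem Good.wd_cons_empty {c : Word r → k} (hc : Good c) {w : Word r} (hw : w ≠ []) :
    wd c (∅ :: w) = 0 := by
  cases w with
  | nil => exact absurd rfl hw
  | cons T w =>
    exact hc.wd_eq_zero_of_not_chain (not_chain_of_disjoint (Finset.empty_inter T) w)

theorem Good.wd_prep {c : Word r → k} (hc : Good c) (j : Fin r) (w : Word r) :
    wd (prep j c) w = c w - (∑ l, c [{l}]) * constW k j w - prep j (wd c) w :=
  eq_sub_of_add_eq (EInf.wd_prep j hc.nil hc.cons_empty (fun _ => hc.wd_cons_empty) w)

theorem constW_ne_zero {j : Fin r} {w : Word r} (h : constW k j w ≠ 0) :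
    ∃ n, w = List.replicate (n + 1) {j} := by
  induction w with
  | nil => exact absurd rfl h
  | cons T w ih =>
    rw [constW] at h
    split_ifs at h with h1 h2
    · exact ⟨0, by rw [h1, h2]; rfl⟩
    · obtain ⟨n, hn⟩ := ih h
      exact ⟨n + 1, by rw [h1, hn]; rfl⟩
    · exact absurd rfl h

theorem constW_chain {j : Fin r} {w : Word r} (h : constW k j w ≠ 0) : Chain w := by
  obtain ⟨n, rfl⟩ := constW_ne_zero h
  have := chain_replicate (T := {j}) (w := []) (Finset.mem_singleton_self j)
    (List.isChain_singleton _) n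
  rwa [List.replicate_succ']

/-- The function which is `1` on the empty word. -/
def nilW (k : Type u) [CommRing k] (r : ℕ) : Word r → k
  | [] => 1
  | _ :: _ => 0

theorem wd_nilW (w : Word r) : wd (nilW k r) w = if w = [∅] then -1 else 0 := by
  cases w with
  | nil => simp [wd]
  | cons T w =>
    have h1 : (fun w' => nilW k r (T :: w')) = fun _ => 0 := rfl
    rw [wd, h1, wd_zero']
    cases w <;> by_cases hT : T = ∅ <;> simp [nilW, hT]

/-- Evaluating after a prefixed letter `{j}` turns `constW` into `constW + nilW`, and the
differentials of these two cancel. Only the insertion of `j` into the one-letter word `[∅]` remains.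
-/
theorem wd_constW (j : Fin r) (w : Word r) : wd (constW k j) w = if w = [∅] then 1 else 0 := by
  induction w with
  | nil => simp [wd]
  | cons T w ih =>
    by_cases hT : T = ∅
    · subst hT
      have h1 : (fun w' => constW k j (∅ :: w')) = fun _ => 0 := by
        funext w'; rw [constW, if_neg (Finset.singleton_ne_empty j).symm]
      rw [wd, h1, wd_zero', Finset.sum_eq_single j]
      · cases w <;> simp [constW, below]
      · intro l _ hl
        rw [constW, if_neg (by simpa using hl), mul_zero]
      · simp
    have h2 : ∑ l ∈ Tᶜ, (-1 : k) ^ below T l * constW k j (insert l T :: w) = 0 := by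
      refine Finset.sum_eq_zero fun l hl => ?_
      rw [constW, if_neg, mul_zero]
      intro h
      obtain ⟨x, hx⟩ := Finset.nonempty_iff_ne_empty.2 hT
      have h3 : x = j := by simpa [h] using Finset.mem_insert_of_mem (b := l) hx
      have h4 : l = j := by simpa [h] using Finset.mem_insert_self l T
      exact (Finset.mem_compl.1 hl) (h4 ▸ h3 ▸ hx)
    rw [wd, h2, if_neg hT, if_neg (by simp [hT])]
    by_cases hj : T = {j}
    · have h1 : (fun w' => constW k j (T :: w')) = constW k j + nilW k r := by
        funext w'
        rw [constW, if_pos hj]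
        cases w' <;> simp [constW, nilW]
      rw [h1, wd_add, ih, wd_nilW]
      split_ifs <;> simp
    · have h1 : (fun w' => constW k j (T :: w')) = fun _ => 0 := by
        funext w'; rw [constW, if_neg hj]
      rw [h1, wd_zero']; simp

theorem Good.constW (j : Fin r) : Good (constW k j) where
  nil := rfl
  empty := by rw [EInf.constW, if_neg (Finset.singleton_ne_empty j).symm]
  chain _ := constW_chain
  dchain w h := by
    rw [wd_constW] at h
    split_ifs at h with h1
    · rw [h1]; exact List.isChain_singleton _
    · exact absurd rfl h

/-- The homotopy formula expresses `wd (prep j c)` through `c`, `constW` and `prep j (wd c)`, all of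
which are supported on chains. -/
theorem Good.prep {c : Word r → k} (hc : Good c) (j : Fin r) : Good (prep j c) where
  nil := rfl
  empty := prep_of_notMem c [] (Finset.notMem_empty j)
  chain := prep_chain hc.chain
  dchain w h := by
    by_contra h1
    apply h
    rw [hc.wd_prep, hc.eq_zero_of_not_chain h1, (Good.constW j).eq_zero_of_not_chain h1,
      by_contra fun h2 => h1 (prep_chain hc.dchain w h2)]
    ring

theorem Good.zero : Good (0 : Word r → k) where
  nil := rfl
  empty := rfl
  chain _ h := absurd rfl h
  dchain w h := absurd (wd_zero w) h

theorem Good.add {c c' : Word r → k} (hc : Good c) (hc' : Good c') : Good (c + c') where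
  nil := by simp [hc.nil, hc'.nil]
  empty := by simp [hc.empty, hc'.empty]
  chain w h := by
    by_contra h1
    exact h (by simp [hc.eq_zero_of_not_chain h1, hc'.eq_zero_of_not_chain h1])
  dchain w h := by
    by_contra h1
    exact h (by simp [wd_add, hc.wd_eq_zero_of_not_chain h1, hc'.wd_eq_zero_of_not_chain h1])

theorem Good.smul (a : k) {c : Word r → k} (hc : Good c) : Good (a • c) where
  nil := by simp [hc.nil]
  empty := by simp [hc.empty]
  chain w h := hc.chain w (right_ne_zero_of_mul h)
  dchain w h := by
    rw [wd_smul] at h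
    exact hc.dchain w (right_ne_zero_of_mul h)

/-- The function is homogeneous of degree `M`. -/
def HomW (c : Word r → k) (M : ℕ) : Prop :=
  ∀ w, c w ≠ 0 → (w.map Finset.card).sum = w.length + M

theorem HomW.constW (j : Fin r) : HomW (constW k j) 0 := fun w h => by
  obtain ⟨n, rfl⟩ := constW_ne_zero h
  simp

theorem HomW.prep {c : Word r → k} {M : ℕ} (hc : HomW c M) (j : Fin r) :
    HomW (prep j c) (M + 1) := fun w h => by
  obtain ⟨n, X, w', -, hj, rfl, h1⟩ := prep_ne_zero h
  have := hc _ h1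
  simp only [List.map_cons, List.sum_cons, List.length_cons] at this
  simp [Finset.card_insert_of_notMem hj]
  omega

/-! #### The basis of cut functions -/

/-- The indicator function, up to signs, of the words which come from the subdivisions of a simplex
into consecutive intervals with given labels. -/
def cutW (k : Type u) [CommRing k] : List (Fin r) → Word r → k
  | [] => 0
  | [j] => constW k j
  | j :: l :: u => prep j (cutW k (l :: u))

/-- The shortest word with given labels of the intervals. -/
def genW : List (Fin r) → Word r
  | [] => []
  | [j] => [{j}]
  | j :: l :: u => {j} :: insert j {l} :: genW (l :: u)

theorem genW_cons (j : Fin r) (u : List (Fin r)) : ∃ w, genW (j :: u) = {j} :: w := by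
  cases u with
  | nil => exact ⟨_, rfl⟩
  | cons l u => exact ⟨_, rfl⟩

theorem Good.cutW (u : List (Fin r)) : Good (cutW k u) := by
  induction u with
  | nil => exact Good.zero
  | cons j u ih =>
    cases u with
    | nil => exact Good.constW j
    | cons l u => exact ih.prep j

theorem HomW.cutW (j : Fin r) (u : List (Fin r)) : HomW (cutW k (j :: u)) u.length := by
  induction u generalizing j with
  | nil => exact HomW.constW j
  | cons l u ih => exact (ih l).prep j

/-- The word `∅ :: w` is not a chain, so the differential vanishes there. It consists of the
insertions into the empty letter minus the deletion of that letter. -/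
theorem Good.eq_sum {c : Word r → k} (hc : Good c) {w : Word r} (hw : w ≠ []) :
    c w = ∑ l, c ({l} :: w) := by
  have h := hc.wd_cons_empty hw
  have h9 : (fun w' => c (∅ :: w')) = fun _ => 0 := funext hc.cons_empty
  rw [wd, h9, wd_zero'] at h
  simp only [Finset.compl_empty, below, Finset.filter_empty, Finset.card_empty, pow_zero,
    one_mul, if_true, mul_zero, add_zero, insert_empty_eq] at h
  exact (sub_eq_zero.1 h).symm

theorem Good.double {c : Word r → k} (hc : Good c) (j : Fin r) (w : Word r) :
    c ({j} :: {j} :: w) = c ({j} :: w) := by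
  rw [hc.eq_sum (w := {j} :: w) (by simp), Finset.sum_eq_single j]
  · intro l _ hl
    exact hc.eq_zero_of_not_chain (not_chain_of_disjoint (by simp [hl]) w)
  · simp

/-- This is `wd c = 0` at `{a} :: X :: w`, which is not a chain because its first two letters are
disjoint. A term can survive only if the inserted label repairs this: a label put into `{a}`, or `a`
put into `X`. -/
theorem Good.zigzag {c : Word r → k} (hc : Good c) {a : Fin r} {X : Finset (Fin r)} (ha : a ∉ X)
    (hX : X.Nonempty) (w : Word r) :
    ∑ l ∈ ({a} : Finset (Fin r))ᶜ, (-1) ^ below {a} l * c (insert l {a} :: X :: w) +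
      (-1) ^ below X a * c ({a} :: insert a X :: w) = 0 := by
  have h1 := hc.wd_eq_zero_of_not_chain (w := {a} :: X :: w)
    (not_chain_of_disjoint (by simp [ha]) w)
  have h2 : (fun w' => c ({a} :: X :: w')) = fun _ => 0 := funext fun w' =>
    hc.eq_zero_of_not_chain (not_chain_of_disjoint (by simp [ha]) w')
  rw [wd, wd, h2, wd_zero', if_neg (Finset.singleton_ne_empty a), if_neg hX.ne_empty,
    Finset.sum_eq_single_of_mem (s := Xᶜ) a (by simpa using ha)] at h1
  · simpa using h1
  · intro l hl hla
    rw [hc.eq_zero_of_not_chain (not_chain_of_disjoint _ w), mul_zero]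
    simp [ha, Ne.symm hla]

/-- In the zigzag relation with `X = {b}`, every term of the sum contains the disjoint neighbours
`{b}` and `Y`, so only the last term is left. -/
theorem Good.eq_zero_of_zigzag {c : Word r → k} (hc : Good c) {a b : Fin r} (hab : b ≠ a)
    {Y : Finset (Fin r)} (hb : b ∉ Y) (w : Word r) : c ({a} :: insert a {b} :: Y :: w) = 0 := by
  have h1 := hc.zigzag (a := a) (X := {b}) (by simpa using hab.symm) (Finset.singleton_nonempty b)
    (Y :: w)
  rw [Finset.sum_eq_zero, zero_add] at h1
  · rw [← one_mul (c _), ← neg_one_pow_mul_self (below {b} a), mul_assoc, h1, mul_zero]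
  · intro l _
    rw [hc.eq_zero_of_not_chain (not_chain_tail (not_chain_of_disjoint (by simp [hb]) w)),
      mul_zero]

/-- The function which describes the values of `c` on the words starting with the label `j`. -/
def extr (j : Fin r) (c : Word r → k) : Word r → k
  | [] => 0
  | T :: w => ∑ l ∈ ({j} : Finset (Fin r))ᶜ,
      (-1) ^ below {j} l * c ({j} :: insert l {j} :: T :: w)

theorem extr_ne_zero {j : Fin r} {c : Word r → k} {w : Word r} (h : extr j c w ≠ 0) :
    ∃ l, l ≠ j ∧ c ({j} :: insert l {j} :: w) ≠ 0 := by
  cases w with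
  | nil => exact absurd rfl h
  | cons T w =>
    obtain ⟨l, hl, h1⟩ := Finset.exists_ne_zero_of_sum_ne_zero h
    exact ⟨l, by simpa using hl, right_ne_zero_of_mul h1⟩

/-- Up to sign, `extr j` removes an initial interval with label `j`, in the opposite direction to
`prep j`. It inherits the chain conditions because the words at which `c` is evaluated end with the
given word. -/
theorem Good.extr {c : Word r → k} (hc : Good c) (j : Fin r) : Good (extr j c) where
  nil := rfl
  empty := by
    by_contra h
    obtain ⟨l, -, h1⟩ := extr_ne_zero h
    exact not_chain_tail (not_chain_of_disjoint (Finset.inter_empty _) _) (hc.chain _ h1)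
  chain w h := by
    obtain ⟨l, -, h1⟩ := extr_ne_zero h
    exact (hc.chain _ h1).tail.tail
  dchain w h := by
    by_contra hw
    apply h
    -- The value of `extr` at the empty word is set to zero, whereas the sum of shifted functions
    -- need not vanish there. The correction by a multiple of `nilW` affects the differential only
    -- at `[∅]`, which is a chain.
    have h1 : EInf.extr j c = ∑ l ∈ ({j} : Finset (Fin r))ᶜ,
        ((-1 : k) ^ below {j} l • fun w => c ({j} :: insert l {j} :: w)) -
        (∑ l ∈ ({j} : Finset (Fin r))ᶜ,
          (-1 : k) ^ below {j} l * c ({j} :: insert l {j} :: [])) • nilW k r := by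
      funext w
      rw [Pi.sub_apply, Finset.sum_apply]
      cases w <;> simp [EInf.extr, nilW]
    have h2 : w ≠ [∅] := by rintro rfl; exact hw (List.isChain_singleton _)
    rw [h1, ← wdL_apply, map_sub, map_sum, map_smul, Pi.sub_apply, Finset.sum_apply,
      Pi.smul_apply, wdL_apply (nilW k r), wd_nilW, if_neg h2, smul_zero, sub_zero]
    refine Finset.sum_eq_zero fun l hl => ?_
    rw [map_smul, Pi.smul_apply, wdL_apply]
    have h3 := hc.wd_eq_zero_of_not_chain (w := {j} :: insert l {j} :: w)
      (not_chain_tail (not_chain_tail hw))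
    have h4 : ∀ S T, c (S :: T :: w) = 0 := fun S T =>
      hc.eq_zero_of_not_chain (not_chain_tail (not_chain_tail hw))
    rw [wd, wd] at h3
    simp only [h4, mul_zero, Finset.sum_const_zero, if_neg (Finset.singleton_ne_empty j),
      if_neg (Finset.insert_ne_empty _ _), sub_zero, zero_add] at h3
    have h5 : wd (fun w' => c ({j} :: insert l {j} :: w')) w = 0 := by
      have h6 := neg_one_pow_mul_self (k := k) ((insert l ({j} : Finset (Fin r))).card)
      rw [Finset.card_singleton] at h3
      linear_combination -(-1) ^ (insert l ({j} : Finset (Fin r))).card * h3 -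
        wd (fun w' => c ({j} :: insert l {j} :: w')) w * h6
    rw [h5, smul_zero]

theorem HomW.extr {c : Word r → k} {M : ℕ} (hc : HomW c (M + 1)) (j : Fin r) :
    HomW (extr j c) M := fun w h => by
  obtain ⟨l, hl, h1⟩ := extr_ne_zero h
  have := hc _ h1
  simp only [List.map_cons, List.sum_cons, List.length_cons, Finset.card_singleton,
    Finset.card_pair hl] at this
  omega

/-- In the zigzag relation each term of the sum may be prefixed with `{j}`: by `Good.eq_sum` only
the prefixes `{j}` and `{l}` are possible, and the second gives zero by `Good.eq_zero_of_zigzag`.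
The sum is then `extr j c`. -/
theorem Good.cons_insert {c : Word r → k} (hc : Good c) {j : Fin r} {X : Finset (Fin r)}
    (hj : j ∉ X) (hX : X.Nonempty) (w : Word r) :
    c ({j} :: insert j X :: w) = - ((-1) ^ below X j * EInf.extr j c (X :: w)) := by
  have h1 := hc.zigzag hj hX w
  have h2 : ∀ l ∈ ({j} : Finset (Fin r))ᶜ, (-1) ^ below {j} l * c (insert l {j} :: X :: w) =
      (-1) ^ below {j} l * c ({j} :: insert l {j} :: X :: w) := by
    intro l hl
    have hl : l ≠ j := by simpa using hl
    rw [hc.eq_sum (w := insert l {j} :: X :: w) (by simp), Finset.sum_eq_single j]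
    · intro m _ hm
      by_cases hml : m = l
      · subst hml
        exact hc.eq_zero_of_zigzag hl.symm hj w
      · exact hc.eq_zero_of_not_chain (not_chain_of_disjoint (by simp [hm, hml]) _)
    · simp
  rw [Finset.sum_congr rfl h2] at h1
  change EInf.extr j c (X :: w) + _ = 0 at h1
  have h3 := neg_one_pow_mul_self (k := k) (below X j)
  linear_combination (-1) ^ below X j * h1 - c ({j} :: insert j X :: w) * h3

theorem Good.nonempty_of_mem {c : Word r → k} (hc : Good c) {w : Word r} (h : c w ≠ 0) :
    ∀ T ∈ w, T.Nonempty := by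
  have key : ∀ w : Word r, w ≠ [∅] → Chain w → ∀ T ∈ w, T.Nonempty := by
    intro w
    induction w with
    | nil => simp
    | cons S w ih =>
      intro h1 h2 T hT
      cases w with
      | nil =>
        rw [List.mem_singleton.1 hT, Finset.nonempty_iff_ne_empty]
        rintro rfl; exact h1 rfl
      | cons U w =>
        obtain ⟨h3, h4⟩ := List.isChain_cons_cons.1 h2
        rcases List.mem_cons.1 hT with rfl | hT
        · exact h3.mono Finset.inter_subset_left
        · refine ih ?_ h4 T hT
          intro h5
          rw [(List.cons.inj h5).1, Finset.inter_empty] at h3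
          exact absurd h3 (by simp)
  exact key w (by rintro rfl; exact h hc.empty) (hc.chain w h)

theorem length_le_sum_card {w : Word r} (h : ∀ T ∈ w, T.Nonempty) :
    w.length ≤ (w.map Finset.card).sum := by
  induction w with
  | nil => simp
  | cons T w ih =>
    have h1 := ih fun T hT => h T (List.mem_cons_of_mem _ hT)
    have h2 := (h T List.mem_cons_self).card_pos
    simp only [List.length_cons, List.map_cons, List.sum_cons]
    omega

/-- By `Good.eq_sum` it suffices to treat words with a singleton as first letter. Repeated letters
`{j}` can be dropped until the word ends or the label `j` meets a larger letter. -/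
theorem Good.eq_zero_of_cons {c : Word r → k} (hc : Good c) (h1 : ∀ j, c [{j}] = 0)
    (h2 : ∀ j X w, j ∉ X → X.Nonempty → c ({j} :: insert j X :: w) = 0) : c = 0 := by
  have key : ∀ j w, c ({j} :: w) = 0 := by
    intro j w
    induction w with
    | nil => exact h1 j
    | cons T w ih =>
      by_cases hj : j ∈ T
      · obtain ⟨X, hX, rfl⟩ : ∃ X, j ∉ X ∧ T = insert j X :=
          ⟨T.erase j, Finset.notMem_erase _ _, (Finset.insert_erase hj).symm⟩
        rcases X.eq_empty_or_nonempty with rfl | hXn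
        · rw [insert_empty_eq, hc.double, ih]
        · exact h2 j X w hX hXn
      · exact hc.eq_zero_of_not_chain (not_chain_of_disjoint (by simp [hj]) w)
  funext w
  cases w with
  | nil => exact hc.nil
  | cons T w =>
    rw [hc.eq_sum (by simp), Finset.sum_eq_zero fun l _ => key l _]; rfl

/-- A function which is supported on chains together with its differential is determined by its
values on the shortest words. -/
theorem Good.eq_zero_of_genW {M : ℕ} {c : Word r → k} (hc : Good c) (hM : HomW c M)
    (h : ∀ u : List (Fin r), u.length = M + 1 → u.IsChain (· ≠ ·) → c (genW u) = 0) : c = 0 := by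
  induction M generalizing c with
  | zero =>
    refine hc.eq_zero_of_cons (fun j => h [j] rfl (List.isChain_singleton _)) fun j X w hj hX => ?_
    by_contra h0
    have h1 := hM _ h0
    have h2 := length_le_sum_card (w := w) fun T hT => hc.nonempty_of_mem h0 T (by simp [hT])
    have h3 := hX.card_pos
    simp only [List.map_cons, List.sum_cons, List.length_cons, Finset.card_singleton,
      Finset.card_insert_of_notMem hj] at h1
    omega
  | succ M ih =>
    -- The operator `extr j` lowers the degree by one. Its value at `genW (l :: u)` is, up to sign,
    -- the value of `c` at `genW (j :: l :: u)` if `l ≠ j`, and it vanishes by the zigzag relation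
    -- if `l = j`.
    have h1 : ∀ j, EInf.extr j c = 0 := by
      intro j
      refine ih (hc.extr j) (hM.extr j) fun u hu hu' => ?_
      cases u with
      | nil => simp at hu
      | cons l u =>
        obtain ⟨w, hw⟩ := genW_cons l u
        by_cases hlj : l = j
        · subst hlj
          rw [hw]
          refine Finset.sum_eq_zero fun m hm => ?_
          have hm : m ≠ l := by simpa using hm
          rw [Finset.pair_comm, hc.eq_zero_of_zigzag hm (by simpa using hm), mul_zero]
        · rw [hw]
          refine (Finset.sum_eq_single l ?_ ?_).trans ?_
          · intro m hm hml
            rw [hc.eq_zero_of_not_chain, mul_zero]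
            exact not_chain_tail (not_chain_of_disjoint (by simp [Ne.symm hml, hlj]) _)
          · intro hl
            exact absurd (by simpa using hlj) hl
          · have := h (j :: l :: u) (by simpa using hu)
              (List.isChain_cons_cons.2 ⟨Ne.symm hlj, hu'⟩)
            rw [genW, hw, Finset.pair_comm] at this
            rw [this, mul_zero]
    refine hc.eq_zero_of_cons (fun j => ?_) fun j X w hj hX => ?_
    · by_contra h0
      have := hM _ h0
      simp at this
    · rw [hc.cons_insert hj hX, h1 j]; simp

/-- The value is a sign, but only its invertibility matters. Together with `cutW_genW_of_ne` this
makes the matrix of cut functions on shortest words diagonal with invertible entries. -/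
theorem cutW_genW_self (u : List (Fin r)) (hu : u.IsChain (· ≠ ·)) (hu' : u ≠ []) :
    cutW k u (genW u) * cutW k u (genW u) = 1 := by
  induction u with
  | nil => exact absurd rfl hu'
  | cons j u ih =>
    cases u with
    | nil => simp [cutW, genW, constW]
    | cons l u =>
      obtain ⟨h1, h2⟩ := List.isChain_cons_cons.1 hu
      obtain ⟨w, hw⟩ := genW_cons l u
      have h3 := ih h2 (by simp)
      rw [cutW, genW, prep_singleton, prep_insert _ _ (Finset.singleton_nonempty l)
        (by simpa using h1), hw, (Good.cutW (l :: u)).double, ← hw, mul_mul_mul_comm,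
        neg_one_pow_mul_self, one_mul, h3]

theorem cutW_genW_of_ne {u u' : List (Fin r)} (hl : u.length = u'.length)
    (hu' : u'.IsChain (· ≠ ·)) (h : u ≠ u') : cutW k u (genW u') = 0 := by
  induction u generalizing u' with
  | nil => exact absurd (List.eq_nil_of_length_eq_zero hl.symm).symm h
  | cons j u ih =>
    cases u with
    | nil =>
      obtain ⟨j', rfl⟩ := List.length_eq_one_iff.1 hl.symm
      have : ({j'} : Finset (Fin r)) ≠ {j} := by
        rw [Ne, Finset.singleton_inj]; rintro rfl; exact h rfl
      simp [cutW, genW, constW, this]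
    | cons l u =>
      match u', hl, hu', h with
      | j' :: l' :: u', hl, hu', h =>
        obtain ⟨h1, h2⟩ := List.isChain_cons_cons.1 hu'
        by_cases hj : j' = j
        · subst hj
          obtain ⟨w, hw⟩ := genW_cons l' u'
          rw [cutW, genW, prep_singleton, prep_insert _ _ (Finset.singleton_nonempty l')
            (by simpa using h1), hw, (Good.cutW (l :: u)).double, ← hw,
            ih (by simpa using hl) h2 (fun h3 => h (by rw [h3])), mul_zero]
        · rw [cutW, genW, prep_of_notMem _ _ (by simpa using Ne.symm hj)]

end Good
end EInf

/-! ### Words in which every label occurs -/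

namespace EInf

section Guarded
variable {k : Type u} [CommRing k] {r : ℕ}

/-- All labels occur in the word. -/
def Guarded (w : Word r) : Prop := ∀ j, ∃ T ∈ w, j ∈ T

/-- A label occurring in a single letter cannot be the common label of two neighbours, so dropping
it does not break a chain. -/
theorem chain_of_insert {l : Fin r} {T : Finset (Fin r)} {w₁ w₂ : Word r}
    (h : Chain (w₁ ++ insert l T :: w₂)) (hl : ∀ S ∈ w₁ ++ T :: w₂, l ∉ S) :
    Chain (w₁ ++ T :: w₂) := by
  have key : ∀ S : Finset (Fin r), l ∉ S → (S ∩ insert l T).Nonempty → (S ∩ T).Nonempty := by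
    intro S hS ⟨x, hx⟩
    obtain ⟨hx1, hx2⟩ := Finset.mem_inter.1 hx
    exact ⟨x, Finset.mem_inter.2 ⟨hx1, (Finset.mem_insert.1 hx2).resolve_left
      (by rintro rfl; exact hS hx1)⟩⟩
  unfold Chain at h ⊢
  rw [List.isChain_append] at h ⊢
  obtain ⟨h1, h2, h3⟩ := h
  refine ⟨h1, ?_, fun x hx y hy => ?_⟩
  · cases w₂ with
    | nil => exact List.isChain_singleton _
    | cons U w =>
      obtain ⟨h4, h5⟩ := List.isChain_cons_cons.1 h2
      rw [Finset.inter_comm] at h4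
      exact List.isChain_cons_cons.2 ⟨by
        rw [Finset.inter_comm]; exact key U (hl U (by simp)) h4, h5⟩
  · obtain rfl : T = y := by simpa using hy
    exact key x (hl x (List.mem_append_left _ (List.mem_of_mem_getLast? hx)))
      (h3 x hx _ (by simp))

/-- For functions supported on chains in which all labels occur, the differential has no values on
other words than chains unless all labels occur. -/
theorem chain_of_not_guarded {c : Word r → k} (h1 : ∀ w, c w ≠ 0 → Chain w)
    (h2 : ∀ w, c w ≠ 0 → Guarded w) {w : Word r} (h : wd c w ≠ 0) (hw : ¬ Guarded w) : Chain w := by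
  obtain ⟨w₁, T, w₂, rfl, ⟨l, hl, h3⟩ | ⟨hT, h3⟩⟩ := wd_ne_zero h
  · refine chain_of_insert (h1 _ h3) fun S hS hlS => hw fun j => ?_
    by_cases hj : j = l
    · exact ⟨S, hS, hj ▸ hlS⟩
    · obtain ⟨U, hU, hjU⟩ := h2 _ h3 j
      rw [List.mem_append, List.mem_cons] at hU
      rcases hU with hU | rfl | hU
      · exact ⟨U, by simp [hU], hjU⟩
      · exact ⟨T, by simp, (Finset.mem_insert.1 hjU).resolve_left hj⟩
      · exact ⟨U, by simp [hU], hjU⟩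
  · refine absurd (fun j => ?_) hw
    obtain ⟨U, hU, hjU⟩ := h2 _ h3 j
    rw [List.mem_append] at hU
    exact ⟨U, by rw [List.mem_append, List.mem_cons]; tauto, hjU⟩

theorem prep_mem {j : Fin r} {c : Word r → k} {w : Word r} (h : prep j c w ≠ 0) :
    ∃ w', c w' ≠ 0 ∧ ∀ i, (∃ T ∈ w, i ∈ T) ↔ i = j ∨ ∃ T ∈ w', i ∈ T := by
  obtain ⟨n, X, w', -, -, rfl, h1⟩ := prep_ne_zero h
  refine ⟨_, h1, fun i => ?_⟩
  constructor
  · rintro ⟨T, hT, hi⟩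
    rw [List.mem_append, List.mem_cons] at hT
    rcases hT with hT | rfl | hT
    · rw [List.eq_of_mem_replicate hT, Finset.mem_singleton] at hi
      exact Or.inl hi
    · exact (Finset.mem_insert.1 hi).imp_right fun hi => ⟨X, by simp, hi⟩
    · exact Or.inr ⟨T, by simp [hT], hi⟩
  · rintro (rfl | ⟨T, hT, hi⟩)
    · exact ⟨insert i X, by simp, Finset.mem_insert_self _ _⟩
    · rcases List.mem_cons.1 hT with rfl | hT
      · exact ⟨insert j T, by simp, Finset.mem_insert_of_mem hi⟩
      · exact ⟨T, by simp [hT], hi⟩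

theorem genW_mem (u : List (Fin r)) (i : Fin r) : (∃ T ∈ genW u, i ∈ T) ↔ i ∈ u := by
  induction u with
  | nil => simp [genW]
  | cons j u ih =>
    cases u with
    | nil => simp [genW]
    | cons l u =>
      simp only [genW, List.mem_cons, exists_eq_or_imp, Finset.mem_singleton, Finset.mem_insert]
      rw [ih, List.mem_cons]
      tauto

/-- The sequences of `n` labels without equal neighbours. -/
def labels (r n : ℕ) : Finset (List (Fin r)) :=
  (Finset.univ.image fun f : Fin n → Fin r => List.ofFn f).filter (List.IsChain (· ≠ ·))

theorem mem_labels {n : ℕ} {u : List (Fin r)} :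
    u ∈ labels r n ↔ u.length = n ∧ u.IsChain (· ≠ ·) := by
  rw [labels, Finset.mem_filter, Finset.mem_image]
  constructor
  · rintro ⟨⟨f, -, rfl⟩, h⟩; exact ⟨List.length_ofFn, h⟩
  · rintro ⟨rfl, h⟩; exact ⟨⟨u.get, Finset.mem_univ _, List.ofFn_get u⟩, h⟩

theorem homW_cutW_of_mem {M : ℕ} {u : List (Fin r)} (hu : u ∈ labels r (M + 1)) :
    HomW (cutW k u) M := by
  obtain ⟨h1, -⟩ := mem_labels.1 hu
  cases u with
  | nil => simp at h1
  | cons j u =>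
    have h2 : u.length = M := by simpa using h1
    exact h2 ▸ HomW.cutW j u

end Guarded
end EInf

namespace EInf

/-! ### Kernels as functions on words -/

section Transform
variable {k : Type u} [CommRing k] {r : ℕ}

/-- The quadratic part of the sign exponent which compares kernels and functions on words. -/
def crossing (p q : Σ _ : Fin r, ℕ) : ZMod 2 :=
  if (p.1 < q.1 ∧ p.2 ≤ q.2) ∨ (p.1 = q.1 ∧ p.2 < q.2) then 1 else 0

/-- The incidences of a family of sets of vertices. -/
def inc (S : Fin r → Finset ℕ) : Finset (Σ _ : Fin r, ℕ) := Finset.univ.sigma S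

theorem mem_inc {S : Fin r → Finset ℕ} {p : Σ _ : Fin r, ℕ} : p ∈ inc S ↔ p.2 ∈ S p.1 := by
  simp [inc]

/-- The sign exponent which compares kernels and functions on words. -/
def wsign (N : Finset ℕ) (S : Fin r → Finset ℕ) : ZMod 2 :=
  ∑ p ∈ inc S, (((N.filter (p.2 < ·)).card : ZMod 2) + ((p.1 : ℕ) : ZMod 2)) +
    ∑ p ∈ inc S, ∑ q ∈ inc S, crossing p q + ((N.card : ZMod 2) + 1) * (r + 1)

theorem inc_image (S : Fin r → Finset ℕ) (φ : ℕ → ℕ) :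
    inc (fun j => (S j).image φ) = (inc S).image fun p => ⟨p.1, φ p.2⟩ := by
  ext ⟨j, x⟩
  rw [mem_inc, Finset.mem_image, Finset.mem_image]
  constructor
  · rintro ⟨y, hy, rfl⟩; exact ⟨⟨j, y⟩, mem_inc.2 hy, rfl⟩
  · rintro ⟨⟨j', y⟩, hy, h⟩
    simp only [Sigma.mk.injEq, heq_eq_eq] at h
    obtain ⟨rfl, h⟩ := h
    exact ⟨y, mem_inc.1 hy, h⟩

theorem wsign_image {N : Finset ℕ} {S : Fin r → Finset ℕ} {φ : ℕ → ℕ} (hφ : StrictMonoOn φ N)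
    (hS : ∀ j, S j ⊆ N) : wsign (N.image φ) (fun j => (S j).image φ) = wsign N S := by
  have hmem : ∀ p ∈ inc S, p.2 ∈ N := fun p hp => hS _ (mem_inc.1 hp)
  have hinj : Set.InjOn (fun p : Σ _ : Fin r, ℕ => (⟨p.1, φ p.2⟩ : Σ _ : Fin r, ℕ)) (inc S) := by
    rintro ⟨j, x⟩ hp ⟨j', y⟩ hq h
    simp only [Sigma.mk.injEq, heq_eq_eq] at h
    obtain ⟨rfl, h⟩ := h
    rw [show x = y from hφ.injOn (hmem _ hp) (hmem _ hq) h]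
  have h1 : ∀ p ∈ inc S, ((N.image φ).filter (φ p.2 < ·)).card = (N.filter (p.2 < ·)).card := by
    intro p hp
    rw [Finset.filter_image, Finset.card_image_of_injOn
      (hφ.injOn.mono (Finset.coe_subset.2 (Finset.filter_subset _ _)))]
    congr 1
    exact Finset.filter_congr fun y hy => hφ.lt_iff_lt (hmem p hp) hy
  have h2 : ∀ p ∈ inc S, ∀ q ∈ inc S, crossing (⟨p.1, φ p.2⟩ : Σ _ : Fin r, ℕ) ⟨q.1, φ q.2⟩ =
      crossing p q := by
    intro p hp q hq
    simp only [crossing, hφ.lt_iff_lt (hmem p hp) (hmem q hq), hφ.le_iff_le (hmem p hp) (hmem q hq)]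
  rw [wsign, wsign, inc_image, Finset.sum_image hinj, Finset.sum_image hinj,
    Finset.card_image_of_injOn hφ.injOn]
  congr 2
  · exact Finset.sum_congr rfl fun p hp => by rw [h1 p hp]
  · refine Finset.sum_congr rfl fun p hp => ?_
    rw [Finset.sum_image hinj]
    exact Finset.sum_congr rfl fun q hq => h2 p hp q hq

theorem crossing_self (p : Σ _ : Fin r, ℕ) : crossing p p = 0 := by simp [crossing]

theorem inc_update {S : Fin r → Finset ℕ} (l : Fin r) (x : ℕ) :
    inc (Function.update S l (insert x (S l))) = insert ⟨l, x⟩ (inc S) := by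
  ext ⟨j, y⟩
  rw [mem_inc, Finset.mem_insert, mem_inc]
  by_cases hj : j = l
  · subst hj; simp
  · simp [hj]

theorem sum_inc {M : Type*} [AddCommMonoid M] (S : Fin r → Finset ℕ) (f : (Σ _ : Fin r, ℕ) → M) :
    ∑ p ∈ inc S, f p = ∑ j, ∑ x ∈ S j, f ⟨j, x⟩ := Finset.sum_sigma _ _ _

/-- The parity of the number of vertices and incidences at the vertices before `v`. -/
def pathSign (N : Finset ℕ) (S : Fin r → Finset ℕ) (v : ℕ) : ZMod 2 :=
  ((N.filter (· < v)).card : ZMod 2) + ∑ p ∈ inc S, if p.2 < v then 1 else 0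

/-- The left side collects the signs of the term of `dk` in which `v` is added to `S l`, the right
side those of the corresponding insertion in `wd`. The quadratic part of `wsign` is chosen so that
they agree. -/
theorem wsign_update {N : Finset ℕ} {S : Fin r → Finset ℕ} {l : Fin r} {v : ℕ} (hv : v ∈ N)
    (hvl : v ∉ S l) : wsign N S + pre dimParity l S + (((S l).filter (· < v)).card : ZMod 2) +
      (tot dimParity (Function.update S l (insert v (S l))) + dimParity N) + 1 +
      wsign N (Function.update S l (insert v (S l))) =
    r + pathSign N S v + ∑ p ∈ inc S, if p.2 = v ∧ p.1 < l then 1 else 0 := by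
  have hp : (⟨l, v⟩ : Σ _ : Fin r, ℕ) ∉ inc S := fun h => hvl (mem_inc.1 h)
  have hcard : (N.card : ZMod 2) = (N.filter (· < v)).card + 1 + (N.filter (v < ·)).card := by
    have h1 := Finset.card_filter_add_card_filter_not (s := N) (· < v)
    have h2 : N.filter (fun a => ¬ a < v) = insert v (N.filter (v < ·)) := by
      ext y; simp only [Finset.mem_filter, Finset.mem_insert]; grind
    rw [h2, Finset.card_insert_of_notMem (by simp)] at h1
    rw [← h1]; push_cast; ring
  have htot : tot dimParity (Function.update S l (insert v (S l))) =
      ∑ p ∈ inc S, (1 : ZMod 2) + 1 + r := by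
    have h1 : ∀ S : Fin r → Finset ℕ, tot dimParity S = ∑ p ∈ inc S, (1 : ZMod 2) + r := by
      intro S
      simp [tot, inc, dimParity, Finset.sum_add_distrib]
    rw [h1, inc_update, Finset.sum_insert hp]; ring
  have hpre : pre dimParity l S = (∑ p ∈ inc S, if p.1 < l then (1 : ZMod 2) else 0) + (l : ℕ) := by
    have h1 : ((l : ℕ) : ZMod 2) = ∑ j : Fin r, if j < l then 1 else 0 := by
      rw [Finset.sum_boole, show Finset.univ.filter (· < l) = Finset.Iio l by ext; simp, Fin.card_Iio]
    rw [h1, sum_inc, ← Finset.sum_add_distrib]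
    refine Finset.sum_congr rfl fun j _ => ?_
    by_cases h : j < l
    · have h' : (j : ℕ) < l := h
      simp [h, dimParity]
    · have h' : ¬ (j : ℕ) < l := h
      simp [h]
  have hbel : (((S l).filter (· < v)).card : ZMod 2) =
      ∑ p ∈ inc S, if p.1 = l ∧ p.2 < v then 1 else 0 := by
    rw [sum_inc, Finset.sum_eq_single l]
    · simp [Finset.sum_boole]
    · intro j _ hj; simp [hj]
    · simp
  -- The comparison is made separately for each existing incidence `q`: after all exponents are
  -- written as sums over incidences, the contributions of `q` cancel for every relative position of
  -- `q` and the new incidence.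
  have hpt : ∀ q ∈ inc S, crossing ⟨l, v⟩ q + crossing q ⟨l, v⟩ +
      (if q.1 = l ∧ q.2 < v then 1 else 0) + 1 + (if q.1 < l then 1 else 0) +
      (if q.2 < v then 1 else 0) + (if q.2 = v ∧ q.1 < l then 1 else 0) = (0 : ZMod 2) := by
    rintro ⟨j, y⟩ hq
    have hne : ¬ (j = l ∧ y = v) := by rintro ⟨rfl, rfl⟩; exact hp hq
    simp only [crossing]
    rcases lt_trichotomy j l with h | h | h
    · rcases lt_trichotomy y v with h' | h' | h'
      · simp [h, h', h.not_gt, h.ne, h.ne', h'.ne, h'.ne', h'.le, h'.not_gt]; decide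
      · subst h'; simp [h, h.not_gt, h.ne, h.ne']; decide
      · simp [h, h', h.not_gt, h.ne, h.ne', h'.ne, h'.ne', h'.le, h'.not_gt, h'.not_ge]; decide
    · subst h
      rcases lt_trichotomy y v with h' | h' | h'
      · simp [h', h'.not_gt]; decide
      · exact absurd ⟨rfl, h'⟩ hne
      · simp [h', h'.not_gt]; decide
    · rcases lt_trichotomy y v with h' | h' | h'
      · simp [h, h', h.not_gt, h.ne, h.ne', h'.not_ge]; decide
      · subst h'; simp [h, h.not_gt, h.ne, h.ne']; decide
      · simp [h, h', h.not_gt, h.ne, h.ne', h'.le, h'.not_gt]; decide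
  have hsum := Finset.sum_eq_zero hpt
  simp only [Finset.sum_add_distrib] at hsum
  have hs : wsign N (Function.update S l (insert v (S l))) = wsign N S +
      ((N.filter (v < ·)).card + (l : ℕ)) + ∑ q ∈ inc S, crossing ⟨l, v⟩ q +
        ∑ q ∈ inc S, crossing q ⟨l, v⟩ := by
    simp only [wsign, inc_update, Finset.sum_insert hp, crossing_self, Finset.sum_add_distrib]
    ring
  rw [hs, htot, hpre, hbel, pathSign, dimParity, hcard]
  linear_combination hsum + (wsign N S + (l : ℕ) + r + (N.filter (v < ·)).card + 2 -
    ∑ p ∈ inc S, (if p.2 < v then (1 : ZMod 2) else 0) -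
    ∑ p ∈ inc S, (if p.2 = v ∧ p.1 < l then (1 : ZMod 2) else 0) - r) * two_zmod

/-- The analogous comparison for a vertex in no member of the family: a face term of `dk` against
the deletion of an empty letter, whose minus sign is the summand `1`. -/
theorem wsign_erase {N : Finset ℕ} {S : Fin r → Finset ℕ} {v : ℕ} (hv : v ∈ N)
    (hS : ∀ j, v ∉ S j) : wsign N S + ((N.filter (· < v)).card : ZMod 2) =
      r + pathSign N S v + 1 + wsign (N.erase v) S := by
  have h1 : (N.card : ZMod 2) = (N.erase v).card + 1 := by
    rw [← Finset.card_erase_add_one hv]; push_cast; rfl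
  have h2 : ∀ p ∈ inc S, ((N.filter (p.2 < ·)).card : ZMod 2) =
      ((N.erase v).filter (p.2 < ·)).card + if p.2 < v then 1 else 0 := by
    intro p hp
    rw [show (N.erase v).filter (p.2 < ·) = (N.filter (p.2 < ·)).erase v by ext; simp only [Finset.mem_filter, Finset.mem_erase]; tauto]
    split_ifs with h
    · rw [← Finset.card_erase_add_one (Finset.mem_filter.2 ⟨hv, h⟩)]; push_cast; rfl
    · rw [Finset.erase_eq_of_notMem (by simp [h]), add_zero]
  rw [wsign, wsign, pathSign, Finset.sum_congr rfl fun p hp => by rw [h2 p hp], h1]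
  simp only [Finset.sum_add_distrib]
  ring

end Transform
end EInf

/-! ### Translation between families of faces and words -/

namespace EInf

section Transform
variable {k : Type u} [CommRing k] {r : ℕ}

/-- The vertices of the members of a family of faces which is described by a word. -/
def vert (w : Word r) : Fin r → Finset ℕ := fun j =>
  (Finset.range w.length).filter fun v => j ∈ w.getD v ∅

theorem mem_vert {w : Word r} {j : Fin r} {v : ℕ} : v ∈ vert w j ↔ j ∈ w.getD v ∅ := by
  rw [vert, Finset.mem_filter, Finset.mem_range, and_iff_right_of_imp]
  intro h
  by_contra h1
  rw [List.getD_eq_default _ _ (not_lt.1 h1)] at h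
  simp at h

theorem vert_subset (w : Word r) (j : Fin r) : vert w j ⊆ Finset.range w.length :=
  Finset.filter_subset _ _

/-- The word of a family of sets of vertices. -/
def word (N : Finset ℕ) (S : Fin r → Finset ℕ) : Word r :=
  N.sort.map fun v => Finset.univ.filter (v ∈ S ·)

theorem length_word (N : Finset ℕ) (S : Fin r → Finset ℕ) : (word N S).length = N.card := by
  rw [word, List.length_map, Finset.length_sort]

theorem word_range (w : Word r) : word (Finset.range w.length) (vert w) = w := by
  refine List.ext_getElem (by simp [length_word]) fun v h1 h2 => ?_
  simp only [word, Finset.sort_range, List.getElem_map, List.getElem_range]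
  ext j
  simp only [Finset.mem_filter, Finset.mem_univ, true_and, mem_vert]
  rw [List.getD_eq_getElem _ _ h2]

theorem sort_image {N : Finset ℕ} {φ : ℕ → ℕ} (hφ : StrictMonoOn φ N) :
    (N.image φ).sort = N.sort.map φ := by
  have h1 : N.image φ = (N.sort.map φ).toFinset := by ext; simp
  have h2 : (N.sort.map φ).Nodup := (N.sort_nodup (· ≤ ·)).map_on fun x hx y hy h =>
    hφ.injOn (by simpa using hx) (by simpa using hy) h
  rw [h1, List.toFinset_sort (· ≤ ·) h2, List.pairwise_map]
  exact (N.pairwise_sort (· ≤ ·)).imp_of_mem fun hx hy h =>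
    (hφ.le_iff_le (by simpa using hx) (by simpa using hy)).2 h

theorem mem_image_iff {N T : Finset ℕ} {φ : ℕ → ℕ} (hφ : StrictMonoOn φ N) (hT : T ⊆ N) {x : ℕ}
    (hx : x ∈ N) : φ x ∈ T.image φ ↔ x ∈ T := by
  refine ⟨fun h => ?_, Finset.mem_image_of_mem φ⟩
  obtain ⟨y, hy, h1⟩ := Finset.mem_image.1 h
  exact hφ.injOn (hT hy) hx h1 ▸ hy

theorem word_image {N : Finset ℕ} {S : Fin r → Finset ℕ} {φ : ℕ → ℕ} (hφ : StrictMonoOn φ N)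
    (hS : ∀ j, S j ⊆ N) : word (N.image φ) (fun j => (S j).image φ) = word N S := by
  rw [word, sort_image hφ, List.map_map, word]
  refine List.map_congr_left fun v hv => ?_
  have hv : v ∈ N := by simpa using hv
  ext j
  simp only [Function.comp_apply, Finset.mem_filter, Finset.mem_univ, true_and]
  exact mem_image_iff hφ (hS j) hv

/-- The increasing enumeration of a finite set. -/
def enum (N : Finset ℕ) (i : ℕ) : ℕ := N.sort.getD i 0

theorem enum_strictMonoOn (N : Finset ℕ) : StrictMonoOn (enum N) (Finset.range N.card) := by
  intro i hi j hj hij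
  have hi : i < N.sort.length := by simpa using hi
  have hj : j < N.sort.length := by simpa using hj
  rw [enum, enum, List.getD_eq_getElem _ _ hi, List.getD_eq_getElem _ _ hj]
  exact N.sortedLT_sort.getElem_lt_getElem_of_lt hij

theorem image_enum (N : Finset ℕ) : (Finset.range N.card).image (enum N) = N := by
  ext x
  rw [Finset.mem_image, ← Finset.mem_sort (· ≤ ·), List.mem_iff_getElem]
  constructor
  · rintro ⟨i, hi, rfl⟩
    have hi : i < N.sort.length := by simpa using hi
    exact ⟨i, hi, by rw [enum, List.getD_eq_getElem _ _ hi]⟩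
  · rintro ⟨i, hi, rfl⟩
    exact ⟨i, by simpa using hi, by rw [enum, List.getD_eq_getElem _ _ hi]⟩

theorem image_vert_word {N : Finset ℕ} {S : Fin r → Finset ℕ} {j : Fin r} (hS : S j ⊆ N) :
    (vert (word N S) j).image (enum N) = S j := by
  have h1 : ∀ i, (hi : i < N.sort.length) → (i ∈ vert (word N S) j ↔ N.sort[i] ∈ S j) := by
    intro i hi
    rw [mem_vert, List.getD_eq_getElem _ _ (by simpa [word] using hi)]
    simp [word]
  ext x
  rw [Finset.mem_image]
  constructor
  · rintro ⟨i, hi, rfl⟩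
    have hi' : i < N.sort.length := by
      have := vert_subset _ _ hi
      rwa [Finset.mem_range, length_word, ← Finset.length_sort (· ≤ ·)] at this
    rw [enum, List.getD_eq_getElem _ _ hi']
    exact (h1 i hi').1 hi
  · intro hx
    obtain ⟨i, hi, rfl⟩ := List.mem_iff_getElem.1 ((Finset.mem_sort (· ≤ ·)).2 (hS hx))
    exact ⟨i, (h1 i hi).2 hx, by rw [enum, List.getD_eq_getElem _ _ hi]⟩

/-- Every family of subsets is the image of the family of a word. -/
theorem eq_image_word {N : Finset ℕ} {S : Fin r → Finset ℕ} (hS : ∀ j, S j ⊆ N) :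
    ∃ (w : Word r) (φ : ℕ → ℕ), StrictMonoOn φ (Finset.range w.length) ∧
      N = (Finset.range w.length).image φ ∧ S = fun j => (vert w j).image φ := by
  refine ⟨word N S, enum N, ?_, ?_, funext fun j => (image_vert_word (hS j)).symm⟩
  · rw [length_word]; exact enum_strictMonoOn N
  · rw [length_word, image_enum]

theorem linked_image {N : Finset ℕ} {S : Fin r → Finset ℕ} {φ : ℕ → ℕ} (hφ : StrictMonoOn φ N)
    (hS : ∀ j, S j ⊆ N) :
    Linked (N.image φ) (fun j => (S j).image φ) ↔ Linked N S := by
  simp only [Linked, Finset.forall_mem_image]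
  refine forall₂_congr fun x hx => forall₂_congr fun y hy => ?_
  rw [hφ.lt_iff_lt hx hy]
  refine imp_congr_right fun _ => imp_congr (forall₂_congr fun z hz => ?_) (exists_congr fun j => ?_)
  · rw [hφ.lt_iff_lt hx hz, hφ.lt_iff_lt hz hy]
  · rw [mem_image_iff hφ (hS j) hx, mem_image_iff hφ (hS j) hy]

theorem linked_vert (w : Word r) : Linked (Finset.range w.length) (vert w) ↔ Chain w := by
  unfold Chain
  rw [List.isChain_iff_getElem]
  constructor
  · intro h i hi
    obtain ⟨j, h1, h2⟩ := h i (by simp; omega) (i + 1) (by simpa using hi) (by omega)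
      (fun z _ hz => by omega)
    rw [mem_vert, List.getD_eq_getElem _ _ (by omega)] at h1
    rw [mem_vert, List.getD_eq_getElem _ _ (by omega)] at h2
    exact ⟨j, Finset.mem_inter.2 ⟨h1, h2⟩⟩
  · intro h x hx y hy hxy hc
    obtain rfl : y = x + 1 := by
      by_contra hne
      exact hc (x + 1) (by simp at hy ⊢; omega) (by omega)
    have hy : x + 1 < w.length := by simpa using hy
    obtain ⟨j, hj⟩ := h x hy
    rw [Finset.mem_inter] at hj
    refine ⟨j, ?_, ?_⟩
    · rw [mem_vert, List.getD_eq_getElem _ _ (by omega)]; exact hj.1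
    · rw [mem_vert, List.getD_eq_getElem _ _ (by omega)]; exact hj.2

theorem linked_iff_chain {N : Finset ℕ} {S : Fin r → Finset ℕ} (hS : ∀ j, S j ⊆ N) :
    Linked N S ↔ Chain (word N S) := by
  obtain ⟨w, φ, hφ, rfl, rfl⟩ := eq_image_word hS
  rw [linked_image hφ (vert_subset _), linked_vert, word_image hφ (vert_subset _), word_range]

theorem guarded_iff {w : Word r} : Guarded w ↔ ∀ j, (vert w j).Nonempty := by
  refine forall_congr' fun j => ?_
  constructor
  · rintro ⟨T, hT, hj⟩
    obtain ⟨v, hv, rfl⟩ := List.mem_iff_getElem.1 hT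
    exact ⟨v, mem_vert.2 (by rwa [List.getD_eq_getElem _ _ hv])⟩
  · rintro ⟨v, hv⟩
    have h1 : v < w.length := by simpa using vert_subset _ _ hv
    rw [mem_vert, List.getD_eq_getElem _ _ h1] at hv
    exact ⟨_, List.getElem_mem h1, hv⟩

/-- The function on words of a kernel. -/
def toWord (c : Kern k (Finset ℕ) r) : Word r → k := fun w =>
  sgn k (wsign (Finset.range w.length) (vert w)) * c (Finset.range w.length) (vert w)

/-- The kernel of a function on words. -/
def ofWord (f : Word r → k) : Kern k (Finset ℕ) r := fun N S =>
  if N.Nonempty ∧ ∀ j, (S j).Nonempty ∧ S j ⊆ N then sgn k (wsign N S) * f (word N S) else 0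

theorem toWord_ofWord {f : Word r → k} {w : Word r} (hw : w ≠ []) (hg : Guarded w) :
    toWord (ofWord f) w = f w := by
  rw [toWord, ofWord, if_pos ⟨by simpa using hw, fun j => ⟨guarded_iff.1 hg j, vert_subset w j⟩⟩,
    ← mul_assoc, sgn_mul_self, one_mul, word_range]

theorem ofWord_ne_zero {f : Word r → k} {N : Finset ℕ} {S : Fin r → Finset ℕ}
    (h : ofWord f N S ≠ 0) : (N.Nonempty ∧ ∀ j, (S j).Nonempty ∧ S j ⊆ N) ∧ f (word N S) ≠ 0 := by
  unfold ofWord at h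
  split_ifs at h with h1
  · exact ⟨h1, right_ne_zero_of_mul h⟩
  · exact absurd rfl h

theorem ofWord_supp (f : Word r → k) : Supp (ofWord f) := fun _ _ h => (ofWord_ne_zero h).1

theorem ofWord_natural (f : Word r → k) : Natural (ofWord f) := by
  intro N S φ hφ hS
  have h1 : ∀ j, (S j).image φ ⊆ N.image φ := fun j => Finset.image_subset_image (hS j)
  simp only [ofWord, Finset.image_nonempty, h1, hS, wsign_image hφ hS, word_image hφ hS]

theorem toWord_word {c : Kern k (Finset ℕ) r} (hc : Natural c) {N : Finset ℕ}
    {S : Fin r → Finset ℕ} (hS : ∀ j, S j ⊆ N) :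
    toWord c (word N S) = sgn k (wsign N S) * c N S := by
  obtain ⟨w, φ, hφ, rfl, rfl⟩ := eq_image_word hS
  rw [wsign_image hφ (vert_subset _), hc _ _ φ hφ (vert_subset _), word_image hφ (vert_subset _),
    word_range]
  rfl

theorem eq_toWord {c : Kern k (Finset ℕ) r} (hc : Natural c) {N : Finset ℕ}
    {S : Fin r → Finset ℕ} (hS : ∀ j, S j ⊆ N) :
    c N S = sgn k (wsign N S) * toWord c (word N S) := by
  rw [toWord_word hc hS, ← mul_assoc, sgn_mul_self, one_mul]

/-- By naturality every entry can be moved to an initial segment of the natural numbers, where it is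
a value of `toWord`; the support condition restricts attention to nonempty words containing all
labels. -/
theorem ext_toWord {c c' : Kern k (Finset ℕ) r} (hc : Natural c) (hs : Supp c) (hc' : Natural c')
    (hs' : Supp c') (h : ∀ w, w ≠ [] → Guarded w → toWord c w = toWord c' w) : c = c' := by
  funext N S
  by_cases h1 : N.Nonempty ∧ ∀ j, (S j).Nonempty ∧ S j ⊆ N
  · rw [eq_toWord hc fun j => (h1.2 j).2, eq_toWord hc' fun j => (h1.2 j).2, h]
    · rw [← List.length_pos_iff, length_word]; exact h1.1.card_pos
    · rw [guarded_iff]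
      intro j
      rw [← Finset.image_nonempty (f := enum N), image_vert_word (h1.2 j).2]
      exact (h1.2 j).1
  · rw [not_imp_comm.1 (hs N S) h1, not_imp_comm.1 (hs' N S) h1]

theorem toWord_supp {c : Kern k (Finset ℕ) r} (hc : Supp c) {w : Word r} (h : toWord c w ≠ 0) :
    w ≠ [] ∧ Guarded w := by
  obtain ⟨h1, h2⟩ := hc _ _ (right_ne_zero_of_mul h)
  exact ⟨by simpa using h1, guarded_iff.2 fun j => (h2 j).1⟩

theorem toWord_chain {c : Kern k (Finset ℕ) r} (hc : LinkedSupp c) {w : Word r}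
    (h : toWord c w ≠ 0) : Chain w := (linked_vert w).1 (hc _ _ (right_ne_zero_of_mul h))

theorem toWord_ofWord_toWord {c : Kern k (Finset ℕ) r} (hc : Natural c) (hs : Supp c) :
    ofWord (toWord c) = c :=
  ext_toWord (ofWord_natural _) (ofWord_supp _) hc hs fun _ hw hg => toWord_ofWord hw hg

theorem sum_card_vert (w : Word r) : ∑ j, (vert w j).card = (w.map Finset.card).sum := by
  have h1 : (w.map Finset.card).sum = ∑ v ∈ Finset.range w.length, (w.getD v ∅).card := by
    induction w with
    | nil => simp
    | cons T w ih => simp [Finset.sum_range_succ', ih, add_comm]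
  have h2 : ∀ v, (w.getD v ∅).card = ∑ j : Fin r, if j ∈ w.getD v ∅ then 1 else 0 := by simp
  rw [h1, Finset.sum_congr rfl fun v _ => h2 v, Finset.sum_comm]
  exact Finset.sum_congr rfl fun j _ => by rw [vert, Finset.card_filter]

/-- The excess counts incidences minus vertices, corrected by the `r` inputs and the output. Hence
degree `a` in arity `r` corresponds to `HomW` of degree `a + r - 1`, and to sequences of `a + r`
labels. -/
theorem excess_word {N : Finset ℕ} {S : Fin r → Finset ℕ} (hS : ∀ j, S j ⊆ N) :
    excess N S = ((word N S).map Finset.card).sum - (word N S).length - r + 1 := by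
  have h1 : ∑ j, (S j).card = ((word N S).map Finset.card).sum := by
    rw [← sum_card_vert]
    refine Finset.sum_congr rfl fun j _ => ?_
    conv_lhs => rw [← image_vert_word (hS j)]
    refine Finset.card_image_of_injOn ((enum_strictMonoOn N).injOn.mono ?_)
    have := vert_subset (word N S) j
    rwa [length_word] at this
  rw [excess, ← h1, length_word, Finset.sum_sub_distrib]
  push_cast
  simp
  ring

end Transform
end EInf

/-! ### Comparison of the two differentials -/

namespace EInf

section Differential
variable {k : Type u} [CommRing k] {r : ℕ}

theorem wd_eq_sum (c : Word r → k) (w : Word r) :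
    wd c w = ∑ v ∈ Finset.range w.length,
      (-1) ^ (∑ u ∈ Finset.range v, ((w.getD u ∅).card + 1)) *
        (∑ l ∈ (w.getD v ∅)ᶜ, (-1) ^ below (w.getD v ∅) l *
          c (w.set v (insert l (w.getD v ∅))) - if w.getD v ∅ = ∅ then c (w.eraseIdx v) else 0) := by
  induction w generalizing c with
  | nil => simp [wd]
  | cons T w ih =>
    rw [wd, ih, List.length_cons, Finset.sum_range_succ', Finset.mul_sum, add_comm]
    congr 1
    · refine Finset.sum_congr rfl fun v _ => ?_
      rw [Finset.sum_range_succ' _ v, add_comm _ ((List.getD (T :: w) 0 ∅).card + 1), pow_add,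
        mul_assoc]
      simp
      ring
    · simp

theorem pathSign_vert (w : Word r) {v : ℕ} (hv : v ≤ w.length) :
    pathSign (Finset.range w.length) (vert w) v =
      ((∑ u ∈ Finset.range v, ((w.getD u ∅).card + 1) : ℕ) : ZMod 2) := by
  have h1 : (Finset.range w.length).filter (· < v) = Finset.range v := by
    ext x; simp only [Finset.mem_filter, Finset.mem_range]; omega
  have h2 : ∀ u, ((w.getD u ∅).card : ZMod 2) = ∑ j : Fin r, if j ∈ w.getD u ∅ then 1 else 0 := by
    simp
  rw [pathSign, h1, sum_inc, Finset.sum_add_distrib, Nat.cast_add, Nat.cast_sum,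
    Finset.sum_congr rfl fun u _ => h2 u, Finset.sum_comm, add_comm]
  congr 1
  · refine Finset.sum_congr rfl fun j _ => ?_
    rw [Finset.sum_boole, Finset.sum_boole]
    congr 2
    ext x
    simp only [Finset.mem_filter, mem_vert, Finset.mem_range]
    tauto
  · simp

theorem below_vert (w : Word r) (v : ℕ) (l : Fin r) :
    (∑ p ∈ inc (vert w), if p.2 = v ∧ p.1 < l then (1 : ZMod 2) else 0) =
      (below (w.getD v ∅) l : ℕ) := by
  rw [below, sum_inc, Finset.card_filter, Nat.cast_sum]
  have h1 : ∀ j : Fin r, ∑ x ∈ vert w j, (if x = v ∧ j < l then (1 : ZMod 2) else 0) =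
      if j ∈ w.getD v ∅ then (if j < l then 1 else 0) else 0 := by
    intro j
    have h2 : ∀ x, (if x = v ∧ j < l then (1 : ZMod 2) else 0) =
        if x = v then (if j < l then 1 else 0) else 0 := fun x => by split_ifs <;> simp_all
    rw [Finset.sum_congr rfl fun x _ => h2 x, Finset.sum_ite_eq']
    simp only [mem_vert]
  simp only [h1, Finset.sum_ite_mem, Finset.univ_inter, Nat.cast_ite, Nat.cast_one, Nat.cast_zero]

theorem vert_set {w : Word r} {v : ℕ} (hv : v < w.length) (l : Fin r) :
    vert (w.set v (insert l (w.getD v ∅))) =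
      Function.update (vert w) l (insert v (vert w l)) := by
  funext j
  ext x
  rw [mem_vert]
  by_cases hx : x = v
  · subst hx
    rw [List.getD_eq_getElem _ _ (by simpa using hv), List.getElem_set_self, Finset.mem_insert]
    by_cases hj : j = l
    · subst hj; simp
    · simp [hj, mem_vert]
  · have h1 : (w.set v (insert l (w.getD v ∅))).getD x ∅ = w.getD x ∅ := by
      simp [List.getD_eq_getElem?_getD, List.getElem?_set_ne (Ne.symm hx)]
    rw [h1, ← mem_vert]
    by_cases hj : j = l
    · subst hj; simp [hx]
    · simp [hj]

/-- The increasing map which omits the value `v`. -/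
def skip (v i : ℕ) : ℕ := if i < v then i else i + 1

theorem skip_strictMono (v : ℕ) : StrictMono (skip v) := by
  intro i j h
  unfold skip
  split_ifs <;> omega

theorem image_skip_range {v n : ℕ} (hv : v < n) :
    (Finset.range (n - 1)).image (skip v) = (Finset.range n).erase v := by
  ext x
  simp only [Finset.mem_image, Finset.mem_range, Finset.mem_erase, skip]
  constructor
  · rintro ⟨i, hi, rfl⟩
    split_ifs <;> omega
  · rintro ⟨h1, h2⟩
    refine ⟨if x < v then x else x - 1, ?_, ?_⟩ <;> split_ifs <;> omega

theorem image_skip_vert {w : Word r} {v : ℕ} (hw : w.getD v ∅ = ∅) (j : Fin r) :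
    (vert (w.eraseIdx v) j).image (skip v) = vert w j := by
  have h1 : ∀ i, (w.eraseIdx v).getD i ∅ = w.getD (skip v i) ∅ := by
    intro i
    rw [List.getD_eq_getElem?_getD, List.getD_eq_getElem?_getD, List.getElem?_eraseIdx, skip]
    split_ifs <;> rfl
  ext x
  simp only [Finset.mem_image, mem_vert, h1]
  constructor
  · rintro ⟨i, hi, rfl⟩; exact hi
  · intro hx
    have hxv : x ≠ v := by rintro rfl; rw [hw] at hx; simp at hx
    have : skip v (if x < v then x else x - 1) = x := by
      unfold skip; split_ifs <;> omega
    exact ⟨_, by rwa [this], this⟩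

/-- The terms are grouped by the vertex that is deleted from `N` or added to an input, which matches
the letters in `wd_eq_sum`. -/
theorem dk_apply {c : Kern k (Finset ℕ) r} (hs : Supp c) {N : Finset ℕ} {S : Fin r → Finset ℕ}
    (hS : ∀ j, (S j).Nonempty) : dk c N S = ∑ v ∈ N, ((-1) ^ (N.filter (· < v)).card *
      c (N.erase v) S - ∑ j ∈ Finset.univ.filter (v ∉ S ·), sgn k (pre dimParity j S) *
        (-1) ^ ((S j).filter (· < v)).card *
          theta dimParity 1 c N (Function.update S j (insert v (S j)))) := by
  rw [kdL_apply, kd, Pi.sub_apply, Pi.sub_apply, bd_kcomp _ hs, Finset.sum_apply, Finset.sum_apply,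
    Finset.sum_sub_distrib]
  congr 1
  simp only [kcomp_bd _ (hs.theta 1), if_pos (hS _)]
  rw [Finset.sum_comm' (t' := N) (s' := fun v => Finset.univ.filter (v ∉ S ·))]
  intro j v
  simp only [Finset.mem_univ, Finset.mem_sdiff, Finset.mem_filter, true_and]
  tauto

/-- The differential of the operad of kernels in terms of functions on words. -/
theorem toWord_dk {c : Kern k (Finset ℕ) r} (hs : Supp c) (hn : Natural c) {w : Word r}
    (hg : Guarded w) : toWord (dk c) w = (-1) ^ r * wd (toWord c) w := by
  rw [toWord, dk_apply hs (guarded_iff.1 hg), wd_eq_sum, Finset.mul_sum, Finset.mul_sum]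
  refine Finset.sum_congr rfl fun v hv => ?_
  have hv' : v < w.length := Finset.mem_range.1 hv
  have hcompl : Finset.univ.filter (v ∉ vert w ·) = (w.getD v ∅)ᶜ := by
    ext j; simp [mem_vert]
  rw [hcompl, mul_sub, mul_sub, mul_sub, Finset.mul_sum, Finset.mul_sum, Finset.mul_sum,
    sub_eq_add_neg, sub_eq_neg_add, ← Finset.sum_neg_distrib]
  rw [← sgn_natCast (k := k) r, ← sgn_natCast (k := k) (∑ u ∈ Finset.range v, _),
    ← pathSign_vert w hv'.le]
  have hsum : ∀ l ∈ (w.getD v ∅)ᶜ, -(sgn k (wsign (Finset.range w.length) (vert w)) *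
      (sgn k (pre dimParity l (vert w)) * (-1) ^ ((vert w l).filter (· < v)).card *
        theta dimParity 1 c (Finset.range w.length)
          (Function.update (vert w) l (insert v (vert w l))))) =
      sgn k r * (sgn k (pathSign (Finset.range w.length) (vert w) v) *
        ((-1) ^ below (w.getD v ∅) l * toWord c (w.set v (insert l (w.getD v ∅))))) := by
    intro l hl
    have hvl : v ∉ vert w l := by rw [mem_vert]; exact Finset.mem_compl.1 hl
    have h1 := congrArg (sgn k) (wsign_update hv hvl)
    rw [below_vert] at h1
    simp only [sgn_add, sgn_one, sgn_natCast] at h1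
    rw [toWord, List.length_set, vert_set hv', theta, one_mul, sgn_add]
    rw [sgn_natCast]
    have h2 := sgn_mul_self (k := k) (wsign (Finset.range w.length)
      (Function.update (vert w) l (insert v (vert w l))))
    linear_combination (sgn k (wsign (Finset.range w.length)
      (Function.update (vert w) l (insert v (vert w l)))) * c (Finset.range w.length)
        (Function.update (vert w) l (insert v (vert w l)))) * h1 + (sgn k (wsign (Finset.range w.length) (vert w)) *
      sgn k (pre dimParity l (vert w)) * (-1) ^ ((vert w l).filter (· < v)).card *
      sgn k (tot dimParity (Function.update (vert w) l (insert v (vert w l)))) *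
      sgn k (dimParity (Finset.range w.length)) * c (Finset.range w.length)
        (Function.update (vert w) l (insert v (vert w l)))) * h2
  rw [Finset.sum_congr rfl hsum, ← Finset.mul_sum, ← Finset.mul_sum]
  rw [add_comm]
  conv_rhs => rw [add_comm]
  congr 1
  -- A face term survives only if the deleted vertex lies in no input, that is, if its letter is
  -- empty; otherwise some input is not contained in the smaller simplex.
  by_cases hT : w.getD v ∅ = ∅
  · have hS : ∀ j, v ∉ vert w j := fun j => by rw [mem_vert, hT]; simp
    have h1 := congrArg (sgn k) (wsign_erase hv hS)
    have hlen : (w.eraseIdx v).length = w.length - 1 := List.length_eraseIdx_of_lt hv'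
    have h3 : vert w = fun j => (vert (w.eraseIdx v) j).image (skip v) :=
      funext fun j => (image_skip_vert hT j).symm
    have h4 := vert_subset (w.eraseIdx v)
    have h5 : (Finset.range w.length).erase v =
        (Finset.range (w.eraseIdx v).length).image (skip v) := by
      rw [hlen, image_skip_range hv']
    have h6 : toWord c (w.eraseIdx v) = sgn k (wsign ((Finset.range w.length).erase v) (vert w)) *
        c ((Finset.range w.length).erase v) (vert w) := by
      rw [toWord, h5, h3, wsign_image ((skip_strictMono v).strictMonoOn _) h4,
        hn _ _ _ ((skip_strictMono v).strictMonoOn _) h4]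
    rw [if_pos hT, h6]
    simp only [sgn_add, sgn_one, sgn_natCast] at h1
    rw [sgn_natCast]
    have h2 := sgn_mul_self (k := k) (wsign ((Finset.range w.length).erase v) (vert w))
    linear_combination c ((Finset.range w.length).erase v) (vert w) * h1
  · have h0 : c ((Finset.range w.length).erase v) (vert w) = 0 := by
      by_contra h0
      obtain ⟨j, hj⟩ := Finset.nonempty_iff_ne_empty.2 hT
      exact (Finset.notMem_erase v _) (((hs _ _ h0).2 j).2 (mem_vert.2 hj))
    rw [if_neg hT, h0]
    ring

end Differential
end EInf

namespace EInf

/-! ### Exactness -/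

section Exact
variable {k : Type u} [CommRing k] {r : ℕ}

theorem wd_congr {f g : Word r → k} {w : Word r}
    (h : ∀ w₁ T w₂, w = w₁ ++ T :: w₂ → (∀ l, f (w₁ ++ insert l T :: w₂) = g (w₁ ++ insert l T :: w₂)) ∧
      (T = ∅ → f (w₁ ++ w₂) = g (w₁ ++ w₂))) : wd f w = wd g w := by
  rw [← sub_eq_zero]
  have h1 : wd f w - wd g w = wd (f - g) w := by
    rw [← wdL_apply (f - g), map_sub]; rfl
  rw [h1]
  by_contra h2
  obtain ⟨w₁, T, w₂, hw, ⟨l, -, h3⟩ | ⟨hT, h3⟩⟩ := wd_ne_zero h2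
  · exact h3 (sub_eq_zero.2 ((h w₁ T w₂ hw).1 l))
  · exact h3 (sub_eq_zero.2 ((h w₁ T w₂ hw).2 hT))

theorem Guarded.ne_nil {w : Word (r + 1)} (h : Guarded w) : w ≠ [] := by
  rintro rfl
  obtain ⟨T, hT, -⟩ := h 0
  simp at hT

theorem wd_toWord_ofWord (f : Word (r + 1) → k) {w : Word (r + 1)} (hw : Guarded w) :
    wd (toWord (ofWord f)) w = wd f w := by
  refine wd_congr fun w₁ T w₂ h => ⟨fun l => ?_, fun hT => ?_⟩
  · have hg : Guarded (w₁ ++ insert l T :: w₂) := fun j => by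
      obtain ⟨U, hU, hj⟩ := hw j
      rw [h, List.mem_append, List.mem_cons] at hU
      rcases hU with hU | rfl | hU
      · exact ⟨U, by simp [hU], hj⟩
      · exact ⟨insert l U, by simp, Finset.mem_insert_of_mem hj⟩
      · exact ⟨U, by simp [hU], hj⟩
    exact toWord_ofWord hg.ne_nil hg
  · have hg : Guarded (w₁ ++ w₂) := fun j => by
      obtain ⟨U, hU, hj⟩ := hw j
      rw [h, List.mem_append, List.mem_cons] at hU
      rcases hU with hU | rfl | hU
      · exact ⟨U, by simp [hU], hj⟩
      · rw [hT] at hj; simp at hj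
      · exact ⟨U, by simp [hU], hj⟩
    exact toWord_ofWord hg.ne_nil hg

theorem not_guarded_empty : ¬ Guarded ([∅] : Word (r + 1)) := fun h => by
  obtain ⟨T, hT, h0⟩ := h 0
  rw [List.mem_singleton.1 hT] at h0
  simp at h0

/-- On words with all labels, `wd` is the differential of the kernel up to sign, and `dlinked`
applies. On other words it may still be nonzero, but only on chains, by `chain_of_not_guarded`.
Positive arity ensures that `[∅]` misses a label. -/
theorem IsLinked.good {c : Kern k (Finset ℕ) (r + 1)} (hc : IsLinked c) : Good (toWord c) where
  nil := by_contra fun h => (toWord_supp hc.supp h).1 rfl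
  empty := by_contra fun h => not_guarded_empty (toWord_supp hc.supp h).2
  chain _ := toWord_chain hc.linked
  dchain w h := by
    by_cases hw : Guarded w
    · refine toWord_chain hc.dlinked (w := w) ?_
      rw [toWord_dk hc.supp hc.natural hw]
      intro h1
      apply h
      rw [← one_mul (wd _ w), ← neg_one_pow_mul_self (r + 1), mul_assoc, h1, mul_zero]
    · exact chain_of_not_guarded (fun _ => toWord_chain hc.linked)
        (fun _ h => (toWord_supp hc.supp h).2) h hw

/-- The degrees of the words in the support are bounded. -/
def BddW (c : Word r → k) : Prop :=
  ∃ A : ℕ, ∀ w, c w ≠ 0 → (w.map Finset.card).sum ≤ w.length + A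

theorem HomW.bddW {c : Word r → k} {M : ℕ} (hc : HomW c M) : BddW c :=
  ⟨M, fun w h => (hc w h).le⟩

theorem BddW.add {c c' : Word r → k} (hc : BddW c) (hc' : BddW c') : BddW (c + c') := by
  obtain ⟨A, hA⟩ := hc
  obtain ⟨A', hA'⟩ := hc'
  refine ⟨A + A', fun w h => ?_⟩
  by_cases h1 : c w = 0
  · have := hA' w fun h2 => h (by simp [h1, h2])
    omega
  · have := hA w h1
    omega

theorem BddW.smul (a : k) {c : Word r → k} (hc : BddW c) : BddW (a • c) :=
  hc.imp fun _ hA w h => hA w (right_ne_zero_of_mul h)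

theorem BddW.prep {c : Word r → k} (hc : BddW c) (j : Fin r) : BddW (prep j c) := by
  obtain ⟨A, hA⟩ := hc
  refine ⟨A + 1, fun w h => ?_⟩
  obtain ⟨n, X, w', -, hj, rfl, h1⟩ := prep_ne_zero h
  have := hA _ h1
  simp only [List.map_cons, List.sum_cons, List.length_cons] at this
  simp [Finset.card_insert_of_notMem hj]
  omega

theorem bddW_toWord {c : Kern k (Finset ℕ) r} {A : ℤ} (hc : DegLE c A) : BddW (toWord c) := by
  refine ⟨(A + r).toNat, fun w h => ?_⟩
  have h1 := hc _ _ (right_ne_zero_of_mul h)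
  rw [excess_word (vert_subset w), word_range] at h1
  omega

theorem IsLinked.ofWord {f : Word (r + 1) → k} (hf : Good f) (hb : BddW f) :
    IsLinked (ofWord f) where
  supp := ofWord_supp f
  natural := ofWord_natural f
  linked N S h := by
    obtain ⟨h1, h2⟩ := ofWord_ne_zero h
    exact (linked_iff_chain fun j => (h1.2 j).2).2 (hf.chain _ h2)
  dlinked N S h := by
    have h1 := (ofWord_supp f).dk N S h
    have hS := fun j => (h1.2 j).2
    have hn := (ofWord_natural f).dk (ofWord_supp f)
    rw [eq_toWord hn hS] at h
    have h2 := right_ne_zero_of_mul h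
    have hg := (toWord_supp (ofWord_supp f).dk h2).2
    rw [toWord_dk (ofWord_supp f) (ofWord_natural f) hg, wd_toWord_ofWord f hg] at h2
    exact (linked_iff_chain hS).2 (hf.dchain _ (right_ne_zero_of_mul h2))
  bounded := by
    obtain ⟨A, hA⟩ := hb
    refine ⟨A, fun N S h => ?_⟩
    obtain ⟨h1, h2⟩ := ofWord_ne_zero h
    have := hA _ h2
    rw [excess_word fun j => (h1.2 j).2]
    omega

/-! #### Omitting the first label -/

/-- The labels of a letter after the first one, renumbered. -/
def pull (T : Finset (Fin (r + 1))) : Finset (Fin r) := Finset.univ.filter fun j => j.succ ∈ T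

theorem mem_pull {T : Finset (Fin (r + 1))} {j : Fin r} : j ∈ pull T ↔ j.succ ∈ T := by
  simp [pull]

/-- The extension by zero to the words which contain the first label. -/
def push (g : Word r → k) : Word (r + 1) → k := fun w =>
  if ∀ T ∈ w, 0 ∉ T then g (w.map pull) else 0

theorem pull_insert (T : Finset (Fin (r + 1))) (m : Fin r) :
    pull (insert m.succ T) = insert m (pull T) := by
  ext j; simp [mem_pull]

theorem map_succ_pull {T : Finset (Fin (r + 1))} (h : 0 ∉ T) :
    (pull T).map (Fin.succEmb r) = T := by
  ext j
  refine Fin.cases ?_ (fun j => ?_) j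
  · simp [h, Fin.succ_ne_zero]
  · simp [mem_pull]

theorem card_pull {T : Finset (Fin (r + 1))} (h : 0 ∉ T) : (pull T).card = T.card := by
  conv_rhs => rw [← map_succ_pull h, Finset.card_map]

theorem pull_eq_empty {T : Finset (Fin (r + 1))} (h : 0 ∉ T) : pull T = ∅ ↔ T = ∅ := by
  rw [← Finset.card_eq_zero, card_pull h, Finset.card_eq_zero]

theorem below_pull {T : Finset (Fin (r + 1))} (h : 0 ∉ T) (m : Fin r) :
    below (pull T) m = below T m.succ := by
  conv_rhs => rw [← map_succ_pull h, below, Finset.filter_map, Finset.card_map]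
  rw [below]
  congr 1
  ext j
  rw [Finset.mem_filter, Finset.mem_filter]
  simp

theorem push_cons_of_mem (g : Word r → k) {T : Finset (Fin (r + 1))} (h : 0 ∈ T)
    (w : Word (r + 1)) : push g (T :: w) = 0 := if_neg fun h1 => h1 T (by simp) h

theorem push_cons {g : Word r → k} {T : Finset (Fin (r + 1))} (h : 0 ∉ T) (w : Word (r + 1)) :
    push g (T :: w) = push (fun w' => g (pull T :: w')) w := by
  simp [push, h]

/-- Insertions of the label `0` lead to words where `push g` vanishes. The remaining insertions keep
their signs, since `0` is the smallest label and is absent. -/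
theorem wd_push (g : Word r → k) (w : Word (r + 1)) : wd (push g) w = push (wd g) w := by
  induction w generalizing g with
  | nil => simp [push, wd]
  | cons T w ih =>
    by_cases h : (0 : Fin (r + 1)) ∈ T
    · have h1 : (fun w' => push g (T :: w')) = fun _ => 0 := funext fun w' => push_cons_of_mem g h w'
      rw [push_cons_of_mem _ h, wd, h1, wd_zero', if_neg (Finset.ne_empty_of_mem h),
        Finset.sum_eq_zero fun l _ => by
          rw [push_cons_of_mem _ (Finset.mem_insert_of_mem h), mul_zero]]
      ring
    · have h1 : (fun w' => push g (T :: w')) = push fun w' => g (pull T :: w') :=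
        funext fun w' => push_cons h w'
      rw [push_cons h, wd, h1, ih]
      have h2 : ∑ l ∈ Tᶜ, (-1) ^ below T l * push g (insert l T :: w) =
          ∑ m ∈ (pull T)ᶜ, (-1) ^ below (pull T) m *
            push (fun w' => g (insert m (pull T) :: w')) w := by
        have h3 : ∀ f : Fin (r + 1) → k, ∑ l ∈ Tᶜ, f l = f 0 + ∑ m ∈ (pull T)ᶜ, f m.succ := by
          intro f
          rw [← Finset.sum_filter_add_sum_filter_not Tᶜ (fun l => l = 0)]
          congr 1
          · rw [Finset.filter_eq' Tᶜ 0, if_pos (by simpa using h), Finset.sum_singleton]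
          · symm
            refine Finset.sum_bij (fun m _ => m.succ) ?_ ?_ ?_ ?_
            · intro m hm
              simpa [mem_pull, Fin.succ_ne_zero] using hm
            · intro m _ m' _ h; exact Fin.succ_injective _ h
            · intro l hl
              rw [Finset.mem_filter, Finset.mem_compl] at hl
              obtain ⟨m, rfl⟩ := Fin.exists_succ_eq.2 hl.2
              exact ⟨m, by simpa [mem_pull] using hl.1, rfl⟩
            · intro _ _; rfl
        rw [h3, push_cons_of_mem _ (Finset.mem_insert_self _ _), mul_zero, zero_add]
        refine Finset.sum_congr rfl fun m _ => ?_
        rw [below_pull h, push_cons (by simp [h, (Fin.succ_ne_zero m).symm]), pull_insert]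
      rw [h2]
      by_cases hw : ∀ T ∈ w, (0 : Fin (r + 1)) ∉ T
      · simp only [push, if_pos hw, wd, pull_eq_empty h, card_pull h]
      · simp [push, if_neg hw]

theorem guarded_pull {w : Word (r + 1)} (h : ∀ j ≠ 0, ∃ T ∈ w, j ∈ T) :
    Guarded (w.map pull) := fun j => by
  obtain ⟨T, hT, hj⟩ := h j.succ (Fin.succ_ne_zero j)
  exact ⟨pull T, List.mem_map_of_mem hT, mem_pull.2 hj⟩

theorem chain_of_pull {w : Word (r + 1)} (h : Chain (w.map pull)) : Chain w :=
  List.isChain_of_isChain_map pull (fun S T ⟨j, hj⟩ => by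
    rw [Finset.mem_inter, mem_pull, mem_pull] at hj
    exact ⟨j.succ, Finset.mem_inter.2 hj⟩) h

theorem push_ne_zero {g : Word r → k} {w : Word (r + 1)} (h : push g w ≠ 0) :
    (∀ T ∈ w, 0 ∉ T) ∧ g (w.map pull) ≠ 0 := by
  unfold push at h
  split_ifs at h with h1
  · exact ⟨h1, h⟩
  · exact absurd rfl h

theorem Good.push {g : Word r → k} (hg : Good g) : Good (push g) where
  nil := by simp [EInf.push, hg.nil]
  empty := by simp [EInf.push, pull, hg.empty]
  chain w h := chain_of_pull (hg.chain _ (push_ne_zero h).2)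
  dchain w h := by
    rw [wd_push] at h
    exact chain_of_pull (hg.dchain _ (push_ne_zero h).2)

theorem BddW.push {g : Word r → k} (hg : BddW g) : BddW (push g) := by
  obtain ⟨A, hA⟩ := hg
  refine ⟨A, fun w h => ?_⟩
  obtain ⟨h1, h2⟩ := push_ne_zero h
  have h3 := hA _ h2
  rw [List.length_map, List.map_map] at h3
  convert h3 using 2
  exact List.map_congr_left fun T hT => (card_pull (h1 T hT)).symm

/-- On a one-vertex simplex the support condition forces every input to be that vertex, and the
corresponding value is the augmentation. -/
theorem toWord_singleton {c : Kern k (Finset ℕ) r} (hs : Supp c) (ha : aug c = 0)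
    (T : Finset (Fin r)) : toWord c [T] = 0 := by
  by_contra h
  have h1 := right_ne_zero_of_mul h
  have h2 : vert [T] = fun _ => {0} := funext fun j => by
    have := (hs _ _ h1).2 j
    exact (Finset.subset_singleton_iff.1 (by simpa using this.2)).resolve_left this.1.ne_empty
  rw [h2] at h1
  exact h1 ha

end Exact
end EInf

/-! ### Acyclicity by induction on the arity -/

namespace EInf

section Exact
variable {k : Type u} [CommRing k] {r : ℕ}

/-- The unit is nonzero only on single vertices, and the dimension of a vertex contributes no sign.
-/
theorem kcomp_unitKern (c : Kern k (Finset ℕ) (r + 1)) (N : Finset ℕ) (S : Fin r → Finset ℕ) :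
    kcomp (r := r + 1) (s := 0) (n := r) dimParity rfl 0 c unitKern N S =
      ∑ v ∈ N, c N (Fin.cons {v} S) := by
  have h1 : ∀ t, outerFam (r := r + 1) (s := 0) (n := r) rfl 0 S t = Fin.cons t S := fun t => by
    funext j
    refine Fin.cases ?_ (fun j => ?_) j
    · simp
    · rw [outerFam_of_ne _ _ _ _ (Fin.succ_ne_zero j), Fin.cons_succ]
      congr 1
  have h2 : (N.image fun v => ({v} : Finset ℕ)) ⊆ Finset.Iic N := by
    intro t ht
    obtain ⟨v, hv, rfl⟩ := Finset.mem_image.1 ht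
    exact Finset.mem_Iic.2 (Finset.singleton_subset_iff.2 hv)
  rw [kcomp, ← Finset.sum_subset h2, Finset.sum_image fun x _ y _ h => Finset.singleton_injective h]
  · refine Finset.sum_congr rfl fun v _ => ?_
    simp [h1, unitKern, tot, dimParity_singleton]
  · intro t ht ht'
    rw [unitKern, if_neg, mul_zero]
    intro h3
    obtain ⟨v, rfl⟩ := Finset.card_eq_one.1 h3
    exact ht' (Finset.mem_image.2 ⟨v, Finset.singleton_subset_iff.1 (Finset.mem_Iic.1 ht), rfl⟩)

theorem inc_cons (v : ℕ) (S : Fin r → Finset ℕ) :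
    inc (Fin.cons {v} S : Fin (r + 1) → Finset ℕ) =
      insert ⟨0, v⟩ ((inc S).image fun p => ⟨p.1.succ, p.2⟩) := by
  ext ⟨j, x⟩
  rw [mem_inc, Finset.mem_insert, Finset.mem_image]
  refine Fin.cases ?_ (fun j => ?_) j
  · simp only [Fin.cons_zero, Finset.mem_singleton, Sigma.mk.injEq, heq_eq_eq, true_and]
    refine (or_iff_left ?_).symm
    rintro ⟨p, -, h, -⟩
    exact Fin.succ_ne_zero _ h
  · simp only [Fin.cons_succ, Sigma.mk.injEq, Fin.succ_ne_zero, false_and, false_or, heq_eq_eq]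
    constructor
    · intro h; exact ⟨⟨j, x⟩, mem_inc.2 h, rfl, rfl⟩
    · rintro ⟨p, hp, h1, h2⟩
      rw [← Fin.succ_injective _ h1, ← h2]; exact mem_inc.1 hp

/-- The change of sign is exactly the sign with which `wd` inserts a label at the vertex `v`. This
is why composition with the unit can be compared with `wd` in `wd_toWord_of_notMem`. -/
theorem wsign_cons {N : Finset ℕ} {v : ℕ} (hv : v ∈ N) (S : Fin r → Finset ℕ) :
    wsign N (Fin.cons {v} S : Fin (r + 1) → Finset ℕ) = wsign N S + pathSign N S v := by
  have hinj : Function.Injective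
      (fun p : Σ _ : Fin r, ℕ => (⟨p.1.succ, p.2⟩ : Σ _ : Fin (r + 1), ℕ)) := by
    rintro ⟨j, x⟩ ⟨j', y⟩ h
    simp only [Sigma.mk.injEq, heq_eq_eq, Fin.succ_inj] at h
    obtain ⟨rfl, rfl⟩ := h
    rfl
  have hp : (⟨0, v⟩ : Σ _ : Fin (r + 1), ℕ) ∉
      (inc S).image fun p => (⟨p.1.succ, p.2⟩ : Σ _ : Fin (r + 1), ℕ) := by
    rw [Finset.mem_image]
    rintro ⟨p, -, h⟩
    exact Fin.succ_ne_zero _ (Sigma.mk.inj h).1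
  have hcard : (N.card : ZMod 2) = (N.filter (· < v)).card + 1 + (N.filter (v < ·)).card := by
    have h1 := Finset.card_filter_add_card_filter_not (s := N) (· < v)
    have h2 : N.filter (fun a => ¬ a < v) = insert v (N.filter (v < ·)) := by
      ext y; simp only [Finset.mem_filter, Finset.mem_insert]; grind
    rw [h2, Finset.card_insert_of_notMem (by simp)] at h1
    rw [← h1]; push_cast; ring
  have h1 : ∀ p q : Σ _ : Fin r, ℕ, crossing (⟨p.1.succ, p.2⟩ : Σ _ : Fin (r + 1), ℕ)
      ⟨q.1.succ, q.2⟩ = crossing p q := fun p q => by simp [crossing]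
  have h2 : ∀ p : Σ _ : Fin r, ℕ, crossing (⟨p.1.succ, p.2⟩ : Σ _ : Fin (r + 1), ℕ) ⟨0, v⟩ = 0 :=
    fun p => by simp [crossing, Fin.succ_ne_zero]
  have h3 : ∀ q : Σ _ : Fin r, ℕ, crossing (⟨0, v⟩ : Σ _ : Fin (r + 1), ℕ) ⟨q.1.succ, q.2⟩ =
      1 + if q.2 < v then 1 else 0 := fun q => by
    by_cases h : q.2 < v
    · simp [crossing, h, not_le.2 h, (Fin.succ_ne_zero _).symm]; decide
    · simp [crossing, h, (Fin.succ_ne_zero _).symm, not_lt.1 h]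
  rw [wsign, wsign, pathSign, inc_cons, Finset.sum_insert hp, Finset.sum_insert hp,
    Finset.sum_image hinj.injOn, Finset.sum_image hinj.injOn, Finset.sum_insert hp,
    Finset.sum_image hinj.injOn]
  simp only [Finset.sum_insert hp, Finset.sum_image hinj.injOn, h1, h2, h3, crossing_self, zero_add,
    Finset.sum_add_distrib, Fin.val_succ, Fin.val_zero, hcard, Nat.cast_add, Nat.cast_one]
  linear_combination (∑ p ∈ inc S, (1 : ZMod 2) + (N.filter (v < ·)).card + 1) * two_zmod

theorem vert_pull {w : Word (r + 1)} (j : Fin r) : vert (w.map pull) j = vert w j.succ := by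
  ext x
  have h1 : (w.map pull).getD x ∅ = pull (w.getD x ∅) := by
    rw [List.getD_eq_getElem?_getD, List.getD_eq_getElem?_getD, List.getElem?_map]
    cases w[x]? <;> simp [pull]
  rw [mem_vert, mem_vert, h1, mem_pull]

/-- On the words without the label `0`, the differential is composition with the unit. -/
theorem wd_toWord_of_notMem {c : Kern k (Finset ℕ) (r + 1)} (hs : Supp c) {w : Word (r + 1)}
    (hw : ∀ T ∈ w, 0 ∉ T) : wd (toWord c) w =
      toWord (kcomp (r := r + 1) (s := 0) (n := r) dimParity rfl 0 c unitKern) (w.map pull) := by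
  have hw' : ∀ v, (0 : Fin (r + 1)) ∉ w.getD v ∅ := by
    intro v
    rw [← mem_vert]
    intro h
    have h1 : v < w.length := by simpa using vert_subset _ _ h
    rw [mem_vert, List.getD_eq_getElem _ _ h1] at h
    exact hw _ (List.getElem_mem h1) h
  have h0 : ∀ w' : Word (r + 1), (∀ T ∈ w', 0 ∉ T) → toWord c w' = 0 := by
    intro w' h
    by_contra h1
    obtain ⟨T, hT, h2⟩ := (toWord_supp hs h1).2 0
    exact h T hT h2
  rw [wd_eq_sum, toWord, kcomp_unitKern, List.length_map, Finset.mul_sum]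
  refine Finset.sum_congr rfl fun v hv => ?_
  have hv' := Finset.mem_range.1 hv
  have h1 : (if w.getD v ∅ = ∅ then toWord c (w.eraseIdx v) else 0) = 0 := by
    split_ifs
    · exact h0 _ fun T hT => hw T (List.mem_of_mem_eraseIdx hT)
    · rfl
  have hv0 : (Fin.cons {v} (vert (w.map pull)) : Fin (r + 1) → Finset ℕ) =
      vert (w.set v (insert 0 (w.getD v ∅))) := by
    rw [vert_set hv']
    funext j
    refine Fin.cases ?_ (fun j => ?_) j
    · have : vert w 0 = ∅ := Finset.eq_empty_of_forall_notMem fun x hx => hw' x (mem_vert.1 hx)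
      simp [this]
    · rw [Fin.cons_succ, vert_pull, Function.update_of_ne (Fin.succ_ne_zero j)]
  have hbel : below (w.getD v ∅) 0 = 0 := by simp [below]
  have hpath : pathSign (Finset.range w.length) (vert (w.map pull)) v =
      ((∑ u ∈ Finset.range v, ((w.getD u ∅).card + 1) : ℕ) : ZMod 2) := by
    have := pathSign_vert (w.map pull) (v := v) (by simpa using hv'.le)
    rw [List.length_map] at this
    rw [this]
    congr 1
    refine Finset.sum_congr rfl fun u _ => ?_
    have h1 : (w.map pull).getD u ∅ = pull (w.getD u ∅) := by
      rw [List.getD_eq_getElem?_getD, List.getD_eq_getElem?_getD, List.getElem?_map]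
      cases w[u]? <;> simp [pull]
    rw [h1, card_pull (hw' u)]
  have hsg := congrArg (sgn k) (wsign_cons hv (vert (w.map pull)))
  rw [sgn_add, hpath, sgn_natCast] at hsg
  rw [h1, sub_zero, Finset.sum_eq_single (0 : Fin (r + 1)), hbel, pow_zero, one_mul, toWord, List.length_set, ← hv0,
    hsg]
  · have h2 := neg_one_pow_mul_self (k := k) (∑ u ∈ Finset.range v, ((w.getD u ∅).card + 1))
    linear_combination sgn k (wsign (Finset.range w.length) (vert (w.map pull))) *
      c (Finset.range w.length) (Fin.cons {v} (vert (w.map pull))) * h2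
  · intro l _ hl
    rw [h0, mul_zero]
    intro T hT
    rcases List.mem_or_eq_of_mem_set hT with hT | rfl
    · exact hw T hT
    · rw [Finset.mem_insert, not_or]
      exact ⟨Ne.symm hl, hw' v⟩
  · intro h
    exact absurd (by simpa using hw' v) h

theorem dk_ofWord {f : Word (r + 1) → k} {c : Kern k (Finset ℕ) (r + 1)} (hs : Supp c)
    (hn : Natural c) (h : ∀ w, Guarded w → wd f w = (-1) ^ (r + 1) * toWord c w) :
    dk (ofWord f) = c := by
  refine ext_toWord ((ofWord_natural f).dk (ofWord_supp f)) (ofWord_supp f).dk hn hs fun w _ hg => ?_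
  rw [toWord_dk (ofWord_supp f) (ofWord_natural f) hg, wd_toWord_ofWord f hg, h w hg, ← mul_assoc,
    neg_one_pow_mul_self, one_mul]

/-- The augmented chain complexes of the operad of kernels are acyclic. -/
theorem exists_dk_eq (c : Kern k (Finset ℕ) r) (hc : IsLinked c) (hd : dk c = 0) (ha : aug c = 0) :
    ∃ y : Kern k (Finset ℕ) r, IsLinked y ∧ dk y = c ∧ aug y = 0 := by
  induction r with
  | zero =>
    have h1 := eq_smul_unitKern hc.supp hc.natural hc.linked
    rw [ha, zero_smul] at h1
    exact ⟨0, IsLinked.zero, by rw [map_zero, h1], rfl⟩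
  | succ r ih =>
    -- Inserting the unit into the first slot gives a cycle of augmentation zero in arity `r`, to
    -- which the induction hypothesis applies.
    have hc' := hc.kcomp (r := r + 1) (s := 0) (n := r) rfl 0 (unitKern_isLinked (k := k))
    obtain ⟨y, hy, hdy, hay⟩ := ih (kcomp (r := r + 1) (s := 0) (n := r) dimParity rfl 0 c unitKern) hc'
      (by rw [dk_kcomp _ _ hc.supp unitKern_supp, hd, dk_unitKern, kcomp_zero_left,
        kcomp_zero_right, add_zero])
      (by rw [aug_kcomp _ _ unitKern_supp, ha, zero_mul])
    -- In arity zero `IsLinked.good` is not available; there `y` vanishes because its augmentation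
    -- is zero. This is one reason for keeping `aug y = 0` in the induction.
    have hgy : Good (toWord y) := by
      cases r with
      | zero =>
        have h1 := eq_smul_unitKern hy.supp hy.natural hy.linked
        rw [hay, zero_smul] at h1
        rw [h1, show toWord (0 : Kern k (Finset ℕ) 0) = 0 from funext fun w => mul_zero _]
        exact Good.zero
      | succ r => exact hy.good
    obtain ⟨A, hA⟩ := hc.bounded
    obtain ⟨A', hA'⟩ := hy.bounded
    -- The function of `c` vanishes on words without the label `0`, although its differential need
    -- not. The primitive `y` supplies values there for which the differential vanishes on all words
    -- containing the other labels.
    set x : Word (r + 1) → k := toWord c + (-(-1) ^ r : k) • push (toWord y) with hx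
    have hgx : Good x := hc.good.add (hgy.push.smul _)
    have hbx : BddW x := (bddW_toWord hA).add ((bddW_toWord hA').push.smul _)
    have hx1 : ∀ T, x [T] = 0 := by
      intro T
      rw [hx, Pi.add_apply, toWord_singleton hc.supp ha, Pi.smul_apply, zero_add, push]
      split_ifs
      · rw [List.map_singleton, toWord_singleton hy.supp hay, smul_zero]
      · rw [smul_zero]
    have hwd : ∀ w, wd x w = wd (toWord c) w - (-1) ^ r * push (wd (toWord y)) w := by
      intro w
      rw [hx, wd_add, wd_smul, wd_push]; ring
    -- Without the label `0`, the differential of the first summand is composition with the unit,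
    -- hence the differential of `y`; the factor `(-1)^r` is the one in `toWord_dk`. If `0` occurs,
    -- the word contains all labels and `dk c = 0` is used.
    have hwd0 : ∀ w, (∀ j ≠ 0, ∃ T ∈ w, j ∈ T) → wd x w = 0 := by
      intro w hw
      rw [hwd]
      by_cases h0 : ∀ T ∈ w, (0 : Fin (r + 1)) ∉ T
      · rw [push, if_pos h0, wd_toWord_of_notMem hc.supp h0, ← hdy,
          toWord_dk hy.supp hy.natural (guarded_pull hw), sub_self]
      · have hg : Guarded w := fun j => by
          by_cases hj : j = 0
          · subst hj; by_contra! h; exact h0 h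
          · exact hw j hj
        have h1 := toWord_dk hc.supp hc.natural hg
        rw [hd, show toWord (0 : Kern k (Finset ℕ) (r + 1)) w = 0 from mul_zero _] at h1
        have h2 := neg_one_pow_mul_self (k := k) (r + 1)
        rw [push, if_neg h0]
        linear_combination (-1) ^ (r + 1) * (-h1) - wd (toWord c) w * h2
    -- The operator `prep 0` affects only the occurrence of `0` among the labels, so `prep 0 (wd x)`
    -- vanishes on words with all labels. The constant term of the homotopy formula vanishes because
    -- `x` is zero on one-letter words.
    have hz : ∀ w, Guarded w → wd (prep 0 x) w = toWord c w := by
      intro w hw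
      have h1 : prep 0 (wd x) w = 0 := by
        by_contra h
        obtain ⟨w', h2, h3⟩ := prep_mem h
        exact h2 (hwd0 w' fun j hj => ((h3 j).1 (hw j)).resolve_left hj)
      have h2 : push (toWord y) w = 0 := if_neg fun h => by
        obtain ⟨T, hT, h0⟩ := hw 0
        exact h T hT h0
      rw [hgx.wd_prep, h1, Finset.sum_eq_zero fun l _ => hx1 {l}, hx, Pi.add_apply, Pi.smul_apply,
        h2, smul_zero]
      ring
    refine ⟨ofWord ((-1 : k) ^ (r + 1) • prep 0 x), .ofWord ((hgx.prep 0).smul _)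
      ((hbx.prep 0).smul _), dk_ofWord hc.supp hc.natural fun w hw => by rw [wd_smul, hz w hw], ?_⟩
    -- The augmentation of the primitive is a value of `prep 0 x` at a one-letter word, which is
    -- zero or, up to sign, a value of `x` at a one-letter word.
    by_contra h
    obtain ⟨-, h1⟩ := ofWord_ne_zero h
    have h2 : word {0} (fun _ : Fin (r + 1) => ({0} : Finset ℕ)) = [Finset.univ] := by
      simp [word]
    have h3 := right_ne_zero_of_mul (a := (-1 : k) ^ (r + 1)) h1
    rw [h2, prep] at h3
    split_ifs at h3 with h4 h5
    · exact h3 rfl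
    · rw [hx1, mul_zero] at h3; exact h3 rfl
    · exact h3 rfl

end Exact
end EInf

namespace EInf

/-! ### Freeness over the symmetric groups -/

section Free
variable {k : Type u} [CommRing k] {r : ℕ}

theorem vert_image (w : Word r) (σ : Equiv.Perm (Fin r)) :
    vert (w.map (Finset.image σ)) = vert w ∘ σ.symm := by
  funext j
  ext x
  have h1 : (w.map (Finset.image σ)).getD x ∅ = (w.getD x ∅).image σ := by
    rw [List.getD_eq_getElem?_getD, List.getD_eq_getElem?_getD, List.getElem?_map]
    cases w[x]? <;> simp
  rw [mem_vert, h1, Function.comp_apply, mem_vert, Finset.mem_image]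
  constructor
  · rintro ⟨i, hi, rfl⟩; simpa using hi
  · intro h; exact ⟨_, h, by simp⟩

/-- The sign depends on the word; for freeness it is enough that it is invertible. -/
theorem toWord_kact (σ : Equiv.Perm (Fin r)) (c : Kern k (Finset ℕ) r) (w : Word r) :
    ∃ e : k, e * e = 1 ∧ toWord (kact dimParity σ c) w = e * toWord c (w.map (Finset.image σ)) := by
  refine ⟨sgn k (wsign (Finset.range w.length) (vert w) + kos σ (dimParity ∘ vert w) +
    wsign (Finset.range w.length) (vert w ∘ σ.symm)), sgn_mul_self _, ?_⟩
  rw [toWord, toWord, kact, vert_image, List.length_map, sgn_add, sgn_add]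
  have h := sgn_mul_self (k := k) (wsign (Finset.range w.length) (vert w ∘ σ.symm))
  linear_combination -sgn k (wsign (Finset.range w.length) (vert w)) *
    sgn k (kos σ (dimParity ∘ vert w)) * c (Finset.range w.length) (vert w ∘ σ.symm) * h

theorem genW_map (σ : Equiv.Perm (Fin r)) (u : List (Fin r)) :
    (genW u).map (Finset.image σ) = genW (u.map σ) := by
  induction u with
  | nil => rfl
  | cons j u ih =>
    cases u with
    | nil => simp [genW]
    | cons l u =>
      rw [genW, List.map_cons, List.map_cons, ih]
      simp [genW, Finset.image_insert]

theorem guarded_genW {u : List (Fin r)} : Guarded (genW u) ↔ ∀ j, j ∈ u :=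
  forall_congr' fun j => genW_mem u j

theorem HasDeg.homW {c : Kern k (Finset ℕ) r} {a : ℕ} (hc : HasDeg c a) {M : ℕ}
    (hM : M + 1 = a + r) : HomW (toWord c) M := fun w h => by
  have h1 := hc _ _ (right_ne_zero_of_mul h)
  rw [excess_word (vert_subset w), word_range] at h1
  omega

theorem HomW.hasDeg {f : Word r → k} {M : ℕ} (hf : HomW f M) {a : ℕ} (hM : M + 1 = a + r) :
    HasDeg (ofWord f) a := fun N S h => by
  obtain ⟨h1, h2⟩ := ofWord_ne_zero h
  rw [excess_word fun j => (h1.2 j).2, hf _ h2]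
  push_cast
  omega

theorem cutW_isLinked (u : List (Fin (r + 1))) : IsLinked (ofWord (cutW k u)) := by
  refine .ofWord (Good.cutW u) ?_
  cases u with
  | nil => exact ⟨0, fun w h => absurd rfl h⟩
  | cons j u => exact (HomW.cutW j u).bddW

theorem toWord_cutW {u : List (Fin (r + 1))} {w : Word (r + 1)} (hw : Guarded w) :
    toWord (ofWord (cutW k u)) w = cutW k u w := toWord_ofWord hw.ne_nil hw

theorem eq_zero_of_genW {c : Kern k (Finset ℕ) (r + 1)} (hc : IsLinked c) {a : ℕ} (ha : HasDeg c a)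
    (h : ∀ u ∈ labels (r + 1) (a + r + 1), toWord c (genW u) = 0) : c = 0 := by
  have h1 := hc.good.eq_zero_of_genW (ha.homW (M := a + r) rfl)
    fun u hu hu' => h u (mem_labels.2 ⟨hu, hu'⟩)
  rw [← toWord_ofWord_toWord hc.natural hc.supp, h1]
  funext N S
  simp [ofWord]

/-- Both sides are determined by their values on shortest words. There each is supported on the
single sequence `u.map σ.symm`, so one constant, fixed by the value at this sequence, makes them
equal. -/
theorem kact_cutW (σ : Equiv.Perm (Fin (r + 1))) {a : ℕ} {u : List (Fin (r + 1))}
    (hu : u ∈ labels (r + 1) (a + r + 1)) (hs : ∀ j, j ∈ u) : ∃ e : k, e * e = 1 ∧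
      kact dimParity σ (ofWord (cutW k u)) = e • ofWord (cutW k (u.map σ.symm)) := by
  obtain ⟨hu1, hu2⟩ := mem_labels.1 hu
  have hchain : ∀ (τ : Equiv.Perm (Fin (r + 1))) {u : List (Fin (r + 1))},
      u.IsChain (· ≠ ·) → (u.map τ).IsChain (· ≠ ·) := fun τ u h =>
    List.isChain_map_of_isChain τ (fun _ _ h => τ.injective.ne h) h
  have hs' : ∀ j, j ∈ u.map σ.symm := fun j => by
    rw [List.mem_map]; exact ⟨σ j, hs _, by simp⟩
  have hu' : u.map σ.symm ∈ labels (r + 1) (a + r + 1) :=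
    mem_labels.2 ⟨by rw [List.length_map, hu1], hchain _ hu2⟩
  obtain ⟨e, he, h1⟩ := toWord_kact σ (ofWord (cutW k u)) (genW (u.map σ.symm))
  have hsq := cutW_genW_self (k := k) u hu2 (by rintro rfl; simp at hu1)
  have hsq' := cutW_genW_self (k := k) (u.map σ.symm) (hchain _ hu2) (by
    rintro h; rw [List.map_eq_nil_iff] at h; subst h; simp at hu1)
  rw [genW_map, List.map_map, Equiv.self_comp_symm, List.map_id,
    toWord_cutW (guarded_genW.2 hs)] at h1
  refine ⟨e * cutW k u (genW u) * cutW k (u.map σ.symm) (genW (u.map σ.symm)), ?_, ?_⟩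
  · linear_combination (cutW k u (genW u) * cutW k u (genW u)) *
      (cutW k (u.map σ.symm) (genW (u.map σ.symm)) * cutW k (u.map σ.symm) (genW (u.map σ.symm))) * he +
      (cutW k (u.map σ.symm) (genW (u.map σ.symm)) * cutW k (u.map σ.symm) (genW (u.map σ.symm))) * hsq + hsq'
  set e' := e * cutW k u (genW u) * cutW k (u.map σ.symm) (genW (u.map σ.symm)) with he'
  have hdeg : ∀ {u : List (Fin (r + 1))}, u ∈ labels (r + 1) (a + r + 1) →
      HasDeg (ofWord (cutW k u)) a := fun hu => (homW_cutW_of_mem hu).hasDeg rfl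
  rw [← sub_eq_zero, sub_eq_add_neg, ← neg_one_smul k (e' • _)]
  have hl := (((cutW_isLinked (k := k) u).kact σ).add
    (((cutW_isLinked (k := k) (u.map σ.symm)).smul e').smul (-1)))
  refine eq_zero_of_genW hl (a := a) ?_ fun v hv => ?_
  · intro N S h
    by_cases h2 : kact dimParity σ (ofWord (cutW k u)) N S = 0
    · rw [Pi.add_apply, Pi.add_apply, h2, zero_add] at h
      exact hdeg hu' N S (right_ne_zero_of_mul (right_ne_zero_of_mul h))
    · exact (hdeg hu).kact σ N S h2
  · obtain ⟨hv1, hv2⟩ := mem_labels.1 hv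
    by_cases hg : Guarded (genW v)
    · have h2 : ∀ (x y : Kern k (Finset ℕ) (r + 1)) (w), toWord (x + (-1 : k) • e' • y) w =
          toWord x w - e' * toWord y w := fun x y w => by
        simp only [toWord, Pi.add_apply, Pi.smul_apply, smul_eq_mul]; ring
      rw [h2, toWord_cutW hg]
      by_cases hvu : u.map σ.symm = v
      · subst hvu
        rw [h1, he']
        linear_combination -(e * cutW k u (genW u)) * hsq'
      · obtain ⟨e₂, -, h3⟩ := toWord_kact σ (ofWord (cutW k u)) (genW v)
        have hne : u ≠ v.map σ := by
          rintro rfl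
          apply hvu
          rw [List.map_map, Equiv.symm_comp_self, List.map_id]
        rw [h3, genW_map, toWord_cutW (guarded_genW.2 fun j => by
          rw [List.mem_map]; exact ⟨σ.symm j, guarded_genW.1 hg _, by simp⟩),
          cutW_genW_of_ne (by rw [List.length_map, hv1, hu1]) (hchain σ hv2) hne,
          cutW_genW_of_ne (by rw [List.length_map, hv1, hu1]) hv2 hvu]
        ring
    · by_contra h3
      exact hg (toWord_supp hl.supp h3).2

/-- The basis elements of arity `r + 1` and degree `a`: the surjections without equal neighbours. -/
def Surj (r a : ℕ) : Type := {u : List (Fin (r + 1)) // u ∈ labels (r + 1) (a + r + 1) ∧ ∀ j, j ∈ u}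

/-- Surjections which differ by a permutation of the labels. -/
def surjSetoid (r a : ℕ) : Setoid (Surj r a) where
  r u u' := ∃ σ : Equiv.Perm (Fin (r + 1)), u.1.map σ = u'.1
  iseqv :=
    { refl := fun u => ⟨1, by simp⟩
      symm := fun {u u'} ⟨σ, h⟩ => ⟨σ.symm, by rw [← h, List.map_map]; simp⟩
      trans := fun {u u' u''} ⟨σ, h⟩ ⟨τ, h'⟩ => ⟨σ.trans τ, by rw [← h', ← h, List.map_map]; rfl⟩ }

/-- The symmetric group acts freely on surjective sequences; this is the source of freeness over the
group ring. -/
theorem perm_eq_of_map {u : List (Fin (r + 1))} (hu : ∀ j, j ∈ u)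
    {σ τ : Equiv.Perm (Fin (r + 1))} (h : u.map σ = u.map τ) : σ = τ :=
  Equiv.ext fun j => List.map_inj_left.1 h j (hu j)

/-- One surjection is chosen from each orbit. The translates of its cut function are, up to sign,
the cut functions of all surjections in the orbit, each occurring once, and evaluation on shortest
words gives independence and spanning. -/
theorem linkedOperad_free_succ (r a : ℕ) :
    ∃ (ι : Type u) (β : ι → (linkedOperad k).obj (r + 1)),
      LinearIndependent k (fun x : ι × Equiv.Perm (Fin (r + 1)) =>
        (linkedOperad k).act (r + 1) x.2 (β x.1)) ∧
      Submodule.span k (Set.range fun x : ι × Equiv.Perm (Fin (r + 1)) =>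
        (linkedOperad k).act (r + 1) x.2 (β x.1)) = (linkedOperad k).deg (r + 1) a := by
  let rep : Quotient (surjSetoid r a) → Surj r a := Quotient.out
  let idx : ULift.{u} (Quotient (surjSetoid r a)) × Equiv.Perm (Fin (r + 1)) →
    List (Fin (r + 1)) := fun x => (rep x.1.down).1.map x.2.symm
  let β : ULift.{u} (Quotient (surjSetoid r a)) → (linkedOperad k).obj (r + 1) := fun q =>
    ⟨ofWord (cutW k (rep q.down).1), cutW_isLinked _⟩
  let V := fun x : ULift.{u} (Quotient (surjSetoid r a)) × Equiv.Perm (Fin (r + 1)) =>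
    (linkedOperad k).act (r + 1) x.2 (β x.1)
  have hchain : ∀ (τ : Equiv.Perm (Fin (r + 1))) {u : List (Fin (r + 1))},
      u.IsChain (· ≠ ·) → (u.map τ).IsChain (· ≠ ·) := fun τ u h =>
    List.isChain_map_of_isChain τ (fun _ _ h => τ.injective.ne h) h
  have hinj : Function.Injective idx := by
    rintro ⟨⟨q⟩, σ⟩ ⟨⟨q'⟩, σ'⟩ h
    have h : (rep q).1.map σ.symm = (rep q').1.map σ'.symm := h
    have hq : q = q' := by
      rw [← Quotient.out_eq q, ← Quotient.out_eq q']
      refine Quotient.sound ⟨σ.symm.trans σ', ?_⟩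
      change (rep q).1.map (σ' ∘ σ.symm) = (rep q').1
      rw [← List.map_map, h, List.map_map]
      simp
    subst hq
    have := perm_eq_of_map (rep q).2.2 h
    rw [← Equiv.symm_symm σ, this, Equiv.symm_symm]
  have hidx : ∀ x, idx x ∈ labels (r + 1) (a + r + 1) ∧ ∀ j, j ∈ idx x := by
    intro x
    obtain ⟨h1, h2⟩ := mem_labels.1 (rep x.1.down).2.1
    refine ⟨mem_labels.2 ⟨by rw [List.length_map, h1], hchain _ h2⟩, fun j => ?_⟩
    rw [List.mem_map]
    exact ⟨x.2 j, (rep x.1.down).2.2 _, by simp⟩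
  have hsurj : ∀ u ∈ labels (r + 1) (a + r + 1), (∀ j, j ∈ u) → ∃ x, idx x = u := by
    intro u hu hs
    obtain ⟨σ, hσ⟩ := (Quotient.mk_out (s := surjSetoid r a) (⟨u, hu, hs⟩ : Surj r a))
    refine ⟨(⟨Quotient.mk (surjSetoid r a) ⟨u, hu, hs⟩⟩, σ.symm), ?_⟩
    exact hσ
  have hV : ∀ x, ∃ e : k, e * e = 1 ∧ (V x).1 = e • ofWord (cutW k (idx x)) := fun x =>
    kact_cutW x.2 (rep x.1.down).2.1 (rep x.1.down).2.2
  choose e he hV using hV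
  have hne : ∀ x, idx x ≠ [] := fun x h => by
    have := (hidx x).2 0
    rw [h] at this
    simp at this
  -- the values on the shortest words
  have hev : ∀ x, ∀ v ∈ labels (r + 1) (a + r + 1), (∀ j, j ∈ v) → toWord (V x).1 (genW v) =
      if idx x = v then e x * cutW k v (genW v) else 0 := by
    intro x v hv hs
    obtain ⟨hv1, hv2⟩ := mem_labels.1 hv
    have h1 : toWord (V x).1 (genW v) = e x * toWord (ofWord (cutW k (idx x))) (genW v) := by
      rw [hV, toWord, toWord, Pi.smul_apply, Pi.smul_apply, smul_eq_mul]; ring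
    rw [h1, toWord_cutW (guarded_genW.2 hs)]
    split_ifs with h
    · rw [h]
    · rw [cutW_genW_of_ne ((mem_labels.1 (hidx x).1).1.trans hv1.symm) hv2 h, mul_zero]
  let ev : List (Fin (r + 1)) → (linkedOperad k).obj (r + 1) →ₗ[k] k := fun v =>
    { toFun := fun c => toWord (show linkedKern k (r + 1) from c).1 (genW v)
      map_add' := fun c c' => mul_add _ _ _
      map_smul' := fun t c => mul_left_comm _ _ _ }
  refine ⟨_, β, linearIndependent_iff'.2 fun s g hg x hx => ?_, le_antisymm ?_ ?_⟩
  · have h1 := congrArg (ev (idx x)) hg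
    rw [map_zero, map_sum, Finset.sum_eq_single_of_mem x hx] at h1
    · rw [map_smul, smul_eq_mul] at h1
      have h2 : toWord (V x).1 (genW (idx x)) = e x * cutW k (idx x) (genW (idx x)) := by
        rw [hev x _ (hidx x).1 (hidx x).2, if_pos rfl]
      have h3 : g x * (e x * cutW k (idx x) (genW (idx x))) = 0 := by rw [← h2]; exact h1
      have h4 := cutW_genW_self (k := k) (idx x) (mem_labels.1 (hidx x).1).2 (hne x)
      linear_combination (e x * cutW k (idx x) (genW (idx x))) * h3 -
        g x * (cutW k (idx x) (genW (idx x)) * cutW k (idx x) (genW (idx x))) * he x - g x * h4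
    · intro y _ hy
      have h2 : toWord (V y).1 (genW (idx x)) = 0 := by
        rw [hev y _ (hidx x).1 (hidx x).2, if_neg (hinj.ne hy)]
      rw [map_smul, smul_eq_mul]
      exact mul_eq_zero_of_right _ h2
  · rw [Submodule.span_le]
    rintro _ ⟨x, rfl⟩
    exact (linkedOperad k).act_mem x.2
      (show HasDeg (ofWord (cutW k (rep x.1.down).1)) a from
        (homW_cutW_of_mem (rep x.1.down).2.1).hasDeg rfl)
  · intro c hc
    have hc' : HasDeg c.1 a := hc
    letI : Fintype (ULift.{u} (Quotient (surjSetoid r a)) × Equiv.Perm (Fin (r + 1))) :=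
      Fintype.ofInjective (fun x => (⟨idx x, (hidx x).1⟩ : labels (r + 1) (a + r + 1)))
        fun x y h => hinj (Subtype.ext_iff.1 h)
    -- The value of `V x` on its own shortest word squares to `1`, so multiplication by it inverts
    -- it. Thus `c'` has the same values as `c` on the shortest words.
    set c' : (linkedOperad k).obj (r + 1) := ∑ x,
      (ev (idx x) c * (e x * cutW k (idx x) (genW (idx x)))) • V x with hcdef
    have hmem : ∀ y, V y ∈ (linkedOperad k).deg (r + 1) a := fun y =>
      (linkedOperad k).act_mem y.2 (show HasDeg (ofWord (cutW k (rep y.1.down).1)) a from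
        (homW_cutW_of_mem (rep y.1.down).2.1).hasDeg rfl)
    have hc'mem : c' ∈ (linkedOperad k).deg (r + 1) a := Submodule.sum_mem _ fun u _ =>
      Submodule.smul_mem _ _ (hmem _)
    have h0 : c - c' = 0 := by
      apply Subtype.ext
      refine eq_zero_of_genW (show linkedKern k (r + 1) from c - c').2 (a := a) (sub_mem hc hc'mem)
        fun v hv => ?_
      by_cases hs : ∀ j, j ∈ v
      · change ev v (c - c') = 0
        obtain ⟨x, rfl⟩ := hsurj v hv hs
        rw [map_sub, hcdef, map_sum, Finset.sum_eq_single x]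
        · have h2 : ev (idx x) (V x) = e x * cutW k (idx x) (genW (idx x)) := by
            have := hev x _ hv hs
            rwa [if_pos rfl] at this
          rw [map_smul, smul_eq_mul, h2]
          have h4 := cutW_genW_self (k := k) (idx x) (mem_labels.1 hv).2 (hne x)
          linear_combination -(ev (idx x) c * (cutW k (idx x) (genW (idx x)) *
            cutW k (idx x) (genW (idx x)))) * he x - ev (idx x) c * h4
        · intro y _ hy
          have h2 : ev (idx x) (V y) = 0 := by
            have := hev y _ hv hs
            rwa [if_neg (hinj.ne hy)] at this
          rw [map_smul, h2, smul_zero]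
        · intro h
          exact absurd (Finset.mem_univ _) h
      · by_contra h
        exact hs (guarded_genW.1 (toWord_supp (show linkedKern k (r + 1) from c - c').2.supp h).2)
    rw [sub_eq_zero.1 h0]
    exact Submodule.sum_mem _ fun u _ => Submodule.smul_mem _ _ (Submodule.subset_span ⟨_, rfl⟩)

end Free
end EInf

namespace EInf

/-! ### The operations of arity two and the `E_∞` property -/

section Binary
variable {k : Type u} [CommRing k]

/-- The alternating sequences of the labels `0` and `1`. -/
def alt : Fin 2 → ℕ → List (Fin 2)
  | _, 0 => []
  | x, n + 1 => x :: alt (x + 1) n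

theorem add_one_ne (x : Fin 2) : x ≠ x + 1 := by revert x; decide

theorem add_one_add_one (x : Fin 2) : x + 1 + 1 = x := by revert x; decide

theorem length_alt (x : Fin 2) (n : ℕ) : (alt x n).length = n := by
  induction n generalizing x with
  | zero => rfl
  | succ n ih => simp [alt, ih]

theorem alt_mem_labels (x : Fin 2) (n : ℕ) : alt x n ∈ labels 2 n := by
  refine mem_labels.2 ⟨length_alt x n, ?_⟩
  induction n generalizing x with
  | zero => exact List.IsChain.nil
  | succ n ih =>
    cases n with
    | zero => exact List.isChain_singleton _
    | succ n => exact List.isChain_cons_cons.2 ⟨add_one_ne x, ih (x + 1)⟩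

theorem mem_alt (x : Fin 2) (n : ℕ) (j : Fin 2) : j ∈ alt x (n + 2) := by
  simp only [alt, List.mem_cons]
  have : j = x ∨ j = x + 1 := by revert j x; decide
  tauto

theorem alt_map_swap (x : Fin 2) (n : ℕ) : (alt x n).map (Equiv.swap (0 : Fin 2) 1) = alt (x + 1) n := by
  have h : ∀ x : Fin 2, Equiv.swap (0 : Fin 2) 1 x = x + 1 := by decide
  induction n generalizing x with
  | zero => rfl
  | succ n ih => rw [alt, alt, List.map_cons, ih, h]

/-- The function on words of the alternating sequence of length `m + 1`. -/
def altW (k : Type u) [CommRing k] (x : Fin 2) (m : ℕ) : Word 2 → k := cutW k (alt x (m + 1))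

theorem altW_zero (x : Fin 2) : altW k x 0 = constW k x := rfl

theorem altW_succ (x : Fin 2) (m : ℕ) : altW k x (m + 1) = prep x (altW k (x + 1) m) := rfl

theorem altW_good (x : Fin 2) (m : ℕ) : Good (altW k x m) := Good.cutW _

theorem altW_homW (x : Fin 2) (m : ℕ) : HomW (altW k x m) m :=
  homW_cutW_of_mem (alt_mem_labels x (m + 1))

/-- Prepending the label that already comes first is degenerate: a nonzero value would require `altW
k x m` not to vanish on a word whose first letter lacks `x`. -/
theorem prep_altW (x : Fin 2) (m : ℕ) (w : Word 2) : prep x (altW k x m) w = 0 := by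
  by_contra h
  obtain ⟨n, X, w', hX, hx, -, h1⟩ := prep_ne_zero h
  cases m with
  | zero =>
    obtain ⟨n, hn⟩ := constW_ne_zero h1
    rw [List.replicate_succ] at hn
    rw [(List.cons.inj hn).1] at hx
    simp at hx
  | succ m => exact h1 (prep_of_notMem _ _ hx)

/-- The homotopy formula is applied recursively. Of the two terms of the previous differential,
`prep x` kills the one starting with `x` and turns the other into `altW k x`. For `m = 0` the second
term comes from the constant in the formula. -/
theorem wd_altW (x : Fin 2) (m : ℕ) (w : Word 2) : wd (altW k x (m + 1)) w =
    altW k (x + 1) m w + (-1) ^ (m + 1) * altW k x m w := by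
  rw [altW_succ, (altW_good (x + 1) m).wd_prep]
  cases m with
  | zero =>
    have h1 : ∑ l, altW k (x + 1) 0 [{l}] = 1 := by
      rw [Finset.sum_eq_single (x + 1)]
      · simp [altW_zero, constW]
      · intro l _ hl
        simp [altW_zero, constW, hl]
      · simp
    have h2 : prep x (wd (altW k (x + 1) 0)) w = 0 := by
      by_contra h
      obtain ⟨n, X, w', hX, hx, -, h1⟩ := prep_ne_zero h
      rw [altW_zero, wd_constW] at h1
      split_ifs at h1 with h3
      · rw [(List.cons.inj h3).1] at hX
        exact absurd hX (by simp)
      · exact h1 rfl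
    rw [h1, h2, altW_zero x]
    ring
  | succ m =>
    have h1 : ∑ l, altW k (x + 1) (m + 1) [{l}] = 0 := by
      refine Finset.sum_eq_zero fun l _ => ?_
      by_contra h
      have := altW_homW _ _ _ h
      simp at this
    have h2 : wd (altW k (x + 1) (m + 1)) =
        altW k x m + ((-1) ^ (m + 1) : k) • altW k (x + 1) m := by
      funext w'
      have := wd_altW (x + 1) m w'
      rw [add_one_add_one] at this
      exact this
    rw [h1, h2, prep_add, prep_altW, prep_smul, ← altW_succ, pow_succ (-1 : k) (m + 1)]
    ring

/-- The kernels of the operations of arity two. -/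
def altKern (k : Type u) [CommRing k] (x : Fin 2) (i : ℕ) : Kern k (Finset ℕ) 2 :=
  ofWord (altW k x (i + 1))

theorem altKern_isLinked (x : Fin 2) (i : ℕ) : IsLinked (altKern k x i) := cutW_isLinked _

theorem altKern_hasDeg (x : Fin 2) (i : ℕ) : HasDeg (altKern k x i) i :=
  (altW_homW x (i + 1)).hasDeg rfl

theorem dk_altKern (x : Fin 2) (i : ℕ) : dk (altKern k x (i + 1)) =
    altKern k (x + 1) i + (-1 : k) ^ i • altKern k x i := by
  have hl := (altKern_isLinked (k := k) (x + 1) i).add ((altKern_isLinked (k := k) x i).smul ((-1) ^ i))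
  refine dk_ofWord hl.supp hl.natural fun w hw => ?_
  have h1 : toWord (altKern k (x + 1) i + (-1 : k) ^ i • altKern k x i) w =
      toWord (altKern k (x + 1) i) w + (-1) ^ i * toWord (altKern k x i) w := by
    simp only [toWord, Pi.add_apply, Pi.smul_apply, smul_eq_mul]; ring
  rw [wd_altW, h1, altKern, altKern, toWord_ofWord hw.ne_nil hw, toWord_ofWord hw.ne_nil hw]
  ring

theorem aug_altKern : aug (altKern k 0 0) = 1 ∧ aug (altKern k 1 0) = -1 := by
  have h1 : wsign {0} (fun _ : Fin 2 => ({0} : Finset ℕ)) = 0 := by decide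
  have h2 : word {0} (fun _ : Fin 2 => ({0} : Finset ℕ)) = [Finset.univ] := by simp [word]
  have h3 : ∀ x : Fin 2, aug (altKern k x 0) = prep x (constW k (x + 1)) [Finset.univ] := by
    intro x
    rw [aug, altKern, ofWord, if_pos (by simp), h1, h2, sgn_zero, one_mul]
    rfl
  have h4 : (Finset.univ : Finset (Fin 2)) = insert 0 {1} := rfl
  have h5 : (Finset.univ : Finset (Fin 2)) = insert 1 {0} := by decide
  constructor
  · rw [h3, h4, prep_insert _ _ (by simp) (by simp), show below {(1 : Fin 2)} 0 = 0 from rfl]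
    simp [constW]
  · rw [h3, h5, prep_insert _ _ (by simp) (by simp), show below {(0 : Fin 2)} 1 = 1 from rfl]
    simp [constW]

/-- The swap exchanges the two alternating kernels up to a scalar. For `i = 0` the scalar is read
off from the augmentation. In the inductive step the differential is applied to both sides, and the
values at one shortest word are compared. -/
theorem kact_altKern (i : ℕ) :
    kact dimParity (Equiv.swap 0 1) (altKern k 0 i) = - altKern k 1 i := by
  have hex : ∀ i, ∃ e : k,
      kact dimParity (Equiv.swap 0 1) (altKern k 0 i) = e • altKern k 1 i := by
    intro i
    obtain ⟨e, -, h⟩ := kact_cutW (k := k) (Equiv.swap (0 : Fin 2) 1) (a := i)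
      (alt_mem_labels 0 (i + 2)) (mem_alt 0 i)
    exact ⟨e, by rw [Equiv.symm_swap, alt_map_swap] at h; exact h⟩
  induction i with
  | zero =>
    obtain ⟨e, he⟩ := hex 0
    have h1 := congrArg aug he
    rw [aug_kact, aug_altKern.1] at h1
    have h2 : aug (e • altKern k 1 0) = e * aug (altKern k 1 0) := rfl
    rw [h2, aug_altKern.2] at h1
    rw [he, show e = -1 by linear_combination h1, neg_one_smul]
  | succ i ih =>
    obtain ⟨e, he⟩ := hex (i + 1)
    have h1 := congrArg dk he
    have ih' : kact dimParity (Equiv.swap 0 1) (altKern k 1 i) = - altKern k 0 i := by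
      have h2 := kact_mul dimParity (Equiv.swap 0 1) (Equiv.swap 0 1) (altKern k 0 i)
      rw [Equiv.swap_mul_self, kact_one, ih] at h2
      have h3 : kact dimParity (Equiv.swap 0 1) (-altKern k 1 i) =
          - kact dimParity (Equiv.swap 0 1) (altKern k 1 i) := by
        funext N S; exact mul_neg _ _
      rw [h3] at h2
      rw [h2, neg_neg]
    have h4 : kact dimParity (Equiv.swap 0 1) (altKern k 1 i + (-1 : k) ^ i • altKern k 0 i) =
        - altKern k 0 i - (-1 : k) ^ i • altKern k 1 i := by
      have h5 : kact dimParity (Equiv.swap 0 1) (altKern k 1 i + (-1 : k) ^ i • altKern k 0 i) =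
          kact dimParity (Equiv.swap 0 1) (altKern k 1 i) +
            (-1 : k) ^ i • kact dimParity (Equiv.swap 0 1) (altKern k 0 i) := by
        funext N S
        simp only [kact, Pi.add_apply, Pi.smul_apply, smul_eq_mul]; ring
      rw [h5, ih, ih', smul_neg, sub_eq_add_neg]
    rw [dk_kact, dk_altKern, map_smul, dk_altKern, zero_add, h4] at h1
    have hg : Guarded (genW (alt 0 (i + 2))) := guarded_genW.2 (mem_alt 0 i)
    have h5 := congrFun (congrArg toWord h1) (genW (alt 0 (i + 2)))
    have h6 : ∀ (a b : k) (c c' : Kern k (Finset ℕ) 2) w, toWord (a • c + b • c') w =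
        a * toWord c w + b * toWord c' w := by
      intro a b c c' w
      simp only [toWord, Pi.add_apply, Pi.smul_apply, smul_eq_mul]; ring
    have h7 : - altKern k 0 i - (-1 : k) ^ i • altKern k 1 i =
        (-1 : k) • altKern k 0 i + (-(-1) ^ i : k) • altKern k 1 i := by
      rw [neg_one_smul, neg_smul, sub_eq_add_neg]
    have h8 : e • (altKern k (1 + 1) i + (-1 : k) ^ i • altKern k 1 i) =
        e • altKern k 0 i + (e * (-1) ^ i : k) • altKern k 1 i := by
      rw [smul_add, smul_smul]; rfl
    have h9 : toWord (altKern k 1 i) (genW (alt 0 (i + 2))) = 0 := by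
      rw [altKern, toWord_ofWord hg.ne_nil hg]
      exact cutW_genW_of_ne (by rw [length_alt, length_alt])
        (mem_labels.1 (alt_mem_labels 0 (i + 2))).2 (by simp [alt])
    have h10 : toWord (altKern k 0 i) (genW (alt 0 (i + 2))) =
        cutW k (alt 0 (i + 2)) (genW (alt 0 (i + 2))) := toWord_cutW hg
    have h11 := cutW_genW_self (k := k) (alt 0 (i + 2))
      (mem_labels.1 (alt_mem_labels 0 (i + 2))).2 (by simp [alt])
    rw [h7, h8, h6, h6, h9, h10] at h5
    have h12 : e = -1 := by
      linear_combination (-cutW k (alt 0 (i + 2)) (genW (alt 0 (i + 2)))) * h5 + (-1 - e) * h11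
    rw [he, h12, neg_one_smul]

variable (k) in
/-- The operations of arity two which give rise to the cup products. -/
def cupOp (i : ℕ) : (linkedOperad k).obj 2 :=
  ⟨(-1 : k) ^ i • altKern k 0 i, (altKern_isLinked 0 i).smul _⟩

theorem cupOp_mem (i : ℕ) : cupOp k i ∈ (linkedOperad k).deg 2 i :=
  Submodule.smul_mem (linkedDeg k 2 i) ((-1 : k) ^ i)
    (show (⟨altKern k 0 i, altKern_isLinked 0 i⟩ : linkedKern k 2) ∈ linkedDeg k 2 i from
      altKern_hasDeg 0 i)

/-- The factor `(-1)^i` in `cupOp` compensates the minus sign in `kact_altKern`. -/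
theorem d_cupOp (i : ℕ) : (linkedOperad k).d 2 (cupOp k (i + 1)) =
    (linkedOperad k).act 2 (Equiv.swap 0 1) (cupOp k i) + (-1 : k) ^ (i + 1) • cupOp k i := by
  apply Subtype.ext
  change dk ((-1 : k) ^ (i + 1) • altKern k 0 (i + 1)) =
    kact dimParity (Equiv.swap 0 1) ((-1 : k) ^ i • altKern k 0 i) +
      (-1 : k) ^ (i + 1) • (-1 : k) ^ i • altKern k 0 i
  have h1 : kact dimParity (Equiv.swap 0 1) ((-1 : k) ^ i • altKern k 0 i) =
      (-1 : k) ^ i • kact dimParity (Equiv.swap 0 1) (altKern k 0 i) := by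
    funext N S; exact mul_left_comm _ _ _
  rw [map_smul, dk_altKern, h1, kact_altKern, zero_add, smul_add, smul_neg, pow_succ, mul_neg_one,
    neg_smul, neg_smul]

theorem linkedAug_cupOp : linkedAug 2 (cupOp k 0) = 1 := by
  change (-1 : k) ^ 0 * aug (altKern k 0 0) = 1
  rw [aug_altKern.1, pow_zero, one_mul]

/-- Iterated cup-`0` products, starting from the unit, have augmentation one. -/
theorem exists_aug_eq_one (r : ℕ) :
    ∃ x : Kern k (Finset ℕ) r, IsLinked x ∧ HasDeg x 0 ∧ aug x = 1 := by
  induction r with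
  | zero => exact ⟨unitKern, unitKern_isLinked, unitKern_hasDeg, aug_unitKern⟩
  | succ r ih =>
    obtain ⟨x, hx, hdx, hax⟩ := ih
    refine ⟨kcomp (r := 2) (s := r) (n := r + 1) dimParity (by omega) 0 (altKern k 0 0) x,
      (altKern_isLinked 0 0).kcomp _ _ hx, ?_, ?_⟩
    · simpa using (altKern_hasDeg 0 0).kcomp (n := r + 1) (by omega) 0 hdx
    · rw [aug_kcomp _ _ hx.supp, aug_altKern.1, hax, one_mul]

/-- The primitive from `exists_dk_eq` may be inhomogeneous. Its part of degree `a + 1` is already a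
primitive, since the differential is homogeneous. -/
theorem exists_dk_eq_of_hasDeg {r a : ℕ} {c : Kern k (Finset ℕ) r} (hc : IsLinked c)
    (hdeg : HasDeg c a) (hd : dk c = 0) (ha : aug c = 0) :
    ∃ y : Kern k (Finset ℕ) r, IsLinked y ∧ HasDeg y (a + 1 : ℕ) ∧ dk y = c := by
  obtain ⟨y, hy, rfl, -⟩ := exists_dk_eq c hc hd ha
  refine ⟨degPart ((a + 1 : ℕ) : ℤ) y, hy.degPart (a + 1), degPart_hasDeg _ y, hy.dk_degPart ?_⟩
  rwa [Nat.cast_add, Nat.cast_one, add_sub_cancel_right]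

theorem linkedOperad_free_zero (a : ℕ) :
    ∃ (ι : Type u) (β : ι → (linkedOperad k).obj 0),
      LinearIndependent k (fun x : ι × Equiv.Perm (Fin 0) =>
        (linkedOperad k).act 0 x.2 (β x.1)) ∧
      Submodule.span k (Set.range fun x : ι × Equiv.Perm (Fin 0) =>
        (linkedOperad k).act 0 x.2 (β x.1)) = (linkedOperad k).deg 0 a := by
  have hgen : ∀ c : linkedKern k 0, c = aug c.1 • (⟨unitKern, unitKern_isLinked⟩ : linkedKern k 0) :=
    fun c => Subtype.ext (eq_smul_unitKern c.2.supp c.2.natural c.2.linked)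
  rcases Nat.eq_zero_or_pos a with rfl | ha
  · refine ⟨PUnit, fun _ => (⟨unitKern, unitKern_isLinked⟩ : linkedKern k 0), ?_, ?_⟩
    · refine linearIndependent_iff'.2 fun s g hg x hx => ?_
      have h1 := congrArg (linkedAug (k := k) 0) hg
      rw [map_zero, map_sum, Finset.sum_eq_single_of_mem x hx
        fun y _ hy => absurd (Subsingleton.elim y x) hy, map_smul, smul_eq_mul] at h1
      have h2 : aug (kact dimParity x.2 (unitKern (k := k))) = 1 := by rw [aug_kact, aug_unitKern]
      have h3 : g x * aug (kact dimParity x.2 (unitKern (k := k))) = 0 := h1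
      rwa [h2, mul_one] at h3
    · refine le_antisymm ?_ ?_
      · rw [Submodule.span_le]
        rintro _ ⟨x, rfl⟩
        exact (linkedOperad k).act_mem x.2 (show HasDeg (unitKern (k := k)) 0 from unitKern_hasDeg)
      · intro c _
        have h1 := hgen c
        rw [h1]
        refine Submodule.smul_mem _ _ (Submodule.subset_span ⟨(PUnit.unit, 1), ?_⟩)
        exact (linkedOperad k).act_one _
  · refine ⟨PEmpty, fun x => x.elim, linearIndependent_empty_type, ?_⟩
    rw [Set.range_eq_empty, Submodule.span_empty]
    refine le_antisymm bot_le fun c hc => ?_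
    have h1 : aug (show linkedKern k 0 from c).1 = 0 :=
      aug_of_hasDeg (show HasDeg (show linkedKern k 0 from c).1 a from hc) (by omega)
    have h2 := hgen c
    rw [h1, zero_smul] at h2
    exact h2

theorem linkedOperad_isEInfinity : (linkedOperad k).IsEInfinity linkedAug where
  aug_one := aug_linkedOne
  aug_act σ x := aug_kact σ x.1
  aug_comp h i x y := aug_kcomp h i y.2.supp
  aug_pos {r a x} hx := aug_of_hasDeg (show HasDeg x.1 (a + 1 : ℕ) from hx) (by omega)
  aug_d x := aug_dk x.2.supp
  aug_surj r := by
    obtain ⟨x, h1, h2, h3⟩ := exists_aug_eq_one (k := k) r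
    exact ⟨⟨x, h1⟩, h2, h3⟩
  exact_zero {r x} hx ha := by
    have hd : dk x.1 = 0 := congrArg Subtype.val ((linkedOperad k).d_zero hx)
    obtain ⟨y, h1, h2, h3⟩ := exists_dk_eq_of_hasDeg x.2 (a := 0) hx hd ha
    exact ⟨⟨y, h1⟩, h2, Subtype.ext h3⟩
  exact_succ {r a x} hx hd := by
    obtain ⟨y, h1, h2, h3⟩ := exists_dk_eq_of_hasDeg x.2 (a := a + 1) hx (congrArg Subtype.val hd)
      (aug_of_hasDeg (show HasDeg x.1 (a + 1 : ℕ) from hx) (by omega))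
    exact ⟨⟨y, h1⟩, h2, Subtype.ext h3⟩
  free r a := by
    cases r with
    | zero => exact linkedOperad_free_zero a
    | succ r => exact linkedOperad_free_succ r a

end Binary
end EInf

namespace EInf

/-! ### The kernels of the cup products -/

section CupKernel
variable {k : Type u} [CommRing k]

/-- The word of a decomposition into intervals with alternating labels, the first of which is `x`. -/
def CutWord : Fin 2 → Word 2 → Prop
  | _, [] => True
  | x, T :: w => (T = {x} ∧ CutWord x w) ∨ (T = Finset.univ ∧ CutWord (x + 1) w)

/-- The value of `altW` on its support. -/
def altSign (k : Type u) [CommRing k] : Fin 2 → ℕ → k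
  | _, 0 => 1
  | x, m + 1 => (-1) ^ (x : ℕ) * altSign k (x + 1) m

theorem univ_ne_singleton (x : Fin 2) : (Finset.univ : Finset (Fin 2)) ≠ {x} := by
  revert x; decide

theorem prep_univ (x : Fin 2) (c : Word 2 → k) (w : Word 2) :
    prep x c (Finset.univ :: w) = (-1) ^ (x : ℕ) * c ({x + 1} :: w) := by
  have h1 : (Finset.univ : Finset (Fin 2)) = insert x {x + 1} := by revert x; decide
  have h2 : below {x + 1} x = (x : ℕ) := by revert x; decide
  rw [h1, prep_insert _ _ (by simpa using add_one_ne x) (by simp), h2]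

theorem altW_singleton_cons (x : Fin 2) (m : ℕ) {w : Word 2} (hw : w ≠ []) :
    altW k x m ({x} :: w) = altW k x m w := by
  cases m with
  | zero => rw [altW_zero, constW, if_pos rfl, if_neg hw]
  | succ m => rw [altW_succ, prep_singleton]

-- After a leading `{x}` the value depends only on the interval structure. Each letter is the
-- singleton of the current label or the full set; a full letter marks a cut point, where the label
-- changes.
open Classical in
theorem altW_cons (x : Fin 2) (m : ℕ) (w : Word 2) : altW k x m ({x} :: w) =
    if CutWord x w ∧ w.count Finset.univ = m then altSign k x m else 0 := by
  induction w generalizing x m with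
  | nil =>
    cases m with
    | zero => simp [altW_zero, constW, CutWord, altSign]
    | succ m => rw [altW_succ, prep_singleton]; simp [prep]
  | cons T w ih =>
    rw [altW_singleton_cons _ _ (List.cons_ne_nil _ _)]
    by_cases h1 : T = {x}
    · subst h1
      have h2 : ({x} : Finset (Fin 2)) ≠ Finset.univ := (univ_ne_singleton x).symm
      rw [ih, List.count_cons_of_ne h2]
      simp [CutWord, h2]
    by_cases h2 : T = Finset.univ
    · subst h2
      rw [List.count_cons_self]
      simp only [CutWord, univ_ne_singleton, false_and, true_and, false_or]
      cases m with
      | zero => rw [altW_zero, constW, if_neg h1]; simp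
      | succ m =>
        rw [altW_succ, prep_univ, ih, mul_ite, mul_zero]
        simp only [add_left_inj]
        rfl
    · simp only [CutWord, h1, h2, false_and, false_or, if_false]
      cases m with
      | zero => rw [altW_zero, constW, if_neg h1]
      | succ m =>
        refine prep_of_notMem _ _ fun h3 => ?_
        have h4 : ∀ (x : Fin 2) (T : Finset (Fin 2)), x ∈ T → T = {x} ∨ T = Finset.univ := by
          decide
        exact (h4 x T h3).elim h1 h2

theorem altSign_zero (m : ℕ) : altSign k 0 m = (-1) ^ (m / 2) := by
  induction m using Nat.twoStepInduction with
  | zero => simp [altSign]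
  | one => simp [altSign]
  | more m ih _ =>
    rw [altSign, altSign, add_one_add_one, ih, Nat.add_div_right _ two_pos, pow_succ]
    simp

/-- The label of an interval with a given number. -/
def labelAt (x : Fin 2) (c : ℕ) : Fin 2 := if Even c then x else x + 1

/-- The current label at a vertex is determined by the parity of the number of earlier cut points.
This local form is compared with `evenPart` and `oddPart`. -/
theorem cutWord_iff (x : Fin 2) (w : Word 2) : CutWord x w ↔ ∀ v < w.length,
    w.getD v ∅ = Finset.univ ∨ w.getD v ∅ = {labelAt x ((w.take v).count Finset.univ)} := by
  induction w generalizing x with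
  | nil => simp [CutWord]
  | cons T w ih =>
    have h0 : (∀ v < (T :: w).length, (T :: w).getD v ∅ = Finset.univ ∨
        (T :: w).getD v ∅ = {labelAt x (((T :: w).take v).count Finset.univ)}) ↔
        (T = Finset.univ ∨ T = {x}) ∧ ∀ v < w.length, w.getD v ∅ = Finset.univ ∨
          w.getD v ∅ = {labelAt x ((T :: w.take v).count Finset.univ)} := by
      constructor
      · intro h
        refine ⟨by simpa [labelAt] using h 0 (by simp), fun v hv => ?_⟩
        simpa using h (v + 1) (by simpa using hv)
      · rintro ⟨h1, h2⟩ v hv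
        cases v with
        | zero => simpa [labelAt] using h1
        | succ v => simpa using h2 v (by simpa using hv)
    rw [h0, CutWord, ih, ih]
    have hl : ∀ c, labelAt x (c + 1) = labelAt (x + 1) c := by
      intro c
      simp only [labelAt, Nat.even_add_one]
      split_ifs <;> first | rfl | rw [add_one_add_one]
    by_cases h1 : T = {x}
    · subst h1
      have h2 : ({x} : Finset (Fin 2)) ≠ Finset.univ := (univ_ne_singleton x).symm
      simp [h2, List.count_cons_of_ne h2]
    by_cases h2 : T = Finset.univ
    · subst h2
      simp [univ_ne_singleton, hl]
    · simp [h1, h2]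

theorem count_word_range (n v : ℕ) (hv : v ≤ n) (S : Fin 2 → Finset ℕ) :
    ((word (Finset.range n) S).take v).count Finset.univ =
      ((Finset.range v).filter (· ∈ S 0 ∩ S 1)).card := by
  rw [word, Finset.sort_range, ← List.map_take, List.take_range, min_eq_left hv]
  clear hv
  induction v with
  | zero => simp
  | succ v ih =>
    rw [List.range_succ, List.map_append, List.count_append, ih, Finset.range_add_one,
      Finset.filter_insert]
    have h1 : (Finset.univ.filter (v ∈ S ·) = Finset.univ) ↔ v ∈ S 0 ∩ S 1 := by
      simp [Finset.filter_eq_self]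
    split_ifs with h2
    · rw [Finset.card_insert_of_notMem (by simp)]
      simp [h1.2 h2]
    · rw [List.map_singleton, List.count_singleton, if_neg (by simpa using fun h => h2 (h1.1 h))]
      rfl

/-- The members of a family of two sets which is given by a set of cut points. -/
theorem cutWord_word {n : ℕ} {S : Fin 2 → Finset ℕ} (hS : ∀ j, S j ⊆ Finset.range n) :
    CutWord 0 (word (Finset.range n) S) ↔
      S 0 = (Finset.range n).filter (fun v => v ∈ S 0 ∩ S 1 ∨
        Even ((S 0 ∩ S 1).filter (· < v)).card) ∧
      S 1 = (Finset.range n).filter (fun v => v ∈ S 0 ∩ S 1 ∨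
        Odd ((S 0 ∩ S 1).filter (· < v)).card) := by
  have h0 : ∀ v < n, (Finset.range v).filter (· ∈ S 0 ∩ S 1) = (S 0 ∩ S 1).filter (· < v) := by
    intro v hv
    ext u; simp only [Finset.mem_filter, Finset.mem_range]; tauto
  have h1 : CutWord 0 (word (Finset.range n) S) ↔ ∀ v < n,
      v ∈ S 0 ∩ S 1 ∨ (v ∈ S 0 ∧ v ∉ S 1 ∧ Even ((S 0 ∩ S 1).filter (· < v)).card) ∨
        (v ∉ S 0 ∧ v ∈ S 1 ∧ Odd ((S 0 ∩ S 1).filter (· < v)).card) := by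
    rw [cutWord_iff, length_word, Finset.card_range]
    refine forall₂_congr fun v hv => ?_
    rw [count_word_range n v hv.le, h0 v hv]
    have h2 : (word (Finset.range n) S).getD v ∅ = Finset.univ.filter (v ∈ S ·) := by
      rw [List.getD_eq_getElem _ _ (by rwa [length_word, Finset.card_range])]
      simp [word]
    rw [h2, labelAt, ← Nat.not_even_iff_odd]
    simp only [Finset.ext_iff, Finset.mem_filter, Finset.mem_univ, true_and, Fin.forall_fin_two,
      Finset.mem_inter, Finset.mem_singleton, iff_true]
    by_cases hc : Even ((S 0 ∩ S 1).filter (· < v)).card <;> simp [hc]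
  rw [h1]
  constructor
  · intro h
    constructor
    · ext v
      rw [Finset.mem_filter, Finset.mem_range]
      constructor
      · intro hv
        have hn := Finset.mem_range.1 (hS 0 hv)
        have := h v hn
        tauto
      · rintro ⟨hn, hv⟩
        have := h v hn
        rw [← Nat.not_even_iff_odd] at this
        simp only [Finset.mem_inter] at this hv
        tauto
    · ext v
      rw [Finset.mem_filter, Finset.mem_range]
      constructor
      · intro hv
        have hn := Finset.mem_range.1 (hS 1 hv)
        have := h v hn
        tauto
      · rintro ⟨hn, hv⟩
        have := h v hn
        rw [← Nat.not_even_iff_odd] at this hv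
        simp only [Finset.mem_inter] at this hv
        tauto
  · rintro ⟨h2, h3⟩ v hv
    have h4 : v ∈ S 0 ↔ v ∈ S 0 ∩ S 1 ∨ Even ((S 0 ∩ S 1).filter (· < v)).card := by
      conv_lhs => rw [h2]
      simp only [Finset.mem_filter, Finset.mem_range, hv, true_and]
    have h5 : v ∈ S 1 ↔ v ∈ S 0 ∩ S 1 ∨ Odd ((S 0 ∩ S 1).filter (· < v)).card := by
      conv_lhs => rw [h3]
      simp only [Finset.mem_filter, Finset.mem_range, hv, true_and]
    rw [← Nat.not_even_iff_odd] at h5 ⊢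
    simp only [Finset.mem_inter] at h4 h5 ⊢
    tauto

theorem sum_card_filter_lt (U : Finset ℕ) :
    ∑ y ∈ U, (U.filter (· < y)).card = U.card.choose 2 := by
  induction U using Finset.induction_on_max with
  | empty => simp
  | insert a s h ih =>
    have ha : a ∉ s := fun h' => lt_irrefl a (h a h')
    rw [Finset.sum_insert ha, Finset.card_insert_of_notMem ha, Nat.choose_succ_succ', ← ih,
      Nat.choose_one_right, Finset.filter_insert, if_neg (lt_irrefl a), Finset.filter_true_of_mem h]
    congr 1
    refine Finset.sum_congr rfl fun y hy => ?_
    rw [Finset.filter_insert, if_neg (h y hy).not_gt]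

/-- The sign which compares kernels and functions on words, for two sets which cover. -/
theorem wsign_two {N : Finset ℕ} {S : Fin 2 → Finset ℕ} (hS : ∀ j, S j ⊆ N)
    (hcov : ∀ x ∈ N, x ∈ S 0 ∨ x ∈ S 1) : wsign N S =
      ((N ×ˢ N).filter (fun z => z.1 ∈ S 1 \ S 0 ∧ z.2 ∈ S 0 \ S 1 ∧ z.1 < z.2)).card +
      (S 0 \ S 1).card * (S 0 ∩ S 1).card + (S 0 ∩ S 1).card.choose 2 + (S 0 ∩ S 1).card +
      (S 1).card + N.card + 1 := by
  -- With indicator functions every cardinality becomes a single or double sum over `N`. The sign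
  -- comparison then reduces to a polynomial identity at each pair of vertices.
  let s : ℕ → ZMod 2 := fun x => if x ∈ S 0 then 1 else 0
  let t : ℕ → ZMod 2 := fun x => if x ∈ S 1 then 1 else 0
  let L : ℕ → ℕ → ZMod 2 := fun x y => if x < y then 1 else 0
  have hs : ∀ f : ℕ → ZMod 2, ∑ x ∈ S 0, f x = ∑ x ∈ N, s x * f x := by
    intro f
    simp only [s, ite_mul, one_mul, zero_mul]
    rw [← Finset.sum_filter, Finset.filter_mem_eq_inter, Finset.inter_eq_right.2 (hS 0)]
  have ht : ∀ f : ℕ → ZMod 2, ∑ x ∈ S 1, f x = ∑ x ∈ N, t x * f x := by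
    intro f
    simp only [t, ite_mul, one_mul, zero_mul]
    rw [← Finset.sum_filter, Finset.filter_mem_eq_inter, Finset.inter_eq_right.2 (hS 1)]
  have hst : ∀ f : ℕ → ZMod 2, ∑ x ∈ S 0 ∩ S 1, f x = ∑ x ∈ N, s x * (t x * f x) := by
    intro f
    rw [← hs]
    simp only [t, ite_mul, one_mul, zero_mul]
    rw [← Finset.sum_filter, Finset.filter_mem_eq_inter]
  have hsd : ∀ f : ℕ → ZMod 2, ∑ x ∈ S 0 \ S 1, f x = ∑ x ∈ N, s x * ((1 + t x) * f x) := by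
    intro f
    rw [← hs, ← Finset.filter_notMem_eq_sdiff, Finset.sum_filter]
    refine Finset.sum_congr rfl fun x _ => ?_
    by_cases h : x ∈ S 1
    · have : (1 + 1 : ZMod 2) = 0 := rfl
      simp [t, h, this]
    · simp [t, h]
  have hN : ∀ x, ((N.filter (x < ·)).card : ZMod 2) = ∑ y ∈ N, L x y := by
    intro x; simp only [L, Finset.sum_boole]
  have hinv : (((N ×ˢ N).filter
      (fun z => z.1 ∈ S 1 \ S 0 ∧ z.2 ∈ S 0 \ S 1 ∧ z.1 < z.2)).card : ZMod 2) =
      ∑ x ∈ N, ∑ y ∈ N, L x y * (t x * (1 + s x) * (s y * (1 + t y))) := by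
    rw [← Finset.sum_product', Finset.natCast_card_filter]
    refine Finset.sum_congr rfl fun z _ => ?_
    have : (1 + 1 : ZMod 2) = 0 := rfl
    simp only [L, s, t, Finset.mem_sdiff]
    by_cases h1 : z.1 ∈ S 0 <;> by_cases h2 : z.1 ∈ S 1 <;> by_cases h3 : z.2 ∈ S 0 <;>
      by_cases h4 : z.2 ∈ S 1 <;> simp [h1, h2, h3, h4, this]
  have hcard : ∀ U : Finset ℕ, (U.card : ZMod 2) = ∑ x ∈ U, 1 := by simp
  have hch : (((S 0 ∩ S 1).card.choose 2 : ℕ) : ZMod 2) =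
      ∑ x ∈ N, ∑ y ∈ N, L x y * (s x * t x * (s y * t y)) := by
    rw [← sum_card_filter_lt, Nat.cast_sum, hst, Finset.sum_comm]
    refine Finset.sum_congr rfl fun y _ => ?_
    rw [Finset.natCast_card_filter, hst, Finset.mul_sum, Finset.mul_sum]
    refine Finset.sum_congr rfl fun x _ => ?_
    simp only [L]; ring
  have hmul : (((S 0 \ S 1).card : ZMod 2) * (S 0 ∩ S 1).card) =
      ∑ x ∈ N, ∑ y ∈ N, L x y * (s x * (1 + t x) * (s y * t y)) +
      ∑ x ∈ N, ∑ y ∈ N, L x y * (s x * t x * (s y * (1 + t y))) := by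
    rw [Finset.sum_comm (f := fun x y => L x y * (s x * t x * (s y * (1 + t y)))),
      ← Finset.sum_add_distrib, hcard, hcard, hsd, hst, Finset.sum_mul_sum]
    refine Finset.sum_congr rfl fun x _ => ?_
    rw [← Finset.sum_add_distrib]
    refine Finset.sum_congr rfl fun y _ => ?_
    have h1 : ∀ a b : ZMod 2, b * a * (1 + a) = 0 := by decide
    rcases lt_trichotomy x y with h | h | h
    · simp only [L, h, h.not_gt, if_true, if_false]; ring
    · subst h
      simp only [L, lt_irrefl, if_false]
      linear_combination s x * h1 (t x) (s x)
    · simp only [L, h, h.not_gt, if_true, if_false]; ring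
  have hc0 : ∀ x y : ℕ, crossing (⟨0, x⟩ : Σ _ : Fin 2, ℕ) ⟨0, y⟩ = L x y := by
    intro x y; simp [crossing, L]
  have hc1 : ∀ x y : ℕ, crossing (⟨1, x⟩ : Σ _ : Fin 2, ℕ) ⟨1, y⟩ = L x y := by
    intro x y; simp [crossing, L]
  have hc2 : ∀ x y : ℕ, crossing (⟨1, x⟩ : Σ _ : Fin 2, ℕ) ⟨0, y⟩ = 0 := by
    intro x y; simp [crossing]
  have hc3 : ∀ x y : ℕ, crossing (⟨0, x⟩ : Σ _ : Fin 2, ℕ) ⟨1, y⟩ =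
      L x y + if x = y then 1 else 0 := by
    intro x y
    simp only [crossing, L]
    rcases lt_trichotomy x y with h | h | h
    · simp [h, h.le, h.ne]
    · simp [h]
    · simp [h.not_gt, h.not_ge, h.ne']
  have hm : ((S 0 ∩ S 1).card : ZMod 2) = ∑ x ∈ N, ∑ y ∈ N, if x = y then s x * t y else 0 := by
    rw [hcard, hst]
    refine Finset.sum_congr rfl fun x hx => ?_
    rw [Finset.sum_ite_eq, if_pos hx, mul_one]
  -- The identity uses that every vertex is covered, so only finitely many cases modulo two have to
  -- be checked.
  have hfin : ∀ x ∈ N, ∀ y ∈ N, L x y * (s x + t x + s x * s y + t x * t y + s x * t y +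
      (t x * (1 + s x) * (s y * (1 + t y)) + s x * (1 + t x) * (s y * t y) +
        s x * t x * (s y * (1 + t y)) + s x * t x * (s y * t y))) = 0 := by
    intro x hx y hy
    have h1 : ∀ x ∈ N, s x = 1 ∨ t x = 1 := by
      intro x hx
      exact (hcov x hx).imp (fun h => if_pos h) (fun h => if_pos h)
    have h2 : ∀ a b c d : ZMod 2, (a = 1 ∨ b = 1) → (c = 1 ∨ d = 1) →
        a + b + a * c + b * d + a * d + (b * (1 + a) * (c * (1 + d)) + a * (1 + b) * (c * d) +
          a * b * (c * (1 + d)) + a * b * (c * d)) = 0 := by decide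
    rw [h2 _ _ _ _ (h1 x hx) (h1 y hy), mul_zero]
  have hsum := Finset.sum_eq_zero fun x hx => Finset.sum_eq_zero (hfin x hx)
  rw [wsign]
  simp only [sum_inc, Fin.sum_univ_two, hc0, hc1, hc2, hc3, hN, Finset.sum_const_zero]
  rw [hinv, hch, hmul, hm, hcard (S 1)]
  simp only [hs, ht, Finset.mul_sum, Finset.sum_add_distrib, mul_add, mul_ite, mul_one, mul_zero,
    Fin.val_zero, Fin.val_one, Nat.cast_zero, Nat.cast_one, zero_add, add_zero] at hsum ⊢
  simp only [mul_left_comm _ (L _ _), mul_comm _ (L _ _)] at hsum ⊢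
  refine CharTwo.add_eq_zero.1 ?_
  linear_combination hsum + (2 * ((N.card : ZMod 2) + 1) + ∑ x ∈ N, t x +
    ∑ x ∈ N, ∑ y ∈ N, if x = y then s x * t y else 0) * two_zmod

/-- This matches the sign `(-1)^((i+1)/2)` of the alternating cut function with the binomial
coefficient in `wsign_two`. -/
theorem two_dvd_choose_two_add_half (i : ℕ) : 2 ∣ (i + 1).choose 2 + (i + 1) / 2 := by
  induction i using Nat.twoStepInduction with
  | zero => simp
  | one => simp
  | more i ih _ =>
    have h1 : ∀ n : ℕ, (n + 1).choose 2 = n + n.choose 2 := fun n => by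
      rw [Nat.choose_succ_succ' n 1, Nat.choose_one_right]
    have h3 : (i + 2 + 1) / 2 = (i + 1) / 2 + 1 := by omega
    have h4 := h1 (i + 1)
    rw [h1, show (i + 2).choose 2 = _ from h4, h3]
    omega

/-- The values of the kernels of the cup products. -/
theorem altKern_apply {n i : ℕ} {S : Fin 2 → Finset ℕ} (hS : ∀ j, S j ⊆ Finset.range (n + 1))
    (h0 : S 0 = (Finset.range (n + 1)).filter (fun v => v ∈ S 0 ∩ S 1 ∨
        Even ((S 0 ∩ S 1).filter (· < v)).card))
    (h1 : S 1 = (Finset.range (n + 1)).filter (fun v => v ∈ S 0 ∩ S 1 ∨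
        Odd ((S 0 ∩ S 1).filter (· < v)).card)) (hi : (S 0 ∩ S 1).card = i + 1) :
    altKern k 0 i (Finset.range (n + 1)) S =
      (-1) ^ (((Finset.range (n + 1) ×ˢ Finset.range (n + 1)).filter
        (fun z => z.1 ∈ S 1 \ S 0 ∧ z.2 ∈ S 0 \ S 1 ∧ z.1 < z.2)).card + i * ((S 0).card + 1)) := by
  have hcov : ∀ x ∈ Finset.range (n + 1), x ∈ S 0 ∨ x ∈ S 1 := by
    intro x hx
    rcases Nat.even_or_odd ((S 0 ∩ S 1).filter (· < x)).card with h | h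
    · left; rw [h0]; exact Finset.mem_filter.2 ⟨hx, Or.inr h⟩
    · right; rw [h1]; exact Finset.mem_filter.2 ⟨hx, Or.inr h⟩
  have hc : ∀ j, (S j).Nonempty := by
    obtain ⟨u, hu⟩ := Finset.card_pos.1 (by omega : 0 < (S 0 ∩ S 1).card)
    rw [Finset.mem_inter] at hu
    exact Fin.forall_fin_two.2 ⟨⟨u, hu.1⟩, ⟨u, hu.2⟩⟩
  have hw : word (Finset.range (n + 1)) S ≠ [] := by
    rw [← List.length_pos_iff, length_word]; simp
  have hcount := count_word_range (n + 1) (n + 1) le_rfl S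
  rw [List.take_of_length_le (by rw [length_word, Finset.card_range]),
    Finset.filter_mem_eq_inter, Finset.inter_eq_right.2
      (Finset.inter_subset_left.trans (hS 0)), hi] at hcount
  -- A leading `{0}` does not change the value and makes `altW_cons` applicable; the full letters
  -- are the `i + 1` cut points.
  rw [altKern, ofWord, if_pos ⟨by simp, fun j => ⟨hc j, hS j⟩⟩, ← altW_singleton_cons _ _ hw,
    altW_cons, if_pos ⟨(cutWord_word hS).2 ⟨h0, h1⟩, hcount⟩, altSign_zero, ← sgn_natCast,
    ← sgn_natCast, ← sgn_add, wsign_two hS hcov]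
  congr 1
  have e0 := Finset.card_sdiff_add_card_inter (S 0) (S 1)
  have e1 := Finset.card_sdiff_add_card_inter (S 1) (S 0)
  have e2 : (Finset.range (n + 1)).card = (S 0 \ S 1).card + (S 1 \ S 0).card +
      (S 0 ∩ S 1).card := by
    have : Finset.range (n + 1) = S 0 ∪ S 1 := by
      ext x
      rw [Finset.mem_union]
      exact ⟨hcov x, fun h => h.elim (fun h => hS 0 h) fun h => hS 1 h⟩
    have h2 := Finset.card_union_add_card_inter (S 0) (S 1)
    rw [Finset.inter_comm] at e1
    rw [this]; omega
  rw [Finset.inter_comm, hi] at e1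
  rw [hi] at e0 e2
  rw [hi, e2, ← e0, ← e1]
  generalize (S 0 \ S 1).card = e
  generalize (S 1 \ S 0).card = o
  generalize Finset.card _ = v
  have h3 : ((((i + 1).choose 2 + (i + 1) / 2 : ℕ)) : ZMod 2) = 0 :=
    (ZMod.natCast_eq_zero_iff _ _).2 (two_dvd_choose_two_add_half i)
  have h4 : ∀ x : ZMod 2, x * x = x := by decide
  push_cast at h3 ⊢
  linear_combination h3 - h4 i + (o + i + 2 + e - i : ZMod 2) * two_zmod

/-- The support of the kernels of the cup products. -/
theorem altKern_ne_zero {n i : ℕ} {S : Fin 2 → Finset ℕ}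
    (h : altKern k 0 i (Finset.range (n + 1)) S ≠ 0) :
    (∀ j, S j ⊆ Finset.range (n + 1)) ∧ (S 0 ∩ S 1).card = i + 1 ∧
    S 0 = (Finset.range (n + 1)).filter (fun v => v ∈ S 0 ∩ S 1 ∨
        Even ((S 0 ∩ S 1).filter (· < v)).card) ∧
    S 1 = (Finset.range (n + 1)).filter (fun v => v ∈ S 0 ∩ S 1 ∨
        Odd ((S 0 ∩ S 1).filter (· < v)).card) := by
  obtain ⟨⟨-, h1⟩, h2⟩ := ofWord_ne_zero h
  have hS : ∀ j, S j ⊆ Finset.range (n + 1) := fun j => (h1 j).2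
  have hw : word (Finset.range (n + 1)) S ≠ [] := by
    rw [← List.length_pos_iff, length_word]; simp
  have hcount := count_word_range (n + 1) (n + 1) le_rfl S
  rw [List.take_of_length_le (by rw [length_word, Finset.card_range]),
    Finset.filter_mem_eq_inter, Finset.inter_eq_right.2
      (Finset.inter_subset_left.trans (hS 0))] at hcount
  rw [← altW_singleton_cons _ _ hw, altW_cons] at h2
  split_ifs at h2 with h3
  · exact ⟨hS, hcount ▸ h3.2, (cutWord_word hS).1 h3.1⟩
  · exact absurd rfl h2

end CupKernel
end EInf

namespace Autopoietic

/-! ### Products of consecutive entries and faces -/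

section Edge
variable {A : Type v} [Ring A]

/-- The product of the entries of a sequence with the numbers `u, …, v - 1`. -/
def edge (a : ℕ → A) (u v : ℕ) : A := ((List.Ico u v).map a).prod

theorem edge_self (a : ℕ → A) (u : ℕ) : edge a u u = 1 := by simp [edge]

theorem edge_succ (a : ℕ → A) {u v : ℕ} (h : u ≤ v) : edge a u (v + 1) = edge a u v * a v := by
  simp [edge, List.Ico.succ_top h]

theorem edge_single (a : ℕ → A) (u : ℕ) : edge a u (u + 1) = a u := by
  rw [edge_succ a le_rfl, edge_self, one_mul]

theorem edge_mul (a : ℕ → A) {u v x : ℕ} (h : u ≤ v) (h' : v ≤ x) :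
    edge a u v * edge a v x = edge a u x := by
  rw [edge, edge, edge, ← List.prod_append, ← List.map_append, List.Ico.append_consecutive h h']

theorem edge_congr {a a' : ℕ → A} {u v : ℕ} (h : ∀ l, u ≤ l → l < v → a l = a' l) :
    edge a u v = edge a' u v := by
  rw [edge, edge, List.map_congr_left fun l hl => ?_]
  exact h l (List.Ico.mem.1 hl).1 (List.Ico.mem.1 hl).2

/-- Consecutive products telescope, so a face of a face is again a face. -/
theorem edge_edge (a : ℕ → A) {φ : ℕ → ℕ} {p : ℕ} (hφ : StrictMonoOn φ (Finset.range (p + 1)))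
    {u v : ℕ} (huv : u ≤ v) (hv : v ≤ p) :
    edge (fun j => edge a (φ j) (φ (j + 1))) u v = edge a (φ u) (φ v) := by
  induction v, huv using Nat.le_induction with
  | base => rw [edge_self, edge_self]
  | succ v huv ih =>
    have h1 : ∀ x ≤ p, x ∈ (Finset.range (p + 1) : Set ℕ) := fun x hx => by simpa using by omega
    rw [edge_succ _ huv, ih (by omega), edge_mul]
    · exact hφ.monotoneOn (h1 _ (by omega)) (h1 _ (by omega)) huv
    · exact hφ.monotoneOn (h1 _ (by omega)) (h1 _ (by omega)) (Nat.le_succ v)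

/-- A tuple, extended by `1` to a sequence. -/
def seq {n : ℕ} (a : Fin n → A) (l : ℕ) : A := if h : l < n then a ⟨l, h⟩ else 1

theorem seq_val {n : ℕ} (a : Fin n → A) (l : Fin n) : seq a l = a l := by simp [seq]

theorem edge_seq {n : ℕ} (a : Fin n → A) : edge (seq a) 0 n = (List.ofFn a).prod := by
  rw [edge, List.ofFn_eq_map, List.Ico.zero_bot, ← List.map_coe_finRange_eq_range, List.map_map]
  congr 1
  exact List.map_congr_left fun l _ => seq_val a l

/-- The face of the simplex `(a₁, …, aₙ)` with the vertices `φ 0 < ⋯ < φ p`. -/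
def faceAlong {n p : ℕ} (φ : ℕ → ℕ) (a : Fin n → A) : Fin p → A :=
  fun j => edge (seq a) (φ j) (φ (j + 1))

theorem edge_faceAlong {n p : ℕ} {φ : ℕ → ℕ} (hφ : StrictMonoOn φ (Finset.range (p + 1)))
    (a : Fin n → A) {u v : ℕ} (huv : u ≤ v) (hv : v ≤ p) :
    edge (seq (faceAlong φ a : Fin p → A)) u v = edge (seq a) (φ u) (φ v) := by
  rw [← edge_edge _ hφ huv hv]
  refine edge_congr fun l _ hl => ?_
  rw [seq, dif_pos (hl.trans_le hv)]
  rfl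

theorem faceAlong_faceAlong {n p q : ℕ} {φ ψ : ℕ → ℕ} (hφ : StrictMonoOn φ (Finset.range (p + 1)))
    (hψ : StrictMonoOn ψ (Finset.range (q + 1))) (hq : ψ q ≤ p) (a : Fin n → A) :
    (faceAlong ψ (faceAlong φ a : Fin p → A) : Fin q → A) = faceAlong (φ ∘ ψ) a := by
  funext j
  have h1 : ∀ x ≤ q, x ∈ (Finset.range (q + 1) : Set ℕ) := fun x hx => by simpa using by omega
  have hj := j.isLt
  exact edge_faceAlong hφ a
    (hψ.monotoneOn (h1 _ (by omega)) (h1 _ (by omega)) (Nat.le_succ j))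
    ((hψ.monotoneOn (h1 _ (by omega)) (h1 _ le_rfl) (by omega)).trans hq)

theorem faceAlong_congr {n p : ℕ} {φ ψ : ℕ → ℕ} (h : ∀ j ≤ p, φ j = ψ j) (a : Fin n → A) :
    (faceAlong φ a : Fin p → A) = faceAlong ψ a := by
  funext j
  have hj := j.isLt
  rw [faceAlong, faceAlong, h _ (by omega), h _ (by omega)]

theorem faceAlong_id {n : ℕ} (a : Fin n → A) : (faceAlong id a : Fin n → A) = a := by
  funext j
  rw [faceAlong, id, id, edge_single, seq_val]

end Edge

theorem enum_image {p : ℕ} {φ : ℕ → ℕ} (hφ : StrictMonoOn φ (Finset.range (p + 1))) {j : ℕ}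
    (hj : j ≤ p) : EInf.enum ((Finset.range (p + 1)).image φ) j = φ j := by
  rw [EInf.enum, EInf.sort_image (by simpa using hφ), Finset.sort_range,
    List.getD_eq_getElem _ _ (by simpa using Nat.lt_succ_of_le hj)]
  simp

theorem enum_mem {N : Finset ℕ} {i : ℕ} (hi : i < N.card) : EInf.enum N i ∈ N := by
  have h := EInf.image_enum N
  rw [Finset.ext_iff] at h
  exact (h _).1 (Finset.mem_image_of_mem _ (Finset.mem_range.2 hi))

section FaceEq
variable {A : Type v} [Ring A]

/-- Faces are rewritten as faces along increasing maps of natural numbers, which compose well and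
fit the kernels. -/
theorem face_eq {n p : ℕ} (S : Finset (Fin (n + 1))) (hS : S.card = p + 1) (a : Fin n → A) :
    face S hS a = faceAlong (EInf.enum (S.map Fin.valEmbedding)) a := by
  have h1 : ∀ j : Fin (p + 1),
      EInf.enum (S.map Fin.valEmbedding) j = (S.orderEmbOfFin hS j : ℕ) := by
    have h2 : (Finset.range (p + 1)).image
        (fun j => if h : j < p + 1 then (S.orderEmbOfFin hS ⟨j, h⟩ : ℕ) else 0) =
        S.map Fin.valEmbedding := by
      ext x
      simp only [Finset.mem_image, Finset.mem_range, Finset.mem_map, Fin.valEmbedding_apply]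
      constructor
      · rintro ⟨j, hj, rfl⟩
        rw [dif_pos hj]
        exact ⟨_, S.orderEmbOfFin_mem hS _, rfl⟩
      · rintro ⟨y, hy, rfl⟩
        have : y ∈ Set.range (S.orderEmbOfFin hS) := by rw [S.range_orderEmbOfFin hS]; exact hy
        obtain ⟨j, rfl⟩ := this
        exact ⟨j, j.isLt, by rw [dif_pos j.isLt]⟩
    intro j
    rw [← h2, enum_image _ (Nat.lt_succ_iff.1 j.isLt), dif_pos j.isLt]
    intro x hx y hy hxy
    have hx : x < p + 1 := by simpa using hx
    have hy : y < p + 1 := by simpa using hy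
    simp only [dif_pos hx, dif_pos hy]
    exact (S.orderEmbOfFin hS).strictMono hxy
  have h2 : ∀ u v : ℕ, v ≤ n → (((List.finRange n).filter fun l : Fin n =>
      u ≤ (l : ℕ) ∧ (l : ℕ) < v).map a).prod = edge (seq a) u v := by
    intro u v hv
    have h3 : List.Ico u v = (((List.finRange n).filter fun l : Fin n =>
        u ≤ (l : ℕ) ∧ (l : ℕ) < v).map Fin.val) := by
      have h4 : List.Ico u v = (List.range n).filter fun l => u ≤ l ∧ l < v := by
        refine List.Perm.eq_of_pairwise' (r := (· < ·)) (List.Ico.pairwise_lt u v)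
          (List.pairwise_lt_range.filter _) ?_
        refine (List.perm_ext_iff_of_nodup (List.Ico.nodup u v) (List.nodup_range.filter _)).2
          fun l => ?_
        simp only [List.Ico.mem, List.mem_filter, List.mem_range, decide_eq_true_eq]
        omega
      rw [h4, ← List.map_coe_finRange_eq_range, List.filter_map]
      rfl
    rw [edge, h3, List.map_map]
    congr 1
    exact List.map_congr_left fun l _ => (seq_val a l).symm
  funext j
  have h3 := h1 j.castSucc
  have h4 := h1 j.succ
  rw [Fin.val_castSucc] at h3
  rw [Fin.val_succ] at h4
  rw [faceAlong, h3, h4, ← h2 _ _ (Nat.lt_succ_iff.1 (Fin.isLt _)), face]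
  rfl

end FaceEq

/-! ### The weight of a tuple of basis elements -/

section Weight
variable {k : Type u} {A : Type v} {Ω : Type w} [CommRing k] [Ring A] [Algebra k A]
  {b : Module.Basis Ω k A}

theorem basisProd_eq_edge {n : ℕ} (σ : Fin n → Ω) :
    basisProd b σ = edge (seq fun l => b (σ l)) 0 n := (edge_seq _).symm

theorem smul_basis_eq_zero {t : k} {m : Ω} (h : t • b m = 0) : t = 0 := by
  have := congrArg (fun x => b.repr x m) h
  simpa using this

theorem exists_edge_eq (hb : IsIdempotentBasis b) {n : ℕ} (σ : Fin n → Ω) {u v : ℕ} (huv : u < v)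
    (hv : v ≤ n) : ∃ (m : Ω) (μ : k), μ * μ = μ ∧ edge (seq fun l => b (σ l)) u v = μ • b m := by
  induction v, Nat.succ_le_of_lt huv using Nat.le_induction with
  | base => exact ⟨σ ⟨u, by omega⟩, 1, by simp, by rw [edge_single, seq, dif_pos, one_smul]⟩
  | succ v huv' ih =>
    obtain ⟨m, μ, hμ, h⟩ := ih (by omega) (by omega)
    obtain ⟨m', ν, hν, h'⟩ := hb m (σ ⟨v, by omega⟩)
    refine ⟨m', μ * ν, by rw [mul_mul_mul_comm, hμ, hν], ?_⟩
    rw [edge_succ _ (by omega), h, seq, dif_pos (by omega), smul_mul_assoc, h', mul_smul]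

/-- A nonempty product is `μ • b m` and a basis element has zero annihilator, so `μ` works. The
empty product is the unit, whose annihilator is zero if there is a basis element; if there is none,
the algebra is zero and the weight `0` is taken. -/
theorem exists_weight (hb : IsIdempotentBasis b) {n : ℕ} (σ : Fin n → Ω) :
    ∃ x : k, x * x = x ∧ ∀ t : k, t • basisProd b σ = 0 ↔ t * x = 0 := by
  cases n with
  | zero =>
    have h1 : basisProd b σ = 1 := by simp [basisProd]
    rw [h1]
    cases isEmpty_or_nonempty Ω with
    | inl hΩ =>
      have := b.repr.toEquiv.subsingleton
      exact ⟨0, by simp, fun t => by simp [Subsingleton.elim (t • (1 : A)) 0]⟩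
    | inr hΩ =>
      obtain ⟨m⟩ := hΩ
      refine ⟨1, by simp, fun t => ⟨fun h => ?_, fun h => by rw [mul_one] at h; rw [h, zero_smul]⟩⟩
      rw [mul_one]
      refine smul_basis_eq_zero (b := b) (m := m) ?_
      rw [← one_mul (b m), ← smul_mul_assoc, h, zero_mul]
  | succ n =>
    obtain ⟨m, μ, hμ, h⟩ := exists_edge_eq hb σ (Nat.succ_pos n) le_rfl
    refine ⟨μ, hμ, fun t => ?_⟩
    rw [basisProd_eq_edge, h, smul_smul]
    exact ⟨smul_basis_eq_zero, fun h => by rw [h, zero_smul]⟩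

/-- The idempotent of `k` with the same annihilator as the product `φ₁⋯φₙ`. -/
noncomputable def weight (hb : IsIdempotentBasis b) {n : ℕ} (σ : Fin n → Ω) : k :=
  (exists_weight hb σ).choose

variable (hb : IsIdempotentBasis b) {n : ℕ}

theorem weight_mul_self (σ : Fin n → Ω) : weight hb σ * weight hb σ = weight hb σ :=
  (exists_weight hb σ).choose_spec.1

theorem smul_basisProd_eq_zero (σ : Fin n → Ω) (t : k) :
    t • basisProd b σ = 0 ↔ t * weight hb σ = 0 := (exists_weight hb σ).choose_spec.2 t

theorem smul_basisProd_eq (σ : Fin n → Ω) (s t : k) :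
    s • basisProd b σ = t • basisProd b σ ↔ s * weight hb σ = t * weight hb σ := by
  rw [← sub_eq_zero, ← sub_smul, smul_basisProd_eq_zero hb, sub_mul, sub_eq_zero]

theorem weight_smul_basisProd (σ : Fin n → Ω) : weight hb σ • basisProd b σ = basisProd b σ := by
  rw [← one_smul k (basisProd b σ), smul_smul, smul_basisProd_eq hb, mul_one, one_mul,
    weight_mul_self]

/-- The scalar `1 - weight hb σ` kills the product, so the normalisation says that the weight fixes
`c`; this gives existence and uniqueness of the coefficient. -/
theorem isCoeff_iff (f : Cochain k A A n) (σ : Fin n → Ω) (c : k) : IsCoeff b f σ c ↔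
    f (fun l => b (σ l)) = c • basisProd b σ ∧ c * weight hb σ = c := by
  refine and_congr_right fun _ => ⟨fun h => ?_, fun h t ht => ?_⟩
  · have := h (1 - weight hb σ) (by
      rw [smul_basisProd_eq_zero hb, sub_mul, weight_mul_self, one_mul, sub_self])
    linear_combination -this
  · rw [← h, mul_left_comm, (smul_basisProd_eq_zero hb σ t).1 ht, mul_zero]

theorem exists_isCoeff (hb : IsIdempotentBasis b) (f : AP b n) (σ : Fin n → Ω) : ∃ c, IsCoeff b f.1 σ c := by
  obtain ⟨c, hc⟩ := f.2 σ
  refine ⟨c * weight hb σ, (isCoeff_iff hb _ _ _).2 ⟨?_, ?_⟩⟩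
  · rw [hc, mul_smul, weight_smul_basisProd]
  · rw [mul_assoc, weight_mul_self]

theorem isCoeff_Phi (hb : IsIdempotentBasis b) (f : AP b n) (σ : Fin n → Ω) :
    IsCoeff b f.1 σ (Phi b f fun l => b (σ l)) := by
  have h := exists_isCoeff hb f σ
  rw [Phi, ofBasis_apply, dif_pos h]
  exact h.choose_spec

theorem apply_eq_Phi (hb : IsIdempotentBasis b) (f : AP b n) (σ : Fin n → Ω) :
    f.1 (fun l => b (σ l)) = (Phi b f fun l => b (σ l)) • basisProd b σ := (isCoeff_Phi hb f σ).1

theorem Phi_mul_weight (f : AP b n) (σ : Fin n → Ω) :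
    (Phi b f fun l => b (σ l)) * weight hb σ = Phi b f fun l => b (σ l) :=
  ((isCoeff_iff hb _ _ _).1 (isCoeff_Phi hb f σ)).2

theorem Phi_eq (f : AP b n) (σ : Fin n → Ω) {c : k} (h : f.1 (fun l => b (σ l)) = c • basisProd b σ) :
    (Phi b f fun l => b (σ l)) = c * weight hb σ := by
  rw [← Phi_mul_weight hb, ← smul_basisProd_eq hb, ← apply_eq_Phi hb, h]

theorem cochain_ext {M : Type*} [AddCommGroup M] [Module k M] {f g : Cochain k A M n}
    (h : ∀ σ : Fin n → Ω, f (fun l => b (σ l)) = g (fun l => b (σ l))) : f = g :=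
  Module.Basis.ext_multilinear (fun _ => b) fun σ => h σ

theorem Psi_apply (α : Cochain k A k n) (σ : Fin n → Ω) :
    (Psi b α).1 (fun l => b (σ l)) = α (fun l => b (σ l)) • basisProd b σ := ofBasis_apply b _ σ

theorem AP_ext {f g : AP b n}
    (h : ∀ σ : Fin n → Ω, f.1 (fun l => b (σ l)) = g.1 (fun l => b (σ l))) : f = g :=
  Subtype.ext (cochain_ext h)

/-- Scalars act on the product only through their multiples by the weight. Identities that fail for
the coefficients themselves are proved in this form. -/
theorem Psi_eq_Psi {α β : Cochain k A k n}
    (h : ∀ σ : Fin n → Ω, weight hb σ * α (fun l => b (σ l)) = weight hb σ * β fun l => b (σ l)) :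
    Psi b α = Psi b β :=
  AP_ext fun σ => by
    rw [Psi_apply, Psi_apply, smul_basisProd_eq hb, mul_comm, h, mul_comm]

theorem Psi_Phi (hb : IsIdempotentBasis b) (f : AP b n) : Psi b (Phi b f) = f :=
  AP_ext fun σ => by rw [Psi_apply, ← apply_eq_Phi hb]

theorem Phi_Psi (α : Cochain k A k n) (σ : Fin n → Ω) :
    (Phi b (Psi b α) fun l => b (σ l)) = α (fun l => b (σ l)) * weight hb σ :=
  Phi_eq hb _ _ (Psi_apply α σ)

theorem Psi_isLinearMap : IsLinearMap k (Psi b (n := n)) where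
  map_add α β := AP_ext fun σ => by
    change _ = (Psi b α).1 _ + (Psi b β).1 _
    simp only [Psi_apply, add_apply, add_smul]
  map_smul c α := AP_ext fun σ => by
    change _ = c • (Psi b α).1 _
    simp only [Psi_apply, smul_apply, smul_assoc]

theorem Phi_isLinearMap (hb : IsIdempotentBasis b) : IsLinearMap k (Phi b (n := n)) where
  map_add f g := cochain_ext (b := b) fun σ => by
    rw [add_apply, ← Phi_mul_weight hb f, ← Phi_mul_weight hb g, ← add_mul]
    refine Phi_eq hb _ _ ?_
    rw [add_smul, ← apply_eq_Phi hb, ← apply_eq_Phi hb]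
    rfl
  map_smul c f := cochain_ext (b := b) fun σ => by
    rw [smul_apply, ← Phi_mul_weight hb f, smul_eq_mul, ← mul_assoc]
    refine Phi_eq hb _ _ ?_
    rw [mul_smul, ← apply_eq_Phi hb]
    rfl

/-- `t` does not change multiples of the product `φ₁⋯φₙ` if it does not change the product of some
consecutive factors. -/
theorem weight_mul_eq (σ : Fin n → Ω) {u v : ℕ} (huv : u ≤ v) (hv : v ≤ n) {t : k}
    (h : t • edge (seq fun l => b (σ l)) u v = edge (seq fun l => b (σ l)) u v) :
    weight hb σ * t = weight hb σ := by
  rw [mul_comm, ← one_mul (weight hb σ), ← mul_assoc, mul_one, ← smul_basisProd_eq hb, one_smul,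
    basisProd_eq_edge, ← edge_mul _ (Nat.zero_le u) (huv.trans hv), ← edge_mul _ huv hv,
    ← mul_smul_comm, ← smul_mul_assoc, h]

theorem weight_mul_prod {ι : Type*} {x : k} (s : Finset ι) {c : ι → k}
    (h : ∀ j ∈ s, x * c j = x) : x * ∏ j ∈ s, c j = x := by
  classical
  induction s using Finset.induction_on with
  | empty => simp
  | insert a s ha ih =>
    rw [Finset.prod_insert ha, ← mul_assoc, h a (Finset.mem_insert_self a s),
      ih fun j hj => h j (Finset.mem_insert_of_mem hj)]

/-- Scalars absorbed by `x` may be removed from the arguments; this discards the idempotents that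
appear on the edges of faces. -/
theorem weight_mul_apply {x : k} {c : Fin n → k} (h : ∀ j, x * c j = x) (α : Cochain k A k n)
    (a : Fin n → A) : x * α (fun j => c j • a j) = x * α a := by
  rw [α.map_smul_univ, smul_eq_mul, ← mul_assoc, weight_mul_prod _ fun j _ => h j]

/-- The faces of a tuple of basis elements. -/
theorem exists_faceAlong_eq (σ : Fin n → Ω) {p : ℕ} {φ : ℕ → ℕ}
    (hφ : StrictMonoOn φ (Finset.range (p + 1))) (hp : φ p ≤ n) :
    ∃ (τ : Fin p → Ω) (μ : Fin p → k), (∀ j, μ j * μ j = μ j) ∧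
      (∀ j, faceAlong φ (fun l => b (σ l)) j = μ j • b (τ j)) ∧
      (∀ j, weight hb σ * μ j = weight hb σ) ∧ weight hb σ * weight hb τ = weight hb σ := by
  have h1 : ∀ x ≤ p, x ∈ (Finset.range (p + 1) : Set ℕ) := fun x hx => by simpa using by omega
  have h2 : ∀ x ≤ p, φ x ≤ n := fun x hx => (hφ.monotoneOn (h1 x hx) (h1 p le_rfl) hx).trans hp
  have h3 : ∀ j : Fin p, φ j < φ (j + 1) := fun j =>
    hφ (h1 _ (by omega)) (h1 _ (by omega)) (Nat.lt_succ_self _)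
  choose τ μ hμ hτ using fun j : Fin p =>
    exists_edge_eq hb σ (h3 j) (h2 _ (by omega))
  refine ⟨τ, μ, hμ, hτ, fun j => ?_, ?_⟩
  · refine weight_mul_eq hb σ (h3 j).le (h2 _ (by omega)) ?_
    rw [hτ, smul_smul, hμ]
  · refine weight_mul_eq hb σ (hφ.monotoneOn (h1 0 (by omega)) (h1 p le_rfl) (Nat.zero_le p))
      hp ?_
    rw [← edge_faceAlong hφ _ (Nat.zero_le p) le_rfl, edge_seq]
    have h4 : (faceAlong φ (fun l => b (σ l)) : Fin p → A) = fun j => μ j • b (τ j) := funext hτ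
    have h5 := (MultilinearMap.mkPiAlgebraFin k p A).map_smul_univ μ fun j => b (τ j)
    rw [MultilinearMap.mkPiAlgebraFin_apply, MultilinearMap.mkPiAlgebraFin_apply] at h5
    rw [h4, h5, smul_comm]
    congr 1
    exact weight_smul_basisProd hb τ

end Weight
end Autopoietic

namespace Autopoietic

/-! ### The coboundaries -/

section Skip
variable {A : Type v} [Ring A]

/-- The increasing enumeration of the natural numbers different from `i`. -/
def skip (i m : ℕ) : ℕ := if m < i then m else m + 1

theorem skip_strictMono (i : ℕ) : StrictMono (skip i) := by
  intro x y h
  simp only [skip]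
  split_ifs <;> omega

theorem image_skip {n i : ℕ} (hi : i < n + 1) :
    (Finset.range n).image (skip i) = (Finset.range (n + 1)).erase i := by
  ext x
  simp only [Finset.mem_image, Finset.mem_range, Finset.mem_erase, skip]
  constructor
  · rintro ⟨m, hm, rfl⟩
    split_ifs <;> omega
  · rintro ⟨h1, h2⟩
    rcases lt_or_gt_of_ne h1 with h | h
    · exact ⟨x, by omega, if_pos h⟩
    · exact ⟨x - 1, by omega, by rw [if_neg (by omega)]; omega⟩

theorem faceAlong_skip_zero {n : ℕ} (a : Fin (n + 1) → A) :
    (faceAlong (skip 0) a : Fin n → A) = fun l => a l.succ := by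
  funext j
  rw [faceAlong, skip, skip, if_neg (by omega), if_neg (by omega), edge_single]
  exact seq_val a j.succ

theorem faceAlong_skip_last {n : ℕ} (a : Fin (n + 1) → A) :
    (faceAlong (skip (n + 1)) a : Fin n → A) = fun l => a l.castSucc := by
  funext j
  have := j.isLt
  rw [faceAlong, skip, skip, if_pos (by omega), if_pos (by omega), edge_single]
  exact seq_val a j.castSucc

theorem faceAlong_skip {n : ℕ} (j : Fin n) (a : Fin (n + 1) → A) :
    (faceAlong (skip (j + 1)) a : Fin n → A) = Fin.contractNth j.castSucc (· * ·) a := by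
  funext l
  rw [faceAlong, skip, skip]
  rcases lt_trichotomy l j with h | h | h
  · have h' : (l : ℕ) < j := h
    rw [Fin.contractNth_apply_of_lt _ _ _ _ (by simpa using h), if_pos (by omega),
      if_pos (by omega), edge_single]
    exact seq_val a l.castSucc
  · subst h
    rw [Fin.contractNth_apply_of_eq _ _ _ _ (by simp), if_pos (by omega), if_neg (by omega),
      edge_succ _ (by omega), edge_single]
    exact congrArg₂ _ (seq_val a l.castSucc) (seq_val a l.succ)
  · have h' : (j : ℕ) < l := h
    rw [Fin.contractNth_apply_of_gt _ _ _ _ (by simpa using h), if_neg (by omega),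
      if_neg (by omega), edge_single]
    exact seq_val a l.succ

end Skip

section Cochains
variable {k : Type u} {A : Type v} {Ω : Type w} [CommRing k] [Ring A] [Algebra k A]
  {b : Module.Basis Ω k A} {n : ℕ}

theorem dStar_apply (α : Cochain k A k n) (σ : Fin (n + 1) → Ω) :
    dStar b α (fun l => b (σ l)) =
      ∑ i ∈ Finset.range (n + 2), (-1) ^ i * α (faceAlong (skip i) fun l => b (σ l)) := by
  rw [dStar, ofBasis_apply, Finset.sum_range]
  refine Finset.sum_congr rfl fun i _ => ?_
  rw [face_eq]
  congr 2
  refine faceAlong_congr (fun j hj => ?_) _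
  have h : ((Finset.univ.erase i).map Fin.valEmbedding : Finset ℕ) =
      (Finset.range (n + 1)).image (skip i) := by
    rw [image_skip i.isLt, Finset.map_erase, Fin.map_valEmbedding_univ, Fin.valEmbedding_apply]
    congr 1
    ext; simp [Nat.lt_succ_iff]
  rw [h, enum_image ((skip_strictMono i).strictMonoOn _) hj]

/-- The scalars occur once on the left, but twice on the right: in `α a` and in the product of the
arguments. Idempotence makes the two agree, which extends the formula for `Ψ` from tuples of basis
elements to their faces. -/
theorem Psi_apply_of_eq (α : Cochain k A k n) {a : Fin n → A} {μ : Fin n → k} {τ : Fin n → Ω}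
    (hμ : ∀ j, μ j * μ j = μ j) (ha : ∀ j, a j = μ j • b (τ j)) :
    (Psi b α).1 a = α a • (List.ofFn a).prod := by
  obtain rfl : a = fun j => μ j • b (τ j) := funext ha
  have h5 := (MultilinearMap.mkPiAlgebraFin k n A).map_smul_univ μ fun j => b (τ j)
  rw [MultilinearMap.mkPiAlgebraFin_apply, MultilinearMap.mkPiAlgebraFin_apply] at h5
  rw [h5, MultilinearMap.map_smul_univ, MultilinearMap.map_smul_univ, Psi_apply, smul_smul,
    smul_smul, smul_eq_mul, mul_right_comm, ← Finset.prod_mul_distrib, Finset.prod_congr rfl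
      fun j _ => hμ j]
  rfl

theorem Psi_faceAlong (hb : IsIdempotentBasis b) (σ : Fin n → Ω) {p : ℕ} {φ : ℕ → ℕ}
    (hφ : StrictMonoOn φ (Finset.range (p + 1))) (hp : φ p ≤ n) (α : Cochain k A k p) :
    (Psi b α).1 (faceAlong φ fun l => b (σ l)) =
      α (faceAlong φ fun l => b (σ l)) • edge (seq fun l => b (σ l)) (φ 0) (φ p) := by
  obtain ⟨τ, μ, hμ, hτ, -, -⟩ := exists_faceAlong_eq hb σ hφ hp
  rw [Psi_apply_of_eq α hμ hτ, ← edge_seq, edge_faceAlong hφ _ (Nat.zero_le p) le_rfl]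

/-- On each face `Ψ(α)` is the value of `α` times the product of the labels of the face. For inner
faces this is the whole product; for the two outer ones the missing factor is supplied by the outer
terms of the Hochschild coboundary. -/
theorem Psi_dStar (hb : IsIdempotentBasis b) (α : Cochain k A k n) :
    Psi b (dStar b α) = delta hb n (Psi b α) := by
  refine AP_ext fun σ => ?_
  let a : Fin (n + 1) → A := fun l => b (σ l)
  have hn : ∀ i ≤ n + 1, (Psi b α).1 (faceAlong (skip i) a) =
      α (faceAlong (skip i) a) • edge (seq a) (skip i 0) (skip i n) := fun i hi =>
    Psi_faceAlong hb σ ((skip_strictMono i).strictMonoOn _) (by simp only [skip]; split_ifs <;> omega) α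
  change _ = a 0 * (Psi b α).1 (fun l => a l.succ) +
    (∑ j : Fin n, (-1 : k) ^ ((j : ℕ) + 1) • inner (Psi b α).1 j) a +
    (-1 : k) ^ (n + 1) • ((Psi b α).1 (fun l => a l.castSucc) * a (Fin.last n))
  rw [Psi_apply, dStar_apply, Finset.sum_range, Fin.sum_univ_succ, Fin.sum_univ_castSucc,
    ← add_assoc, add_smul, add_smul, Finset.sum_smul, ← faceAlong_skip_zero, ← faceAlong_skip_last,
    hn _ (Nat.zero_le _), hn _ le_rfl, sum_apply, basisProd_eq_edge]
  congr 1
  · congr 1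
    · have h1 : a 0 = edge (seq a) 0 (0 + 1) := by rw [edge_single]; exact (seq_val a 0).symm
      rw [mul_smul_comm, h1]
      simp only [skip, Nat.not_lt_zero, if_false]
      rw [edge_mul _ (by omega) (by omega)]
      simp [a]
    · refine Finset.sum_congr rfl fun j _ => ?_
      rw [smul_apply]
      change _ = _ • (Psi b α).1 (Fin.contractNth j.castSucc (· * ·) a)
      have := j.isLt
      rw [← faceAlong_skip, hn _ (by omega), skip, skip, if_pos (by omega), if_neg (by omega),
        smul_smul]
      simp [a]
  · have h1 : a (Fin.last n) = edge (seq a) n (n + 1) := by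
      rw [edge_single]; exact (seq_val a (Fin.last n)).symm
    rw [smul_mul_assoc, h1]
    simp only [skip, Nat.succ_pos, if_true, Nat.lt_succ_self]
    rw [edge_mul _ (by omega) (by omega), smul_smul]
    simp [a]

theorem delta_eq (hb : IsIdempotentBasis b) (f : AP b n) :
    delta hb n f = Psi b (dStar b (Phi b f)) := by rw [Psi_dStar, Psi_Phi hb]

/-- In this case every nonempty product of basis elements is a basis element, so the weights in
positive degree are `1` and no information about coefficients is lost. -/
theorem Phi_delta (hb : IsIdempotentBasis b) (h : ∀ x y, ∃ m, b x * b y = b m) (f : AP b n) :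
    Phi b (delta hb n f) = dStar b (Phi b f) := by
  refine cochain_ext (b := b) fun σ => ?_
  have h1 : ∀ v, v < n + 1 → ∃ m, edge (seq fun l => b (σ l)) 0 (v + 1) = b m := by
    intro v
    induction v with
    | zero => exact fun _ => ⟨σ 0, by rw [edge_single]; exact seq_val (fun l => b (σ l)) 0⟩
    | succ v ih =>
      intro hv
      obtain ⟨m, hm⟩ := ih (by omega)
      obtain ⟨m', hm'⟩ := h m (σ ⟨v + 1, hv⟩)
      exact ⟨m', by rw [edge_succ _ (Nat.zero_le _), hm, ← hm', seq, dif_pos hv]⟩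
  obtain ⟨m, hm⟩ := h1 n (Nat.lt_succ_self n)
  have h2 : weight hb σ = 1 := by
    have h3 : (1 - weight hb σ) • basisProd b σ = 0 := by
      rw [smul_basisProd_eq_zero hb, sub_mul, weight_mul_self, one_mul, sub_self]
    rw [basisProd_eq_edge, hm] at h3
    exact (sub_eq_zero.1 (smul_basis_eq_zero h3)).symm
  rw [delta_eq hb, Phi_Psi hb, h2, mul_one]

/-! ### Coefficients of faces, up to the weight -/

theorem edge_smul {p : ℕ} (μ : Fin p → k) (a : Fin p → A) {u v : ℕ} (h : u ≤ v) :
    edge (seq fun j => μ j • a j) u v = edge (seq μ) u v • edge (seq a) u v := by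
  induction v, h using Nat.le_induction with
  | base => simp [edge_self]
  | succ v h ih =>
    rw [edge_succ _ h, edge_succ _ h, edge_succ _ h, ih, ← smul_mul_smul_comm]
    congr 1
    simp only [seq]
    split_ifs <;> simp

theorem mul_edge {p : ℕ} {x : k} {μ : Fin p → k} (h : ∀ j, x * μ j = x) {u v : ℕ} (huv : u ≤ v) :
    x * edge (seq μ) u v = x := by
  induction v, huv using Nat.le_induction with
  | base => rw [edge_self, mul_one]
  | succ v huv ih =>
    rw [edge_succ _ huv, ← mul_assoc, ih, seq]
    split_ifs
    · exact h _
    · exact mul_one x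

/-- A face of a face of a tuple of basis elements. -/
theorem mul_apply_faceAlong {p q : ℕ} {x : k} {μ : Fin p → k} (h : ∀ j, x * μ j = x)
    (a : Fin p → A) {ψ : ℕ → ℕ} (hψ : StrictMonoOn ψ (Finset.range (q + 1))) (α : Cochain k A k q) :
    x * α (faceAlong ψ fun j => μ j • a j) = x * α (faceAlong ψ a) := by
  have h1 : ∀ j : Fin q, ψ j ≤ ψ (j + 1) := fun j =>
    hψ.monotoneOn (by simpa using by omega) (by simp) (Nat.le_succ _)
  have h2 : (faceAlong ψ (fun j => μ j • a j) : Fin q → A) =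
      fun j : Fin q => edge (seq μ) (ψ j) (ψ (j + 1)) • (faceAlong ψ a : Fin q → A) j :=
    funext fun j => edge_smul μ a (h1 j)
  rw [h2]
  exact weight_mul_apply (fun j => mul_edge h (h1 j)) α _

/-- On a tuple of basis elements, `Φ ∘ Ψ` multiplies `α` by the weight of that tuple. For the tuple
of a face of `σ` this weight is absorbed by the weight of `σ`. -/
theorem weight_mul_Phi_Psi (hb : IsIdempotentBasis b) (σ : Fin n → Ω) {p : ℕ} {φ : ℕ → ℕ}
    (hφ : StrictMonoOn φ (Finset.range (p + 1))) (hp : φ p ≤ n) (α : Cochain k A k p) :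
    weight hb σ * Phi b (Psi b α) (faceAlong φ fun l => b (σ l)) =
      weight hb σ * α (faceAlong φ fun l => b (σ l)) := by
  obtain ⟨τ, μ, -, hτ, hμ, hw⟩ := exists_faceAlong_eq hb σ hφ hp
  have h1 : (faceAlong φ (fun l => b (σ l)) : Fin p → A) = fun j => μ j • b (τ j) := funext hτ
  rw [h1, weight_mul_apply hμ, weight_mul_apply hμ, Phi_Psi hb, mul_left_comm, hw, mul_comm]

/-- The coboundary of the cochain of coefficients, up to the weight. -/
theorem weight_mul_Phi_delta (hb : IsIdempotentBasis b) (σ : Fin n → Ω) {p : ℕ} {φ : ℕ → ℕ}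
    (hφ : StrictMonoOn φ (Finset.range (p + 2))) (hp : φ (p + 1) ≤ n) (f : AP b p) :
    weight hb σ * Phi b (delta hb p f) (faceAlong φ fun l => b (σ l)) =
      ∑ i ∈ Finset.range (p + 2), (-1) ^ i *
        (weight hb σ * Phi b f (faceAlong (φ ∘ skip i) fun l => b (σ l))) := by
  rw [delta_eq, weight_mul_Phi_Psi hb σ hφ hp]
  obtain ⟨τ, μ, -, hτ, hμ, -⟩ := exists_faceAlong_eq hb σ hφ hp
  have h1 : (faceAlong φ (fun l => b (σ l)) : Fin (p + 1) → A) = fun j => μ j • b (τ j) :=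
    funext hτ
  rw [h1, weight_mul_apply hμ, dStar_apply, Finset.mul_sum]
  refine Finset.sum_congr rfl fun i hi => ?_
  have hi' := Finset.mem_range.1 hi
  rw [mul_left_comm, ← mul_apply_faceAlong hμ _ ((skip_strictMono i).strictMonoOn _), ← h1,
    faceAlong_faceAlong hφ ((skip_strictMono i).strictMonoOn _)
      (by simp only [skip]; split_ifs <;> omega)]

/-! ### The cup products -/

theorem cup_apply (i : ℕ) {p q : ℕ} (α : Cochain k A k p) (β : Cochain k A k q)
    (σ : Fin (p + q - i) → Ω) : cup b i α β (fun l => b (σ l)) =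
    ∑ U ∈ (Finset.univ : Finset (Fin (p + q - i + 1))).powersetCard (i + 1),
      if (evenPart U).card = p + 1 ∧ (oddPart U).card = q + 1 then
        (-1) ^ (inversions U + (p + q) * i.choose 2) *
          α (faceAlong (EInf.enum ((evenPart U).map Fin.valEmbedding)) fun l => b (σ l)) *
          β (faceAlong (EInf.enum ((oddPart U).map Fin.valEmbedding)) fun l => b (σ l))
      else 0 := by
  rw [cup, ofBasis_apply]
  refine Finset.sum_congr rfl fun U _ => ?_
  split_ifs with h
  · rw [face_eq, face_eq]
  · rfl

theorem enum_strictMonoOn' {N : Finset ℕ} {p : ℕ} (h : N.card = p + 1) :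
    StrictMonoOn (EInf.enum N) (Finset.range (p + 1)) := h ▸ EInf.enum_strictMonoOn N

theorem enum_le {n p : ℕ} {N : Finset ℕ} (hN : N ⊆ Finset.range (n + 1)) (h : N.card = p + 1) :
    EInf.enum N p ≤ n := by
  have := hN (enum_mem (N := N) (i := p) (by omega))
  rw [Finset.mem_range] at this
  omega

theorem map_val_subset (U : Finset (Fin (n + 1))) :
    U.map Fin.valEmbedding ⊆ Finset.range (n + 1) := by
  intro x hx
  obtain ⟨y, -, rfl⟩ := Finset.mem_map.1 hx
  exact Finset.mem_range.2 y.isLt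

theorem apCup_Psi (hb : IsIdempotentBasis b) (i : ℕ) {p q : ℕ} (α : Cochain k A k p)
    (β : Cochain k A k q) : apCup b i (Psi b α) (Psi b β) = Psi b (cup b i α β) := by
  refine Psi_eq_Psi hb fun σ => ?_
  rw [cup_apply, cup_apply, Finset.mul_sum, Finset.mul_sum]
  refine Finset.sum_congr rfl fun U _ => ?_
  split_ifs with h
  · have h1 := weight_mul_Phi_Psi hb σ (enum_strictMonoOn' ((Finset.card_map _).trans h.1))
      (enum_le (map_val_subset _) ((Finset.card_map _).trans h.1)) α
    have h2 := weight_mul_Phi_Psi hb σ (enum_strictMonoOn' ((Finset.card_map _).trans h.2))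
      (enum_le (map_val_subset _) ((Finset.card_map _).trans h.2)) β
    rw [← mul_assoc, mul_left_comm, mul_assoc ((-1 : k) ^ _), h1, ← mul_assoc, mul_assoc,
      mul_right_comm, h2]
    ring
  · rfl

end Cochains
end Autopoietic

/-! ### Operations with natural kernels: relabelling and change of arguments -/

namespace EInf

section Kev
variable {k : Type u} [CommRing k] {r : ℕ}

theorem card_image_of_subset {N S : Finset ℕ} {φ : ℕ → ℕ} (hφ : StrictMonoOn φ N) (hS : S ⊆ N) :
    (S.image φ).card = S.card :=
  Finset.card_image_of_injOn (hφ.injOn.mono (Finset.coe_subset.2 hS))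

/-- Natural operations commute with restriction to faces: the subfamilies of `φ(N)` are the images
of those of `N`. -/
theorem kev_image {c : Kern k (Finset ℕ) r} (hc : Natural c) {N : Finset ℕ} {φ : ℕ → ℕ}
    (hφ : StrictMonoOn φ N) (f : Fin r → Finset ℕ → k) :
    kev c f (N.image φ) = kev c (fun j S => f j (S.image φ)) N := by
  rw [kev_eq, kev_eq]
  symm
  refine Finset.sum_nbij (fun y j => (y j).image φ) ?_ ?_ ?_ ?_
  · intro y hy
    rw [Fintype.mem_piFinset] at hy ⊢
    exact fun j => Finset.mem_Iic.2 (Finset.image_subset_image (Finset.mem_Iic.1 (hy j)))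
  · intro y hy z hz h
    rw [Finset.mem_coe, Fintype.mem_piFinset] at hy hz
    funext j
    ext x
    have hy' := Finset.mem_Iic.1 (hy j)
    have hz' := Finset.mem_Iic.1 (hz j)
    constructor
    · intro hx
      rw [← mem_image_iff hφ hz' (hy' hx)]
      refine (congrFun h j).subset ?_
      exact Finset.mem_image_of_mem φ hx
    · intro hx
      rw [← mem_image_iff hφ hy' (hz' hx)]
      refine (congrFun h j).superset ?_
      exact Finset.mem_image_of_mem φ hx
  · intro y hy
    rw [Finset.mem_coe, Fintype.mem_piFinset] at hy
    choose z hz hzy using fun j => Finset.subset_image_iff.1 (Finset.mem_Iic.1 (hy j))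
    refine ⟨z, ?_, funext hzy⟩
    rw [Finset.mem_coe, Fintype.mem_piFinset]
    exact fun j => Finset.mem_Iic.2 (Finset.coe_subset.1 (hz j))
  · intro y hy
    rw [Fintype.mem_piFinset] at hy
    rw [hc N y φ hφ fun j => Finset.mem_Iic.1 (hy j)]

/-- One factor `x` serves all `r` arguments: it is passed through the product and never used up. -/
theorem mul_kev_congr {x : k} (c : Kern k (Finset ℕ) r) {f g : Fin r → Finset ℕ → k} {N : Finset ℕ}
    (h : ∀ j, ∀ S ⊆ N, x * f j S = x * g j S) : x * kev c f N = x * kev c g N := by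
  rw [kev_eq, kev_eq, Finset.mul_sum, Finset.mul_sum]
  refine Finset.sum_congr rfl fun y hy => ?_
  rw [Fintype.mem_piFinset] at hy
  have h1 : ∀ s : Finset (Fin r), x * ∏ j ∈ s, f j (y j) = x * ∏ j ∈ s, g j (y j) := by
    intro s
    induction s using Finset.induction_on with
    | empty => rfl
    | insert a s ha ih =>
      rw [Finset.prod_insert ha, Finset.prod_insert ha, ← mul_assoc, h _ _ (Finset.mem_Iic.1 (hy a)),
        mul_right_comm, ih, mul_right_comm, mul_assoc]
  rw [mul_left_comm, h1, mul_left_comm]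

theorem kev_bd (f : Finset ℕ → k) (N : Finset ℕ) : kev (bd k) (fun _ => f) N =
    ∑ x ∈ N, if (N.erase x).Nonempty then (-1) ^ (N.filter (· < x)).card * f (N.erase x) else 0 := by
  rw [kev_eq]
  simp only [bd, Finset.sum_mul, Finset.univ_unique, Fin.default_eq_zero, Finset.prod_singleton]
  rw [Finset.sum_comm]
  refine Finset.sum_congr rfl fun x _ => ?_
  rw [Finset.sum_eq_single fun _ => N.erase x]
  · simp only [true_and, ite_mul, zero_mul]
  · intro y _ hy
    rw [if_neg, zero_mul]
    rintro ⟨h1, -⟩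
    exact hy (funext fun j => by rw [Subsingleton.elim j 0, h1])
  · intro h
    exact absurd (Fintype.mem_piFinset.2 fun _ => Finset.mem_Iic.2 (Finset.erase_subset x N)) h

theorem enum_image_of_subset {N S : Finset ℕ} {φ : ℕ → ℕ} (hφ : StrictMonoOn φ N) (hS : S ⊆ N)
    {j : ℕ} (hj : j < S.card) : enum (S.image φ) j = φ (enum S j) := by
  have h1 : StrictMonoOn φ S := hφ.mono (Finset.coe_subset.2 hS)
  rw [enum, sort_image h1, enum, List.getD_eq_getElem _ _ (by simpa using hj),
    List.getD_eq_getElem _ _ (by simpa using hj), List.getElem_map]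

end Kev
end EInf

namespace Autopoietic

/-! ### The coefficients of the faces of a simplex -/

section Coeffs
variable {k : Type u} {A : Type v} {Ω : Type w} [CommRing k] [Ring A] [Algebra k A]
  {b : Module.Basis Ω k A} (hb : IsIdempotentBasis b) {n : ℕ}

/-- The coefficients of the faces of the simplex `(φ₁, …, φₙ)`, normalised by the weight of the
simplex. -/
noncomputable def coeffs (σ : Fin n → Ω) : (⨁ m, AP b m) →ₗ[k] Finset ℕ → k where
  toFun f N := if N.Nonempty ∧ N ⊆ Finset.range (n + 1) then
    weight hb σ * Phi b (f (N.card - 1)) (faceAlong (EInf.enum N) fun l => b (σ l)) else 0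
  map_add' f g := by
    funext N
    rw [Pi.add_apply, DirectSum.add_apply, (Phi_isLinearMap hb).map_add, add_apply, mul_add]
    split_ifs
    · rfl
    · rw [add_zero]
  map_smul' c f := by
    funext N
    rw [RingHom.id_apply, Pi.smul_apply, DirectSum.smul_apply, (Phi_isLinearMap hb).map_smul,
      smul_apply, mul_smul_comm, smul_ite, smul_zero]

theorem coeffs_apply (σ : Fin n → Ω) (f : ⨁ m, AP b m) (N : Finset ℕ) :
    coeffs hb σ f N = if N.Nonempty ∧ N ⊆ Finset.range (n + 1) then
      weight hb σ * Phi b (f (N.card - 1)) (faceAlong (EInf.enum N) fun l => b (σ l)) else 0 := rfl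

theorem coeffs_of_card (σ : Fin n → Ω) (f : ⨁ m, AP b m) {N : Finset ℕ} {p : ℕ}
    (hN : N ⊆ Finset.range (n + 1)) (hp : N.card = p + 1) : coeffs hb σ f N =
      weight hb σ * Phi b (f p) (faceAlong (EInf.enum N) fun l => b (σ l)) := by
  obtain rfl : p = N.card - 1 := by omega
  exact if_pos ⟨Finset.card_pos.1 (by omega), hN⟩

theorem coeffs_eq_zero (σ : Fin n → Ω) {f : ⨁ m, AP b m} {N : Finset ℕ}
    (hf : f (N.card - 1) = 0) : coeffs hb σ f N = 0 := by
  rw [coeffs_apply, hf, (Phi_isLinearMap hb).map_zero, zero_apply, mul_zero, ite_self]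

theorem coeffs_ne_zero {σ : Fin n → Ω} {f : ⨁ m, AP b m} {N : Finset ℕ}
    (h : coeffs hb σ f N ≠ 0) : N.Nonempty ∧ f (N.card - 1) ≠ 0 := by
  refine ⟨?_, fun h1 => h (coeffs_eq_zero hb σ h1)⟩
  by_contra h1
  exact h (if_neg fun h2 => h1 h2.1)

theorem coeffs_lof_ne_zero {σ : Fin n → Ω} {p : ℕ} {x : AP b p} {N : Finset ℕ}
    (h : coeffs hb σ (DirectSum.lof k ℕ (fun m => AP b m) p x) N ≠ 0) : N.card = p + 1 := by
  obtain ⟨h1, h2⟩ := coeffs_ne_zero hb h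
  by_contra h3
  refine h2 (DirectSum.of_eq_of_ne _ _ _ ?_)
  have := h1.card_pos
  omega

theorem weight_mul_coeffs (σ : Fin n → Ω) (f : ⨁ m, AP b m) (N : Finset ℕ) :
    weight hb σ * coeffs hb σ f N = coeffs hb σ f N := by
  rw [coeffs_apply, mul_ite, mul_zero, ← mul_assoc, weight_mul_self]

theorem coeffs_range (σ : Fin n → Ω) (f : ⨁ m, AP b m) :
    coeffs hb σ f (Finset.range (n + 1)) = Phi b (f n) fun l => b (σ l) := by
  rw [coeffs_of_card hb σ f le_rfl (Finset.card_range _), ← Phi_mul_weight hb, mul_comm]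
  congr 2
  conv_rhs => rw [← faceAlong_id fun l => b (σ l)]
  refine faceAlong_congr (fun j hj => ?_) _
  conv_lhs => rw [← Finset.image_id (s := Finset.range (n + 1))]
  exact enum_image (strictMono_id.strictMonoOn _) hj

/-- A cochain is recovered from its coefficients on the top faces, because `Ψ ∘ Φ` is the identity.
All operad identities are checked in this way. -/
theorem ext_coeffs {f g : ⨁ m, AP b m} (h : ∀ σ : Fin n → Ω,
    coeffs hb σ f (Finset.range (n + 1)) = coeffs hb σ g (Finset.range (n + 1))) : f n = g n := by
  rw [← Psi_Phi hb (f n), ← Psi_Phi hb (g n)]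
  congr 1
  refine cochain_ext (b := b) fun σ => ?_
  rw [← coeffs_range hb, ← coeffs_range hb, h]

theorem deltaTotal_lof {p : ℕ} (x : AP b p) :
    deltaTotal hb (DirectSum.lof k ℕ (fun m => AP b m) p x) =
      DirectSum.lof k ℕ (fun m => AP b m) (p + 1) (delta hb p x) := by
  rw [deltaTotal, DirectSum.toModule_lof, LinearMap.comp_apply]

/-- The weight of the ambient simplex makes the coefficients of all its faces behave like simplicial
cochains, although `Φ` itself need not commute with the coboundaries. -/
theorem coeffs_deltaTotal_lof (σ : Fin n → Ω) {p : ℕ} (x : AP b p) {N : Finset ℕ}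
    (hN : N ⊆ Finset.range (n + 1)) :
    coeffs hb σ (deltaTotal hb (DirectSum.lof k ℕ (fun m => AP b m) p x)) N =
      EInf.kev (EInf.bd k) (fun _ => coeffs hb σ (DirectSum.lof k ℕ (fun m => AP b m) p x)) N := by
  rw [deltaTotal_lof, EInf.kev_bd]
  by_cases hp : N.card = p + 2
  · have h1 : StrictMonoOn (EInf.enum N) (Finset.range (p + 2)) := hp ▸ EInf.enum_strictMonoOn N
    have h2 : (Finset.range (p + 2)).image (EInf.enum N) = N := hp ▸ EInf.image_enum N
    have h3 : ∀ x ∈ N, (N.erase x).card = p + 1 := fun x hx => by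
      have := Finset.card_erase_add_one hx
      omega
    rw [coeffs_of_card hb σ _ hN hp, DirectSum.lof_apply,
      weight_mul_Phi_delta hb σ h1 (enum_le hN hp)]
    conv_rhs => rw [← h2]
    rw [Finset.sum_image h1.injOn]
    refine Finset.sum_congr rfl fun i hi => ?_
    have hi' := Finset.mem_range.1 hi
    have hm : EInf.enum N i ∈ N := enum_mem (by omega)
    have hs : (Finset.range (p + 1)).image (EInf.enum N ∘ skip i) = N.erase (EInf.enum N i) := by
      rw [← Finset.image_image, image_skip hi', ← h2, ← Finset.coe_inj, Finset.coe_image,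
        Finset.coe_erase, Finset.coe_erase, Finset.coe_image, h2]
      rw [h1.injOn.image_sdiff_subset (by simpa using hi'), Set.image_singleton]
    have hmono : StrictMonoOn (EInf.enum N ∘ skip i) (Finset.range (p + 1)) := by
      refine h1.comp ((skip_strictMono i).strictMonoOn _) fun x hx => ?_
      have : x < p + 1 := by simpa using hx
      simp only [skip, Finset.coe_range, Set.mem_Iio]
      split_ifs <;> omega
    rw [h2, if_pos (Finset.card_pos.1 (by rw [h3 _ hm]; omega)),
      coeffs_of_card hb σ _ ((Finset.erase_subset _ _).trans hN) (h3 _ hm), DirectSum.lof_apply]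
    have h4 : (N.filter (· < EInf.enum N i)).card = i := by
      have := EInf.card_filter_image h1 (Finset.mem_range.2 hi')
      rw [h2] at this
      rw [this, show (Finset.range (p + 2)).filter (· < i) = Finset.range i by ext; simp; omega,
        Finset.card_range]
    have h5 : (faceAlong (EInf.enum N ∘ skip i) fun l => b (σ l) : Fin p → A) =
        faceAlong (EInf.enum (N.erase (EInf.enum N i))) fun l => b (σ l) :=
      faceAlong_congr (fun j hj => by rw [← hs, enum_image hmono hj]) _
    rw [h4, h5]
  · rw [Finset.sum_eq_zero]
    · by_contra h
      exact hp (coeffs_lof_ne_zero hb h)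
    · intro y hy
      rw [ite_eq_right_iff]
      intro _
      refine mul_eq_zero_of_right _ ?_
      by_contra h
      have h1 := coeffs_lof_ne_zero hb h
      have h2 := Finset.card_erase_add_one hy
      omega

/-! ### The operations on the total complex -/

variable {r : ℕ}

/-- The component of degree `n` of the value of the operation with the kernel `c`. -/
noncomputable def actAt (c : EInf.Kern k (Finset ℕ) r) (n : ℕ) (f : Fin r → ⨁ m, AP b m) : AP b n :=
  Psi b (ofBasis b fun σ => EInf.kev c (fun j => coeffs hb σ (f j)) (Finset.range (n + 1)))

/-- The operation is defined on top faces only. On a face `N` it is computed in the tuple `τ`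
underlying that face; naturality transports the kernel along the enumeration of `N`, and the weight
of `σ` absorbs the weight of `τ` and the idempotents on the edges. -/
theorem coeffs_actAt {c : EInf.Kern k (Finset ℕ) r} (hc : EInf.Natural c)
    (f : Fin r → ⨁ m, AP b m) {g : ⨁ m, AP b m} (hg : ∀ m, g m = actAt hb c m f) (σ : Fin n → Ω)
    {N : Finset ℕ} (hN : N.Nonempty) (hN' : N ⊆ Finset.range (n + 1)) :
    coeffs hb σ g N = weight hb σ * EInf.kev c (fun j => coeffs hb σ (f j)) N := by
  obtain ⟨m, hm⟩ : ∃ m, N.card = m + 1 := ⟨N.card - 1, by have := hN.card_pos; omega⟩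
  have hmono := enum_strictMonoOn' hm
  have himg : (Finset.range (m + 1)).image (EInf.enum N) = N := hm ▸ EInf.image_enum N
  rw [coeffs_of_card hb σ g hN' hm, hg, actAt, weight_mul_Phi_Psi hb σ hmono (enum_le hN' hm)]
  obtain ⟨τ, μ, -, hτ, hμ, hw⟩ := exists_faceAlong_eq hb σ hmono (enum_le hN' hm)
  have h1 : (faceAlong (EInf.enum N) (fun l => b (σ l)) : Fin m → A) = fun j => μ j • b (τ j) :=
    funext hτ
  rw [h1, weight_mul_apply hμ, ofBasis_apply]
  conv_rhs => rw [← himg, EInf.kev_image hc hmono]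
  refine EInf.mul_kev_congr c fun j S hS => ?_
  by_cases hS0 : S.Nonempty
  · obtain ⟨q, hq⟩ : ∃ q, S.card = q + 1 := ⟨S.card - 1, by have := hS0.card_pos; omega⟩
    have hq' : (S.image (EInf.enum N)).card = q + 1 := by
      rw [EInf.card_image_of_subset hmono hS, hq]
    have hsub : S.image (EInf.enum N) ⊆ Finset.range (n + 1) :=
      ((Finset.image_subset_image hS).trans_eq himg).trans hN'
    rw [coeffs_of_card hb τ _ hS hq, coeffs_of_card hb σ _ hsub hq', ← mul_assoc, hw, ← mul_assoc,
      weight_mul_self, ← mul_apply_faceAlong hμ _ (enum_strictMonoOn' hq), ← h1,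
      faceAlong_faceAlong hmono (enum_strictMonoOn' hq) (enum_le hS hq)]
    congr 2
    exact faceAlong_congr (fun j hj =>
      (EInf.enum_image_of_subset hmono hS (by omega)).symm) _
  · rw [Finset.not_nonempty_iff_eq_empty.1 hS0, Finset.image_empty, coeffs_apply, coeffs_apply,
      if_neg (by simp), if_neg (by simp)]

theorem actAt_eq_zero (c : EInf.Kern k (Finset ℕ) r) (n : ℕ) (f : Fin r → ⨁ m, AP b m)
    (h : ∀ S, c (Finset.range (n + 1)) S ≠ 0 → ∃ j, f j ((S j).card - 1) = 0) :
    actAt hb c n f = 0 := by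
  rw [← Psi_isLinearMap.map_zero, actAt]
  congr 1
  refine cochain_ext (b := b) fun σ => ?_
  rw [ofBasis_apply, zero_apply, EInf.kev_eq]
  refine Finset.sum_eq_zero fun S _ => ?_
  by_cases h0 : c (Finset.range (n + 1)) S = 0
  · rw [h0, zero_mul]
  · obtain ⟨j, hj⟩ := h S h0
    rw [Finset.prod_eq_zero (Finset.mem_univ j) (coeffs_eq_zero hb σ hj), mul_zero]

/-- Since the excess is not negative, the output degree is at most the sum of the input degrees. The
values therefore have finitely many components and lie in the direct sum. -/
theorem exists_actAt_eq_zero {c : EInf.Kern k (Finset ℕ) r}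
    (hc : c ∈ EInf.linkedKern k r) (f : Fin r → ⨁ m, AP b m) : ∃ B, ∀ n, B ≤ n → actAt hb c n f = 0 := by
  classical
  have h1 : ∀ j, ∃ B, ∀ n, B < n → f j n = 0 := fun j =>
    ⟨(f j).support.sup id, fun n hn => by
      by_contra h
      exact absurd (Finset.le_sup (f := id) (DFinsupp.mem_support_iff.2 h)) (not_le.2 hn)⟩
  choose B hB using h1
  refine ⟨∑ j, B j + 1, fun n hn => actAt_eq_zero hb c n f fun S hS => ?_⟩
  by_contra! h
  have h2 := EInf.IsLinked.excess_nonneg hc hS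
  have h3 : ∀ j, ((S j).card : ℤ) - 1 ≤ B j := by
    intro j
    have := not_lt.1 (mt (hB j _) (h j))
    omega
  have h4 := Finset.sum_le_sum fun j (_ : j ∈ Finset.univ) => h3 j
  rw [EInf.excess, Finset.card_range] at h2
  push_cast at h2
  have h5 : (∑ j, (B j : ℤ)) = ((∑ j, B j : ℕ) : ℤ) := by push_cast; rfl
  omega

theorem actAt_update_add (c : EInf.Kern k (Finset ℕ) r) (n : ℕ) (f : Fin r → ⨁ m, AP b m)
    (j : Fin r) (x y : ⨁ m, AP b m) : actAt hb c n (Function.update f j (x + y)) =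
      actAt hb c n (Function.update f j x) + actAt hb c n (Function.update f j y) := by
  rw [actAt, actAt, actAt, ← Psi_isLinearMap.map_add]
  congr 1
  refine cochain_ext (b := b) fun σ => ?_
  have h : ∀ x, (fun l => coeffs hb σ (Function.update f j x l)) =
      Function.update (fun l => coeffs hb σ (f l)) j (coeffs hb σ x) := fun x => by
    funext l
    by_cases hl : l = j
    · subst hl; simp
    · simp [hl]
  rw [add_apply, ofBasis_apply, ofBasis_apply, ofBasis_apply, h, h, h, map_add, EInf.kev,
    MultilinearMap.map_update_add]
  rfl

theorem actAt_update_smul (c : EInf.Kern k (Finset ℕ) r) (n : ℕ) (f : Fin r → ⨁ m, AP b m)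
    (j : Fin r) (a : k) (x : ⨁ m, AP b m) : actAt hb c n (Function.update f j (a • x)) =
      a • actAt hb c n (Function.update f j x) := by
  rw [actAt, actAt, ← Psi_isLinearMap.map_smul]
  congr 1
  refine cochain_ext (b := b) fun σ => ?_
  have h : ∀ x, (fun l => coeffs hb σ (Function.update f j x l)) =
      Function.update (fun l => coeffs hb σ (f l)) j (coeffs hb σ x) := fun x => by
    funext l
    by_cases hl : l = j
    · subst hl; simp
    · simp [hl]
  rw [smul_apply, ofBasis_apply, ofBasis_apply, h, h, map_smul, EInf.kev,
    MultilinearMap.map_update_smul]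
  rfl

/-- The value of the operation with the kernel `c`. -/
noncomputable def actFun {c : EInf.Kern k (Finset ℕ) r}
    (hc : c ∈ EInf.linkedKern k r) (f : Fin r → ⨁ m, AP b m) : ⨁ m, AP b m :=
  DirectSum.mk (fun m => AP b m) (Finset.range (exists_actAt_eq_zero hb hc f).choose)
    fun m => actAt hb c m f

theorem actFun_apply {c : EInf.Kern k (Finset ℕ) r}
    (hc : c ∈ EInf.linkedKern k r) (f : Fin r → ⨁ m, AP b m) (m : ℕ) : actFun hb hc f m = actAt hb c m f := by
  by_cases h : m ∈ Finset.range (exists_actAt_eq_zero hb hc f).choose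
  · exact DirectSum.mk_apply_of_mem h
  · rw [(exists_actAt_eq_zero hb hc f).choose_spec m (by simpa using h)]
    exact DirectSum.mk_apply_of_notMem h

/-- The operation with the kernel `c` on the total complex. -/
noncomputable def actMultilinear {c : EInf.Kern k (Finset ℕ) r}
    (hc : c ∈ EInf.linkedKern k r) :
    MultilinearMap k (fun _ : Fin r => ⨁ m, AP b m) (⨁ m, AP b m) where
  toFun := actFun hb hc
  map_update_add' {inst} f j x y := by
    obtain rfl : inst = instDecidableEqFin _ := Subsingleton.elim _ _
    refine DFinsupp.ext fun m => ?_
    rw [DirectSum.add_apply, actFun_apply, actFun_apply, actFun_apply]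
    exact actAt_update_add hb c m f j x y
  map_update_smul' {inst} f j a x := by
    obtain rfl : inst = instDecidableEqFin _ := Subsingleton.elim _ _
    refine DFinsupp.ext fun m => ?_
    rw [DirectSum.smul_apply, actFun_apply, actFun_apply]
    exact actAt_update_smul hb c m f j a x

theorem actMultilinear_apply {c : EInf.Kern k (Finset ℕ) r}
    (hc : c ∈ EInf.linkedKern k r) (f : Fin r → ⨁ m, AP b m) (m : ℕ) : actMultilinear hb hc f m = actAt hb c m f :=
  actFun_apply hb hc f m

theorem actAt_add (c c' : EInf.Kern k (Finset ℕ) r) (f : Fin r → ⨁ m, AP b m) (m : ℕ) :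
    actAt hb (c + c') m f = actAt hb c m f + actAt hb c' m f := by
  rw [actAt, actAt, actAt, ← Psi_isLinearMap.map_add]
  congr 1
  refine cochain_ext (b := b) fun σ => ?_
  rw [add_apply, ofBasis_apply, ofBasis_apply, ofBasis_apply]
  exact EInf.kev_add c c' _ _

theorem actAt_smul (a : k) (c : EInf.Kern k (Finset ℕ) r) (f : Fin r → ⨁ m, AP b m) (m : ℕ) :
    actAt hb (a • c) m f = a • actAt hb c m f := by
  rw [actAt, actAt, ← Psi_isLinearMap.map_smul]
  congr 1
  refine cochain_ext (b := b) fun σ => ?_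
  rw [smul_apply, ofBasis_apply, ofBasis_apply]
  exact EInf.kev_smul a c _ _

/-- The operations on the total complex. -/
noncomputable def act (r : ℕ) : EInf.linkedKern k r →ₗ[k]
    MultilinearMap k (fun _ : Fin r => ⨁ m, AP b m) (⨁ m, AP b m) where
  toFun c := actMultilinear hb c.2
  map_add' c c' := by
    refine MultilinearMap.ext fun f => DFinsupp.ext fun m => ?_
    rw [add_apply, DirectSum.add_apply, actMultilinear_apply, actMultilinear_apply,
      actMultilinear_apply]
    exact actAt_add hb c.1 c'.1 f m
  map_smul' a c := by
    refine MultilinearMap.ext fun f => DFinsupp.ext fun m => ?_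
    rw [smul_apply, DirectSum.smul_apply, actMultilinear_apply, actMultilinear_apply]
    exact actAt_smul hb a c.1 f m

theorem act_apply (c : EInf.linkedKern k r) (f : Fin r → ⨁ m, AP b m) (m : ℕ) :
    act hb r c f m = actAt hb c.1 m f := actMultilinear_apply hb c.2 f m

theorem coeffs_act (c : EInf.linkedKern k r) (f : Fin r → ⨁ m, AP b m) (σ : Fin n → Ω)
    {N : Finset ℕ} (hN : N.Nonempty) (hN' : N ⊆ Finset.range (n + 1)) :
    coeffs hb σ (act hb r c f) N =
      weight hb σ * EInf.kev c.1 (fun j => coeffs hb σ (f j)) N :=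
  coeffs_actAt hb c.2.natural f (act_apply hb c f) σ hN hN'

end Coeffs
end Autopoietic

/-! ### Evaluation of the identity and of the square of the coboundary -/

namespace EInf

section Kev
variable {k : Type u} [CommRing k] {r : ℕ}

theorem kev_linkedOne (f : Fin 1 → Finset ℕ → k) {N : Finset ℕ} (hN : N.Nonempty) :
    kev linkedOne f N = f 0 N := by
  rw [kev_eq, Finset.sum_eq_single fun _ => N]
  · simp [linkedOne, hN]
  · intro y _ hy
    rw [linkedOne, if_neg, zero_mul]
    rintro ⟨h1, -⟩
    exact hy (funext fun j => by rw [Subsingleton.elim j 0, h1])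
  · intro h
    exact absurd (Fintype.mem_piFinset.2 fun _ => Finset.mem_Iic.2 le_rfl) h

theorem kev_empty {c : Kern k (Finset ℕ) r} (hc : Supp c) (f : Fin r → Finset ℕ → k) :
    kev c f ∅ = 0 := by
  rw [kev_eq]
  refine Finset.sum_eq_zero fun y _ => ?_
  by_cases h : c ∅ y = 0
  · rw [h, zero_mul]
  · exact absurd (hc _ _ h).1 Finset.not_nonempty_empty

theorem kev_bd_bd (f : Finset ℕ → k) {p : ZMod 2} (hf : ∀ S, f S ≠ 0 → dimParity S = p)
    (N : Finset ℕ) : kev (bd k) (fun _ => kev (bd k) fun _ => f) N = 0 := by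
  have h1 := kev_kcomp dimParity (r := 1) (s := 1) (n := 1) rfl 0 (bd k) bd_supp.local bd_parity
    (fun _ => f) (fun _ => p) (fun _ => hf) N
  rw [bd_bd] at h1
  have h2 : kev (0 : Kern k (Finset ℕ) 1) (fun _ => f) N = 0 := by simp [kev_eq]
  have h3 : outerFam (rfl : 1 + 1 = 1 + 1) (0 : Fin 1) (fun _ => f) (kev (bd k)
      (innerFam (rfl : 1 + 1 = 1 + 1) 0 fun _ => f)) = fun _ => kev (bd k) fun _ => f := by
    funext j
    rw [Subsingleton.elim j 0, outerFam_self]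
    rfl
  rw [h2, h3] at h1
  have h4 := congrArg (sgn k (1 * pre id ((0 : Fin 1) : ℕ) fun _ : Fin 1 => p) * ·) h1
  simpa [← mul_assoc, sgn_mul_self] using h4.symm

theorem sgn_pre (a : ℕ) (i : Fin r) (p : Fin r → ℕ) :
    (-1 : k) ^ (a + ∑ l : Fin r with l < i, p l) =
      sgn k (a + pre id i fun j => (p j : ZMod 2)) := by
  rw [← sgn_natCast, Nat.cast_add, Nat.cast_sum, Finset.sum_filter]
  rfl

end Kev
end EInf

namespace Autopoietic

/-! ### The algebra structure on the total complex -/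

section Algebra
variable {k : Type u} {A : Type v} {Ω : Type w} [CommRing k] [Ring A] [Algebra k A]
  {b : Module.Basis Ω k A} (hb : IsIdempotentBasis b) {n r : ℕ}

open EInf

theorem coeffs_act_of_subset (c : linkedKern k r) (f : Fin r → ⨁ m, AP b m) (σ : Fin n → Ω)
    {N : Finset ℕ} (hN : N ⊆ Finset.range (n + 1)) :
    coeffs hb σ (act hb r c f) N = weight hb σ * kev c.1 (fun j => coeffs hb σ (f j)) N := by
  by_cases h : N.Nonempty
  · exact coeffs_act hb c f σ h hN
  · rw [Finset.not_nonempty_iff_eq_empty.1 h, kev_empty c.2.supp, mul_zero, coeffs_apply,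
      if_neg (by simp)]

theorem coeffs_deltaTotal (σ : Fin n → Ω) (f : ⨁ m, AP b m) {N : Finset ℕ}
    (hN : N ⊆ Finset.range (n + 1)) :
    coeffs hb σ (deltaTotal hb f) N = kev (bd k) (fun _ => coeffs hb σ f) N := by
  induction f using DirectSum.induction_on with
  | zero => simp [kev_bd]
  | of p x => exact coeffs_deltaTotal_lof hb σ x hN
  | add f g hf hg =>
    rw [map_add, map_add, Pi.add_apply, hf, hg, kev_bd, kev_bd, kev_bd, ← Finset.sum_add_distrib]
    refine Finset.sum_congr rfl fun x _ => ?_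
    split_ifs
    · rw [map_add, Pi.add_apply, mul_add]
    · rw [add_zero]

theorem dimParity_of_coeffs_ne_zero {σ : Fin n → Ω} {p : ℕ} {x : AP b p} {N : Finset ℕ}
    (h : coeffs hb σ (DirectSum.lof k ℕ (fun m => AP b m) p x) N ≠ 0) :
    dimParity N = (p : ZMod 2) := by
  rw [dimParity, coeffs_lof_ne_zero hb h]
  push_cast
  rw [add_assoc, show (1 + 1 : ZMod 2) = 0 from rfl, add_zero]

theorem deltaTotal_deltaTotal (f : ⨁ m, AP b m) : deltaTotal hb (deltaTotal hb f) = 0 := by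
  induction f using DirectSum.induction_on with
  | zero => simp
  | of p x =>
    refine DFinsupp.ext fun n => ext_coeffs hb fun σ => ?_
    rw [coeffs_deltaTotal hb σ _ le_rfl, map_zero, Pi.zero_apply,
      ← kev_bd_bd (coeffs hb σ (DirectSum.lof k ℕ (fun m => AP b m) p x))
        (fun S h => dimParity_of_coeffs_ne_zero hb h) (Finset.range (n + 1))]
    exact kev_congr _ fun y hy j => coeffs_deltaTotal hb σ _ ((bd_supp _ _ hy).2 j).2
  | add f g hf hg => rw [map_add, map_add, hf, hg, add_zero]

theorem act_one {c : linkedKern k 1} (hc : c.1 = linkedOne) (x : Fin 1 → ⨁ m, AP b m) :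
    act hb 1 c x = x 0 := by
  refine DFinsupp.ext fun n => ext_coeffs hb fun σ => ?_
  have h1 : (Finset.range (n + 1)).Nonempty := by simp
  rw [coeffs_act hb _ x σ h1 le_rfl, hc, ← weight_mul_coeffs hb σ (x 0)]
  congr 1
  exact kev_linkedOne _ h1

theorem act_deg {a : ℕ} {c : linkedKern k r} (p : Fin r → ℕ) (x : ∀ j, AP b (p j))
    (hc : HasDeg c.1 a) (hn : n + a ≠ ∑ j, p j) :
    act hb r c (fun j => DirectSum.lof k ℕ (fun m => AP b m) (p j) (x j)) n = 0 := by
  rw [act_apply]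
  refine actAt_eq_zero hb _ _ _ fun S hS => ?_
  by_contra! h
  have h1 : ∀ j, (S j).card - 1 = p j := fun j => by
    by_contra h2
    exact h j (DirectSum.of_eq_of_ne _ _ _ h2)
  have h2 : ∀ j, ((S j).card : ℤ) - 1 = p j := fun j => by
    have := (((c.2.supp _ _ hS).2 j).1).card_pos
    have := h1 j
    omega
  have h3 := hc _ _ hS
  rw [excess, Finset.sum_congr rfl fun j _ => h2 j, Finset.card_range, ← Nat.cast_sum] at h3
  push_cast at h3
  have h5 : (∑ j, (p j : ℤ)) = ((∑ j, p j : ℕ) : ℤ) := by push_cast; rfl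
  omega

/-- For each `σ` this is the Leibniz rule `kev_kd` for the coefficient functions. Replacing the
arguments by coefficients of operations introduces further weights, which are idempotent and already
present as a factor. -/
theorem deltaTotal_act {a : ℕ} {c d : linkedKern k r} (p : Fin r → ℕ) (x : ∀ j, AP b (p j))
    (hc : HasDeg c.1 a) (hd : d.1 = dk c.1) :
    deltaTotal hb (act hb r c fun j => DirectSum.lof k ℕ (fun m => AP b m) (p j) (x j)) =
      act hb r d
        (fun j => DirectSum.lof k ℕ (fun m => AP b m) (p j) (x j)) +
      ∑ j : Fin r, (-1 : k) ^ (a + ∑ l : Fin r with l < j, p l) •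
        act hb r c (Function.update (fun l => DirectSum.lof k ℕ (fun m => AP b m) (p l) (x l)) j
          (deltaTotal hb (DirectSum.lof k ℕ (fun m => AP b m) (p j) (x j)))) := by
  set F : Fin r → ⨁ m, AP b m := fun j => DirectSum.lof k ℕ (fun m => AP b m) (p j) (x j) with hF
  refine DFinsupp.ext fun n => ext_coeffs hb fun σ => ?_
  rw [← weight_mul_coeffs, coeffs_deltaTotal hb σ _ le_rfl, mul_kev_congr (bd k)
    (g := fun _ => kev c.1 fun j => coeffs hb σ (F j)) fun _ S hS => by
      rw [coeffs_act_of_subset hb c F σ hS, ← mul_assoc, weight_mul_self],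
    kev_kd dimParity bd_parity bd_supp.local c.2.supp.local hc.parity _ (fun j => (p j : ZMod 2))
      fun j S h => dimParity_of_coeffs_ne_zero hb h]
  rw [map_add, map_sum, Pi.add_apply, Finset.sum_apply, mul_add, Finset.mul_sum]
  congr 1
  · rw [coeffs_act_of_subset hb _ F σ le_rfl, hd]
    rfl
  · refine Finset.sum_congr rfl fun j _ => ?_
    rw [map_smul, Pi.smul_apply, coeffs_act_of_subset hb _ _ σ le_rfl, smul_eq_mul, mul_left_comm,
      Int.cast_natCast, ← sgn_pre]
    congr 1
    refine mul_kev_congr _ fun l S hS => ?_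
    by_cases hl : l = j
    · subst hl
      rw [Function.update_self, Function.update_self, coeffs_deltaTotal hb σ _ hS]
    · rw [Function.update_of_ne hl, Function.update_of_ne hl]

theorem act_perm {c d : linkedKern k r} (τ : Equiv.Perm (Fin r)) (hd : d.1 = kact dimParity τ c.1)
    (p : Fin r → ℕ)
    (x : ∀ j, AP b (p j)) :
    act hb r d
        (fun j => DirectSum.lof k ℕ (fun m => AP b m) (p j) (x j)) =
      koszulSign k τ p • act hb r c fun j =>
        DirectSum.lof k ℕ (fun m => AP b m) (p (τ.symm j)) (x (τ.symm j)) := by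
  refine DFinsupp.ext fun n => ext_coeffs hb fun σ => ?_
  rw [map_smul, Pi.smul_apply, coeffs_act_of_subset hb _ _ σ le_rfl,
    coeffs_act_of_subset hb _ _ σ le_rfl, smul_eq_mul, mul_left_comm, koszulSign_eq, hd]
  congr 1
  exact kev_kact dimParity τ c.1 _ (fun j => (p j : ZMod 2))
    (fun j S h => dimParity_of_coeffs_ne_zero hb h) _

theorem act_comp {s m e : ℕ} (h : m + 1 = r + s) (i : Fin r) (c : linkedKern k r)
    {c' : linkedKern k s} {d : linkedKern k m} (hd : d.1 = kcomp dimParity h i c.1 c'.1)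
    (p : Fin m → ℕ) (x : ∀ j, AP b (p j)) (hc' : HasDeg c'.1 e) :
    act hb m d
        (fun j => DirectSum.lof k ℕ (fun m => AP b m) (p j) (x j)) =
      (-1 : k) ^ (e * ∑ l ∈ Finset.univ.filter (fun l : Fin m => (l : ℕ) < i), p l) •
        act hb r c (fun j => if hj : j = i
          then act hb s c' (fun l => DirectSum.lof k ℕ (fun m => AP b m) _ (x (innerPos h i l)))
          else DirectSum.lof k ℕ (fun m => AP b m) _ (x (outerPos h i j hj))) := by
  refine DFinsupp.ext fun n => ext_coeffs hb fun σ => ?_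
  rw [map_smul, Pi.smul_apply, coeffs_act_of_subset hb _ _ σ le_rfl,
    coeffs_act_of_subset hb _ _ σ le_rfl, smul_eq_mul, hd]
  have h1 := kev_kcomp dimParity h i c.1 c'.2.supp.local hc'.parity
    (fun j => coeffs hb σ (DirectSum.lof k ℕ (fun m => AP b m) (p j) (x j)))
    (fun j => (p j : ZMod 2)) (fun j S h => dimParity_of_coeffs_ne_zero hb h)
    (Finset.range (n + 1))
  have h2 : (-1 : k) ^ (e * ∑ l ∈ Finset.univ.filter (fun l : Fin m => (l : ℕ) < i), p l) =
      sgn k (((e : ℤ) : ZMod 2) * pre id i fun j => (p j : ZMod 2)) := by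
    rw [← sgn_natCast, Nat.cast_mul, Nat.cast_sum, Finset.sum_filter, Int.cast_natCast]
    rfl
  rw [h1, h2, mul_left_comm]
  congr 1
  refine mul_kev_congr _ fun j S hS => ?_
  by_cases hj : j = i
  · subst hj
    rw [outerFam_self, dif_pos rfl, coeffs_act_of_subset hb _ _ σ hS, ← mul_assoc,
      weight_mul_self]
    rfl
  · rw [outerFam_of_ne _ _ _ _ hj, dif_neg hj]

/-- The autopoietic cochains as an algebra over the operad of linked kernels. -/
noncomputable def operadAlgebra :
    OperadAlgebra (linkedOperad k) (fun n => AP b n) (deltaTotal hb) where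
  D_deg {p n} x hn := by
    rw [deltaTotal_lof]
    exact DirectSum.of_eq_of_ne _ _ _ hn
  D_D := deltaTotal_deltaTotal hb
  act r := act hb r
  act_deg p x hu hn := act_deg hb p x hu hn
  act_one := act_one hb rfl
  D_act p x hu := deltaTotal_act hb p x hu rfl
  act_perm u σ p x := act_perm hb σ rfl p x
  act_comp h i u _ p x hw := act_comp hb h i u rfl p x hw

theorem act_unitKern : act hb 0 ⟨unitKern, unitKern_isLinked⟩ ![] =
    incl b (Psi b (ofBasis b fun _ : Fin 0 → Ω => (1 : k))) := by
  refine DFinsupp.ext fun n => ?_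
  rw [act_apply]
  cases n with
  | zero =>
    rw [incl, DirectSum.lof_apply, actAt]
    congr 2
    funext σ
    rw [kev_eq, Finset.sum_eq_single ![]]
    · simp [unitKern]
    · intro y _ hy
      exact absurd (Subsingleton.elim _ _) hy
    · intro h
      exact absurd (Fintype.mem_piFinset.2 fun j => j.elim0) h
  | succ n =>
    rw [incl, actAt_eq_zero]
    · exact (DirectSum.of_eq_of_ne (β := fun n => AP b n) _ _ _ (Nat.succ_ne_zero n)).symm
    · intro S hS
      have := unitKern_ne_zero (k := k) (S := S) hS
      simp at this

/-- The only nonempty face of a vertex is the vertex itself, so a component of degree zero needs an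
input component of degree zero. -/
theorem act_pos (c : linkedKern k (r + 1)) (p : Fin (r + 1) → ℕ) (x : ∀ j, AP b (p j + 1)) :
    act hb (r + 1) c (fun j => incl b (x j)) 0 = 0 := by
  rw [act_apply]
  refine actAt_eq_zero hb _ _ _ fun S hS => ⟨0, DirectSum.of_eq_of_ne _ _ _ ?_⟩
  have h1 := Finset.card_le_card ((c.2.supp _ _ hS).2 0).2
  rw [Finset.card_range] at h1
  omega

end Algebra
end Autopoietic

namespace Autopoietic

/-! ### The cup products as operations -/

section CutSets
variable {n : ℕ}

theorem card_filter_map_val (U : Finset (Fin (n + 1))) (v : Fin (n + 1)) :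
    ((U.map Fin.valEmbedding).filter (· < (v : ℕ))).card = (U.filter (· < v)).card := by
  rw [Finset.filter_map, Finset.card_map]
  rfl

theorem map_evenPart (U : Finset (Fin (n + 1))) : (evenPart U).map Fin.valEmbedding =
    (Finset.range (n + 1)).filter (fun v => v ∈ U.map Fin.valEmbedding ∨
      Even ((U.map Fin.valEmbedding).filter (· < v)).card) := by
  ext x
  rw [Finset.mem_filter, Finset.mem_range]
  constructor
  · intro hx
    obtain ⟨y, hy, rfl⟩ := Finset.mem_map.1 hx
    rw [evenPart, Finset.mem_filter] at hy
    refine ⟨y.isLt, ?_⟩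
    rw [Finset.mem_map', Fin.valEmbedding_apply, card_filter_map_val]
    exact hy.2
  · rintro ⟨hx, h⟩
    have h1 := card_filter_map_val U ⟨x, hx⟩
    rw [Fin.val_mk] at h1
    have h2 : x ∈ U.map Fin.valEmbedding ↔ ⟨x, hx⟩ ∈ U :=
      Finset.mem_map' Fin.valEmbedding (a := ⟨x, hx⟩)
    rw [h1, h2] at h
    exact Finset.mem_map.2 ⟨⟨x, hx⟩, Finset.mem_filter.2 ⟨Finset.mem_univ _, h⟩, rfl⟩

theorem map_oddPart (U : Finset (Fin (n + 1))) : (oddPart U).map Fin.valEmbedding =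
    (Finset.range (n + 1)).filter (fun v => v ∈ U.map Fin.valEmbedding ∨
      Odd ((U.map Fin.valEmbedding).filter (· < v)).card) := by
  ext x
  rw [Finset.mem_filter, Finset.mem_range]
  constructor
  · intro hx
    obtain ⟨y, hy, rfl⟩ := Finset.mem_map.1 hx
    rw [oddPart, Finset.mem_filter] at hy
    refine ⟨y.isLt, ?_⟩
    rw [Finset.mem_map', Fin.valEmbedding_apply, card_filter_map_val]
    exact hy.2
  · rintro ⟨hx, h⟩
    have h1 := card_filter_map_val U ⟨x, hx⟩
    rw [Fin.val_mk] at h1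
    have h2 : x ∈ U.map Fin.valEmbedding ↔ ⟨x, hx⟩ ∈ U :=
      Finset.mem_map' Fin.valEmbedding (a := ⟨x, hx⟩)
    rw [h1, h2] at h
    exact Finset.mem_map.2 ⟨⟨x, hx⟩, Finset.mem_filter.2 ⟨Finset.mem_univ _, h⟩, rfl⟩

theorem evenPart_inter_oddPart (U : Finset (Fin (n + 1))) : evenPart U ∩ oddPart U = U := by
  ext v
  simp only [evenPart, oddPart, Finset.mem_inter, Finset.mem_filter, Finset.mem_univ, true_and,
    ← Nat.not_even_iff_odd]
  tauto

/-- The two faces which belong to a set of cut points. -/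
def cutFaces (U : Finset (Fin (n + 1))) : Fin 2 → Finset ℕ :=
  ![(evenPart U).map Fin.valEmbedding, (oddPart U).map Fin.valEmbedding]

theorem cutFaces_inter (U : Finset (Fin (n + 1))) :
    cutFaces U 0 ∩ cutFaces U 1 = U.map Fin.valEmbedding := by
  change (evenPart U).map Fin.valEmbedding ∩ (oddPart U).map Fin.valEmbedding = _
  rw [← Finset.map_inter, evenPart_inter_oddPart]

theorem cutFaces_subset (U : Finset (Fin (n + 1))) (j : Fin 2) :
    cutFaces U j ⊆ Finset.range (n + 1) := by
  revert j
  exact Fin.forall_fin_two.2 ⟨map_val_subset _, map_val_subset _⟩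

/-- Since the two parts meet exactly in `U`, removing `U` from one part is the same as removing the
other part; this matches the count in `altKern_apply`. -/
theorem inversions_eq (U : Finset (Fin (n + 1))) : inversions U =
    ((Finset.range (n + 1) ×ˢ Finset.range (n + 1)).filter (fun z =>
      z.1 ∈ cutFaces U 1 \ cutFaces U 0 ∧ z.2 ∈ cutFaces U 0 \ cutFaces U 1 ∧ z.1 < z.2)).card := by
  have hO : ∀ x, x ∈ oddPart U \ U ↔ (x : ℕ) ∈ cutFaces U 1 \ cutFaces U 0 := by
    intro x
    change _ ↔ Fin.valEmbedding x ∈ (oddPart U).map _ \ (evenPart U).map _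
    rw [← Finset.map_sdiff, Finset.mem_map', Finset.mem_sdiff, Finset.mem_sdiff]
    have h1 := evenPart_inter_oddPart U
    rw [Finset.ext_iff] at h1
    have h2 := h1 x
    rw [Finset.mem_inter] at h2
    tauto
  have hE : ∀ x, x ∈ evenPart U \ U ↔ (x : ℕ) ∈ cutFaces U 0 \ cutFaces U 1 := by
    intro x
    change _ ↔ Fin.valEmbedding x ∈ (evenPart U).map _ \ (oddPart U).map _
    rw [← Finset.map_sdiff, Finset.mem_map', Finset.mem_sdiff, Finset.mem_sdiff]
    have h1 := evenPart_inter_oddPart U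
    rw [Finset.ext_iff] at h1
    have h2 := h1 x
    rw [Finset.mem_inter] at h2
    tauto
  rw [inversions]
  refine Finset.card_nbij (fun z => ((z.1 : ℕ), (z.2 : ℕ))) ?_ ?_ ?_
  · intro z hz
    rw [Finset.mem_coe, Finset.mem_filter] at hz
    rw [Finset.mem_coe, Finset.mem_filter, Finset.mem_product, Finset.mem_range, Finset.mem_range, ← hO, ← hE]
    exact ⟨⟨z.1.isLt, z.2.isLt⟩, hz.2⟩
  · rintro ⟨x, y⟩ - ⟨x', y'⟩ - h
    simp only [Prod.mk.injEq] at h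
    rw [Fin.ext h.1, Fin.ext h.2]
  · rintro ⟨x, y⟩ hz
    rw [Finset.mem_coe, Finset.mem_filter, Finset.mem_product, Finset.mem_range,
      Finset.mem_range] at hz
    refine ⟨(⟨x, hz.1.1⟩, ⟨y, hz.1.2⟩), ?_, rfl⟩
    rw [Finset.mem_coe, Finset.mem_filter, hO, hE]
    exact ⟨Finset.mem_univ _, hz.2⟩

end CutSets

section Cup
variable {k : Type u} {A : Type v} {Ω : Type w} [CommRing k] [Ring A] [Algebra k A]
  {b : Module.Basis Ω k A} (hb : IsIdempotentBasis b)

open EInf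

theorem altKern_cutFaces {n i : ℕ} {U : Finset (Fin (n + 1))} (hU : U.card = i + 1) :
    altKern k 0 i (Finset.range (n + 1)) (cutFaces U) =
      (-1) ^ (inversions U + i * ((evenPart U).card + 1)) := by
  rw [altKern_apply (cutFaces_subset U), ← inversions_eq]
  · congr 3
    congr 1
    exact Finset.card_map _
  · rw [cutFaces_inter]; exact map_evenPart U
  · rw [cutFaces_inter]; exact map_oddPart U
  · rw [cutFaces_inter, Finset.card_map, hU]

theorem exists_eq_cutFaces {n i : ℕ} {S : Fin 2 → Finset ℕ}
    (h : altKern k 0 i (Finset.range (n + 1)) S ≠ 0) :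
    ∃ U : Finset (Fin (n + 1)), U.card = i + 1 ∧ S = cutFaces U := by
  obtain ⟨hS, hi, h0, h1⟩ := altKern_ne_zero h
  let U : Finset (Fin (n + 1)) := Finset.univ.filter fun v => (v : ℕ) ∈ S 0 ∩ S 1
  have hU : U.map Fin.valEmbedding = S 0 ∩ S 1 := by
    ext x
    rw [Finset.mem_map]
    constructor
    · rintro ⟨y, hy, rfl⟩
      exact (Finset.mem_filter.1 hy).2
    · intro hx
      have h2 := Finset.mem_range.1 (hS 0 (Finset.mem_inter.1 hx).1)
      exact ⟨⟨x, h2⟩, Finset.mem_filter.2 ⟨Finset.mem_univ _, hx⟩, rfl⟩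
  refine ⟨U, by rw [← Finset.card_map Fin.valEmbedding, hU, hi], ?_⟩
  funext j
  revert j
  refine Fin.forall_fin_two.2 ⟨?_, ?_⟩
  · change S 0 = (evenPart U).map Fin.valEmbedding
    rw [map_evenPart, hU]
    exact h0
  · change S 1 = (oddPart U).map Fin.valEmbedding
    rw [map_oddPart, hU]
    exact h1

/-- The nonzero entries of the alternating kernel are the pairs of faces given by sets of `i + 1`
cut points, and different sets give different pairs. This reindexes the operation as Steenrod's sum.
-/
theorem act_cup {i p q : ℕ} {c : linkedKern k 2} (hc : c.1 = (-1 : k) ^ i • altKern k 0 i)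
    (f : AP b p) (g : AP b q) : act hb 2 c ![incl b f, incl b g] =
      (-1 : k) ^ (i + p * (i + 1).choose 2 + q * i.choose 2) • incl b (apCup b i f g) := by
  refine DFinsupp.ext fun n => ?_
  rw [act_apply, DirectSum.smul_apply]
  -- The difference is truncated: for `i > p + q` this is degree zero, where one vertex cannot carry
  -- `i + 1` cut points and both sides vanish.
  by_cases hn : n = p + q - i
  · subst hn
    rw [incl, incl, incl, DirectSum.lof_apply, apCup, actAt, ← Psi_isLinearMap.map_smul]
    refine Psi_eq_Psi hb fun σ => ?_
    rw [ofBasis_apply, smul_apply, smul_eq_mul, cup_apply, kev_eq, Finset.mul_sum, Finset.mul_sum,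
      Finset.mul_sum]
    symm
    refine Finset.sum_of_injOn cutFaces ?_ ?_ ?_ ?_
    · intro U _ V _ h
      have h1 := cutFaces_inter U
      rw [h, cutFaces_inter] at h1
      exact (Finset.map_injective _ h1).symm
    · intro U _
      rw [Finset.mem_coe, Fintype.mem_piFinset]
      exact fun j => Finset.mem_Iic.2 (cutFaces_subset U j)
    · intro S _ hS
      by_cases h : altKern k 0 i (Finset.range (p + q - i + 1)) S = 0
      · rw [hc, Pi.smul_apply, Pi.smul_apply, h, smul_zero, zero_mul, mul_zero]
      · obtain ⟨U, hU, rfl⟩ := exists_eq_cutFaces h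
        exact absurd ⟨U, Finset.mem_coe.2 (Finset.mem_powersetCard.2
          ⟨Finset.subset_univ _, hU⟩), rfl⟩ hS
    · intro U hU
      rw [Fin.prod_univ_two]
      change _ = weight hb σ * (c.1 _ _ *
        (coeffs hb σ (DirectSum.lof k ℕ (fun m => AP b m) p f) ((evenPart U).map Fin.valEmbedding) *
        coeffs hb σ (DirectSum.lof k ℕ (fun m => AP b m) q g) ((oddPart U).map Fin.valEmbedding)))
      have h0 := Finset.card_map (s := evenPart U) Fin.valEmbedding
      have h1 := Finset.card_map (s := oddPart U) Fin.valEmbedding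
      split_ifs with h
      · rw [coeffs_of_card hb σ _ (map_val_subset _) (h0.trans h.1),
          coeffs_of_card hb σ _ (map_val_subset _) (h1.trans h.2), DirectSum.lof_apply,
          DirectSum.lof_apply, hc, Pi.smul_apply, Pi.smul_apply,
          altKern_cutFaces (Finset.mem_powersetCard.1 hU).2, h.1, smul_eq_mul]
        have hsign : (-1 : k) ^ (i + p * (i + 1).choose 2 + q * i.choose 2) *
            (-1) ^ (inversions U + (p + q) * i.choose 2) =
            (-1) ^ i * (-1) ^ (inversions U + i * (p + 1 + 1)) := by
          rw [Nat.choose_succ_succ' i 1, Nat.choose_one_right, ← pow_add, ← pow_add,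
            ← sgn_natCast, ← sgn_natCast]
          congr 1
          push_cast
          linear_combination ((p : ZMod 2) * (i.choose 2 : ℕ) + (q : ZMod 2) * (i.choose 2 : ℕ) -
            i) * two_zmod
        generalize Phi b f _ = x
        generalize Phi b g _ = y
        rw [← mul_assoc ((-1 : k) ^ (i + p * _ + _)), ← mul_assoc ((-1 : k) ^ (i + p * _ + _)),
          hsign]
        -- The operation carries three copies of the weight, one of them from each coefficient
        -- function, while the cup product carries one.
        linear_combination (-(-1) ^ i * (-1) ^ (inversions U + i * (p + 1 + 1)) * x * y *
          (weight hb σ + 1)) * weight_mul_self hb σ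
      · rw [mul_zero, mul_zero]
        symm
        by_contra h2
        have h3 := right_ne_zero_of_mul (right_ne_zero_of_mul h2)
        exact h ⟨h0.symm.trans (coeffs_lof_ne_zero hb (left_ne_zero_of_mul h3)),
          h1.symm.trans (coeffs_lof_ne_zero hb (right_ne_zero_of_mul h3))⟩
  · have h1 : incl b (apCup b i f g) n = 0 :=
      DirectSum.of_eq_of_ne (β := fun n => AP b n) _ _ _ hn
    rw [h1, smul_zero]
    refine actAt_eq_zero hb _ _ _ fun S hS => ?_
    by_contra! h
    have h2 : (S 0).card - 1 = p := by
      by_contra h3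
      exact h 0 (DirectSum.of_eq_of_ne (β := fun n => AP b n) _ _ _ h3)
    have h3 : (S 1).card - 1 = q := by
      by_contra h4
      exact h 1 (DirectSum.of_eq_of_ne (β := fun n => AP b n) _ _ _ h4)
    have h4 := ((c.2.supp _ _ hS).2 0).1.card_pos
    have h5 := ((c.2.supp _ _ hS).2 1).1.card_pos
    rw [hc] at hS
    have h6 := altKern_hasDeg _ _ _ _ (right_ne_zero_of_mul hS)
    rw [excess, Fin.sum_univ_two, Finset.card_range] at h6
    omega

end Cup
end Autopoietic

namespace Autopoietic

/-! ### The Gerstenhaber product and the pre-Lie product -/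

section CutPoints

theorem evenPart_singleton {n : ℕ} (u : Fin (n + 1)) : evenPart {u} = Finset.Iic u := by
  ext v
  rw [evenPart, Finset.mem_filter, Finset.mem_singleton, Finset.filter_singleton, Finset.mem_Iic]
  split_ifs with h
  · simp [h.ne', h]
  · simp [not_lt.1 h]

theorem oddPart_singleton {n : ℕ} (u : Fin (n + 1)) : oddPart {u} = Finset.Ici u := by
  ext v
  rw [oddPart, Finset.mem_filter, Finset.mem_singleton, Finset.filter_singleton, Finset.mem_Ici]
  split_ifs with h
  · simp [h.le]
  · simp only [Finset.mem_univ, Finset.card_empty, Nat.not_odd_zero, or_false, true_and]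
    exact ⟨fun h => h.ge, fun h' => le_antisymm (not_lt.1 h) h'⟩

theorem inversions_singleton {n : ℕ} (u : Fin (n + 1)) : inversions {u} = 0 := by
  rw [inversions, Finset.card_eq_zero, Finset.filter_eq_empty_iff]
  rintro ⟨x, y⟩ - ⟨hx, hy, hxy⟩
  rw [oddPart_singleton, Finset.mem_sdiff, Finset.mem_Ici] at hx
  rw [evenPart_singleton, Finset.mem_sdiff, Finset.mem_Iic] at hy
  exact absurd (hx.1.trans_lt hxy) (not_lt.2 hy.1)

theorem card_filter_pair {n : ℕ} {u v : Fin (n + 1)} (h : u < v) (x : Fin (n + 1)) :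
    (({u, v} : Finset (Fin (n + 1))).filter (· < x)).card =
      if x ≤ u then 0 else if x ≤ v then 1 else 2 := by
  rw [Finset.filter_insert, Finset.filter_singleton]
  by_cases h1 : x ≤ u
  · rw [if_neg (not_lt.2 h1), if_neg (not_lt.2 (h1.trans h.le)), if_pos h1, Finset.card_empty]
  · rw [if_pos (not_le.1 h1), if_neg h1]
    by_cases h2 : x ≤ v
    · rw [if_neg (not_lt.2 h2), if_pos h2]; rfl
    · rw [if_pos (not_le.1 h2), if_neg h2, Finset.card_pair h.ne]

theorem mem_evenPart_pair {n : ℕ} {u v : Fin (n + 1)} (h : u < v) (x : Fin (n + 1)) :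
    x ∈ evenPart {u, v} ↔ x ≤ u ∨ v ≤ x := by
  rw [evenPart, Finset.mem_filter, card_filter_pair h, Finset.mem_insert, Finset.mem_singleton]
  split_ifs with h1 h2
  · simp [h1]
  · simp only [Finset.mem_univ, Nat.not_even_one, or_false, true_and]
    constructor
    · rintro (rfl | rfl)
      · exact Or.inl le_rfl
      · exact Or.inr le_rfl
    · exact fun h3 => Or.inr (le_antisymm h2 (h3.resolve_left h1))
  · simp [(not_le.1 h2).le]

theorem mem_oddPart_pair {n : ℕ} {u v : Fin (n + 1)} (h : u < v) (x : Fin (n + 1)) :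
    x ∈ oddPart {u, v} ↔ u ≤ x ∧ x ≤ v := by
  rw [oddPart, Finset.mem_filter, card_filter_pair h, Finset.mem_insert, Finset.mem_singleton]
  split_ifs with h1 h2
  · simp only [Finset.mem_univ, Nat.not_odd_zero, or_false, true_and]
    constructor
    · rintro (rfl | rfl)
      · exact ⟨le_rfl, h.le⟩
      · exact ⟨h.le, le_rfl⟩
    · exact fun h3 => Or.inl (le_antisymm h1 h3.1)
  · simp [(not_le.1 h1).le, h2]
  · have h3 : ¬ Odd 2 := by decide
    simp only [Finset.mem_univ, h3, or_false, true_and]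
    constructor
    · rintro (rfl | rfl)
      · exact ⟨le_rfl, h.le⟩
      · exact ⟨h.le, le_rfl⟩
    · exact fun h4 => absurd h4.2 h2

/-- The inversions pair a vertex strictly between the cut points with a vertex beyond the second
one. -/
theorem inversions_pair {n : ℕ} {u v : Fin (n + 1)} (h : u < v) :
    inversions {u, v} = (v - u - 1) * (n - v) := by
  have h1 : (Finset.univ.filter fun z : Fin (n + 1) × Fin (n + 1) =>
      z.1 ∈ oddPart {u, v} \ {u, v} ∧ z.2 ∈ evenPart {u, v} \ {u, v} ∧ z.1 < z.2) =
      Finset.Ioo u v ×ˢ Finset.Ioi v := by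
    ext ⟨x, y⟩
    simp only [Finset.mem_filter, Finset.mem_univ, true_and, Finset.mem_sdiff, mem_oddPart_pair h,
      mem_evenPart_pair h, Finset.mem_insert, Finset.mem_singleton, Finset.mem_product,
      Finset.mem_Ioo, Finset.mem_Ioi, Fin.ext_iff, Fin.le_def, Fin.lt_def]
    omega
  rw [inversions, h1, Finset.card_product, Fin.card_Ioo, Fin.card_Ioi]
  congr 1

end CutPoints

section Products
variable {k : Type u} {A : Type v} {Ω : Type w} [CommRing k] [Ring A] [Algebra k A]
  {b : Module.Basis Ω k A}

theorem faceAlong_enum_image {n p : ℕ} {N : Finset ℕ} {φ : ℕ → ℕ} (hφ : StrictMono φ)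
    (h : N = (Finset.range (p + 1)).image φ) (a : Fin n → A) :
    (faceAlong (EInf.enum N) a : Fin p → A) = faceAlong φ a := by
  subst h
  exact faceAlong_congr (fun j hj => enum_image (hφ.strictMonoOn _) hj) a

/-- The required size of the even part forces the single cut point to be `p`. -/
theorem cup_zero_apply {p q : ℕ} (α : Cochain k A k p) (β : Cochain k A k q)
    (σ : Fin (p + q) → Ω) : (cup b 0 α β : Cochain k A k (p + q)) (fun l => b (σ l)) =
      α (fun l => b (σ (Fin.castAdd q l))) * β fun l => b (σ (Fin.natAdd p l)) := by
  refine (cup_apply (b := b) 0 α β σ).trans ?_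
  have hp : p < p + q - 0 + 1 := by omega
  rw [Finset.sum_eq_single {⟨p, hp⟩}]
  · have h1 : ((evenPart {(⟨p, hp⟩ : Fin (p + q - 0 + 1))}).map Fin.valEmbedding) =
        (Finset.range (p + 1)).image id := by
      rw [evenPart_singleton, Fin.map_valEmbedding_Iic, Finset.image_id]
      ext; simp [Nat.lt_succ_iff]
    have h2 : ((oddPart {(⟨p, hp⟩ : Fin (p + q - 0 + 1))}).map Fin.valEmbedding) =
        (Finset.range (q + 1)).image (p + ·) := by
      rw [oddPart_singleton]
      ext x
      simp only [Finset.mem_map, Finset.mem_Ici, Fin.valEmbedding_apply, Finset.mem_image,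
        Finset.mem_range]
      constructor
      · rintro ⟨y, hy, rfl⟩
        have h3 : p ≤ (y : ℕ) := hy
        have := y.isLt
        exact ⟨y - p, by omega, by omega⟩
      · rintro ⟨y, hy, rfl⟩
        exact ⟨⟨p + y, by omega⟩, Fin.le_def.2 (Nat.le_add_right p y), rfl⟩
    rw [if_pos, faceAlong_enum_image strictMono_id h1,
      faceAlong_enum_image (add_right_strictMono (a := p)) h2, inversions_singleton]
    · have h3 : (faceAlong id (fun l => b (σ l)) : Fin p → A) = fun l => b (σ (Fin.castAdd q l)) := by
        funext j
        rw [faceAlong, id, id, edge_single]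
        exact seq_val (fun l => b (σ l)) (Fin.castAdd q j)
      have h4 : (faceAlong (p + ·) (fun l => b (σ l)) : Fin q → A) =
          fun l => b (σ (Fin.natAdd p l)) := by
        funext j
        rw [faceAlong, ← add_assoc, edge_single]
        exact seq_val (fun l => b (σ l)) (Fin.natAdd p j)
      rw [← h3, ← h4]
      simp
    · constructor
      · rw [← Finset.card_map Fin.valEmbedding, h1, Finset.image_id, Finset.card_range]
      · rw [← Finset.card_map Fin.valEmbedding, h2,
          Finset.card_image_of_injective _ (add_right_injective p), Finset.card_range]
  · intro U hU hne
    obtain ⟨u, rfl⟩ := Finset.card_eq_one.1 (Finset.mem_powersetCard.1 hU).2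
    rw [if_neg]
    rintro ⟨h1, -⟩
    rw [evenPart_singleton, Fin.card_Iic] at h1
    exact hne (by rw [show u = ⟨p, hp⟩ from Fin.ext (by simpa using h1)])
  · intro h
    exact absurd (Finset.mem_powersetCard.2 ⟨Finset.subset_univ _, Finset.card_singleton _⟩) h

/-- The vertices of the face which omits the inner vertices of the interval `[j, j + q + 1]`. -/
def gap (j q m : ℕ) : ℕ := if m ≤ j then m else m + q

theorem gap_strictMono (j q : ℕ) : StrictMono (gap j q) := by
  intro x y h
  simp only [gap]
  split_ifs <;> omega

/-- The size of the odd part forces the cut points to be `j` and `j + q + 1`. The `q` inner vertices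
between them and the `p - 1 - j` vertices behind them give the sign; the remaining exponent vanishes
as `choose 1 2 = 0`. -/
theorem cup_one_apply {p q : ℕ} (α : Cochain k A k p) (β : Cochain k A k (q + 1))
    (σ : Fin (p + q) → Ω) : (cup b 1 α β : Cochain k A k (p + q)) (fun l => b (σ l)) =
      ∑ j : Fin p, (-1) ^ ((p - 1 - j) * q) * α (faceAlong (gap j q) fun l => b (σ l)) *
        β (faceAlong (j + ·) fun l => b (σ l)) := by
  refine (cup_apply (b := b) 1 α β σ).trans ?_
  symm
  have hu : ∀ j : Fin p, (j : ℕ) < p + (q + 1) - 1 + 1 := fun j => by omega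
  have hv : ∀ j : Fin p, (j : ℕ) + q + 1 < p + (q + 1) - 1 + 1 := fun j => by omega
  have huv : ∀ j : Fin p, (⟨j, hu j⟩ : Fin (p + (q + 1) - 1 + 1)) < ⟨j + q + 1, hv j⟩ := fun j =>
    Fin.lt_def.2 (by simp only; omega)
  refine Finset.sum_of_injOn (fun j => {⟨j, hu j⟩, ⟨j + q + 1, hv j⟩}) ?_ ?_ ?_ ?_
  · intro j _ l _ h
    have h1 : (⟨j, hu j⟩ : Fin (p + (q + 1) - 1 + 1)) ∈
        ({⟨l, hu l⟩, ⟨l + q + 1, hv l⟩} : Finset (Fin (p + (q + 1) - 1 + 1))) := by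
      rw [← show ({⟨j, hu j⟩, ⟨j + q + 1, hv j⟩} : Finset (Fin (p + (q + 1) - 1 + 1))) =
        {⟨l, hu l⟩, ⟨l + q + 1, hv l⟩} from h]
      exact Finset.mem_insert_self _ _
    have h2 : (⟨l, hu l⟩ : Fin (p + (q + 1) - 1 + 1)) ∈
        ({⟨j, hu j⟩, ⟨j + q + 1, hv j⟩} : Finset (Fin (p + (q + 1) - 1 + 1))) := by
      rw [show ({⟨j, hu j⟩, ⟨j + q + 1, hv j⟩} : Finset (Fin (p + (q + 1) - 1 + 1))) = _ from h]
      exact Finset.mem_insert_self _ _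
    simp only [Finset.mem_insert, Finset.mem_singleton, Fin.mk.injEq] at h1 h2
    exact Fin.ext (by omega)
  · intro j _
    exact Finset.mem_coe.2 (Finset.mem_powersetCard.2
      ⟨Finset.subset_univ _, Finset.card_pair (huv j).ne⟩)
  · intro U hU hne
    rw [if_neg]
    rintro ⟨h0, h1⟩
    obtain ⟨u, v, hne', rfl⟩ := Finset.card_eq_two.1 (Finset.mem_powersetCard.1 hU).2
    have key : ∀ u v : Fin (p + (q + 1) - 1 + 1), u < v → (oddPart {u, v}).card = q + 1 + 1 →
        ({u, v} : Finset (Fin (p + (q + 1) - 1 + 1))) ∈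
          (fun j : Fin p => ({⟨j, hu j⟩, ⟨j + q + 1, hv j⟩} : Finset _)) ''
            (↑(Finset.univ : Finset (Fin p))) := by
      intro u v h h1
      have h2 : oddPart {u, v} = Finset.Icc u v := by
        ext x; rw [mem_oddPart_pair h, Finset.mem_Icc]
      rw [h2, Fin.card_Icc] at h1
      have h3 := v.isLt
      have h4 : (u : ℕ) < v := h
      refine ⟨⟨u, by omega⟩, by simp, ?_⟩
      have h5 : (⟨u + q + 1, hv ⟨u, by omega⟩⟩ : Fin (p + (q + 1) - 1 + 1)) = v :=
        Fin.ext (by simp only; omega)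
      simp only [h5]
    rcases lt_or_gt_of_ne hne' with h | h
    · exact hne (by simpa using key u v h h1)
    · rw [Finset.pair_comm] at h1 hne
      exact hne (by simpa using key v u h h1)
  · intro j _
    have hj := j.isLt
    have h1 : ((evenPart {⟨j, hu j⟩, ⟨j + q + 1, hv j⟩}).map Fin.valEmbedding) =
        (Finset.range (p + 1)).image (gap j q) := by
      ext x
      simp only [Finset.mem_map, mem_evenPart_pair (huv j), Fin.valEmbedding_apply,
        Finset.mem_image, Finset.mem_range, gap, Fin.le_def]
      constructor
      · rintro ⟨y, hy, rfl⟩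
        have := y.isLt
        rcases hy with hy | hy
        · exact ⟨y, by omega, if_pos hy⟩
        · exact ⟨y - q, by omega, by rw [if_neg (by omega)]; omega⟩
      · rintro ⟨y, hy, rfl⟩
        split_ifs with h
        · exact ⟨⟨y, by omega⟩, Or.inl h, rfl⟩
        · exact ⟨⟨y + q, by omega⟩, Or.inr (by simp only; omega), rfl⟩
    have h2 : ((oddPart {⟨j, hu j⟩, ⟨j + q + 1, hv j⟩}).map Fin.valEmbedding) =
        (Finset.range (q + 1 + 1)).image ((j : ℕ) + ·) := by
      ext x
      simp only [Finset.mem_map, mem_oddPart_pair (huv j), Fin.valEmbedding_apply,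
        Finset.mem_image, Finset.mem_range, Fin.le_def]
      constructor
      · rintro ⟨y, hy, rfl⟩
        exact ⟨y - j, by omega, by omega⟩
      · rintro ⟨y, hy, rfl⟩
        exact ⟨⟨j + y, by omega⟩, ⟨by simp only; omega, by simp only; omega⟩, rfl⟩
    rw [if_pos, faceAlong_enum_image (gap_strictMono _ _) h1,
      faceAlong_enum_image (add_right_strictMono (a := (j : ℕ))) h2, inversions_pair (huv j)]
    · have h3 : (j : ℕ) + q + 1 - j - 1 = q := by omega
      have h4 : p + (q + 1) - 1 - (j + q + 1) = p - 1 - j := by omega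
      simp only [h3, h4, mul_comm q]
      simp
    · constructor
      · rw [← Finset.card_map Fin.valEmbedding, h1,
          Finset.card_image_of_injective _ (gap_strictMono _ _).injective, Finset.card_range]
      · rw [← Finset.card_map Fin.valEmbedding, h2,
          Finset.card_image_of_injective _ (add_right_injective (j : ℕ)), Finset.card_range]

/-- The product of the values of two cochains. -/
def tensorCochain {p q : ℕ} (f : Cochain k A A p) (g : Cochain k A A q) : Cochain k A A (p + q) :=
  ((LinearMap.mul' k A).compMultilinearMap (f.domCoprod g)).domDomCongr finSumFinEquiv

theorem tensorCochain_apply {p q : ℕ} (f : Cochain k A A p) (g : Cochain k A A q)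
    (a : Fin (p + q) → A) : tensorCochain f g a =
      f (fun l => a (Fin.castAdd q l)) * g fun l => a (Fin.natAdd p l) := by
  simp [tensorCochain, MultilinearMap.domCoprod_apply]

theorem apCup_zero (hb : IsIdempotentBasis b) {p q : ℕ} (f : AP b p) (g : AP b q)
    (a : Fin (p + q) → A) : (apCup b 0 f g).1 a =
      f.1 (fun l => a (Fin.castAdd q l)) * g.1 (fun l => a (Fin.natAdd p l)) := by
  rw [← tensorCochain_apply]
  refine congrFun (congrArg DFunLike.coe
    (?_ : ((apCup b 0 f g).1 : Cochain k A A (p + q)) = tensorCochain f.1 g.1)) a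
  refine cochain_ext (b := b) (n := p + q) fun σ => ?_
  refine (Psi_apply (b := b) (n := p + q) _ σ).trans ?_
  refine (congrArg (· • basisProd b σ) (cup_zero_apply (b := b) (Phi b f) (Phi b g) σ)).trans ?_
  rw [tensorCochain_apply, apply_eq_Phi hb f fun l => σ (Fin.castAdd q l),
    apply_eq_Phi hb g fun l => σ (Fin.natAdd p l), smul_mul_smul_comm]
  congr 1
  rw [basisProd, basisProd, basisProd, ← List.prod_append, ← List.ofFn_fin_append]
  congr 2
  funext l
  refine Fin.addCases (fun l => ?_) (fun l => ?_) l
  · simp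
  · simp

/-- The arguments of the outer cochain of a partial composition are multilinear. -/
theorem partialComp_update {p q n : ℕ} (h : n + 1 = p + q) (g : Cochain k A A q) (j : Fin p)
    (a : Fin n → A) (l : Fin n) : ∃ (m : Fin p) (L : A →ₗ[k] A), ∀ x,
      (fun m => if hm : m = j
        then g fun l' => Function.update a l x (EInf.innerPos h j l')
        else Function.update a l x (EInf.outerPos h j m hm)) =
      Function.update (fun m => if hm : m = j then g fun l' => a (EInf.innerPos h j l')
        else a (EInf.outerPos h j m hm)) m (L x) := by
  have hj := j.isLt
  have hl := l.isLt
  by_cases hin : (j : ℕ) ≤ l ∧ (l : ℕ) < j + q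
  · have hl' : l = EInf.innerPos h j ⟨l - j, by omega⟩ := Fin.ext (by simp [EInf.innerPos]; omega)
    refine ⟨j, g.toLinearMap (fun l' => a (EInf.innerPos h j l')) ⟨l - j, by omega⟩, fun x => ?_⟩
    funext m
    by_cases hm : m = j
    · subst hm
      rw [dif_pos rfl, Function.update_self, MultilinearMap.toLinearMap_apply]
      congr 1
      funext l'
      simp only [Function.update_apply, EInf.innerPos, Fin.ext_iff]
      congr 1
      exact propext (by omega)
    · rw [Function.update_of_ne hm, dif_neg hm, dif_neg hm, Function.update_of_ne]
      intro h1
      have h2 := Fin.ext_iff.1 h1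
      have h3 : (m : ℕ) ≠ j := fun e => hm (Fin.ext e)
      simp only [EInf.outerPos, Fin.lt_def] at h2
      split_ifs at h2 <;> omega
  · obtain ⟨m, hm₀⟩ : ∃ m : Fin p, (m : ℕ) = if (l : ℕ) < j then (l : ℕ) else l + 1 - q :=
      ⟨⟨if (l : ℕ) < j then (l : ℕ) else l + 1 - q, by split_ifs <;> omega⟩, rfl⟩
    have hmj : m ≠ j := fun e => by
      have := Fin.ext_iff.1 e
      split_ifs at hm₀ <;> omega
    refine ⟨m, LinearMap.id, fun x => ?_⟩
    funext m'
    by_cases hm : m' = j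
    · subst hm
      rw [dif_pos rfl, Function.update_of_ne hmj.symm, dif_pos rfl]
      congr 1
      funext l'
      rw [Function.update_of_ne]
      intro h1
      have h2 := Fin.ext_iff.1 h1
      simp only [EInf.innerPos] at h2
      omega
    · rw [dif_neg hm]
      have h3 : (m' : ℕ) ≠ j := fun e => hm (Fin.ext e)
      by_cases hm' : m' = m
      · subst hm'
        rw [Function.update_self, LinearMap.id_apply]
        have : EInf.outerPos h j m' hmj = l := by
          refine Fin.ext ?_
          simp only [EInf.outerPos, Fin.lt_def]
          split_ifs at hm₀ ⊢ <;> omega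
        simp only [this, Function.update_self]
      · rw [Function.update_of_ne hm', dif_neg hm, Function.update_of_ne]
        intro h1
        refine hm' (Fin.ext ?_)
        have h2 := Fin.ext_iff.1 h1
        simp only [EInf.outerPos, Fin.lt_def] at h2
        split_ifs at h2 hm₀ <;> omega

/-- The partial composition as a cochain. -/
def partialCompCochain {p q n : ℕ} (h : n + 1 = p + q) (f : Cochain k A A p) (g : Cochain k A A q)
    (j : Fin p) : Cochain k A A n where
  toFun := partialComp h f g j
  map_update_add' {inst} a l x y := by
    obtain rfl : inst = instDecidableEqFin _ := Subsingleton.elim _ _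
    obtain ⟨m, L, hL⟩ := partialComp_update h g j a l
    simp only [partialComp, hL, map_add, MultilinearMap.map_update_add]
  map_update_smul' {inst} a l c x := by
    obtain rfl : inst = instDecidableEqFin _ := Subsingleton.elim _ _
    obtain ⟨m, L, hL⟩ := partialComp_update h g j a l
    simp only [partialComp, hL, map_smul, MultilinearMap.map_update_smul]

/-- Applying `g` replaces its arguments by a multiple of their product, so `f` is evaluated on the
face that omits the inner vertices of the interval, with one edge rescaled. Positive degree of `g`
ensures that this interval is an edge and not a point. -/
theorem partialComp_basis (hb : IsIdempotentBasis b) {p q : ℕ} (f : AP b p) (g : AP b (q + 1))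
    (j : Fin p) (σ : Fin (p + q) → Ω) :
    partialComp (p := p) (q := q + 1) (n := p + q) rfl f.1 g.1 j (fun l => b (σ l)) =
      (Phi b f (faceAlong (gap j q) fun l => b (σ l)) *
        Phi b g (faceAlong (j + ·) fun l => b (σ l))) • basisProd b σ := by
  have hj := j.isLt
  let a : Fin (p + q) → A := fun l => b (σ l)
  let T : Fin p → A := faceAlong (gap j q) a
  have hin : (fun l => a (EInf.innerPos (r := p) (s := q + 1) (n := p + q) rfl j l)) =
      faceAlong ((j : ℕ) + ·) a := by
    funext l
    rw [faceAlong, ← add_assoc, edge_single]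
    exact (seq_val a (EInf.innerPos (r := p) (s := q + 1) (n := p + q) rfl j l)).symm
  have hT : T j = edge (seq a) j (j + (q + 1)) := by
    change edge (seq a) (gap j q j) (gap j q (j + 1)) = _
    rw [gap, gap, if_pos le_rfl, if_neg (by omega)]
    congr 1
    omega
  have h1 : (fun m => if hm : m = j
      then g.1 fun l => a (EInf.innerPos (r := p) (s := q + 1) (n := p + q) rfl j l)
      else a (EInf.outerPos (r := p) (s := q + 1) (n := p + q) rfl j m hm)) =
      Function.update T j (Phi b g (faceAlong ((j : ℕ) + ·) a) • T j) := by
    funext m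
    by_cases hm : m = j
    · subst hm
      rw [dif_pos rfl, Function.update_self, hT, hin, ← add_zero (m : ℕ)]
      have h2 := Psi_faceAlong hb σ (p := q + 1)
        ((add_right_strictMono (a := (m : ℕ))).strictMonoOn _) (by omega) (Phi b g)
      rw [Psi_Phi hb] at h2
      exact h2
    · have h3 : (m : ℕ) ≠ j := fun e => hm (Fin.ext e)
      rw [dif_neg hm, Function.update_of_ne hm]
      change _ = edge (seq a) (gap j q m) (gap j q (m + 1))
      have h4 : gap j q (m + 1) = gap j q m + 1 := by
        simp only [gap]; split_ifs <;> omega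
      rw [h4, edge_single]
      refine (seq_val a _).symm.trans ?_
      congr 1
      simp only [EInf.outerPos, gap, Fin.lt_def]
      split_ifs <;> omega
  have h2 := Psi_faceAlong hb σ (p := p) ((gap_strictMono j q).strictMonoOn _)
    (by simp only [gap]; split_ifs <;> omega) (Phi b f)
  rw [Psi_Phi hb] at h2
  change f.1 _ = _
  rw [h1, f.1.map_update_smul, Function.update_eq_self, h2, smul_smul, mul_comm,
    basisProd_eq_edge]
  congr 2
  simp only [gap]
  split_ifs <;> omega

theorem apCup_one (hb : IsIdempotentBasis b) {p q : ℕ} (f : AP b p) (g : AP b (q + 1))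
    (a : Fin (p + q) → A) : (apCup b 1 f g).1 a = ∑ j : Fin p, (-1 : k) ^ ((p - 1 - j) * q) •
      partialComp (p := p) (q := q + 1) (n := p + q) rfl f.1 g.1 j a := by
  have h1 : ((apCup b 1 f g).1 : Cochain k A A (p + q)) =
      ∑ j : Fin p, (-1 : k) ^ ((p - 1 - j) * q) •
        partialCompCochain (p := p) (q := q + 1) (n := p + q) rfl f.1 g.1 j := by
    refine cochain_ext (b := b) (n := p + q) fun σ => ?_
    refine (Psi_apply (b := b) (n := p + q) _ σ).trans ?_
    refine (congrArg (· • basisProd b σ) (cup_one_apply (b := b) (Phi b f) (Phi b g) σ)).trans ?_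
    rw [sum_apply, Finset.sum_smul]
    refine Finset.sum_congr rfl fun j _ => ?_
    rw [smul_apply]
    change _ = (-1 : k) ^ ((p - 1 - j) * q) •
      partialComp (p := p) (q := q + 1) (n := p + q) rfl f.1 g.1 j (fun l => b (σ l))
    rw [partialComp_basis hb, smul_smul, mul_assoc]
  have h2 := congrFun (congrArg DFunLike.coe h1) a
  rw [sum_apply] at h2
  exact h2

end Products
end Autopoietic

/-! ### Steenrod's coboundary formula from the operad action -/

namespace EInf
section Koszul

variable {k : Type u} [CommRing k]

theorem koszulSign_swap (p : Fin 2 → ℕ) :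
    koszulSign k (Equiv.swap 0 1) p = (-1) ^ (p 0 * p 1) := by
  rw [koszulSign, Fintype.prod_prod_type]
  simp [Fin.prod_univ_two]

end Koszul
end EInf

namespace Autopoietic
section Steenrod

open EInf

variable {k : Type u} {A : Type v} {Ω : Type w} [CommRing k] [Ring A] [Algebra k A]
  {b : Module.Basis Ω k A} (hb : IsIdempotentBasis b)

theorem lof_pair {p q : ℕ} (f : AP b p) (g : AP b q) :
    (fun j => DirectSum.lof k ℕ (fun n => AP b n) (![p, q] j)
      ((Fin.cons f (Fin.cons g finZeroElim) : ∀ j : Fin 2, AP b (![p, q] j)) j)) =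
      ![incl b f, incl b g] := by
  funext j
  fin_cases j <;> rfl

theorem act_cupOp (i : ℕ) {p q : ℕ} (f : AP b p) (g : AP b q) :
    (operadAlgebra hb).act 2 (cupOp k i) ![incl b f, incl b g] =
      (-1 : k) ^ (i + p * (i + 1).choose 2 + q * i.choose 2) • incl b (apCup b i f g) :=
  act_cup hb rfl f g

/-- The Leibniz rule of the operad action in arity two. The differential of `cupOp` is left
unevaluated, as it vanishes for `i = 0` and has two terms otherwise. -/
theorem deltaTotal_act_cupOp (i : ℕ) {p q : ℕ} (f : AP b p) (g : AP b q) :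
    deltaTotal hb ((operadAlgebra hb).act 2 (cupOp k i) ![incl b f, incl b g]) =
      (operadAlgebra hb).act 2 ((linkedOperad k).d 2 (cupOp k i)) ![incl b f, incl b g] +
      (-1 : k) ^ i • (operadAlgebra hb).act 2 (cupOp k i) ![incl b (delta hb p f), incl b g] +
      (-1 : k) ^ (i + p) •
        (operadAlgebra hb).act 2 (cupOp k i) ![incl b f, incl b (delta hb q g)] := by
  have h := (operadAlgebra hb).D_act ![p, q] (Fin.cons f (Fin.cons g finZeroElim))
    (cupOp_mem (k := k) i)
  rw [lof_pair, Fin.sum_univ_two] at h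
  have h0 : ∑ l : Fin 2 with l < 0, ![p, q] l = 0 := by simp
  have h1 : ∑ l : Fin 2 with l < 1, ![p, q] l = p := by
    rw [show (Finset.univ.filter fun l : Fin 2 => l < 1) = {0} by decide]
    simp
  have h2 : ∀ x : ⨁ n, AP b n, Function.update ![incl b f, incl b g] 0 x = ![x, incl b g] :=
    fun x => by ext j : 1; fin_cases j <;> rfl
  have h3 : ∀ x : ⨁ n, AP b n, Function.update ![incl b f, incl b g] 1 x = ![incl b f, x] :=
    fun x => by ext j : 1; fin_cases j <;> rfl
  rw [h0, h1, h2, h3, add_zero, ← add_assoc] at h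
  refine h.trans ?_
  congr 4
  · congr 1
    exact deltaTotal_lof hb f
  · congr 1
    exact deltaTotal_lof hb g

theorem act_swap_cupOp (i : ℕ) {p q : ℕ} (f : AP b p) (g : AP b q) :
    (operadAlgebra hb).act 2 ((linkedOperad k).act 2 (Equiv.swap 0 1) (cupOp k i))
        ![incl b f, incl b g] =
      (-1 : k) ^ (p * q) • (operadAlgebra hb).act 2 (cupOp k i) ![incl b g, incl b f] := by
  have h := (operadAlgebra hb).act_perm (cupOp k i) (Equiv.swap 0 1) ![p, q]
    (Fin.cons f (Fin.cons g finZeroElim))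
  rw [lof_pair, koszulSign_swap] at h
  refine h.trans ?_
  congr 2
  funext j
  fin_cases j <;> rfl

theorem eq_neg_one_pow_smul {M : Type*} [AddCommGroup M] [Module k M] {n : ℕ} {x y : M}
    (h : (-1 : k) ^ n • x = y) : x = (-1 : k) ^ n • y := by
  rw [← h, smul_smul, ← mul_pow, neg_one_mul, neg_neg, one_pow, one_smul]

theorem deltaTotal_apCup_zero {p q : ℕ} (f : AP b p) (g : AP b q) :
    deltaTotal hb (incl b (apCup b 0 f g)) = incl b (apCup b 0 (delta hb p f) g) +
      (-1 : k) ^ p • incl b (apCup b 0 f (delta hb q g)) := by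
  have h := deltaTotal_act_cupOp hb 0 f g
  rw [(linkedOperad k).d_zero (cupOp_mem 0), map_zero, zero_apply, act_cupOp,
    act_cupOp, act_cupOp] at h
  simpa using h

/-- Pure bookkeeping: the sign relating `cupOp` to the cup product is divided out. All exponents
depend only on the parities of `i`, `p`, `q` and `i.choose 2`, so sixteen cases suffice. -/
theorem eq_of_signed_eq {M : Type*} [AddCommGroup M] [Module k M] {i p q : ℕ} {x s t u v : M}
    (h : (-1 : k) ^ (i + 1 + p * (i + 1 + 1).choose 2 + q * (i + 1).choose 2) • x =
      (-1 : k) ^ (p * q) • (-1 : k) ^ (i + q * (i + 1).choose 2 + p * i.choose 2) • v +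
      (-1 : k) ^ (i + 1) • (-1 : k) ^ (i + p * (i + 1).choose 2 + q * i.choose 2) • u +
      (-1 : k) ^ (i + 1) •
        (-1 : k) ^ (i + 1 + (p + 1) * (i + 1 + 1).choose 2 + q * (i + 1).choose 2) • s +
      (-1 : k) ^ (i + 1 + p) •
        (-1 : k) ^ (i + 1 + p * (i + 1 + 1).choose 2 + (q + 1) * (i + 1).choose 2) • t) :
    x = (-1 : k) ^ (i + 1).choose 2 • s + (-1 : k) ^ (i.choose 2 + p + 1) • t +
      (-1 : k) ^ p • ((-1 : k) ^ (i * (p + q + 1)) • u - (-1 : k) ^ (p * q) • v) := by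
  have h1 : (i + 1).choose 2 = i + i.choose 2 := by
    rw [Nat.choose_succ_succ, Nat.choose_one_right]
  have h2 : (i + 1 + 1).choose 2 = i + 1 + (i + i.choose 2) := by
    rw [Nat.choose_succ_succ, Nat.choose_one_right, h1]
  have h3 : ∀ s t u v : M, v + u + s + t = s + t + (u + v) := by intros; abel
  have h4 : ∀ (n : ℕ) (x : M), -((-1 : k) ^ n • x) = (-1 : k) ^ (n + 1) • x := by
    intro n x
    rw [← neg_smul, pow_succ, mul_neg_one]
  rw [eq_neg_one_pow_smul h, h1, h2]
  simp only [sub_eq_add_neg, h4, smul_add, smul_smul, ← pow_add]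
  rw [h3]
  refine congrArg₂ (· + ·) (congrArg₂ (· + ·) ?_ ?_) (congrArg₂ (· + ·) ?_ ?_) <;>
  · refine congrArg (· • _) (neg_one_pow_congr ?_)
    simp only [Nat.even_add, Nat.even_mul, Nat.even_add_one, Nat.not_even_one]
    by_cases hi : Even i <;> by_cases hp : Even p <;> by_cases hq : Even q <;>
      by_cases hc : Even (i.choose 2) <;> simp [hi, hp, hq, hc]

theorem deltaTotal_apCup_succ (i : ℕ) {p q : ℕ} (f : AP b p) (g : AP b q) :
    deltaTotal hb (incl b (apCup b (i + 1) f g)) =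
      (-1 : k) ^ (i + 1).choose 2 • incl b (apCup b (i + 1) (delta hb p f) g) +
      (-1 : k) ^ (i.choose 2 + p + 1) • incl b (apCup b (i + 1) f (delta hb q g)) +
      (-1 : k) ^ p • ((-1 : k) ^ (i * (p + q + 1)) • incl b (apCup b i f g) -
        (-1 : k) ^ (p * q) • incl b (apCup b i g f)) := by
  have h := deltaTotal_act_cupOp hb (i + 1) f g
  rw [d_cupOp, map_add, map_smul, add_apply, smul_apply,
    act_swap_cupOp, act_cupOp, act_cupOp, act_cupOp, act_cupOp, act_cupOp, map_smul] at h
  exact eq_of_signed_eq (M := ⨁ n, AP b n) h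

theorem exists_unit : ∃ x ∈ (linkedOperad k).deg 0 0, linkedAug 0 x = 1 ∧ ∃ f : AP b 0,
    f.1 ![] = 1 ∧ (operadAlgebra hb).act 0 x ![] = incl b f := by
  refine ⟨⟨unitKern, unitKern_isLinked⟩, unitKern_hasDeg, aug_unitKern, Psi b (ofBasis b fun _ => 1),
    ?_, act_unitKern hb⟩
  have h := Psi_apply (b := b) (ofBasis b fun _ : Fin 0 → Ω => (1 : k)) ![]
  rw [ofBasis_apply, one_smul] at h
  exact (congrArg _ (Subsingleton.elim _ _)).trans (h.trans (by simp [basisProd]))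

end Steenrod
end Autopoietic

/-! ### Assembly of the theorem -/

theorem mainTheorem7 {k : Type u} {A : Type v} {Ω : Type w} [CommRing k] [Ring A] [Algebra k A]
    (b : Module.Basis Ω k A) (hb : Autopoietic.IsIdempotentBasis b) :
    -- `Φ` and `Ψ` are `k`-linear, `Φ` is given by the coefficients, `Ψ` is a cochain map and
    -- `Ψ ∘ Φ = id`; `Φ` is a cochain map if the product of two basis elements is a basis element.
    (∀ n, IsLinearMap k (Autopoietic.Psi b (n := n))) ∧
    (∀ n, IsLinearMap k (Autopoietic.Phi b (n := n))) ∧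
    (∀ n (f : Autopoietic.AP b n) (σ : Fin n → Ω),
      Autopoietic.IsCoeff b f.1 σ (Autopoietic.Phi b f fun l => b (σ l))) ∧
    (∀ n (α : Autopoietic.Cochain k A k n),
      Autopoietic.Psi b (Autopoietic.dStar b α) =
        Autopoietic.delta hb n (Autopoietic.Psi b α)) ∧
    (∀ n (f : Autopoietic.AP b n), Autopoietic.Psi b (Autopoietic.Phi b f) = f) ∧
    ((∀ x y, ∃ m, b x * b y = b m) → ∀ n (f : Autopoietic.AP b n),
      Autopoietic.Phi b (Autopoietic.delta hb n f) =
        Autopoietic.dStar b (Autopoietic.Phi b f)) ∧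
    -- `Ψ` is multiplicative for all cup-`i` products.
    (∀ i p q (α : Autopoietic.Cochain k A k p) (β : Autopoietic.Cochain k A k q),
      Autopoietic.apCup b i (Autopoietic.Psi b α) (Autopoietic.Psi b β) =
        Autopoietic.Psi b (Autopoietic.cup b i α β)) ∧
    -- The cup-`0` product is the Gerstenhaber product.
    (∀ p q (f : Autopoietic.AP b p) (g : Autopoietic.AP b q) (a : Fin (p + q) → A),
      (Autopoietic.apCup b 0 f g).1 a =
        f.1 (fun l => a (Fin.castAdd q l)) * g.1 (fun l => a (Fin.natAdd p l))) ∧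
    -- Partial compositions with cochains of positive degree preserve autopoietic cochains, and the
    -- cup-`1` product is the pre-Lie product.
    (∀ p q (f : Autopoietic.AP b p) (g : Autopoietic.AP b (q + 1)) (j : Fin p)
      (σ : Fin (p + q) → Ω), ∃ c : k,
      Autopoietic.partialComp (p := p) (q := q + 1) (n := p + q) rfl f.1 g.1 j (fun l => b (σ l)) =
        c • Autopoietic.basisProd b σ) ∧
    (∀ p q (f : Autopoietic.AP b p) (g : Autopoietic.AP b (q + 1)) (a : Fin (p + q) → A),
      (Autopoietic.apCup b 1 f g).1 a = ∑ j : Fin p, (-1 : k) ^ ((p - 1 - j) * q) •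
        Autopoietic.partialComp (p := p) (q := q + 1) (n := p + q) rfl f.1 g.1 j a) ∧
    -- Steenrod's coboundary formula for `∪₀` and for `∪ᵢ₊₁`.
    (∀ p q (f : Autopoietic.AP b p) (g : Autopoietic.AP b q),
      Autopoietic.deltaTotal hb (Autopoietic.incl b (Autopoietic.apCup b 0 f g)) =
        Autopoietic.incl b (Autopoietic.apCup b 0 (Autopoietic.delta hb p f) g) +
        (-1 : k) ^ p • Autopoietic.incl b (Autopoietic.apCup b 0 f (Autopoietic.delta hb q g))) ∧
    (∀ i p q (f : Autopoietic.AP b p) (g : Autopoietic.AP b q),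
      Autopoietic.deltaTotal hb (Autopoietic.incl b (Autopoietic.apCup b (i + 1) f g)) =
        (-1 : k) ^ (i + 1).choose 2 •
          Autopoietic.incl b (Autopoietic.apCup b (i + 1) (Autopoietic.delta hb p f) g) +
        (-1 : k) ^ (i.choose 2 + p + 1) •
          Autopoietic.incl b (Autopoietic.apCup b (i + 1) f (Autopoietic.delta hb q g)) +
        (-1 : k) ^ p •
          ((-1 : k) ^ (i * (p + q + 1)) • Autopoietic.incl b (Autopoietic.apCup b i f g) -
            (-1 : k) ^ (p * q) • Autopoietic.incl b (Autopoietic.apCup b i g f))) ∧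
    -- The cup-`i` products are part of an action of an `E_∞`-operad on the autopoietic cochains.
    ∃ (O : EInf.DGOperad k) (ε : ∀ r, O.obj r →ₗ[k] k) (_ : O.IsEInfinity ε)
      (S : EInf.OperadAlgebra O (fun n => Autopoietic.AP b n) (Autopoietic.deltaTotal hb))
      (e : ℕ → O.obj 2),
      (∀ i, e i ∈ O.deg 2 i) ∧ ε 2 (e 0) = 1 ∧
      (∀ i, O.d 2 (e (i + 1)) = O.act 2 (Equiv.swap 0 1) (e i) + (-1 : k) ^ (i + 1) • e i) ∧
      (∀ i p q (f : Autopoietic.AP b p) (g : Autopoietic.AP b q),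
        S.act 2 (e i) ![Autopoietic.incl b f, Autopoietic.incl b g] =
          (-1 : k) ^ (i + p * (i + 1).choose 2 + q * i.choose 2) •
            Autopoietic.incl b (Autopoietic.apCup b i f g)) ∧
      (∃ x ∈ O.deg 0 0, ε 0 x = 1 ∧ ∃ f : Autopoietic.AP b 0,
        f.1 ![] = 1 ∧ S.act 0 x ![] = Autopoietic.incl b f) ∧
      (∀ r (u : O.obj (r + 1)) (p : Fin (r + 1) → ℕ) (x : ∀ j, Autopoietic.AP b (p j + 1)),
        S.act (r + 1) u (fun j => Autopoietic.incl b (x j)) 0 = 0) :=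
  ⟨fun _ => Autopoietic.Psi_isLinearMap, fun _ => Autopoietic.Phi_isLinearMap hb,
    fun _ => Autopoietic.isCoeff_Phi hb, fun _ => Autopoietic.Psi_dStar hb,
    fun _ => Autopoietic.Psi_Phi hb, fun h _ => Autopoietic.Phi_delta hb h,
    fun i _ _ => Autopoietic.apCup_Psi hb i, fun _ _ => Autopoietic.apCup_zero hb,
    fun _ _ f g j σ => ⟨_, Autopoietic.partialComp_basis hb f g j σ⟩,
    fun _ _ => Autopoietic.apCup_one hb, fun _ _ => Autopoietic.deltaTotal_apCup_zero hb,
    fun i _ _ => Autopoietic.deltaTotal_apCup_succ hb i, EInf.linkedOperad k, EInf.linkedAug,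
    EInf.linkedOperad_isEInfinity, Autopoietic.operadAlgebra hb, EInf.cupOp k, EInf.cupOp_mem,
    EInf.linkedAug_cupOp, EInf.d_cupOp, fun i _ _ => Autopoietic.act_cupOp hb i,
    Autopoietic.exists_unit hb, fun _ => Autopoietic.act_pos hb⟩
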